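/- Let $g\ge 0$, $k\ge 1$. On $\mathbb R^{2g}\ni u=(x,y)$ let $\omega(u,v)=\sum_j(u_{g+j}v_j-u_jv_{g+j})$. Smooth sections of $L^n$ ($n\in\mathbb Z$) over $\mathbb T^{2g}=\mathbb R^{2g}/\mathbb Z^{2g}$ are the smooth $s:\mathbb R^{2g}\to\mathbb C$ with $s(u+\lambda)=\big((-1)^{\sum_j\lambda_j\lambda_{g+j}}e^{-\pi i\omega(u,\lambda)}\big)^n s(u)$ for $\lambda\in\mathbb Z^{2g}$, with the $C^\infty$ topology and the connection $\nabla s=ds-n\pi i\,s\sum_j(y_jdx_j-x_jdy_j)$. $\Gamma^{-\infty}(L^k)$ is the strong dual of $\Gamma^\infty(L^{-k})$, and a smooth section $s$ of $L^k$ is identified with $\phi\mapsto\int_{[0,1]^{2g}}s\phi$. An invariant nonnegative polarization is a Lagrangian subspace $P\subset(\mathbb C^{2g},\omega)$ with $-i\omega(v,\bar v)\ge 0$ on $P$; its quantum space $\widetilde{\mathcal Q}_P$ is the space of $\sigma\in\Gamma^{-\infty}(L^k)$ with $\sigma(\mathrm{div}\,\bar\xi\cdot\phi+\nabla_{\bar\xi}\phi)=0$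 for all smooth vector fields $\xi$ on the torus with values in $P$ and all $\phi\in\Gamma^\infty(L^{-k})$. Let $\mathbb D_g=\{\tau\in M_g(\mathbb C):{}^t\tau=\tau,\ 1-\tau^*\tau\ge 0\}$ be the closed Siegel disc and $\breve{\mathbb D}_g$ the open one ($1-\tau^*\tau>0$). For $\tau\in\mathbb D_g$ let $\mathcal P_\tau$ be the span of $\sum_l(-i(1-\bar\tau)_{lj}\partial_{x_l}+(1+\bar\tau)_{lj}\partial_{y_l})$, $j=1,\dots,g$. The half-form bundle over $\mathbb D_g$ is the line bundle trivialized by $\sqrt{d^g(x,y)_\tau}$, a square root of $d^g(x,y)_\tau=\bigwedge^g[(1+\tau)dx-i(1-\tau)dy]$, and $\mathcal Q\to\mathbb D_g$ is the subbundle of $\mathbb D_g\times\Gamma^{-\infty}(L^k)$, twisted by the half-form bundle, with fibres $\mathcal Q_\tau=\widetilde{\mathcal Q}_{\mathcal P_\tau}\otimes\mathbb C\sqrt{d^g(x,y)_\tau}$. For $\tau\in\breve{\mathbb D}_g$ put $\Omega(\tau)=i(1-\tau)(1+\tau)^{-1}$ and, for $l\in\{0,\dots,k-1\}^g$, $$\vartheta^l_\Omega(x,y)=e^{-k\pi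 i\,{}^txy}\sum_{m\in\mathbb Z^g}e^{k\pi i\,{}^t(y-m-l/k)\Omega(y-m-l/k)+2k\pi i\,{}^t(m+l/k)x},\qquad \widetilde\vartheta^l_\tau=\det(1+\tau)^{-1/2}\vartheta^l_{\Omega(\tau)},$$ with the continuous branch equal to $1$ at $\tau=0$, given by $\int_{\mathbb R^g}e^{-\pi\,{}^t\xi(1+\tau)\xi}d\xi$. The group $Sp(2g,\mathbb R)$, with elements $M=\begin{pmatrix}A&B\\C&D\end{pmatrix}$, acts on $\mathbb D_g$ by the continuous extension of $\Omega\mapsto(A\Omega+B)(C\Omega+D)^{-1}$. The metaplectic group is generated by the operators $$S(P,L,Q)_mf(u)=i^{-g/2+m}k^{g/2}|\det L|^{1/2}\int_{\mathbb R^g} e^{k\pi i({}^tuPu-2\,{}^tu\,{}^tLv+{}^tvQv)}f(v)\,dv$$ with $P,Q$ real symmetric, $L$ real invertible and $(i^m)^2=\mathrm{sign}\det L$; this generator covers the symplectic matrix with blocks $PL^{-1},\ PL^{-1}Q-{}^tL,\ L^{-1},\ L^{-1}Q$. It acts on smooth sections of $L^k$ by acting on each Weil–Brezin coefficient $(s)_l(y)=\int_{[0,1]^g}s(x,y+\tfrac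 lk)e^{k\pi i\,{}^tx(y+l/k)-2\pi i\,{}^tlx}dx$, and on $\Gamma^{-\infty}(L^k)$ by the continuous extension. On half-forms it acts by $\sqrt{d^gz_\Omega}\mapsto i^{-m}|\det L|^{-1/2}\det(\Omega+Q)^{1/2}\sqrt{d^gz_{M(\Omega)}}$, where $\sqrt{d^gz_{\Omega(\tau)}}=\det(1+\tau)^{-1/2}\sqrt{d^g(x,y)_\tau}$ and $\det(Z)^{-1/2}=i^{-g/2}\int_{\mathbb R^g} e^{\pi i\,{}^t\xi Z\xi}d\xi$, extended continuously to $\mathbb D_g$. An element $M\in Sp(2g,\mathbb R)$ acts on $\Gamma^{-\infty}(L^k)\otimes\sqrt{d^g(x,y)_\tau}$ through any element of the metaplectic group over $M$. **Theorem.** The map $\tau\mapsto\mathcal P_\tau$ is a bijection from $\mathbb D_g$ onto the set of invariant nonnegative polarizations, $Sp(2g,\mathbb R)$ maps $\mathbb D_g$ to itself with $\mathcal P_{M(\tau)}=M\mathcal P_\tau$, and the Gaussian integral above is the stated branch of $\det(1+\tau)^{-1/2}$. For every $l$ and $\tau\in\breve{\mathbb D}_g$, $\widetilde\vartheta^l_\tau$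 is a smooth section of $L^k$, and $\tau\mapsto\widetilde\vartheta^l_\tau$ extends to a continuous map $\mathbb D_g\to\Gamma^{-\infty}(L^k)$. For every $\tau\in\mathbb D_g$ the $k^g$ elements $\widetilde\vartheta^l_\tau$ form a basis of $\widetilde{\mathcal Q}_{\mathcal P_\tau}$; in particular $\dim\widetilde{\mathcal Q}_P=k^g$ for every invariant nonnegative polarization $P$ (complex, mixed or real). The sections $\sigma^l_\tau=\widetilde\vartheta^l_\tau\sqrt{d^g(x,y)_\tau}$ trivialize $\mathcal Q$: the map $(\tau,c)\mapsto\sum_lc_l\sigma^l_\tau$ is a homeomorphism $\mathbb D_g\times\mathbb C^{k^g}\to\mathcal Q$. Finally, the frame is invariant: for all $M\in Sp(2g,\mathbb R)$, $\tau\in\mathbb D_g$ and $l$, $M$ takes $\sigma^l_\tau$ to $\sigma^l_{M(\tau)}$, whichever element of the metaplectic group over $M$ is used (and there is one). -/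

import Mathlib

open Matrix MeasureTheory Set
open scoped ContDiff ComplexOrder

/-! ## The symplectic torus and its prequantum line bundle -/

/-- The universal cover `ℝ^{2g}` of the torus, with coordinates `u = (x, y)`. -/
abbrev Cover (g : ℕ) : Type := (Fin g → ℝ) × (Fin g → ℝ)

/-- The complexified tangent space `ℂ^{2g}`: the pair `(α, β)` is
`∑ α_j ∂/∂x_j + ∑ β_j ∂/∂y_j`. -/
abbrev CTangent (g : ℕ) : Type := (Fin g → ℂ) × (Fin g → ℂ)

/-- The symplectic form `ω = ∑ dy_j ∧ dx_j`, as a bilinear form on `R^{2g}`. -/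
def symplForm {R : Type*} [CommRing R] {g : ℕ} (u v : (Fin g → R) × (Fin g → R)) : R :=
  u.2 ⬝ᵥ v.1 - u.1 ⬝ᵥ v.2

/-- A lattice vector `λ ∈ ℤ^{2g}` as an element of `ℝ^{2g}`. -/
def latticeVec {g : ℕ} (a : (Fin g → ℤ) × (Fin g → ℤ)) : Cover g :=
  (fun j => (a.1 j : ℝ), fun j => (a.2 j : ℝ))

/-- A real vector as a complex vector. -/
def complexify {g : ℕ} (u : Cover g) : CTangent g :=
  (fun j => (u.1 j : ℂ), fun j => (u.2 j : ℂ))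

/-- The automorphy factor `α(λ) e^{-π i ω(u, λ)}` of the prequantum line bundle `L`, where
`α(λ) = (-1)^{∑ λ_j λ_{g+j}}`. -/
noncomputable def automorphy {g : ℕ} (a : (Fin g → ℤ) × (Fin g → ℤ)) (u : Cover g) : ℂ :=
  (-1 : ℂ) ^ (a.1 ⬝ᵥ a.2) *
    Complex.exp (-(Real.pi * Complex.I * ((symplForm u (latticeVec a) : ℝ) : ℂ)))

/-- Smooth sections of `L^n` (`n ∈ ℤ`), as smooth quasi-periodic functions on `ℝ^{2g}`. -/
def smoothSectionSubmodule (g : ℕ) (n : ℤ) : Submodule ℂ (Cover g → ℂ) where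
  carrier := {s | ContDiff ℝ ∞ s ∧
    ∀ (a : (Fin g → ℤ) × (Fin g → ℤ)) (u : Cover g),
      s (u + latticeVec a) = automorphy a u ^ n * s u}
  add_mem' := by
    rintro s t ⟨hs, hs'⟩ ⟨ht, ht'⟩
    refine ⟨hs.add ht, fun a u => ?_⟩
    simp only [Pi.add_apply, hs', ht', mul_add]
  zero_mem' := ⟨contDiff_const, fun a u => by simp⟩
  smul_mem' := by
    rintro c s ⟨hs, hs'⟩
    refine ⟨hs.const_smul c, fun a u => ?_⟩
    simp only [Pi.smul_apply, hs', smul_eq_mul]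
    ring

/-- The space `Γ^∞(L^n)` (a type of its own, because it carries the `C^∞` topology rather than
the topology of pointwise convergence). -/
def SmoothSection (g : ℕ) (n : ℤ) : Type := smoothSectionSubmodule g n

noncomputable instance (g : ℕ) (n : ℤ) : AddCommGroup (SmoothSection g n) :=
  inferInstanceAs (AddCommGroup (smoothSectionSubmodule g n))

noncomputable instance (g : ℕ) (n : ℤ) : Module ℂ (SmoothSection g n) :=
  inferInstanceAs (Module ℂ (smoothSectionSubmodule g n))

instance (g : ℕ) (n : ℤ) : CoeFun (SmoothSection g n) (fun _ => Cover g → ℂ) :=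
  ⟨fun s => s.1⟩

/-- The closed unit cell `[0,1]^{2g}`. -/
abbrev unitCell (g : ℕ) : Set (Cover g) := Set.Icc 0 1

/-- The `N`-th derivative of a smooth section, restricted to the unit cell. -/
noncomputable def derivOnCell (g : ℕ) (n : ℤ) (N : ℕ) :
    SmoothSection g n →ₗ[ℂ] C(unitCell g, Cover g [×N]→L[ℝ] ℂ) where
  toFun s := ⟨fun u => iteratedFDeriv ℝ N s u,
    (s.2.1.continuous_iteratedFDeriv (by exact_mod_cast le_top)).comp continuous_subtype_val⟩
  map_add' s t := by
    ext1 u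
    exact iteratedFDeriv_add_apply (s.2.1.contDiffAt.of_le (by exact_mod_cast le_top))
      (t.2.1.contDiffAt.of_le (by exact_mod_cast le_top))
  map_smul' c s := by
    ext1 u
    exact iteratedFDeriv_const_smul_apply (s.2.1.contDiffAt.of_le (by exact_mod_cast le_top))

/-- The seminorm `s ↦ sup_{u ∈ [0,1]^{2g}} ‖D^N s(u)‖`. -/
noncomputable def sectionSeminorm (g : ℕ) (n : ℤ) : SeminormFamily ℂ (SmoothSection g n) ℕ :=
  fun N => (normSeminorm ℂ (C(unitCell g, Cover g [×N]→L[ℝ] ℂ))).comp (derivOnCell g n N)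

/-- The `C^∞` topology on the smooth sections of `L^n`. -/
noncomputable instance (g : ℕ) (n : ℤ) : TopologicalSpace (SmoothSection g n) :=
  (sectionSeminorm g n).moduleFilterBasis.topology

theorem sectionSeminorm_withSeminorms (g : ℕ) (n : ℤ) :
    WithSeminorms (sectionSeminorm g n) := ⟨rfl⟩

instance (g : ℕ) (n : ℤ) : IsTopologicalAddGroup (SmoothSection g n) :=
  (sectionSeminorm_withSeminorms g n).topologicalAddGroup

instance (g : ℕ) (n : ℤ) : ContinuousSMul ℂ (SmoothSection g n) :=
  (sectionSeminorm_withSeminorms g n).continuousSMul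

/-- Distributional sections of `L^k`: the continuous dual of the space of (test) sections of
`L^{-k}`, with the strong dual topology (uniform convergence on bounded sets). -/
abbrev DistSection (g k : ℕ) : Type := SmoothSection g (-(k : ℤ)) →L[ℂ] ℂ

/-- The pairing `∫ s φ` over the torus of a section of `L^k` with a test section of `L^{-k}`. -/
noncomputable def torusPairing {g k : ℕ} (s : SmoothSection g k)
    (φ : SmoothSection g (-(k : ℤ))) : ℂ :=
  ∫ u in unitCell g, s u * φ u

/-! ## The weak equations of covariant constancy -/

/-- The derivative `df_u(w)` of `f` at `u` along a complex tangent vector `w`. -/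
noncomputable def complexDeriv {g : ℕ} (f : Cover g → ℂ) (u : Cover g) (w : CTangent g) : ℂ :=
  fderiv ℝ f u (fun j => (w.1 j).re, fun j => (w.2 j).re) +
    Complex.I * fderiv ℝ f u (fun j => (w.1 j).im, fun j => (w.2 j).im)

/-- The covariant derivative of `L^n`:
`(∇_w s)(u) = ds_u(w) - nπi s(u) ∑ (y_j dx_j - x_j dy_j)(w)`. -/
noncomputable def covDeriv {g : ℕ} (n : ℤ) (s : Cover g → ℂ) (u : Cover g) (w : CTangent g) : ℂ :=
  complexDeriv s u w - n * Real.pi * Complex.I * s u * symplForm (complexify u) w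

/-- Smooth complex vector fields on the torus, as periodic functions on the universal cover. -/
structure TorusVectorField (g : ℕ) where
  toFun : Cover g → CTangent g
  smooth : ContDiff ℝ ∞ toFun
  periodic : ∀ (a : (Fin g → ℤ) × (Fin g → ℤ)) (u : Cover g),
    toFun (u + latticeVec a) = toFun u

/-- The divergence of a complex vector field. -/
noncomputable def divergence {g : ℕ} (ξ : TorusVectorField g) (u : Cover g) : ℂ :=
  ∑ j, (fderiv ℝ (fun v => (ξ.toFun v).1 j) u (Pi.single j 1, 0) +
    fderiv ℝ (fun v => (ξ.toFun v).2 j) u (0, Pi.single j 1))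

theorem fderiv_add_latticeVec {g : ℕ} {E : Type*} [NormedAddCommGroup E] [NormedSpace ℝ E]
    (f : Cover g → E) (u v : Cover g) :
    fderiv ℝ f (u + v) = fderiv ℝ (fun w => f (w + v)) u := by
  rw [fderiv_comp_add_right]

theorem symplForm_complexify {g : ℕ} (u v : Cover g) :
    symplForm (complexify u) (complexify v) = ((symplForm u v : ℝ) : ℂ) := by
  simp [symplForm, complexify, dotProduct]

theorem divergence_periodic {g : ℕ} (ξ : TorusVectorField g)
    (a : (Fin g → ℤ) × (Fin g → ℤ)) (u : Cover g) :
    divergence ξ (u + latticeVec a) = divergence ξ u := by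
  simp only [divergence, fderiv_add_latticeVec, ξ.periodic]

theorem automorphy_ne_zero {g : ℕ} (a : (Fin g → ℤ) × (Fin g → ℤ)) (u : Cover g) :
    automorphy a u ≠ 0 :=
  mul_ne_zero (zpow_ne_zero _ (by norm_num)) (Complex.exp_ne_zero _)

theorem hasFDerivAt_automorphy_zpow {g : ℕ} (n : ℤ) (a : (Fin g → ℤ) × (Fin g → ℤ))
    (u : Cover g) :
    ∃ D : Cover g →L[ℝ] ℂ, HasFDerivAt (fun v => automorphy a v ^ n) D u ∧
      ∀ v, D v = automorphy a u ^ n *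
        (-(n * Real.pi * Complex.I * ((symplForm v (latticeVec a) : ℝ) : ℂ))) := by
  let ℓ : Cover g →ₗ[ℝ] ℝ :=
    { toFun := fun v => symplForm v (latticeVec a)
      map_add' := fun v w => by simp [symplForm]; ring
      map_smul' := fun c v => by simp [symplForm]; ring }
  let L : Cover g →L[ℝ] ℂ := Complex.ofRealCLM.comp (LinearMap.toContinuousLinearMap ℓ)
  have hL : ∀ v, L v = ((symplForm v (latticeVec a) : ℝ) : ℂ) := fun v => rfl
  have key : (fun v => automorphy a v ^ n) = fun v =>
      ((-1 : ℂ) ^ (a.1 ⬝ᵥ a.2)) ^ n *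
        Complex.exp ((-(n * Real.pi * Complex.I)) * L v) := by
    funext v
    rw [automorphy, mul_zpow, ← Complex.exp_int_mul, hL]
    congr 2
    ring
  have h1 : HasFDerivAt (fun v => (-(n * Real.pi * Complex.I)) * L v)
      ((-(n * Real.pi * Complex.I) : ℂ) • L) u := L.hasFDerivAt.const_mul _
  have h2 := h1.cexp.const_mul (((-1 : ℂ) ^ (a.1 ⬝ᵥ a.2)) ^ n)
  rw [← key] at h2
  refine ⟨_, h2, fun v => ?_⟩
  have key' := congrFun key u
  rw [key']
  simp only [_root_.smul_apply, smul_eq_mul, hL]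
  ring

/-- The expression `div ξ · s + ∇_ξ s`, as an operator on the smooth sections of `L^n`. -/
noncomputable def divCovDeriv {g : ℕ} (n : ℤ) (ξ : TorusVectorField g) (s : SmoothSection g n) :
    SmoothSection g n :=
  ⟨fun u => divergence ξ u * s u + covDeriv n s u (ξ.toFun u), by
    have hs : ContDiff ℝ ∞ (s : Cover g → ℂ) := s.2.1
    have hξ := ξ.smooth
    have hfd : ContDiff ℝ ∞ (fun u => fderiv ℝ (s : Cover g → ℂ) u) :=
      hs.fderiv_right (by simp)
    have h1 : ∀ j, ContDiff ℝ ∞ (fun u => (ξ.toFun u).1 j) := fun j =>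
      (contDiff_apply ℝ ℂ j).comp (contDiff_fst.comp hξ)
    have h2 : ∀ j, ContDiff ℝ ∞ (fun u => (ξ.toFun u).2 j) := fun j =>
      (contDiff_apply ℝ ℂ j).comp (contDiff_snd.comp hξ)
    have hre : ContDiff ℝ ∞ Complex.re := Complex.reCLM.contDiff
    have him : ContDiff ℝ ∞ Complex.im := Complex.imCLM.contDiff
    have hof : ContDiff ℝ ∞ Complex.ofReal := Complex.ofRealCLM.contDiff
    have hx : ∀ j, ContDiff ℝ ∞ (fun u : Cover g => ((u.1 j : ℝ) : ℂ)) := fun j =>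
      hof.comp ((contDiff_apply ℝ ℝ j).comp contDiff_fst)
    have hy : ∀ j, ContDiff ℝ ∞ (fun u : Cover g => ((u.2 j : ℝ) : ℂ)) := fun j =>
      hof.comp ((contDiff_apply ℝ ℝ j).comp contDiff_snd)
    refine ⟨ContDiff.add (ContDiff.mul ?_ hs) (ContDiff.sub (ContDiff.add ?_ ?_) ?_), ?_⟩
    · refine ContDiff.sum fun j _ => ContDiff.add ?_ ?_
      · exact ((h1 j).fderiv_right (by simp)).clm_apply contDiff_const
      · exact ((h2 j).fderiv_right (by simp)).clm_apply contDiff_const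
    · refine hfd.clm_apply (ContDiff.prodMk ?_ ?_)
      · exact contDiff_pi.2 fun j => hre.comp (h1 j)
      · exact contDiff_pi.2 fun j => hre.comp (h2 j)
    · refine contDiff_const.mul (hfd.clm_apply (ContDiff.prodMk ?_ ?_))
      · exact contDiff_pi.2 fun j => him.comp (h1 j)
      · exact contDiff_pi.2 fun j => him.comp (h2 j)
    · refine (contDiff_const.mul hs).mul (ContDiff.sub ?_ ?_)
      · exact ContDiff.sum fun j _ => (hy j).mul (h1 j)
      · exact ContDiff.sum fun j _ => (hx j).mul (h2 j)
    · intro a u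
      obtain ⟨D, hD, hDv⟩ := hasFDerivAt_automorphy_zpow n a u
      have hsd : HasFDerivAt (s : Cover g → ℂ) (fderiv ℝ s u) u :=
        (hs.differentiable (by simp)).differentiableAt.hasFDerivAt
      have hprod := hD.mul hsd
      have hfun : (fun w => s (w + latticeVec a)) = fun v => automorphy a v ^ n * s v :=
        funext fun w => s.2.2 a w
      have hder : fderiv ℝ s (u + latticeVec a) =
          automorphy a u ^ n • fderiv ℝ s u + s u • D := by
        rw [fderiv_add_latticeVec, hfun]
        exact hprod.fderiv
      have hc : ∀ w : CTangent g, symplForm (complexify (latticeVec a)) w +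
          (((symplForm ((fun j => (w.1 j).re, fun j => (w.2 j).re) : Cover g)
            (latticeVec a) : ℝ) : ℂ) + Complex.I *
          ((symplForm ((fun j => (w.1 j).im, fun j => (w.2 j).im) : Cover g)
            (latticeVec a) : ℝ) : ℂ)) = 0 := by
        intro w
        simp only [symplForm, complexify, dotProduct, latticeVec, Complex.ofReal_sub,
          Complex.ofReal_sum, Complex.ofReal_mul, Finset.mul_sum, mul_sub,
          ← Finset.sum_sub_distrib, ← Finset.sum_add_distrib]
        refine Finset.sum_eq_zero fun j _ => ?_
        nth_rewrite 1 [← Complex.re_add_im (w.1 j)]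
        nth_rewrite 1 [← Complex.re_add_im (w.2 j)]
        ring
      have hadd : symplForm (complexify (u + latticeVec a)) (ξ.toFun u) =
          symplForm (complexify u) (ξ.toFun u) +
            symplForm (complexify (latticeVec a)) (ξ.toFun u) := by
        simp only [symplForm, complexify, dotProduct, Prod.fst_add, Prod.snd_add, Pi.add_apply,
          Complex.ofReal_add, add_mul, Finset.sum_add_distrib]
        ring
      have hc' := hc (ξ.toFun u)
      simp only [covDeriv, complexDeriv, divergence_periodic, ξ.periodic, hder, s.2.2 a u, hadd,
        _root_.add_apply, _root_.smul_apply, smul_eq_mul, hDv]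
      linear_combination (-(automorphy a u ^ n) * n * Real.pi * Complex.I * s u) * hc'⟩

/-- The weak covariant derivative of a distributional section of `L^k`:
`(∇'_ξ σ)(φ) = -σ(div ξ · φ + ∇^{-1}_ξ φ)` for test sections `φ` of `L^{-k}`. -/
noncomputable def weakCovDeriv {g k : ℕ} (ξ : TorusVectorField g) (σ : DistSection g k)
    (φ : SmoothSection g (-(k : ℤ))) : ℂ :=
  -σ (divCovDeriv (-(k : ℤ)) ξ φ)

/-- The quantum space of an invariant polarization `P ⊆ ℂ^{2g}`: the distributional sections `σ`
of `L^k` with `∇'_ξ σ = 0` for every smooth vector field `ξ` that is the complex conjugate of a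
section of `P`. -/
noncomputable def quantumSpace {g : ℕ} (k : ℕ) (P : Submodule ℂ (CTangent g)) :
    Submodule ℂ (DistSection g k) where
  carrier := {σ | ∀ ξ : TorusVectorField g, (∀ u, star (ξ.toFun u) ∈ P) →
    ∀ φ, weakCovDeriv ξ σ φ = 0}
  add_mem' := by
    intro σ σ' h h' ξ hξ φ
    have h1 := h ξ hξ φ
    have h2 := h' ξ hξ φ
    simp only [weakCovDeriv, neg_eq_zero] at h1 h2 ⊢
    simp [h1, h2]
  zero_mem' := by
    intro ξ _ φ
    simp [weakCovDeriv]
  smul_mem' := by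
    intro c σ h ξ hξ φ
    have h1 := h ξ hξ φ
    simp only [weakCovDeriv, neg_eq_zero] at h1 ⊢
    simp [h1]

/-! ## Invariant polarizations and the Siegel disc -/

/-- The open Siegel disc: complex symmetric `τ` with `1 - τ* τ > 0`. -/
def openSiegelDisc (g : ℕ) : Set (Matrix (Fin g) (Fin g) ℂ) :=
  {τ | τ.IsSymm ∧ (1 - τᴴ * τ).PosDef}

/-- The closed Siegel disc `𝔻_g`: complex symmetric `τ` with `1 - τ* τ ≥ 0`. -/
def closedSiegelDisc (g : ℕ) : Set (Matrix (Fin g) (Fin g) ℂ) :=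
  {τ | τ.IsSymm ∧ (1 - τᴴ * τ).PosSemidef}

/-- The inverse Cayley transform `Ω(τ) = i (1 - τ) (1 + τ)⁻¹`, from the open Siegel disc onto the
Siegel upper half-space. -/
noncomputable def cayleyInv {g : ℕ} (τ : Matrix (Fin g) (Fin g) ℂ) : Matrix (Fin g) (Fin g) ℂ :=
  Complex.I • ((1 - τ) * (1 + τ)⁻¹)

/-- The nonnegative Lagrangian subspaces of `(ℂ^{2g}, ω)`, that is, the invariant nonnegative
polarizations: `ω` vanishes on `P`, `dim P = g`, and `-i ω(v, v̄) ≥ 0` for `v ∈ P`. -/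
def nonnegLagrangians (g : ℕ) : Set (Submodule ℂ (CTangent g)) :=
  {P | Module.finrank ℂ P = g ∧ (∀ v ∈ P, ∀ w ∈ P, symplForm v w = 0) ∧
    ∀ v ∈ P, 0 ≤ -Complex.I * symplForm v (star v)}

/-- The polarization `P_τ`, spanned by the vectors
`∑_l (-i (1 - τ̄)_{lj} ∂/∂x_l + (1 + τ̄)_{lj} ∂/∂y_l)`, `j = 1, …, g`. -/
noncomputable def siegelPolarization {g : ℕ} (τ : Matrix (Fin g) (Fin g) ℂ) :
    Submodule ℂ (CTangent g) :=
  Submodule.span ℂ (Set.range fun j : Fin g =>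
    ((fun l => -Complex.I * (1 - τ.map star) l j, fun l => (1 + τ.map star) l j) : CTangent g))

/-- The linear action of a real `2g × 2g` matrix with blocks `A, B, C, D` on `ℂ^{2g}`:
`(x, y) ↦ (A x + B y, C x + D y)`. -/
noncomputable def matrixAct {g : ℕ} (M : Matrix (Fin g ⊕ Fin g) (Fin g ⊕ Fin g) ℝ) :
    CTangent g →ₗ[ℂ] CTangent g :=
  let A := M.toBlocks₁₁.map Complex.ofReal
  let B := M.toBlocks₁₂.map Complex.ofReal
  let C := M.toBlocks₂₁.map Complex.ofReal
  let D := M.toBlocks₂₂.map Complex.ofReal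
  LinearMap.prod
    (A.mulVecLin ∘ₗ LinearMap.fst ℂ _ _ + B.mulVecLin ∘ₗ LinearMap.snd ℂ _ _)
    (C.mulVecLin ∘ₗ LinearMap.fst ℂ _ _ + D.mulVecLin ∘ₗ LinearMap.snd ℂ _ _)

/-- The action of the real symplectic group on the closed Siegel disc. It is the extension of
`Ω ↦ (A Ω + B) (C Ω + D)⁻¹`: in terms of `X = A · i(1 - τ) + B (1 + τ)` and
`Y = C · i(1 - τ) + D (1 + τ)` it reads `M(τ) = (Y + i X) (Y - i X)⁻¹`. -/
noncomputable def siegelAct {g : ℕ} (M : Matrix (Fin g ⊕ Fin g) (Fin g ⊕ Fin g) ℝ)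
    (τ : Matrix (Fin g) (Fin g) ℂ) : Matrix (Fin g) (Fin g) ℂ :=
  let A := M.toBlocks₁₁.map Complex.ofReal
  let B := M.toBlocks₁₂.map Complex.ofReal
  let C := M.toBlocks₂₁.map Complex.ofReal
  let D := M.toBlocks₂₂.map Complex.ofReal
  let X := A * (Complex.I • (1 - τ)) + B * (1 + τ)
  let Y := C * (Complex.I • (1 - τ)) + D * (1 + τ)
  (Y + Complex.I • X) * (Y - Complex.I • X)⁻¹

/-! ## Theta sections -/

/-- The quadratic form `ᵗv Z v`. -/
def quadForm {g : ℕ} (Z : Matrix (Fin g) (Fin g) ℂ) (v : Fin g → ℂ) : ℂ := v ⬝ᵥ (Z *ᵥ v)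

/-- The theta section `ϑ^l_Ω` of `L^k`, as a function on `ℝ^{2g}`:
`e^{-kπi ᵗx y} ∑_m e^{kπi ᵗ(y - m - l/k) Ω (y - m - l/k) + 2kπi ᵗ(m + l/k) x}`. -/
noncomputable def thetaSection {g k : ℕ} (l : Fin g → Fin k) (Ω : Matrix (Fin g) (Fin g) ℂ)
    (u : Cover g) : ℂ :=
  Complex.exp (-(k * Real.pi * Complex.I * ((u.1 ⬝ᵥ u.2 : ℝ) : ℂ))) *
    ∑' m : Fin g → ℤ, Complex.exp
      (k * Real.pi * Complex.I *
          quadForm Ω (fun j => (u.2 j : ℂ) - (m j : ℂ) - ((l j : ℕ) : ℂ) / k) +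
        2 * k * Real.pi * Complex.I * ∑ j, ((m j : ℂ) + ((l j : ℕ) : ℂ) / k) * (u.1 j : ℂ))

/-- The branch of `(det S)^{-1/2}`, for complex symmetric `S` with positive definite real part,
given by the Gaussian integral `∫ e^{-π ᵗξ S ξ} dξ`. -/
noncomputable def gaussInvSqrtDet {g : ℕ} (S : Matrix (Fin g) (Fin g) ℂ) : ℂ :=
  ∫ ξ : Fin g → ℝ, Complex.exp (-(Real.pi * quadForm S (fun j => (ξ j : ℂ))))

/-- The function `det(1 + τ)^{-1/2}` on the open Siegel disc. -/
noncomputable def discInvSqrtDet {g : ℕ} (τ : Matrix (Fin g) (Fin g) ℂ) : ℂ :=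
  gaussInvSqrtDet (1 + τ)

/-- `r` is the branch of `det(1 + τ)^{-1/2}` on the open Siegel disc that is `1` at `τ = 0`. -/
def IsNormalizedBranch {g : ℕ} (r : Matrix (Fin g) (Fin g) ℂ → ℂ) : Prop :=
  ContinuousOn r (openSiegelDisc g) ∧ r 0 = 1 ∧
    ∀ τ ∈ openSiegelDisc g, r τ ^ 2 * (1 + τ).det = 1

/-- The normalized theta section `det(1 + τ)^{-1/2} ϑ^l_{Ω(τ)}`. -/
noncomputable def normalizedTheta {g k : ℕ} (l : Fin g → Fin k) (τ : Matrix (Fin g) (Fin g) ℂ)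
    (u : Cover g) : ℂ :=
  discInvSqrtDet τ * thetaSection l (cayleyInv τ) u

/-! ## The metaplectic group and its actions -/

/-- The `l`-th Weil-Brezin coefficient of a smooth section of `L^k`:
`(s)_l(y) = ∫_{[0,1]^g} s(x, y + l/k) e^{kπi ᵗx (y + l/k)} e^{-2πi ᵗl x} dx`. -/
noncomputable def weilBrezin {g k : ℕ} (s : SmoothSection g k) (l : Fin g → Fin k)
    (y : Fin g → ℝ) : ℂ :=
  ∫ x in Set.Icc (0 : Fin g → ℝ) 1,
    s (x, fun j => y j + ((l j : ℕ) : ℝ) / k) *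
      Complex.exp (k * Real.pi * Complex.I *
        ∑ j, (x j : ℂ) * ((y j : ℂ) + ((l j : ℕ) : ℂ) / k)) *
      Complex.exp (-(2 * Real.pi * Complex.I * ∑ j, ((l j : ℕ) : ℂ) * (x j : ℂ)))

/-- The data `(P, L, Q)_m` of a generator of the metaplectic group: `P`, `Q` symmetric, `L`
invertible, and `i^m` a square root of the sign of `det L`. -/
structure MetaplecticGenerator (g : ℕ) where
  P : Matrix (Fin g) (Fin g) ℝ
  L : Matrix (Fin g) (Fin g) ℝ
  Q : Matrix (Fin g) (Fin g) ℝ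
  m : ℤ
  symm_P : P.IsSymm
  symm_Q : Q.IsSymm
  det_L : L.det ≠ 0
  root : (Complex.I ^ m) ^ 2 = ((L.det / |L.det| : ℝ) : ℂ)

/-- The symplectic matrix covered by the generator `(P, L, Q)_m`. -/
noncomputable def MetaplecticGenerator.toMatrix {g : ℕ} (γ : MetaplecticGenerator g) :
    Matrix (Fin g ⊕ Fin g) (Fin g ⊕ Fin g) ℝ :=
  Matrix.fromBlocks (γ.P * γ.L⁻¹) (γ.P * γ.L⁻¹ * γ.Q - γ.Lᵀ) γ.L⁻¹ (γ.L⁻¹ * γ.Q)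

/-- The integral operator `S(P, L, Q)_m`:
`i^{-g/2+m} k^{g/2} |det L|^{1/2} ∫ e^{kπi (ᵗu P u - 2 ᵗu ᵗL v + ᵗv Q v)} f(v) dv`. -/
noncomputable def MetaplecticGenerator.integralOp {g : ℕ} (k : ℕ) (γ : MetaplecticGenerator g)
    (f : (Fin g → ℝ) → ℂ) (u : Fin g → ℝ) : ℂ :=
  Complex.exp (Real.pi * Complex.I / 2 * (-(g : ℂ) / 2 + γ.m)) *
    ((Real.sqrt k ^ g * Real.sqrt |γ.L.det| : ℝ) : ℂ) *
    ∫ v : Fin g → ℝ, Complex.exp (k * Real.pi * Complex.I *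
      ((u ⬝ᵥ (γ.P *ᵥ u) - 2 * (u ⬝ᵥ (γ.Lᵀ *ᵥ v)) + v ⬝ᵥ (γ.Q *ᵥ v) : ℝ) : ℂ)) * f v

/-- `T` is the action of the generator `γ` on the distributional sections of `L^k`: the operator
`A` on smooth sections that applies `S(P, L, Q)_m` to every Weil-Brezin coefficient has a
continuous transpose `B` on the test sections, and `T` is the extension `σ ↦ σ ∘ B` of `A`. -/
def MetaplecticGenerator.IsSectionAction {g k : ℕ} (γ : MetaplecticGenerator g)
    (T : DistSection g k →ₗ[ℂ] DistSection g k) : Prop :=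
  ∃ (A : SmoothSection g k →ₗ[ℂ] SmoothSection g k)
    (B : SmoothSection g (-(k : ℤ)) →L[ℂ] SmoothSection g (-(k : ℤ))),
    (∀ s l y, weilBrezin (A s) l y = γ.integralOp k (weilBrezin s l) y) ∧
    (∀ s φ, torusPairing (A s) φ = torusPairing s (B φ)) ∧
    ∀ σ, T σ = σ.comp B

/-- The `g`-form `d^g(x, y)_τ`, the wedge product of the components of
`(1 + τ) dx - i (1 - τ) dy`. It spans the canonical line of `P_τ`. -/
noncomputable def canonicalForm {g : ℕ} (τ : Matrix (Fin g) (Fin g) ℂ) :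
    CTangent g [⋀^Fin g]→ₗ[ℂ] ℂ :=
  (Matrix.detRowAlternating (n := Fin g) (R := ℂ)).compLinearMap
    ((1 + τ).mulVecLin ∘ₗ LinearMap.fst ℂ _ _ -
      Complex.I • ((1 - τ).mulVecLin ∘ₗ LinearMap.snd ℂ _ _))

/-- `h` is the action of the generator `γ`, covering `M`, on the half-form bundle, in terms of
the generators `√d^g(x, y)_τ`, whose squares are `d^g(x, y)_τ`:
`γ · √d^g(x, y)_τ = h(τ) √d^g(x, y)_{M(τ)}`.
It is continuous over the closed disc, it squares to the pull-back `(M⁻¹)^*` of `g`-forms, and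
over the open disc, where `√d^g z_Ω = det(1 + τ)^{-1/2} √d^g(x, y)_τ`, it is given by
`γ · √d^g z_Ω = i^{-m} |det L|^{-1/2} det(Ω + Q)^{1/2} √d^g z_{M(Ω)}`, with the branch of the
square root determined by `det(Z)^{-1/2} = i^{-g/2} ∫ e^{πi ᵗξ Z ξ} dξ`. -/
def MetaplecticGenerator.IsHalfFormAction {g : ℕ} (γ : MetaplecticGenerator g)
    (h : Matrix (Fin g) (Fin g) ℂ → ℂ) : Prop :=
  ContinuousOn h (closedSiegelDisc g) ∧
  (∀ τ ∈ closedSiegelDisc g,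
    h τ ^ 2 • canonicalForm (siegelAct γ.toMatrix τ) =
      (canonicalForm τ).compLinearMap (matrixAct γ.toMatrix⁻¹)) ∧
  ∀ τ ∈ openSiegelDisc g,
    h τ * discInvSqrtDet τ =
      Complex.I ^ (-γ.m) * (((Real.sqrt |γ.L.det|)⁻¹ : ℝ) : ℂ) *
        (Complex.exp (-(Real.pi * Complex.I * g / 4)) *
          gaussInvSqrtDet (-Complex.I • (cayleyInv τ + γ.Q.map Complex.ofReal)))⁻¹ *
        discInvSqrtDet (siegelAct γ.toMatrix τ)

/-- The elements of the metaplectic group, as products of the generators (the inverse of a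
generator is a generator): `IsMetaplectic M T h` says that an element over the symplectic matrix
`M` acts on the distributional sections of `L^k` by `T` and on the half-form bundle by
`√d^g(x, y)_τ ↦ h(τ) √d^g(x, y)_{M(τ)}`. -/
inductive IsMetaplectic {g k : ℕ} : Matrix (Fin g ⊕ Fin g) (Fin g ⊕ Fin g) ℝ →
    (DistSection g k →ₗ[ℂ] DistSection g k) → (Matrix (Fin g) (Fin g) ℂ → ℂ) → Prop
  | gen (γ : MetaplecticGenerator g) (T : DistSection g k →ₗ[ℂ] DistSection g k)
      (h : Matrix (Fin g) (Fin g) ℂ → ℂ) (hT : γ.IsSectionAction T)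
      (hh : γ.IsHalfFormAction h) : IsMetaplectic γ.toMatrix T h
  | mul {M₁ M₂ : Matrix (Fin g ⊕ Fin g) (Fin g ⊕ Fin g) ℝ}
      {T₁ T₂ : DistSection g k →ₗ[ℂ] DistSection g k} {h₁ h₂ : Matrix (Fin g) (Fin g) ℂ → ℂ}
      (H₁ : IsMetaplectic M₁ T₁ h₁) (H₂ : IsMetaplectic M₂ T₂ h₂) :
      IsMetaplectic (M₁ * M₂) (T₁ ∘ₗ T₂) (fun τ => h₁ (siegelAct M₂ τ) * h₂ τ)

/-! ## The half-form corrected quantum bundle -/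

/-- The half-form corrected bundle `Γ^{-∞}(L^k) ⊗ ℂ√d^g(x, y)_τ` (over all matrices `τ`), in its
trivialization by `√d^g(x, y)_τ`: the point `(τ, σ)` is `σ ⊗ √d^g(x, y)_τ`. -/
abbrev CorrectedBundle (g k : ℕ) : Type := Matrix (Fin g) (Fin g) ℂ × DistSection g k

/-- The quantum bundle `𝒬 → 𝔻_g`, with fibre `𝒬_τ = {σ ⊗ √d^g(x, y)_τ}`, where `σ` runs over
the quantum space of `P_τ`. -/
def quantumBundle (g k : ℕ) : Set (CorrectedBundle g k) :=
  {p | p.1 ∈ closedSiegelDisc g ∧ p.2 ∈ quantumSpace k (siegelPolarization p.1)}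

/-- The action of `Sp(2g, ℝ)` on the half-form corrected bundle: `M` takes `p = σ ⊗ √d^g(x, y)_τ`
to `q = T σ ⊗ h(τ) √d^g(x, y)_{M(τ)}`, for a metaplectic element over `M`. -/
def SymplecticActs {g k : ℕ} (M : Matrix (Fin g ⊕ Fin g) (Fin g ⊕ Fin g) ℝ)
    (p q : CorrectedBundle g k) : Prop :=
  ∃ (T : DistSection g k →ₗ[ℂ] DistSection g k) (h : Matrix (Fin g) (Fin g) ℂ → ℂ),
    IsMetaplectic M T h ∧ q = (siegelAct M p.1, h p.1 • T p.2)

/-! In the coordinates `p = β + iα`, `q = β - iα` of a complex tangent vector `(α, β)`, the form `ω`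
becomes `(q · p' - p · q') / 2i` and `-iω(v, v̄)` becomes `(|p|² - |q|²) / 2`. A nonnegative
Lagrangian is therefore the graph `q = τ̄ p` of a symmetric contraction, which gives the bijection
with the closed disc (`exists_siegelPolarization_eq`). The action of `Sp(2g, ℝ)` is then
push-forward of graphs (`siegelAct_spec_aux`).

Fourier expansion in `x` (the Weil–Brezin transform, `wbOp` with inverse `synOp`) identifies the
smooth sections of `L^n`, `n ≠ 0`, with `|n|^g` copies of the Schwartz space. It turns `∇_{x_j}`
into multiplication by `-2πi n y_j` and `∇_{y_j}` into `∂_j`. A distributional section of `L^k` is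
thus a tuple of `k^g` tempered distributions `Λ`. Since only constant fields need to be tested
(`mem_quantumSpace_iff`), it lies in the quantum space of `P_τ` exactly when each `Λ` kills the
range of every operator `∑ (1 + τ)_{ji} ∂_i - 2πk ∑ (1 - τ)_{ji} y_i`, that is, when `IsVacuum`
holds. What remains is to show that this system has a one-dimensional solution space, with a
generator that is continuous in `τ` and never zero, up to the boundary, where `1 + τ` may be
singular and the solution need not be a function.

This is done by coherent states `φ_w`, `w = (p, ξ)`, which are eigenvectors of `∂_j + 2πc y_j` with
eigenvalue `z_j = 2πc p_j + 2πi ξ_j`. On them the system reads `4πc Λ(y_j φ_w) = ((1 + τ) z)_j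
Λ(φ_w)`, with no inverse of `1 + τ`. Integrating along the ray `tw` gives `Λ(φ_w) = Λ(φ_0)
exp(-πc|p|² + ᵗz(1 + τ)z / 8πc)` (`IsVacuum.apply_coherent`). The resolution of the identity by
coherent states recovers `Λ` from these values, hence uniqueness. Conversely the exponential is
bounded by `1` for every `τ` in the closed disc (`norm_vacuumSymbol_le_one`), so integrating it
against the coherent state transform of `f` defines a functional `gaussFunctional`. It depends
continuously on `τ`, uniformly for `f` in bounded sets, by dominated convergence.

Over the open disc `gaussFunctional` is integration against the Gaussian of `Ω(τ)` times `det(1 +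
τ)^{-1/2}` (`gaussFunctional_eq_integral`), so its `k^g` lifts are the normalized theta sections.
Its value at `φ_0` is a nonzero constant independent of `τ`, and this produces test sections dual to
the frame, hence the trivialization. Square roots are never computed: signs are settled by
continuity on the connected open disc, and identities pass to the closed disc by density.

For the invariance, a generator of the metaplectic group sends the Gaussian of `Ω` to a multiple of
that of `M(Ω)` (`schwartzOp_discGaussian_apply`), and the half-form factor is the inverse of this
multiple, corrected by the two normalizations. The factor extends to the boundary because it is a
constant divided by the nowhere vanishing amplitude `vacuumAmplitude`. Finally every symplectic
matrix is a product of two matrices covered by generators (`exists_isMetaplectic`). -/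

/-! ## The Siegel disc and nonnegative Lagrangians -/

section SiegelDisc

variable {g : ℕ}

/-- The squared Euclidean norm of a complex vector. -/
noncomputable def sqNorm {n : ℕ} (v : Fin n → ℂ) : ℝ := ∑ i, Complex.normSq (v i)

theorem sqNorm_nonneg {n : ℕ} (v : Fin n → ℂ) : 0 ≤ sqNorm v :=
  Finset.sum_nonneg fun i _ => Complex.normSq_nonneg (v i)

theorem sqNorm_eq_zero {n : ℕ} {v : Fin n → ℂ} : sqNorm v = 0 ↔ v = 0 := by
  rw [sqNorm, Finset.sum_eq_zero_iff_of_nonneg fun i _ => Complex.normSq_nonneg (v i)]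
  simp [funext_iff]

theorem sqNorm_pos {n : ℕ} {v : Fin n → ℂ} (hv : v ≠ 0) : 0 < sqNorm v :=
  lt_of_le_of_ne (sqNorm_nonneg v) fun h => hv (sqNorm_eq_zero.1 h.symm)

theorem star_dotProduct_self {n : ℕ} (v : Fin n → ℂ) : star v ⬝ᵥ v = (sqNorm v : ℂ) := by
  simp [dotProduct, sqNorm, Complex.normSq_eq_conj_mul_self]

theorem sqNorm_star {n : ℕ} (v : Fin n → ℂ) : sqNorm (star v) = sqNorm v := by
  simp [sqNorm]

theorem sqNorm_smul {n : ℕ} (c : ℂ) (v : Fin n → ℂ) :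
    sqNorm (c • v) = Complex.normSq c * sqNorm v := by
  simp [sqNorm, Finset.mul_sum]

/-- This converts positivity of `1 - τᴴ * τ` into the contraction inequality, on which both
membership criteria for the discs rest. -/
theorem star_dotProduct_one_sub_conjTranspose_mul (τ : Matrix (Fin g) (Fin g) ℂ)
    (v : Fin g → ℂ) :
    star v ⬝ᵥ ((1 - τᴴ * τ) *ᵥ v) = ((sqNorm v - sqNorm (τ *ᵥ v) : ℝ) : ℂ) := by
  rw [sub_mulVec, one_mulVec, dotProduct_sub, star_dotProduct_self, ← mulVec_mulVec,
    dotProduct_mulVec, ← star_mulVec, star_dotProduct_self]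
  push_cast
  rfl

theorem isHermitian_one_sub (τ : Matrix (Fin g) (Fin g) ℂ) : (1 - τᴴ * τ).IsHermitian :=
  isHermitian_one.sub (isHermitian_conjTranspose_mul_self τ)

theorem mem_closedSiegelDisc_iff {τ : Matrix (Fin g) (Fin g) ℂ} :
    τ ∈ closedSiegelDisc g ↔ τ.IsSymm ∧ ∀ v, sqNorm (τ *ᵥ v) ≤ sqNorm v := by
  refine and_congr_right fun _ => ?_
  rw [posSemidef_iff_dotProduct_mulVec]
  simp only [isHermitian_one_sub, true_and, star_dotProduct_one_sub_conjTranspose_mul,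
    Complex.zero_le_real, sub_nonneg]

theorem mem_openSiegelDisc_iff {τ : Matrix (Fin g) (Fin g) ℂ} :
    τ ∈ openSiegelDisc g ↔ τ.IsSymm ∧ ∀ v, v ≠ 0 → sqNorm (τ *ᵥ v) < sqNorm v := by
  refine and_congr_right fun _ => ?_
  rw [posDef_iff_dotProduct_mulVec]
  simp only [isHermitian_one_sub, true_and, star_dotProduct_one_sub_conjTranspose_mul,
    Complex.zero_lt_real, sub_pos]

theorem openSiegelDisc_subset : openSiegelDisc g ⊆ closedSiegelDisc g :=
  fun _ h => ⟨h.1, h.2.posSemidef⟩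

/-- Radial shrinking makes a contraction strict. Both the connectedness of the open disc and its
density in the closed disc come from this. -/
theorem real_smul_mem_openSiegelDisc {τ : Matrix (Fin g) (Fin g) ℂ} (hτ : τ ∈ closedSiegelDisc g)
    {r : ℝ} (hr : 0 ≤ r) (hr1 : r < 1) : r • τ ∈ openSiegelDisc g := by
  rw [mem_closedSiegelDisc_iff] at hτ
  refine mem_openSiegelDisc_iff.2 ⟨hτ.1.smul r, fun v hv => ?_⟩
  have h1 : (r • τ) *ᵥ v = (r : ℂ) • (τ *ᵥ v) := by
    rw [smul_mulVec]; ext i; simp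
  rw [h1, sqNorm_smul, Complex.normSq_ofReal]
  have := hτ.2 v
  have h3 := sqNorm_pos hv
  have h4 : r * r < 1 := by nlinarith
  nlinarith [sqNorm_nonneg (τ *ᵥ v), mul_nonneg hr hr]

theorem zero_mem_openSiegelDisc : (0 : Matrix (Fin g) (Fin g) ℂ) ∈ openSiegelDisc g :=
  mem_openSiegelDisc_iff.2 ⟨transpose_zero, fun v hv => by simpa [sqNorm] using sqNorm_pos hv⟩

/-- Connectedness fixes the signs of square roots: two continuous nonvanishing functions with equal
squares agree as soon as they agree at one point. -/
theorem isPreconnected_openSiegelDisc : IsPreconnected (openSiegelDisc g) := by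
  have h : StarConvex ℝ (0 : Matrix (Fin g) (Fin g) ℂ) (openSiegelDisc g) := by
    rw [starConvex_zero_iff]
    intro τ hτ a ha ha1
    rcases ha1.lt_or_eq with h | rfl
    · exact real_smul_mem_openSiegelDisc (openSiegelDisc_subset hτ) ha h
    · simpa using hτ
  exact (h.isPathConnected zero_mem_openSiegelDisc).isConnected.isPreconnected

/-- Identities on the closed disc are proved over the open disc, where the Gaussians converge, and
extended through this density. -/
theorem closedSiegelDisc_subset_closure :
    closedSiegelDisc g ⊆ closure (openSiegelDisc g) := by
  intro τ hτ
  have h : Filter.Tendsto (fun r : ℝ => r • τ) (nhdsWithin 1 (Set.Ico 0 1)) (nhds τ) := by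
    have : Continuous (fun r : ℝ => r • τ) := by fun_prop
    simpa using (this.tendsto 1).mono_left nhdsWithin_le_nhds
  have hne : (nhdsWithin (1 : ℝ) (Set.Ico 0 1)).NeBot := by
    rw [← mem_closure_iff_nhdsWithin_neBot, closure_Ico (by norm_num)]
    simp
  refine mem_closure_of_tendsto h ?_
  filter_upwards [self_mem_nhdsWithin] with r hr
  exact real_smul_mem_openSiegelDisc hτ hr.1 hr.2

/-- The coordinates `p = β + i α` of a tangent vector `(α, β)`. -/
noncomputable def holPart : CTangent g →ₗ[ℂ] (Fin g → ℂ) :=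
  LinearMap.snd ℂ _ _ + Complex.I • LinearMap.fst ℂ _ _

/-- The coordinates `q = β - i α` of a tangent vector `(α, β)`. -/
noncomputable def antiPart : CTangent g →ₗ[ℂ] (Fin g → ℂ) :=
  LinearMap.snd ℂ _ _ - Complex.I • LinearMap.fst ℂ _ _

theorem holPart_apply (v : CTangent g) : holPart v = v.2 + Complex.I • v.1 := rfl

theorem antiPart_apply (v : CTangent g) : antiPart v = v.2 - Complex.I • v.1 := rfl

theorem eq_zero_of_holPart_antiPart {v : CTangent g} (hp : holPart v = 0) (hq : antiPart v = 0) :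
    v = 0 := by
  rw [holPart_apply] at hp
  rw [antiPart_apply] at hq
  ext i
  · have h1 := congrFun hp i
    have h2 := congrFun hq i
    simp at h1 h2 ⊢
    have : 2 * Complex.I * v.1 i = 0 := by linear_combination h1 - h2
    simpa using this
  · have h1 := congrFun hp i
    have h2 := congrFun hq i
    simp at h1 h2 ⊢
    linear_combination (h1 + h2) / 2

theorem symplForm_eq_holPart_antiPart (v w : CTangent g) :
    symplForm v w = (antiPart v ⬝ᵥ holPart w - holPart v ⬝ᵥ antiPart w) / (2 * Complex.I) := by
  rw [eq_div_iff (by simp)]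
  simp only [holPart_apply, antiPart_apply, symplForm, dotProduct_add, add_dotProduct,
    sub_dotProduct, dotProduct_sub, smul_dotProduct, dotProduct_smul, smul_eq_mul]
  ring

/-- The coordinates `p`, `q` diagonalize the Hermitian form, so that nonnegativity of a subspace
reads `|q| ≤ |p|`. -/
theorem neg_I_mul_symplForm_star (v : CTangent g) :
    -Complex.I * symplForm v (star v) =
      (((sqNorm (holPart v) - sqNorm (antiPart v)) / 2 : ℝ) : ℂ) := by
  have h1 : holPart (star v) = star (antiPart v) := by
    ext i
    simp [holPart_apply, antiPart_apply]
  have h2 : antiPart (star v) = star (holPart v) := by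
    ext i
    simp [holPart_apply, antiPart_apply]
    ring
  rw [symplForm_eq_holPart_antiPart, h1, h2, dotProduct_comm, dotProduct_comm (holPart v),
    star_dotProduct_self, star_dotProduct_self]
  field_simp
  push_cast
  ring

theorem mem_siegelPolarization_iff_exists {τ : Matrix (Fin g) (Fin g) ℂ} {v : CTangent g} :
    v ∈ siegelPolarization τ ↔ ∃ a : Fin g → ℂ,
      v = (-Complex.I • ((1 - τ.map star) *ᵥ a), (1 + τ.map star) *ᵥ a) := by
  rw [siegelPolarization, Submodule.mem_span_range_iff_exists_fun]
  refine exists_congr fun a => ?_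
  rw [eq_comm]
  refine Eq.congr rfl ?_
  ext i
  · simp [Prod.fst_sum, mulVec, dotProduct, Finset.mul_sum]
    exact Finset.sum_congr rfl fun j _ => by ring
  · simp [Prod.snd_sum, mulVec, dotProduct]
    exact Finset.sum_congr rfl fun j _ => by ring

/-- The generator with coefficients `a` has `p = 2a` and `q = 2 τ̄ a`, so `P_τ` is the graph of `τ̄`
over the coordinate `p`. -/
theorem mem_siegelPolarization_iff {τ : Matrix (Fin g) (Fin g) ℂ} {v : CTangent g} :
    v ∈ siegelPolarization τ ↔ antiPart v = τ.map star *ᵥ holPart v := by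
  rw [mem_siegelPolarization_iff_exists]
  constructor
  · rintro ⟨a, rfl⟩
    have h : holPart ((-Complex.I • ((1 - τ.map star) *ᵥ a), (1 + τ.map star) *ᵥ a) : CTangent g)
        = (2 : ℂ) • a := by
      rw [holPart_apply]
      ext i
      simp only [sub_mulVec, add_mulVec, one_mulVec, Pi.add_apply, Pi.smul_apply, Pi.sub_apply,
        smul_eq_mul]
      linear_combination (-(a i - (τ.map star *ᵥ a) i)) * Complex.I_mul_I
    rw [h, antiPart_apply, mulVec_smul]
    ext i
    simp only [sub_mulVec, add_mulVec, one_mulVec, Pi.add_apply, Pi.smul_apply, Pi.sub_apply,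
        smul_eq_mul]
    linear_combination ((a i - (τ.map star *ᵥ a) i)) * Complex.I_mul_I
  · intro h
    refine ⟨(1 / 2 : ℂ) • holPart v, ?_⟩
    rw [mulVec_smul, mulVec_smul, sub_mulVec, add_mulVec, one_mulVec, ← h]
    ext i
    · simp only [holPart_apply, antiPart_apply, Pi.add_apply, Pi.smul_apply, Pi.sub_apply,
        smul_eq_mul]
      linear_combination (v.1 i) * Complex.I_mul_I
    · simp only [holPart_apply, antiPart_apply, Pi.add_apply, Pi.smul_apply, Pi.sub_apply,
        smul_eq_mul]
      ring

/-- The tangent vector with given coordinates `p`, `q`. -/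
noncomputable def ofParts (p q : Fin g → ℂ) : CTangent g :=
  ((-Complex.I / 2) • (p - q), (1 / 2 : ℂ) • (p + q))

theorem holPart_ofParts (p q : Fin g → ℂ) : holPart (ofParts p q) = p := by
  rw [holPart_apply]
  ext i
  simp only [ofParts, Pi.add_apply, Pi.smul_apply, Pi.sub_apply, smul_eq_mul]
  linear_combination (-(p i - q i) / 2) * Complex.I_mul_I

theorem antiPart_ofParts (p q : Fin g → ℂ) : antiPart (ofParts p q) = q := by
  rw [antiPart_apply]
  ext i
  simp only [ofParts, Pi.add_apply, Pi.smul_apply, Pi.sub_apply, smul_eq_mul]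
  linear_combination ((p i - q i) / 2) * Complex.I_mul_I

theorem ext_parts {v w : CTangent g} (hp : holPart v = holPart w) (hq : antiPart v = antiPart w) :
    v = w :=
  sub_eq_zero.1 (eq_zero_of_holPart_antiPart (by rw [map_sub, hp, sub_self])
    (by rw [map_sub, hq, sub_self]))

theorem ofParts_mem_siegelPolarization (τ : Matrix (Fin g) (Fin g) ℂ) (p : Fin g → ℂ) :
    ofParts p (τ.map star *ᵥ p) ∈ siegelPolarization τ := by
  rw [mem_siegelPolarization_iff, holPart_ofParts, antiPart_ofParts]

theorem star_mulVec_star (τ : Matrix (Fin g) (Fin g) ℂ) (v : Fin g → ℂ) :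
    star (τ *ᵥ v) = τ.map star *ᵥ star v := by
  ext i
  simp [mulVec, dotProduct]

theorem sqNorm_map_star_mulVec (τ : Matrix (Fin g) (Fin g) ℂ) (v : Fin g → ℂ) :
    sqNorm (τ.map star *ᵥ v) = sqNorm (τ *ᵥ star v) := by
  rw [← sqNorm_star (τ *ᵥ star v), star_mulVec_star, star_star]

/-- The isomorphism of `P_τ` with `ℂ^g` given by the coordinates `p`. -/
noncomputable def siegelPolarizationEquiv (τ : Matrix (Fin g) (Fin g) ℂ) :
    siegelPolarization τ ≃ₗ[ℂ] (Fin g → ℂ) :=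
  LinearEquiv.ofBijective (holPart.domRestrict (siegelPolarization τ)) <| by
    constructor
    · rw [← LinearMap.ker_eq_bot, LinearMap.ker_eq_bot']
      rintro ⟨v, hv⟩ h
      have h' : holPart v = 0 := h
      rw [mem_siegelPolarization_iff, h', mulVec_zero] at hv
      exact Subtype.ext (eq_zero_of_holPart_antiPart h' hv)
    · intro p
      exact ⟨⟨_, ofParts_mem_siegelPolarization τ p⟩, holPart_ofParts _ _⟩

theorem siegelPolarization_mem_nonnegLagrangians {τ : Matrix (Fin g) (Fin g) ℂ}
    (hτ : τ ∈ closedSiegelDisc g) : siegelPolarization τ ∈ nonnegLagrangians g := by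
  rw [mem_closedSiegelDisc_iff] at hτ
  refine ⟨?_, fun v hv w hw => ?_, fun v hv => ?_⟩
  · rw [(siegelPolarizationEquiv τ).finrank_eq]
    simp
  · rw [mem_siegelPolarization_iff] at hv hw
    have hs : (τ.map star)ᵀ = τ.map star := by rw [← transpose_map, hτ.1]
    rw [symplForm_eq_holPart_antiPart, hv, hw, dotProduct_mulVec, ← mulVec_transpose, hs, sub_self,
      zero_div]
  · rw [mem_siegelPolarization_iff] at hv
    rw [neg_I_mul_symplForm_star, Complex.zero_le_real, hv, sqNorm_map_star_mulVec]
    have := hτ.2 (star (holPart v))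
    rw [sqNorm_star] at this
    linarith

theorem siegelPolarization_injective :
    Function.Injective (siegelPolarization (g := g)) := by
  intro τ τ' h
  have key : τ.map star = τ'.map star := by
    refine Matrix.ext_of_mulVec_single fun j => ?_
    have h1 := ofParts_mem_siegelPolarization τ (Pi.single j 1)
    rw [h, mem_siegelPolarization_iff, holPart_ofParts, antiPart_ofParts] at h1
    exact h1
  ext i j
  exact star_injective (congrFun (congrFun key i) j)

/-- Nonnegativity forces `q = 0` wherever `p = 0`, so `P` projects injectively, and by dimension
bijectively, to the coordinate `p`. Hence `P` is the graph of a linear map, which is symmetric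
because `P` is isotropic and a contraction because `P` is nonnegative. -/
theorem exists_siegelPolarization_eq {P : Submodule ℂ (CTangent g)}
    (hP : P ∈ nonnegLagrangians g) : ∃ τ ∈ closedSiegelDisc g, siegelPolarization τ = P := by
  obtain ⟨hdim, hlag, hnn⟩ := hP
  have hle : ∀ v ∈ P, sqNorm (antiPart v) ≤ sqNorm (holPart v) := fun v hv => by
    have := hnn v hv
    rw [neg_I_mul_symplForm_star, Complex.zero_le_real] at this
    linarith
  have hinj : Function.Injective (holPart.domRestrict P) := by
    rw [← LinearMap.ker_eq_bot, LinearMap.ker_eq_bot']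
    rintro ⟨v, hv⟩ h
    have h' : holPart v = 0 := h
    have h2 := hle v hv
    rw [h', sqNorm_eq_zero.2 rfl] at h2
    exact Subtype.ext (eq_zero_of_holPart_antiPart h'
      (sqNorm_eq_zero.1 (le_antisymm h2 (sqNorm_nonneg _))))
  let e : P ≃ₗ[ℂ] (Fin g → ℂ) := LinearEquiv.ofInjectiveOfFinrankEq _ hinj (by simp [hdim])
  have he : ∀ p, holPart (e.symm p : CTangent g) = p := fun p => e.apply_symm_apply p
  -- `T` is the map `p ↦ q` whose graph is `P`; the point of the disc is its entrywise conjugate.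
  let T : Matrix (Fin g) (Fin g) ℂ := LinearMap.toMatrix' (antiPart ∘ₗ P.subtype ∘ₗ e.symm.toLinearMap)
  have hT : ∀ p, T *ᵥ p = antiPart (e.symm p : CTangent g) := fun p => by
    rw [LinearMap.toMatrix'_mulVec]; rfl
  have hTs : (T.map star).map star = T := by ext i j; simp
  have hP : siegelPolarization (T.map star) = P := by
    symm
    refine Submodule.eq_of_le_of_finrank_eq (fun v hv => ?_) ?_
    · rw [mem_siegelPolarization_iff, hTs, hT]
      have : e.symm (holPart v) = ⟨v, hv⟩ := by
        rw [LinearEquiv.symm_apply_eq]; rfl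
      rw [this]
    · rw [hdim, (siegelPolarizationEquiv _).finrank_eq]
      simp
  refine ⟨T.map star, mem_closedSiegelDisc_iff.2 ⟨?_, fun v => ?_⟩, hP⟩
  · have hsymm : Tᵀ = T := by
      refine Matrix.ext fun i j => ?_
      have h1 := hlag _ (e.symm (Pi.single i 1)).2 _ (e.symm (Pi.single j 1)).2
      rw [symplForm_eq_holPart_antiPart, he, he, ← hT, ← hT, div_eq_zero_iff] at h1
      simp at h1
      rw [transpose_apply]
      exact sub_eq_zero.1 h1
    rw [IsSymm, ← transpose_map, hsymm]
  · rw [← sqNorm_star v, ← star_star v, ← sqNorm_map_star_mulVec, hTs, hT, star_star]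
    refine (hle _ (e.symm (star v)).2).trans ?_
    rw [he]

theorem bijOn_siegelPolarization :
    Set.BijOn (siegelPolarization (g := g)) (closedSiegelDisc g) (nonnegLagrangians g) :=
  ⟨fun _ h => siegelPolarization_mem_nonnegLagrangians h, siegelPolarization_injective.injOn,
    fun _ hP => exists_siegelPolarization_eq hP⟩

end SiegelDisc

/-! ### The action of the real symplectic group on the closed disc -/

section SymplecticAction

variable {g : ℕ}

/-- The matrix `X = A · i(1 - τ) + B (1 + τ)`. -/
noncomputable def siegelNum (M : Matrix (Fin g ⊕ Fin g) (Fin g ⊕ Fin g) ℝ)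
    (τ : Matrix (Fin g) (Fin g) ℂ) : Matrix (Fin g) (Fin g) ℂ :=
  M.toBlocks₁₁.map Complex.ofReal * (Complex.I • (1 - τ)) +
    M.toBlocks₁₂.map Complex.ofReal * (1 + τ)

/-- The matrix `Y = C · i(1 - τ) + D (1 + τ)`. -/
noncomputable def siegelDen (M : Matrix (Fin g ⊕ Fin g) (Fin g ⊕ Fin g) ℝ)
    (τ : Matrix (Fin g) (Fin g) ℂ) : Matrix (Fin g) (Fin g) ℂ :=
  M.toBlocks₂₁.map Complex.ofReal * (Complex.I • (1 - τ)) +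
    M.toBlocks₂₂.map Complex.ofReal * (1 + τ)

/-- The automorphy matrix `Y - i X`. -/
noncomputable def siegelCocycle (M : Matrix (Fin g ⊕ Fin g) (Fin g ⊕ Fin g) ℝ)
    (τ : Matrix (Fin g) (Fin g) ℂ) : Matrix (Fin g) (Fin g) ℂ :=
  siegelDen M τ - Complex.I • siegelNum M τ

theorem siegelAct_eq (M : Matrix (Fin g ⊕ Fin g) (Fin g ⊕ Fin g) ℝ)
    (τ : Matrix (Fin g) (Fin g) ℂ) :
    siegelAct M τ = (siegelDen M τ + Complex.I • siegelNum M τ) * (siegelCocycle M τ)⁻¹ := rfl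

theorem matrixAct_apply (M : Matrix (Fin g ⊕ Fin g) (Fin g ⊕ Fin g) ℝ) (v : CTangent g) :
    matrixAct M v = (M.toBlocks₁₁.map Complex.ofReal *ᵥ v.1 + M.toBlocks₁₂.map Complex.ofReal *ᵥ v.2,
      M.toBlocks₂₁.map Complex.ofReal *ᵥ v.1 + M.toBlocks₂₂.map Complex.ofReal *ᵥ v.2) := rfl

/-- Passing from blocks to matrices indexed by `Fin g ⊕ Fin g` makes multiplicativity and the
symplectic relation available without block computations. -/
theorem map_mulVec_sumElim (M : Matrix (Fin g ⊕ Fin g) (Fin g ⊕ Fin g) ℝ) (v : CTangent g) :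
    M.map Complex.ofReal *ᵥ Sum.elim v.1 v.2 =
      Sum.elim (matrixAct M v).1 (matrixAct M v).2 := by
  conv_lhs => rw [← fromBlocks_toBlocks M, fromBlocks_map, fromBlocks_mulVec]
  rfl

theorem sumElim_injective {v w : CTangent g} (h : Sum.elim v.1 v.2 = Sum.elim w.1 w.2) : v = w := by
  ext i
  · exact congrFun h (Sum.inl i)
  · exact congrFun h (Sum.inr i)

theorem matrixAct_mul (M N : Matrix (Fin g ⊕ Fin g) (Fin g ⊕ Fin g) ℝ) :
    matrixAct (M * N) = matrixAct M ∘ₗ matrixAct N := by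
  refine LinearMap.ext fun v => sumElim_injective ?_
  rw [LinearMap.comp_apply, ← map_mulVec_sumElim, ← map_mulVec_sumElim, ← map_mulVec_sumElim,
    mulVec_mulVec]
  exact congrArg (· *ᵥ _) (Matrix.map_mul (f := Complex.ofRealHom))

theorem matrixAct_one : matrixAct (1 : Matrix (Fin g ⊕ Fin g) (Fin g ⊕ Fin g) ℝ) = LinearMap.id := by
  refine LinearMap.ext fun v => sumElim_injective ?_
  rw [LinearMap.id_apply, ← map_mulVec_sumElim, Matrix.map_one _ (by simp) (by simp), one_mulVec]

theorem symplForm_eq_dotProduct_J (v w : CTangent g) :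
    symplForm v w = Sum.elim v.1 v.2 ⬝ᵥ (Matrix.J (Fin g) ℂ *ᵥ Sum.elim w.1 w.2) := by
  simp [Matrix.J, fromBlocks_mulVec, symplForm, neg_mulVec]
  ring

theorem symplForm_matrixAct {M : Matrix (Fin g ⊕ Fin g) (Fin g ⊕ Fin g) ℝ}
    (hM : M ∈ symplecticGroup (Fin g) ℝ) (v w : CTangent g) :
    symplForm (matrixAct M v) (matrixAct M w) = symplForm v w := by
  have h := SymplecticGroup.mem_iff'.1 (SymplecticGroup.map_mem hM Complex.ofRealHom)
  rw [symplForm_eq_dotProduct_J, symplForm_eq_dotProduct_J, ← map_mulVec_sumElim,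
    ← map_mulVec_sumElim, ← vecMul_transpose, ← dotProduct_mulVec, mulVec_mulVec, mulVec_mulVec]
  exact congrArg (fun K => Sum.elim v.1 v.2 ⬝ᵥ (K *ᵥ Sum.elim w.1 w.2)) h

theorem star_map_ofReal_mulVec (A : Matrix (Fin g) (Fin g) ℝ) (v : Fin g → ℂ) :
    star (A.map Complex.ofReal *ᵥ v) = A.map Complex.ofReal *ᵥ star v := by
  rw [star_mulVec_star]
  congr 1
  ext i j
  simp

theorem star_matrixAct (M : Matrix (Fin g ⊕ Fin g) (Fin g ⊕ Fin g) ℝ) (v : CTangent g) :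
    star (matrixAct M v) = matrixAct M (star v) := by
  rw [matrixAct_apply, matrixAct_apply, Prod.star_def]
  simp only [star_add, star_map_ofReal_mulVec]
  rfl

theorem matrixAct_injective {M : Matrix (Fin g ⊕ Fin g) (Fin g ⊕ Fin g) ℝ}
    (hM : M ∈ symplecticGroup (Fin g) ℝ) : Function.Injective (matrixAct M) := by
  refine Function.LeftInverse.injective (g := matrixAct M⁻¹) fun v => ?_
  rw [← LinearMap.comp_apply, ← matrixAct_mul,
    nonsing_inv_mul _ (SymplecticGroup.symplectic_det hM), matrixAct_one, LinearMap.id_apply]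

theorem map_matrixAct_mem_nonnegLagrangians {M : Matrix (Fin g ⊕ Fin g) (Fin g ⊕ Fin g) ℝ}
    (hM : M ∈ symplecticGroup (Fin g) ℝ) {P : Submodule ℂ (CTangent g)}
    (hP : P ∈ nonnegLagrangians g) : P.map (matrixAct M) ∈ nonnegLagrangians g := by
  refine ⟨?_, ?_, ?_⟩
  · rw [← (Submodule.equivMapOfInjective _ (matrixAct_injective hM) P).finrank_eq, hP.1]
  · rintro _ ⟨v, hv, rfl⟩ _ ⟨w, hw, rfl⟩
    rw [symplForm_matrixAct hM, hP.2.1 v hv w hw]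
  · rintro _ ⟨v, hv, rfl⟩
    rw [star_matrixAct, symplForm_matrixAct hM]
    exact hP.2.2 v hv

/-- The vector `(i(1 - τ)a, (1 + τ)a)` of the conjugate of `P_τ`. -/
noncomputable def conjPolVec (τ : Matrix (Fin g) (Fin g) ℂ) (a : Fin g → ℂ) : CTangent g :=
  (Complex.I • ((1 - τ) *ᵥ a), (1 + τ) *ᵥ a)

theorem holPart_star (v : CTangent g) : holPart (star v) = star (antiPart v) := by
  ext i
  simp [holPart_apply, antiPart_apply]

theorem antiPart_star (v : CTangent g) : antiPart (star v) = star (holPart v) := by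
  ext i
  simp [holPart_apply, antiPart_apply]
  ring

/-- The conjugate of `P_τ`, in which the fields of the weak equation take their values, is the graph
`p = τ q`, without conjugation on `τ`. -/
theorem star_mem_siegelPolarization {τ : Matrix (Fin g) (Fin g) ℂ} {v : CTangent g} :
    star v ∈ siegelPolarization τ ↔ holPart v = τ *ᵥ antiPart v := by
  rw [mem_siegelPolarization_iff, holPart_star, antiPart_star, ← star_mulVec_star, star_inj]

theorem holPart_conjPolVec (τ : Matrix (Fin g) (Fin g) ℂ) (a : Fin g → ℂ) :
    holPart (conjPolVec τ a) = (2 : ℂ) • (τ *ᵥ a) := by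
  rw [holPart_apply]
  ext i
  simp only [conjPolVec, sub_mulVec, add_mulVec, one_mulVec, Pi.add_apply, Pi.smul_apply,
    Pi.sub_apply, smul_eq_mul]
  linear_combination ((a i - (τ *ᵥ a) i)) * Complex.I_mul_I

theorem antiPart_conjPolVec (τ : Matrix (Fin g) (Fin g) ℂ) (a : Fin g → ℂ) :
    antiPart (conjPolVec τ a) = (2 : ℂ) • a := by
  rw [antiPart_apply]
  ext i
  simp only [conjPolVec, sub_mulVec, add_mulVec, one_mulVec, Pi.add_apply, Pi.smul_apply,
    Pi.sub_apply, smul_eq_mul]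
  linear_combination (-(a i - (τ *ᵥ a) i)) * Complex.I_mul_I

theorem star_conjPolVec_mem (τ : Matrix (Fin g) (Fin g) ℂ) (a : Fin g → ℂ) :
    star (conjPolVec τ a) ∈ siegelPolarization τ := by
  rw [star_mem_siegelPolarization, holPart_conjPolVec, antiPart_conjPolVec, mulVec_smul]

theorem eq_conjPolVec_of_star_mem {τ : Matrix (Fin g) (Fin g) ℂ} {v : CTangent g}
    (hv : star v ∈ siegelPolarization τ) : v = conjPolVec τ ((1 / 2 : ℂ) • antiPart v) := by
  rw [star_mem_siegelPolarization] at hv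
  refine ext_parts ?_ ?_
  · rw [holPart_conjPolVec, mulVec_smul, smul_smul, hv]
    norm_num
  · rw [antiPart_conjPolVec, smul_smul]
    norm_num

theorem matrixAct_conjPolVec (M : Matrix (Fin g ⊕ Fin g) (Fin g ⊕ Fin g) ℝ)
    (τ : Matrix (Fin g) (Fin g) ℂ) (a : Fin g → ℂ) :
    matrixAct M (conjPolVec τ a) = (siegelNum M τ *ᵥ a, siegelDen M τ *ᵥ a) := by
  rw [matrixAct_apply]
  simp only [conjPolVec, siegelNum, siegelDen, add_mulVec, mulVec_smul, ← mulVec_mulVec,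
    smul_mulVec, mulVec_add]

theorem antiPart_matrixAct_conjPolVec (M : Matrix (Fin g ⊕ Fin g) (Fin g ⊕ Fin g) ℝ)
    (τ : Matrix (Fin g) (Fin g) ℂ) (a : Fin g → ℂ) :
    antiPart (matrixAct M (conjPolVec τ a)) = siegelCocycle M τ *ᵥ a := by
  rw [matrixAct_conjPolVec, antiPart_apply, siegelCocycle, sub_mulVec, smul_mulVec]

theorem holPart_matrixAct_conjPolVec (M : Matrix (Fin g ⊕ Fin g) (Fin g ⊕ Fin g) ℝ)
    (τ : Matrix (Fin g) (Fin g) ℂ) (a : Fin g → ℂ) :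
    holPart (matrixAct M (conjPolVec τ a)) =
      (siegelDen M τ + Complex.I • siegelNum M τ) *ᵥ a := by
  rw [matrixAct_conjPolVec, holPart_apply, add_mulVec, smul_mulVec]

/-- The image of `P_τ` under `M` is again a nonnegative Lagrangian, hence some `P_{τ'}`. With `W`
the cocycle, `M` maps `conjPolVec τ a` to a vector with `q = W a` and `p = τ' W a`. Injectivity of
`M` makes `W` invertible on the whole closed disc, although `CΩ + D` need not make sense on its
boundary, and `τ'` is then the formula for `siegelAct`. -/
theorem siegelAct_spec_aux {M : Matrix (Fin g ⊕ Fin g) (Fin g ⊕ Fin g) ℝ}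
    (hM : M ∈ symplecticGroup (Fin g) ℝ) {τ : Matrix (Fin g) (Fin g) ℂ}
    (hτ : τ ∈ closedSiegelDisc g) :
    (siegelCocycle M τ).det ≠ 0 ∧ siegelAct M τ ∈ closedSiegelDisc g ∧
      siegelPolarization (siegelAct M τ) = (siegelPolarization τ).map (matrixAct M) := by
  obtain ⟨τ', hτ', h⟩ := exists_siegelPolarization_eq
    (map_matrixAct_mem_nonnegLagrangians hM (siegelPolarization_mem_nonnegLagrangians hτ))
  have key : ∀ a, (siegelDen M τ + Complex.I • siegelNum M τ) *ᵥ a =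
      (τ' * siegelCocycle M τ) *ᵥ a := fun a => by
    have h1 : star (matrixAct M (conjPolVec τ a)) ∈ siegelPolarization τ' := by
      rw [h, star_matrixAct]
      exact Submodule.mem_map_of_mem (star_conjPolVec_mem τ a)
    rw [star_mem_siegelPolarization, holPart_matrixAct_conjPolVec,
      antiPart_matrixAct_conjPolVec, mulVec_mulVec] at h1
    exact h1
  have hdet : (siegelCocycle M τ).det ≠ 0 := by
    -- A vector killed by the cocycle would have an image with both coordinates `p` and `q` zero.
    intro h0
    obtain ⟨a, ha, ha0⟩ := exists_mulVec_eq_zero_iff.2 h0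
    have h1 : matrixAct M (conjPolVec τ a) = 0 := by
      refine eq_zero_of_holPart_antiPart ?_ ?_
      · rw [holPart_matrixAct_conjPolVec, key, ← mulVec_mulVec, ha0, mulVec_zero]
      · rw [antiPart_matrixAct_conjPolVec, ha0]
    have h2 : conjPolVec τ a = 0 := matrixAct_injective hM (by rw [h1, map_zero])
    have h3 := antiPart_conjPolVec τ a
    rw [h2, map_zero] at h3
    exact ha (by simpa using h3.symm)
  have hact : siegelAct M τ = τ' := by
    have h4 : siegelDen M τ + Complex.I • siegelNum M τ = τ' * siegelCocycle M τ :=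
      Matrix.ext_of_mulVec_single fun j => key _
    rw [siegelAct_eq, h4, mul_nonsing_inv_cancel_right _ _ (isUnit_iff_ne_zero.2 hdet)]
  rw [hact]
  exact ⟨hdet, hτ', h⟩

theorem det_siegelCocycle_ne_zero {M : Matrix (Fin g ⊕ Fin g) (Fin g ⊕ Fin g) ℝ}
    (hM : M ∈ symplecticGroup (Fin g) ℝ) {τ : Matrix (Fin g) (Fin g) ℂ}
    (hτ : τ ∈ closedSiegelDisc g) : (siegelCocycle M τ).det ≠ 0 :=
  (siegelAct_spec_aux hM hτ).1

theorem siegelAct_mem_closed {M : Matrix (Fin g ⊕ Fin g) (Fin g ⊕ Fin g) ℝ}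
    (hM : M ∈ symplecticGroup (Fin g) ℝ) {τ : Matrix (Fin g) (Fin g) ℂ}
    (hτ : τ ∈ closedSiegelDisc g) : siegelAct M τ ∈ closedSiegelDisc g :=
  (siegelAct_spec_aux hM hτ).2.1

theorem siegelPolarization_siegelAct {M : Matrix (Fin g ⊕ Fin g) (Fin g ⊕ Fin g) ℝ}
    (hM : M ∈ symplecticGroup (Fin g) ℝ) {τ : Matrix (Fin g) (Fin g) ℂ}
    (hτ : τ ∈ closedSiegelDisc g) :
    siegelPolarization (siegelAct M τ) = (siegelPolarization τ).map (matrixAct M) :=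
  (siegelAct_spec_aux hM hτ).2.2

/-- Push-forward of subspaces is functorial and `τ` is determined by `P_τ`, so no matrix computation
is needed. -/
theorem siegelAct_mul {M N : Matrix (Fin g ⊕ Fin g) (Fin g ⊕ Fin g) ℝ}
    (hM : M ∈ symplecticGroup (Fin g) ℝ) (hN : N ∈ symplecticGroup (Fin g) ℝ)
    {τ : Matrix (Fin g) (Fin g) ℂ} (hτ : τ ∈ closedSiegelDisc g) :
    siegelAct (M * N) τ = siegelAct M (siegelAct N τ) := by
  apply siegelPolarization_injective
  rw [siegelPolarization_siegelAct (mul_mem hM hN) hτ,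
    siegelPolarization_siegelAct hM (siegelAct_mem_closed hN hτ),
    siegelPolarization_siegelAct hN hτ, matrixAct_mul, Submodule.map_comp]

theorem continuousOn_siegelAct {M : Matrix (Fin g ⊕ Fin g) (Fin g ⊕ Fin g) ℝ}
    (hM : M ∈ symplecticGroup (Fin g) ℝ) : ContinuousOn (siegelAct M) (closedSiegelDisc g) := by
  have hW : Continuous (siegelCocycle M) := by
    unfold siegelCocycle siegelDen siegelNum
    fun_prop
  have hinv : ContinuousOn (fun τ => (siegelCocycle M τ)⁻¹) (closedSiegelDisc g) := by
    simp only [Matrix.inv_def, Ring.inverse_eq_inv']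
    refine ContinuousOn.smul (ContinuousOn.inv₀ ?_ fun τ hτ => det_siegelCocycle_ne_zero hM hτ) ?_
    · exact (hW.matrix_det).continuousOn
    · exact hW.matrix_adjugate.continuousOn
  have : ContinuousOn (fun τ => (siegelDen M τ + Complex.I • siegelNum M τ) *
      (siegelCocycle M τ)⁻¹) (closedSiegelDisc g) := by
    have h1 : Continuous fun τ => siegelDen M τ + Complex.I • siegelNum M τ := by
      unfold siegelDen siegelNum
      fun_prop
    have h2 : Continuous fun τ : closedSiegelDisc g =>
        siegelDen M τ.1 + Complex.I • siegelNum M τ.1 := h1.comp continuous_subtype_val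
    have h3 : Continuous fun τ : closedSiegelDisc g => (siegelCocycle M τ.1)⁻¹ :=
      continuousOn_iff_continuous_restrict.1 hinv
    exact continuousOn_iff_continuous_restrict.2 (h2.matrix_mul h3)
  exact this

/-- A real symplectic map preserves the Hermitian form, so strict positivity on `P_τ` passes to the
image. -/
theorem siegelAct_mem_open {M : Matrix (Fin g ⊕ Fin g) (Fin g ⊕ Fin g) ℝ}
    (hM : M ∈ symplecticGroup (Fin g) ℝ) {τ : Matrix (Fin g) (Fin g) ℂ}
    (hτ : τ ∈ openSiegelDisc g) : siegelAct M τ ∈ openSiegelDisc g := by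
  have hτc := openSiegelDisc_subset hτ
  have hc := mem_closedSiegelDisc_iff.1 (siegelAct_mem_closed hM hτc)
  refine mem_openSiegelDisc_iff.2 ⟨hc.1, fun p hp => ?_⟩
  have hmem := ofParts_mem_siegelPolarization (siegelAct M τ) (star p)
  have h1 := neg_I_mul_symplForm_star (ofParts (star p) ((siegelAct M τ).map star *ᵥ star p))
  rw [holPart_ofParts, antiPart_ofParts, ← star_mulVec_star, sqNorm_star, sqNorm_star] at h1
  rw [siegelPolarization_siegelAct hM hτc] at hmem
  obtain ⟨v, hv, hve⟩ := hmem
  rw [star_mulVec_star] at h1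
  rw [← hve, star_matrixAct, symplForm_matrixAct hM, neg_I_mul_symplForm_star,
    Complex.ofReal_inj] at h1
  have hv0 : holPart v ≠ 0 := by
    intro h0
    have hv' : v = 0 := by
      refine eq_zero_of_holPart_antiPart h0 ?_
      rw [mem_siegelPolarization_iff.1 hv, h0, mulVec_zero]
    rw [hv', map_zero] at hve
    have := holPart_ofParts (star p) ((siegelAct M τ).map star *ᵥ star p)
    rw [← hve, map_zero] at this
    exact hp (by simpa using this.symm)
  have h2 := (mem_openSiegelDisc_iff.1 hτ).2 (star (holPart v)) (by simpa using hv0)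
  rw [mem_siegelPolarization_iff.1 hv, sqNorm_map_star_mulVec] at h1
  rw [sqNorm_star] at h2
  linarith

end SymplecticAction

/-! ## Gaussian integrals -/

section Gaussian

variable {g : ℕ}

/-- A real vector as a complex vector. -/
def ofRealVec (ξ : Fin g → ℝ) : Fin g → ℂ := fun j => (ξ j : ℂ)

theorem continuous_ofRealVec : Continuous (ofRealVec (g := g)) :=
  continuous_pi fun j => Complex.continuous_ofReal.comp (continuous_apply j)

/-- Complex symmetric matrices with positive definite real part. -/
def IsAccretive (S : Matrix (Fin g) (Fin g) ℂ) : Prop :=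
  S.IsSymm ∧ ∀ ξ : Fin g → ℝ, ξ ≠ 0 → 0 < (quadForm S (ofRealVec ξ)).re

theorem quadForm_add (S T : Matrix (Fin g) (Fin g) ℂ) (v : Fin g → ℂ) :
    quadForm (S + T) v = quadForm S v + quadForm T v := by
  simp [quadForm, add_mulVec]

theorem quadForm_sub (S T : Matrix (Fin g) (Fin g) ℂ) (v : Fin g → ℂ) :
    quadForm (S - T) v = quadForm S v - quadForm T v := by
  simp [quadForm, sub_mulVec]

theorem quadForm_smul (c : ℂ) (S : Matrix (Fin g) (Fin g) ℂ) (v : Fin g → ℂ) :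
    quadForm (c • S) v = c * quadForm S v := by
  simp [quadForm, smul_mulVec]

theorem quadForm_smul_right (c : ℂ) (S : Matrix (Fin g) (Fin g) ℂ) (v : Fin g → ℂ) :
    quadForm S (c • v) = c ^ 2 * quadForm S v := by
  simp [quadForm, mulVec_smul]
  ring

theorem quadForm_eq_sum (S : Matrix (Fin g) (Fin g) ℂ) (v : Fin g → ℂ) :
    quadForm S v = ∑ i, ∑ j, v i * S i j * v j := by
  simp [quadForm, dotProduct, mulVec, Finset.mul_sum, mul_assoc]

theorem quadForm_one (v : Fin g → ℂ) : quadForm 1 v = ∑ i, v i ^ 2 := by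
  simp [quadForm, dotProduct, sq]

theorem quadForm_map_ofReal (Q : Matrix (Fin g) (Fin g) ℝ) (ξ : Fin g → ℝ) :
    quadForm (Q.map Complex.ofReal) (ofRealVec ξ) = ((ξ ⬝ᵥ (Q *ᵥ ξ) : ℝ) : ℂ) := by
  simp [quadForm, dotProduct, mulVec, ofRealVec]

theorem IsAccretive.add {S T : Matrix (Fin g) (Fin g) ℂ} (hS : IsAccretive S)
    (hT : IsAccretive T) : IsAccretive (S + T) :=
  ⟨hS.1.add hT.1, fun ξ hξ => by
    rw [quadForm_add, Complex.add_re]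
    exact add_pos (hS.2 ξ hξ) (hT.2 ξ hξ)⟩

theorem IsAccretive.smul {S : Matrix (Fin g) (Fin g) ℂ} (hS : IsAccretive S) {c : ℝ} (hc : 0 < c) :
    IsAccretive ((c : ℂ) • S) :=
  ⟨hS.1.smul _, fun ξ hξ => by
    rw [quadForm_smul, Complex.re_ofReal_mul]
    exact mul_pos hc (hS.2 ξ hξ)⟩

theorem IsAccretive.sub_I_smul {S : Matrix (Fin g) (Fin g) ℂ} (hS : IsAccretive S)
    {Q : Matrix (Fin g) (Fin g) ℝ} (hQ : Q.IsSymm) :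
    IsAccretive (S - Complex.I • Q.map Complex.ofReal) := by
  refine ⟨hS.1.sub (IsSymm.smul ?_ _), fun ξ hξ => ?_⟩
  · rw [IsSymm, ← transpose_map, hQ]
  · rw [quadForm_sub, quadForm_smul, quadForm_map_ofReal]
    simpa using hS.2 ξ hξ

theorem sum_sq_pos {ξ : Fin g → ℝ} (hξ : ξ ≠ 0) : 0 < ∑ j, ξ j ^ 2 := by
  obtain ⟨j, hj⟩ := Function.ne_iff.1 hξ
  exact Finset.sum_pos' (fun i _ => sq_nonneg _) ⟨j, Finset.mem_univ j, sq_pos_of_ne_zero hj⟩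

theorem isAccretive_one : IsAccretive (1 : Matrix (Fin g) (Fin g) ℂ) :=
  ⟨isSymm_one, fun ξ hξ => by
    rw [quadForm_one]
    have : (∑ i, ofRealVec ξ i ^ 2) = ((∑ i, ξ i ^ 2 : ℝ) : ℂ) := by simp [ofRealVec]
    rw [this, Complex.ofReal_re]
    exact sum_sq_pos hξ⟩

theorem continuous_quadForm :
    Continuous fun p : Matrix (Fin g) (Fin g) ℂ × (Fin g → ℂ) => quadForm p.1 p.2 := by
  simp only [quadForm_eq_sum]
  fun_prop

theorem sum_sq_le (ξ : Fin g → ℝ) : ∑ j, ξ j ^ 2 ≤ g * ‖ξ‖ ^ 2 := by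
  calc ∑ j, ξ j ^ 2 ≤ ∑ _j : Fin g, ‖ξ‖ ^ 2 := Finset.sum_le_sum fun j _ => by
        rw [← sq_abs]
        exact pow_le_pow_left₀ (abs_nonneg _) (norm_le_pi_norm ξ j) 2
    _ = g * ‖ξ‖ ^ 2 := by simp

theorem norm_sq_le_sum_sq (ξ : Fin g → ℝ) : ‖ξ‖ ^ 2 ≤ ∑ j, ξ j ^ 2 := by
  have h : ‖ξ‖ ≤ Real.sqrt (∑ j, ξ j ^ 2) := by
    refine (pi_norm_le_iff_of_nonneg (Real.sqrt_nonneg _)).2 fun j => ?_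
    rw [Real.norm_eq_abs, ← Real.sqrt_sq_eq_abs]
    exact Real.sqrt_le_sqrt (Finset.single_le_sum (f := fun j => ξ j ^ 2)
      (fun i _ => sq_nonneg _) (Finset.mem_univ j))
  calc ‖ξ‖ ^ 2 ≤ (Real.sqrt (∑ j, ξ j ^ 2)) ^ 2 := pow_le_pow_left₀ (norm_nonneg _) h 2
    _ = _ := Real.sq_sqrt (Finset.sum_nonneg fun i _ => sq_nonneg _)

theorem norm_quadForm_le (S : Matrix (Fin g) (Fin g) ℂ) (ξ : Fin g → ℝ) :
    ‖quadForm S (ofRealVec ξ)‖ ≤ (∑ i, ∑ j, ‖S i j‖) * ‖ξ‖ ^ 2 := by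
  rw [quadForm_eq_sum, Finset.sum_mul]
  refine (norm_sum_le _ _).trans (Finset.sum_le_sum fun i _ => ?_)
  rw [Finset.sum_mul]
  refine (norm_sum_le _ _).trans (Finset.sum_le_sum fun j _ => ?_)
  have h1 : ‖ofRealVec ξ i‖ ≤ ‖ξ‖ := by simpa [ofRealVec] using norm_le_pi_norm ξ i
  have h2 : ‖ofRealVec ξ j‖ ≤ ‖ξ‖ := by simpa [ofRealVec] using norm_le_pi_norm ξ j
  rw [norm_mul, norm_mul]
  calc ‖ofRealVec ξ i‖ * ‖S i j‖ * ‖ofRealVec ξ j‖ ≤ ‖ξ‖ * ‖S i j‖ * ‖ξ‖ := by gcongr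
    _ = _ := by ring

/-- The constant is the minimum of the real part over the compact unit sphere, and homogeneity does
the rest. -/
theorem IsAccretive.exists_coercive {S : Matrix (Fin g) (Fin g) ℂ} (hS : IsAccretive S) :
    ∃ c > 0, ∀ ξ : Fin g → ℝ, c * ‖ξ‖ ^ 2 ≤ (quadForm S (ofRealVec ξ)).re := by
  have hcont : Continuous fun ξ : Fin g → ℝ => (quadForm S (ofRealVec ξ)).re :=
    Complex.continuous_re.comp (continuous_quadForm.comp
      (continuous_const.prodMk continuous_ofRealVec))
  obtain ⟨c, hc, h⟩ : ∃ c > 0, ∀ ξ ∈ Metric.sphere (0 : Fin g → ℝ) 1,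
      c ≤ (quadForm S (ofRealVec ξ)).re := by
    rcases (Metric.sphere (0 : Fin g → ℝ) 1).eq_empty_or_nonempty with h | h
    -- The sphere is empty when `g = 0`; any positive constant serves.
    · exact ⟨1, one_pos, by simp [h]⟩
    · obtain ⟨ξ, hξ, hmin⟩ := (isCompact_sphere (0 : Fin g → ℝ) 1).exists_isMinOn h hcont.continuousOn
      refine ⟨_, hS.2 ξ ?_, fun η hη => hmin hη⟩
      rintro rfl
      simp at hξ
  refine ⟨c, hc, fun ξ => ?_⟩
  rcases eq_or_ne ξ 0 with rfl | hξ
  · have : ofRealVec (0 : Fin g → ℝ) = 0 := by ext; simp [ofRealVec]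
    simp [this, quadForm]
  have hn : ‖ξ‖ ≠ 0 := norm_ne_zero_iff.2 hξ
  have h1 := h (‖ξ‖⁻¹ • ξ) (by simp [norm_smul, hn])
  have h2 : ofRealVec (‖ξ‖⁻¹ • ξ) = ((‖ξ‖⁻¹ : ℝ) : ℂ) • ofRealVec ξ := by
    ext; simp [ofRealVec]
  rw [h2, quadForm_smul_right, ← Complex.ofReal_pow, Complex.re_ofReal_mul, inv_pow] at h1
  rwa [le_inv_mul_iff₀ (by positivity), mul_comm] at h1

/-- The lower bound is locally uniform in the matrix, which supplies the dominating Gaussian for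
continuity of the integral. -/
theorem IsAccretive.eventually_coercive {S : Matrix (Fin g) (Fin g) ℂ} (hS : IsAccretive S) :
    ∃ c > 0, ∀ᶠ T in nhds S, ∀ ξ : Fin g → ℝ, c * ‖ξ‖ ^ 2 ≤ (quadForm T (ofRealVec ξ)).re := by
  obtain ⟨c, hc, h⟩ := hS.exists_coercive
  refine ⟨c / 2, half_pos hc, ?_⟩
  have hcont : Continuous fun T : Matrix (Fin g) (Fin g) ℂ => ∑ i, ∑ j, ‖(T - S) i j‖ := by fun_prop
  have hev : ∀ᶠ T in nhds S, ∑ i, ∑ j, ‖(T - S) i j‖ < c / 2 := by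
    refine hcont.continuousAt.eventually_lt continuousAt_const ?_
    simpa using hc
  filter_upwards [hev] with T hT ξ
  have h1 := norm_quadForm_le (T - S) ξ
  have h2 := Complex.abs_re_le_norm (quadForm (T - S) (ofRealVec ξ))
  rw [quadForm_sub, Complex.sub_re] at h2
  rw [quadForm_sub] at h1
  have h3 := neg_abs_le ((quadForm T (ofRealVec ξ)).re - (quadForm S (ofRealVec ξ)).re)
  have h4 : (∑ i, ∑ j, ‖(T - S) i j‖) * ‖ξ‖ ^ 2 ≤ c / 2 * ‖ξ‖ ^ 2 := by gcongr
  have h5 := h ξ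
  linarith

theorem integrable_exp_neg_mul_norm_sq {c : ℝ} (hc : 0 < c) :
    Integrable fun ξ : Fin g → ℝ => Real.exp (-(c * ‖ξ‖ ^ 2)) := by
  -- The norm is the sup norm and `∑ ξ_j² ≤ g ‖ξ‖²`; dividing by `g + 1` rather than `g` keeps the
  -- constant meaningful for `g = 0`.
  have hg : (0 : ℝ) < c / (g + 1) := by positivity
  have h : Integrable fun ξ : Fin g → ℝ => ∏ j, Real.exp (-(c / (g + 1)) * ξ j ^ 2) :=
    Integrable.fintype_prod fun _ => integrable_exp_neg_mul_sq hg
  refine h.mono' (by fun_prop) (Filter.Eventually.of_forall fun ξ => ?_)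
  rw [Real.norm_eq_abs, Real.abs_exp, ← Real.exp_sum, Real.exp_le_exp, ← Finset.mul_sum]
  have h1 : c / (g + 1) * ∑ j, ξ j ^ 2 ≤ c / (g + 1) * (g * ‖ξ‖ ^ 2) := by
    gcongr
    exact sum_sq_le ξ
  have h2 : c / (g + 1) * (g * ‖ξ‖ ^ 2) ≤ c * ‖ξ‖ ^ 2 := by
    rw [div_mul_eq_mul_div, div_le_iff₀ (by positivity)]
    nlinarith [mul_nonneg hc.le (sq_nonneg ‖ξ‖)]
  linarith

theorem continuous_gaussian_integrand (S : Matrix (Fin g) (Fin g) ℂ) :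
    Continuous fun ξ : Fin g → ℝ => Complex.exp (-(Real.pi * quadForm S (ofRealVec ξ))) :=
  Complex.continuous_exp.comp (continuous_const.mul (continuous_quadForm.comp
      (continuous_const.prodMk continuous_ofRealVec))).neg

theorem gaussInvSqrtDet_eq (S : Matrix (Fin g) (Fin g) ℂ) :
    gaussInvSqrtDet S = ∫ ξ : Fin g → ℝ, Complex.exp (-(Real.pi * quadForm S (ofRealVec ξ))) := rfl

theorem norm_gaussian_integrand_le {S : Matrix (Fin g) (Fin g) ℂ} {c : ℝ} {ξ : Fin g → ℝ}
    (h : c * ‖ξ‖ ^ 2 ≤ (quadForm S (ofRealVec ξ)).re) :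
    ‖Complex.exp (-(Real.pi * quadForm S (ofRealVec ξ)))‖ ≤
      Real.exp (-(Real.pi * c * ‖ξ‖ ^ 2)) := by
  rw [Complex.norm_exp, Real.exp_le_exp, Complex.neg_re, Complex.re_ofReal_mul, mul_assoc]
  gcongr

/-- Dominated convergence with a matrix as parameter asks for a first countable parameter space. -/
instance : FirstCountableTopology (Matrix (Fin g) (Fin g) ℂ) :=
  inferInstanceAs (FirstCountableTopology (Fin g → Fin g → ℂ))

theorem continuousAt_gaussInvSqrtDet {S : Matrix (Fin g) (Fin g) ℂ} (hS : IsAccretive S) :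
    ContinuousAt (gaussInvSqrtDet (g := g)) S := by
  obtain ⟨c, hc, h⟩ := hS.eventually_coercive
  refine continuousAt_of_dominated (F := fun T (ξ : Fin g → ℝ) =>
      Complex.exp (-(Real.pi * quadForm T (ofRealVec ξ))))
    (bound := fun ξ => Real.exp (-(Real.pi * c * ‖ξ‖ ^ 2)))
    (Filter.Eventually.of_forall fun T => (continuous_gaussian_integrand T).aestronglyMeasurable)
    ?_ (integrable_exp_neg_mul_norm_sq (by positivity)) ?_
  · filter_upwards [h] with T hT
    exact Filter.Eventually.of_forall fun ξ => norm_gaussian_integrand_le (hT ξ)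
  · refine Filter.Eventually.of_forall fun ξ => Continuous.continuousAt ?_
    exact Complex.continuous_exp.comp (continuous_const.mul (continuous_quadForm.comp
      (continuous_id.prodMk continuous_const))).neg

theorem integral_comp_mulVec {E : Type*} [NormedAddCommGroup E] [NormedSpace ℝ E]
    {C : Matrix (Fin g) (Fin g) ℝ} (hC : C.det ≠ 0) (f : (Fin g → ℝ) → E) :
    ∫ ξ : Fin g → ℝ, f (C *ᵥ ξ) = |C.det|⁻¹ • ∫ ξ, f ξ := by
  let e : (Fin g → ℝ) ≃ₗ[ℝ] (Fin g → ℝ) :=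
    LinearEquiv.ofIsUnitDet (f := toLin' C) (v := Pi.basisFun ℝ (Fin g))
      (v' := Pi.basisFun ℝ (Fin g)) (by
        rw [LinearMap.toMatrix_eq_toMatrix', LinearMap.toMatrix'_toLin']
        exact isUnit_iff_ne_zero.2 hC)
  have he : MeasurableEmbedding (fun ξ : Fin g → ℝ => C *ᵥ ξ) :=
    e.toContinuousLinearEquiv.toHomeomorph.measurableEmbedding
  have h := he.integral_map (μ := volume) f
  rw [← h, show (fun ξ : Fin g → ℝ => C *ᵥ ξ) = toLin' C from rfl,
    Real.map_matrix_volume_pi_eq_smul_volume_pi hC, integral_smul_measure,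
    ENNReal.toReal_ofReal (abs_nonneg _), abs_inv]

theorem exists_orthogonal_diagonalization {A : Matrix (Fin g) (Fin g) ℝ} (hA : A.IsSymm) :
    ∃ (U : Matrix (Fin g) (Fin g) ℝ) (d : Fin g → ℝ), Uᵀ * U = 1 ∧ A = Uᵀ * diagonal d * U := by
  have hH : A.IsHermitian := by rw [IsHermitian, conjTranspose_eq_transpose_of_trivial, hA]
  refine ⟨(star hH.eigenvectorUnitary.1), hH.eigenvalues, ?_, ?_⟩
  · rw [star_eq_conjTranspose, conjTranspose_eq_transpose_of_trivial, transpose_transpose]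
    have := hH.eigenvectorUnitary.2.2
    rwa [star_eq_conjTranspose, conjTranspose_eq_transpose_of_trivial] at this
  · conv_lhs => rw [hH.spectral_theorem, Unitary.conjStarAlgAut_apply]
    rw [star_eq_conjTranspose, conjTranspose_eq_transpose_of_trivial, transpose_transpose]
    rfl

/-- A diagonalization of `A` followed by rescaling makes `A` the identity. In the new coordinates
`B` is diagonalized by an orthogonal matrix, which leaves the identity unchanged. -/
theorem exists_simultaneous_diagonalization {A B : Matrix (Fin g) (Fin g) ℝ} (hA : A.IsSymm)
    (hpos : ∀ ξ, ξ ≠ 0 → 0 < ξ ⬝ᵥ (A *ᵥ ξ)) (hB : B.IsSymm) :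
    ∃ (C : Matrix (Fin g) (Fin g) ℝ) (d : Fin g → ℝ), C.det ≠ 0 ∧ A = Cᵀ * C ∧
      B = Cᵀ * diagonal d * C := by
  obtain ⟨U, l, hU, hAU⟩ := exists_orthogonal_diagonalization hA
  have hU' : U * Uᵀ = 1 := mul_eq_one_comm.1 hU
  have hl : ∀ j, 0 < l j := fun j => by
    have h1 : U *ᵥ (Uᵀ *ᵥ Pi.single j 1) = Pi.single j 1 := by
      rw [mulVec_mulVec, hU', one_mulVec]
    have h := hpos (Uᵀ *ᵥ Pi.single j 1) fun h0 => by
      rw [h0, mulVec_zero] at h1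
      have := congrFun h1 j
      simp at this
    rw [hAU, ← mulVec_mulVec, h1, ← mulVec_mulVec, dotProduct_mulVec, vecMul_transpose, h1] at h
    simpa using h
  let s : Fin g → ℝ := fun j => Real.sqrt (l j)
  have hs : ∀ j, s j ≠ 0 := fun j => (Real.sqrt_pos.2 (hl j)).ne'
  let R := diagonal s * U
  let R' := Uᵀ * diagonal (fun j => (s j)⁻¹)
  have hRR' : R * R' = 1 := by
    simp only [R, R']
    rw [mul_assoc, ← mul_assoc U, hU', one_mul, diagonal_mul_diagonal]
    simp [hs]
  have hR'R : R' * R = 1 := mul_eq_one_comm.1 hRR'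
  have hR : A = Rᵀ * R := by
    simp only [R]
    rw [transpose_mul, diagonal_transpose, mul_assoc, ← mul_assoc (diagonal s),
      diagonal_mul_diagonal, hAU, mul_assoc]
    congr 3
    ext j
    exact (Real.mul_self_sqrt (hl j).le).symm
  have hB' : (R'ᵀ * B * R').IsSymm := by
    rw [IsSymm, transpose_mul (R'ᵀ * B) R', transpose_mul R'ᵀ B, transpose_transpose, hB.eq, mul_assoc]
  obtain ⟨U₂, d, hU₂, hd⟩ := exists_orthogonal_diagonalization hB'
  refine ⟨U₂ * R, d, ?_, ?_, ?_⟩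
  · rw [det_mul]
    refine mul_ne_zero ?_ ?_
    · intro h0
      have := congrArg det hU₂
      simp [h0] at this
    · intro h0
      have := congrArg det hRR'
      simp [h0] at this
  · rw [transpose_mul, mul_assoc, ← mul_assoc U₂ᵀ, hU₂, one_mul, hR]
  · have h1 : Rᵀ * R'ᵀ = 1 := by rw [← transpose_mul, hR'R, transpose_one]
    calc B = (Rᵀ * R'ᵀ) * B * (R' * R) := by rw [h1, hR'R, one_mul, mul_one]
      _ = Rᵀ * (R'ᵀ * B * R') * R := by simp only [mul_assoc]
      _ = _ := by
        rw [hd, transpose_mul U₂ R]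
        simp only [mul_assoc]

/-- A complex symmetric matrix with positive definite real part is congruent over `ℝ` to a
diagonal one. -/
theorem IsAccretive.exists_diagonalization {S : Matrix (Fin g) (Fin g) ℂ} (hS : IsAccretive S) :
    ∃ (C : Matrix (Fin g) (Fin g) ℝ) (d : Fin g → ℝ), C.det ≠ 0 ∧
      S = (C.map Complex.ofRealHom)ᵀ * diagonal (fun j => 1 + Complex.I * d j) *
        C.map Complex.ofRealHom := by
  have hquad : ∀ ξ : Fin g → ℝ, (quadForm S (ofRealVec ξ)).re = ξ ⬝ᵥ (S.map Complex.re *ᵥ ξ) := by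
    intro ξ
    simp [quadForm, dotProduct, mulVec, ofRealVec]
  obtain ⟨C, d, hC, hA, hB⟩ := exists_simultaneous_diagonalization (A := S.map Complex.re)
    (B := S.map Complex.im) (by rw [IsSymm, ← transpose_map, hS.1])
    (fun ξ hξ => by rw [← hquad]; exact hS.2 ξ hξ) (by rw [IsSymm, ← transpose_map, hS.1])
  refine ⟨C, d, hC, ?_⟩
  have h1 : S = (S.map Complex.re).map Complex.ofRealHom +
      Complex.I • (S.map Complex.im).map Complex.ofRealHom := by
    ext i j
    simp [mul_comm Complex.I, Complex.re_add_im]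
  have h2 : diagonal (fun j => 1 + Complex.I * d j : Fin g → ℂ) =
      1 + Complex.I • (diagonal d).map Complex.ofRealHom := by
    ext i j
    rcases eq_or_ne i j with rfl | hij
    · simp
    · simp [hij]
  rw [h2]
  conv_lhs => rw [h1, hA, hB]
  rw [Matrix.map_mul, Matrix.map_mul, Matrix.map_mul, ← transpose_map, mul_add,
    add_mul, mul_one, mul_smul_comm, smul_mul_assoc]

theorem map_ofRealHom_mulVec (C : Matrix (Fin g) (Fin g) ℝ) (ξ : Fin g → ℝ) :
    C.map Complex.ofRealHom *ᵥ ofRealVec ξ = ofRealVec (C *ᵥ ξ) := by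
  ext i
  simp [mulVec, dotProduct, ofRealVec]

theorem quadForm_transpose_mul_diagonal_mul (C : Matrix (Fin g) (Fin g) ℝ) (d : Fin g → ℂ)
    (ξ : Fin g → ℝ) : quadForm ((C.map Complex.ofRealHom)ᵀ * diagonal d * C.map Complex.ofRealHom)
      (ofRealVec ξ) = ∑ j, d j * ((C *ᵥ ξ) j : ℂ) ^ 2 := by
  rw [quadForm, ← mulVec_mulVec, ← mulVec_mulVec, map_ofRealHom_mulVec, dotProduct_mulVec,
    vecMul_transpose, map_ofRealHom_mulVec]
  simp only [mulVec_diagonal, dotProduct, ofRealVec]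
  exact Finset.sum_congr rfl fun j _ => by ring

/-- In real coordinates that diagonalize `S` the integral is a product of one-dimensional Gaussian
integrals. Only the square is evaluated, so the choice of root does not enter; the branch is tracked
by continuity of the integral. -/
theorem gaussInvSqrtDet_sq_mul_det {S : Matrix (Fin g) (Fin g) ℂ} (hS : IsAccretive S) :
    gaussInvSqrtDet S ^ 2 * S.det = 1 := by
  obtain ⟨C, d, hC, hSD⟩ := hS.exists_diagonalization
  have hq : ∀ ξ : Fin g → ℝ, Complex.exp (-(Real.pi * quadForm S (ofRealVec ξ))) =
      (fun η : Fin g → ℝ => ∏ j, Complex.exp (-(Real.pi * (1 + Complex.I * d j)) * (η j : ℂ) ^ 2))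
        (C *ᵥ ξ) := by
    intro ξ
    rw [hSD, quadForm_transpose_mul_diagonal_mul]
    beta_reduce
    rw [← Complex.exp_sum, Finset.mul_sum, ← Finset.sum_neg_distrib]
    congr 1
    exact Finset.sum_congr rfl fun j _ => by ring
  have hre : ∀ j, 0 < (Real.pi * (1 + Complex.I * d j) : ℂ).re := fun j => by
    simp [Real.pi_pos]
  rw [gaussInvSqrtDet_eq]
  rw [integral_congr_ae (Filter.Eventually.of_forall hq), integral_comp_mulVec hC
      (fun η => ∏ j, Complex.exp (-(Real.pi * (1 + Complex.I * d j)) * (η j : ℂ) ^ 2)),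
    integral_fintype_prod_volume_eq_prod
    (f := fun j (x : ℝ) => Complex.exp (-(Real.pi * (1 + Complex.I * d j)) * (x : ℂ) ^ 2))]
  simp_rw [fun j => integral_gaussian_complex (hre j)]
  have hdet : S.det = (C.det : ℂ) ^ 2 * ∏ j, (1 + Complex.I * d j) := by
    have : (C.map Complex.ofRealHom).det = (C.det : ℂ) := (RingHom.map_det Complex.ofRealHom C).symm
    rw [hSD, det_mul, det_mul, det_transpose, this, det_diagonal]
    ring
  have hne : ∀ j, (1 + Complex.I * d j : ℂ) ≠ 0 := fun j h => by
    have := congrArg Complex.re h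
    simp at this
  rw [hdet, Complex.real_smul, mul_pow, ← Finset.prod_pow]
  have hsq : ∀ j, (((Real.pi : ℂ) / (Real.pi * (1 + Complex.I * d j))) ^ (1 / 2 : ℂ)) ^ 2 =
      (1 + Complex.I * d j : ℂ)⁻¹ := fun j => by
    rw [one_div, Complex.cpow_ofNat_inv_pow]
    have : (Real.pi : ℂ) ≠ 0 := by exact_mod_cast Real.pi_ne_zero
    field_simp
  simp_rw [hsq]
  rw [Finset.prod_inv_distrib]
  have hp : ∏ j, (1 + Complex.I * d j : ℂ) ≠ 0 := Finset.prod_ne_zero_iff.2 fun j _ => hne j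
  have hCc : (C.det : ℂ) ≠ 0 := by exact_mod_cast hC
  have habs : ((|C.det|⁻¹ : ℝ) : ℂ) ^ 2 = ((C.det : ℂ) ^ 2)⁻¹ := by
    rw [← Complex.ofReal_pow, inv_pow, sq_abs]
    push_cast
    rfl
  rw [habs]
  field_simp

theorem gaussInvSqrtDet_one : gaussInvSqrtDet (1 : Matrix (Fin g) (Fin g) ℂ) = 1 := by
  have h : ∀ ξ : Fin g → ℝ, Complex.exp (-(Real.pi * quadForm 1 (ofRealVec ξ))) =
      ∏ j, Complex.exp (-(Real.pi : ℂ) * (ξ j : ℂ) ^ 2) := fun ξ => by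
    rw [quadForm_one, ← Complex.exp_sum, Finset.mul_sum, ← Finset.sum_neg_distrib]
    congr 1
    exact Finset.sum_congr rfl fun j _ => by simp [ofRealVec]
  rw [gaussInvSqrtDet_eq]
  simp_rw [h]
  rw [integral_fintype_prod_volume_eq_prod
    (f := fun _ (x : ℝ) => Complex.exp (-(Real.pi : ℂ) * (x : ℂ) ^ 2))]
  have : (∫ x : ℝ, Complex.exp (-(Real.pi : ℂ) * (x : ℂ) ^ 2)) = 1 := by
    rw [integral_gaussian_complex (by simp [Real.pi_pos])]
    rw [div_self (by exact_mod_cast Real.pi_ne_zero), Complex.one_cpow]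
  rw [Finset.prod_congr rfl fun _ _ => this, Finset.prod_const_one]

theorem gaussInvSqrtDet_ne_zero {S : Matrix (Fin g) (Fin g) ℂ} (hS : IsAccretive S) :
    gaussInvSqrtDet S ≠ 0 := fun h => by
  have := gaussInvSqrtDet_sq_mul_det hS
  simp [h] at this

theorem IsAccretive.det_ne_zero {S : Matrix (Fin g) (Fin g) ℂ} (hS : IsAccretive S) :
    S.det ≠ 0 := fun h => by
  have := gaussInvSqrtDet_sq_mul_det hS
  simp [h] at this

end Gaussian

/-! ### The Cayley transform and accretivity over the open disc -/

section CayleyTransform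

variable {g : ℕ}

theorem star_ofRealVec (ξ : Fin g → ℝ) : star (ofRealVec ξ) = ofRealVec ξ := by
  ext j
  simp [ofRealVec]

theorem ofRealVec_ne_zero {ξ : Fin g → ℝ} (hξ : ξ ≠ 0) : ofRealVec ξ ≠ 0 := fun h =>
  hξ (funext fun j => by simpa [ofRealVec] using congrFun h j)

theorem re_star_dotProduct_add_sub (v w : Fin g → ℂ) :
    (star (v + w) ⬝ᵥ (v - w)).re = sqNorm v - sqNorm w := by
  rw [star_add, add_dotProduct, dotProduct_sub, dotProduct_sub, star_dotProduct_self,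
    star_dotProduct_self]
  have : (star v ⬝ᵥ w).re = (star w ⬝ᵥ v).re := by
    rw [← Complex.conj_re, starRingEnd_apply, ← star_dotProduct_star, star_star, dotProduct_comm]
  simp [this]

/-- For real `v` one has `2 Re ᵗv(1 + τ)v = |v + τv|² + |v|² - |τv|²`, and the last difference is
positive. -/
theorem isAccretive_one_add {τ : Matrix (Fin g) (Fin g) ℂ} (hτ : τ ∈ openSiegelDisc g) :
    IsAccretive (1 + τ) := by
  refine ⟨isSymm_one.add hτ.1, fun ξ hξ => ?_⟩
  have h1 := (mem_openSiegelDisc_iff.1 hτ).2 _ (ofRealVec_ne_zero hξ)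
  set v := ofRealVec ξ with hv
  have h2 : quadForm (1 + τ) v = star v ⬝ᵥ (v + τ *ᵥ v) := by
    rw [quadForm, add_mulVec, one_mulVec, hv, star_ofRealVec]
  have h3 : 0 ≤ sqNorm (v + τ *ᵥ v) := sqNorm_nonneg _
  have h4 : ((sqNorm (v + τ *ᵥ v) : ℝ) : ℂ).re =
      sqNorm v + (star v ⬝ᵥ (τ *ᵥ v)).re + (star (τ *ᵥ v) ⬝ᵥ v).re + sqNorm (τ *ᵥ v) := by
    rw [← star_dotProduct_self, star_add, add_dotProduct, dotProduct_add, dotProduct_add,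
      star_dotProduct_self, star_dotProduct_self]
    simp
    ring
  have h5 : (star (τ *ᵥ v) ⬝ᵥ v).re = (star v ⬝ᵥ (τ *ᵥ v)).re := by
    rw [← Complex.conj_re, starRingEnd_apply, ← star_dotProduct_star, star_star, dotProduct_comm]
  rw [Complex.ofReal_re, h5] at h4
  rw [h2, dotProduct_add, star_dotProduct_self, Complex.add_re, Complex.ofReal_re]
  linarith

theorem det_one_add_ne_zero {τ : Matrix (Fin g) (Fin g) ℂ} (hτ : τ ∈ openSiegelDisc g) :
    (1 + τ).det ≠ 0 := (isAccretive_one_add hτ).det_ne_zero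

/-- The matrix `-i Ω(τ) = (1 - τ)(1 + τ)⁻¹`. -/
noncomputable def cayley (τ : Matrix (Fin g) (Fin g) ℂ) : Matrix (Fin g) (Fin g) ℂ :=
  (1 - τ) * (1 + τ)⁻¹

theorem cayleyInv_eq (τ : Matrix (Fin g) (Fin g) ℂ) : cayleyInv τ = Complex.I • cayley τ := rfl

/-- That `1 + τ` and `1 + cayley τ` are inverse up to the factor `2` is why the normalization by
`det(1 + τ)^{-1/2}` gives a constant independent of `τ`. -/
theorem one_add_cayley {τ : Matrix (Fin g) (Fin g) ℂ} (hτ : τ ∈ openSiegelDisc g) :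
    1 + cayley τ = (2 : ℂ) • (1 + τ)⁻¹ := by
  have h := mul_nonsing_inv (1 + τ) (isUnit_iff_ne_zero.2 (det_one_add_ne_zero hτ))
  calc 1 + cayley τ = (1 + τ) * (1 + τ)⁻¹ + (1 - τ) * (1 + τ)⁻¹ := by rw [h, cayley]
    _ = (2 : ℂ) • (1 + τ)⁻¹ := by
      rw [← add_mul, add_add_sub_cancel, one_add_one_eq_two, two_smul, two_mul]

/-- Substituting `ξ = (1 + τ)w` turns the real part of the quadratic form into `|w|² - |τw|²`. -/
theorem isAccretive_cayley {τ : Matrix (Fin g) (Fin g) ℂ} (hτ : τ ∈ openSiegelDisc g) :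
    IsAccretive (cayley τ) := by
  have hu := isUnit_iff_ne_zero.2 (det_one_add_ne_zero hτ)
  have hs1 : (1 + τ)ᵀ = 1 + τ := by rw [transpose_add, transpose_one, hτ.1]
  have hs2 : (1 - τ)ᵀ = 1 - τ := by rw [transpose_sub, transpose_one, hτ.1]
  have hcomm : (1 - τ) * (1 + τ) = (1 + τ) * (1 - τ) := by noncomm_ring
  refine ⟨?_, fun ξ hξ => ?_⟩
  · rw [IsSymm, cayley, transpose_mul, transpose_nonsing_inv, hs1, hs2]
    calc (1 + τ)⁻¹ * (1 - τ) = (1 + τ)⁻¹ * ((1 - τ) * (1 + τ)) * (1 + τ)⁻¹ := by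
          rw [mul_assoc, mul_assoc, mul_nonsing_inv _ hu, mul_one]
      _ = (1 - τ) * (1 + τ)⁻¹ := by
          rw [hcomm, ← mul_assoc, nonsing_inv_mul _ hu, one_mul]
  · set w := (1 + τ)⁻¹ *ᵥ ofRealVec ξ with hw
    have h1 : ofRealVec ξ = w + τ *ᵥ w := by
      have h0 : (1 + τ) *ᵥ w = ofRealVec ξ := by
        rw [hw, mulVec_mulVec, mul_nonsing_inv _ hu, one_mulVec]
      rw [← h0, add_mulVec, one_mulVec]
    have hw0 : w ≠ 0 := fun h0 => ofRealVec_ne_zero hξ (by rw [h1, h0, mulVec_zero, add_zero])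
    have h2 : quadForm (cayley τ) (ofRealVec ξ) = star (w + τ *ᵥ w) ⬝ᵥ (w - τ *ᵥ w) := by
      rw [← h1, star_ofRealVec, quadForm, cayley, ← mulVec_mulVec, ← hw, sub_mulVec, one_mulVec]
    rw [h2, re_star_dotProduct_add_sub, sub_pos]
    exact (mem_openSiegelDisc_iff.1 hτ).2 w hw0

theorem isNormalizedBranch_discInvSqrtDet : IsNormalizedBranch (discInvSqrtDet (g := g)) := by
  refine ⟨fun τ hτ => ?_, ?_, fun τ hτ => gaussInvSqrtDet_sq_mul_det (isAccretive_one_add hτ)⟩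
  · refine ContinuousAt.continuousWithinAt ?_
    exact (continuousAt_gaussInvSqrtDet (isAccretive_one_add hτ)).comp
      (f := fun τ => 1 + τ) (continuous_const.add continuous_id).continuousAt
  · rw [discInvSqrtDet, add_zero, gaussInvSqrtDet_one]

end CayleyTransform

open scoped LineDeriv

/-! ## Schwartz functions -/

section DerivativeBounds

/-- If the vectors `e j` and functionals `p j` satisfy `∑ p_j(v) e_j = v`, then the derivatives of
order `n + 1` are controlled by the derivatives of order `n` of the partial derivatives. -/
theorem norm_iteratedFDeriv_succ_le_sum {ι E F : Type*} [Fintype ι] [NormedAddCommGroup E]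
    [NormedSpace ℝ E] [NormedAddCommGroup F] [NormedSpace ℝ F] (e : ι → E) (p : ι → E →L[ℝ] ℝ)
    (hp : ∀ j, ‖p j‖ ≤ 1) (hep : ∀ v, ∑ j, p j v • e j = v) {f : E → F} {f' : ι → E → F}
    (hf' : ∀ j y, fderiv ℝ f y (e j) = f' j y) {n : ℕ} (hs : ∀ j, ContDiff ℝ n (f' j)) (y : E) :
    ‖iteratedFDeriv ℝ (n + 1) f y‖ ≤ ∑ j, ‖iteratedFDeriv ℝ n (f' j) y‖ := by
  -- The full derivative is the sum of the partial derivatives composed with these maps of norm at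
  -- most one, and such a composition does not increase the norms of higher derivatives.
  let Φ : ι → F →L[ℝ] E →L[ℝ] F := fun j => ContinuousLinearMap.smulRightL ℝ E F (p j)
  have hΦ : ∀ j, ‖Φ j‖ ≤ 1 := fun j => by
    refine ContinuousLinearMap.opNorm_le_bound _ zero_le_one fun x => ?_
    calc ‖Φ j x‖ = ‖p j‖ * ‖x‖ := ContinuousLinearMap.norm_smulRight_apply _ _
      _ ≤ 1 * ‖x‖ := by gcongr; exact hp j
  have h1 : fderiv ℝ f = fun y => ∑ j, Φ j (f' j y) := by
    funext y
    ext v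
    conv_lhs => rw [← hep v, map_sum]
    rw [ContinuousLinearMap.sum_apply]
    exact Finset.sum_congr rfl fun j _ => by rw [map_smul, hf']; rfl
  have hs' : ∀ j, ContDiff ℝ n (fun y => Φ j (f' j y)) := fun j => (Φ j).contDiff.comp (hs j)
  rw [← norm_iteratedFDeriv_fderiv, h1, iteratedFDeriv_fun_sum_apply fun j _ => (hs' j).contDiffAt]
  refine (norm_sum_le _ _).trans (Finset.sum_le_sum fun j _ => ?_)
  refine ((Φ j).norm_iteratedFDeriv_comp_left (hs j).contDiffAt le_rfl).trans ?_
  exact mul_le_of_le_one_left (norm_nonneg _) (hΦ j)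

theorem contDiff_of_partial {ι E F : Type*} [Fintype ι] [NormedAddCommGroup E]
    [NormedSpace ℝ E] [NormedAddCommGroup F] [NormedSpace ℝ F] (e : ι → E) (p : ι → E →L[ℝ] ℝ)
    (hep : ∀ v, ∑ j, p j v • e j = v) {f : E → F} {f' : ι → E → F} (hf : Differentiable ℝ f)
    (hf' : ∀ j y, fderiv ℝ f y (e j) = f' j y) {n : ℕ} (hs : ∀ j, ContDiff ℝ n (f' j)) :
    ContDiff ℝ (n + 1 : ℕ) f := by
  have h1 : fderiv ℝ f = fun y => ∑ j, ContinuousLinearMap.smulRightL ℝ E F (p j) (f' j y) := by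
    funext y
    ext v
    conv_lhs => rw [← hep v, map_sum]
    rw [ContinuousLinearMap.sum_apply]
    exact Finset.sum_congr rfl fun j _ => by rw [map_smul, hf']; rfl
  rw [Nat.cast_add, Nat.cast_one, contDiff_succ_iff_fderiv]
  refine ⟨hf, by simp, ?_⟩
  rw [h1]
  exact ContDiff.sum fun j _ => (ContinuousLinearMap.contDiff _).comp (hs j)

variable {g : ℕ}

/-- The `j`-th basis vector of `ℝ^g`. -/
abbrev stdVec (j : Fin g) : Fin g → ℝ := Pi.single j 1

theorem norm_proj_le_one (j : Fin g) :
    ‖(ContinuousLinearMap.proj j : (Fin g → ℝ) →L[ℝ] ℝ)‖ ≤ 1 :=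
  ContinuousLinearMap.opNorm_le_bound _ zero_le_one fun x => by
    simpa using norm_le_pi_norm x j

theorem sum_proj_smul_stdVec (v : Fin g → ℝ) :
    ∑ j, (ContinuousLinearMap.proj j : (Fin g → ℝ) →L[ℝ] ℝ) v • stdVec j = v := by
  ext i
  simp [Finset.sum_apply, Pi.single_apply]

theorem norm_le_sum_abs (y : Fin g → ℝ) : ‖y‖ ≤ ∑ j, |y j| :=
  (pi_norm_le_iff_of_nonneg (Finset.sum_nonneg fun _ _ => abs_nonneg _)).2 fun j =>
    Finset.single_le_sum (f := fun j => |y j|) (fun _ _ => abs_nonneg _) (Finset.mem_univ j)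

variable {X : Type*}

/-- The bounds of the Schwartz seminorms obtained from a family of functions that is stable under
the partial derivatives (by `D`) and under multiplication by the coordinates (by `Y`). -/
def schwartzBound (D Y : Fin g → X → X) (r : X → ℝ) (m n : ℕ) : X → ℝ :=
  (fun q x => ∑ j, q (D j x))^[n] ((fun q x => ∑ j, q (Y j x))^[m] r)

theorem schwartzBound_zero_zero (D Y : Fin g → X → X) (r : X → ℝ) :
    schwartzBound D Y r 0 0 = r := rfl

theorem schwartzBound_succ_zero (D Y : Fin g → X → X) (r : X → ℝ) (m : ℕ) :
    schwartzBound D Y r (m + 1) 0 = fun x => ∑ j, schwartzBound D Y r m 0 (Y j x) := by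
  simp only [schwartzBound, Function.iterate_succ_apply', Function.iterate_zero, id]

theorem schwartzBound_succ (D Y : Fin g → X → X) (r : X → ℝ) (m n : ℕ) :
    schwartzBound D Y r m (n + 1) = fun x => ∑ j, schwartzBound D Y r m n (D j x) := by
  simp only [schwartzBound, Function.iterate_succ_apply']

/-- A family `T` of functions that is stable under the partial derivatives and under
multiplication by the coordinates, with a uniform bound. -/
structure IsSchwartzFamily (T : X → (Fin g → ℝ) → ℂ) (D Y : Fin g → X → X) (r : X → ℝ) : Prop where
  differentiable : ∀ x, Differentiable ℝ (T x)
  fderiv_eq : ∀ x j y, fderiv ℝ (T x) y (stdVec j) = T (D j x) y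
  coord_eq : ∀ x j y, (y j : ℂ) * T x y = T (Y j x) y
  bound : ∀ x y, ‖T x y‖ ≤ r x

namespace IsSchwartzFamily

variable {T : X → (Fin g → ℝ) → ℂ} {D Y : Fin g → X → X} {r : X → ℝ}

theorem contDiff_nat (h : IsSchwartzFamily T D Y r) (n : ℕ) (x : X) : ContDiff ℝ n (T x) := by
  induction n generalizing x with
  | zero => exact contDiff_zero.2 (h.differentiable x).continuous
  | succ n ih =>
    exact contDiff_of_partial stdVec _ sum_proj_smul_stdVec (h.differentiable x) (h.fderiv_eq x)
      fun j => ih (D j x)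

theorem contDiff (h : IsSchwartzFamily T D Y r) (x : X) : ContDiff ℝ ∞ (T x) :=
  contDiff_infty.2 fun n => h.contDiff_nat n x

/-- Stability under the two kinds of operations trades each derivative and each power of `‖y‖ ≤ ∑
|y_j|` for a change of the parameter, until only the uniform bound `r` is needed. -/
theorem norm_pow_mul_iteratedFDeriv_le (h : IsSchwartzFamily T D Y r) (m n : ℕ) (x : X)
    (y : Fin g → ℝ) :
    ‖y‖ ^ m * ‖iteratedFDeriv ℝ n (T x) y‖ ≤ schwartzBound D Y r m n x := by
  induction n generalizing x with
  | zero =>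
    rw [norm_iteratedFDeriv_zero]
    induction m generalizing x with
    | zero => simpa [schwartzBound_zero_zero] using h.bound x y
    | succ m ih =>
      calc ‖y‖ ^ (m + 1) * ‖T x y‖ ≤ ‖y‖ ^ m * (∑ j, |y j|) * ‖T x y‖ := by
            rw [pow_succ]
            gcongr
            exact norm_le_sum_abs y
        _ = ∑ j, ‖y‖ ^ m * ‖T (Y j x) y‖ := by
            rw [Finset.mul_sum, Finset.sum_mul]
            refine Finset.sum_congr rfl fun j _ => ?_
            rw [← h.coord_eq, norm_mul, Complex.norm_real, Real.norm_eq_abs]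
            ring
        _ ≤ _ := by
            rw [schwartzBound_succ_zero]
            exact Finset.sum_le_sum fun j _ => ih _
  | succ n ih =>
    have := norm_iteratedFDeriv_succ_le_sum stdVec _ norm_proj_le_one sum_proj_smul_stdVec
      (h.fderiv_eq x) (fun j => h.contDiff_nat n (D j x)) y
    calc ‖y‖ ^ m * ‖iteratedFDeriv ℝ (n + 1) (T x) y‖
        ≤ ‖y‖ ^ m * ∑ j, ‖iteratedFDeriv ℝ n (T (D j x)) y‖ := by gcongr
      _ = ∑ j, ‖y‖ ^ m * ‖iteratedFDeriv ℝ n (T (D j x)) y‖ := Finset.mul_sum _ _ _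
      _ ≤ ∑ j, schwartzBound D Y r m n (D j x) := Finset.sum_le_sum fun j _ => ih _
      _ = _ := by rw [schwartzBound_succ]

/-- The members of a Schwartz family, as Schwartz functions. -/
noncomputable def toSchwartz (h : IsSchwartzFamily T D Y r) (x : X) :
    SchwartzMap (Fin g → ℝ) ℂ where
  toFun := T x
  smooth' := h.contDiff x
  decay' m n := ⟨_, h.norm_pow_mul_iteratedFDeriv_le m n x⟩

theorem toSchwartz_apply (h : IsSchwartzFamily T D Y r) (x : X) (y : Fin g → ℝ) :
    h.toSchwartz x y = T x y := rfl

end IsSchwartzFamily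

/-- If the operations are continuous linear and the bound is a continuous seminorm, then so are the
bounds of the Schwartz seminorms. -/
theorem exists_seminorm_eq_schwartzBound {X : Type*} [AddCommGroup X] [Module ℂ X]
    [TopologicalSpace X] (D Y : Fin g → X →L[ℂ] X) (r : Seminorm ℂ X) (hr : Continuous r)
    (m n : ℕ) : ∃ q : Seminorm ℂ X, Continuous q ∧
      ⇑q = schwartzBound (fun j => ⇑(D j)) (fun j => ⇑(Y j)) r m n := by
  have key : ∀ (A : Fin g → X →L[ℂ] X) (q : Seminorm ℂ X), Continuous q →
      ∃ q' : Seminorm ℂ X, Continuous q' ∧ ⇑q' = fun x => ∑ j, q (A j x) := by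
    intro A q hq
    have h : ⇑(∑ j, q.comp (A j).toLinearMap) = fun x => ∑ j, q (A j x) := by
      have h' : ∀ s : Finset (Fin g),
          ⇑(∑ j ∈ s, q.comp (A j).toLinearMap) = fun x => ∑ j ∈ s, q (A j x) := by
        intro s
        induction s using Finset.induction_on with
        | empty => rfl
        | insert a s ha ih =>
          funext x
          rw [Finset.sum_insert ha, Finset.sum_insert ha, Seminorm.add_apply, ih]
          rfl
      exact h' _
    exact ⟨_, by rw [h]; exact continuous_finsetSum _ fun j _ => hq.comp (A j).continuous, h⟩
  induction n with
  | zero =>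
    induction m with
    | zero => exact ⟨r, hr, rfl⟩
    | succ m ih =>
      obtain ⟨q, hq, hq'⟩ := ih
      obtain ⟨q', h1, h2⟩ := key Y q hq
      exact ⟨q', h1, by rw [h2, hq', schwartzBound_succ_zero]⟩
  | succ n ih =>
    obtain ⟨q, hq, hq'⟩ := ih
    obtain ⟨q', h1, h2⟩ := key D q hq
    exact ⟨q', h1, by rw [h2, hq', schwartzBound_succ]⟩

end DerivativeBounds

/-! ### Differentiation and multiplication by coordinates on the Schwartz space -/

section Operators

variable {g : ℕ}

/-- The Schwartz space of `ℝ^g`. -/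
abbrev SchwartzFun (g : ℕ) : Type := SchwartzMap (Fin g → ℝ) ℂ

/-- The partial derivative `∂_j` on Schwartz functions. -/
noncomputable def partialOp (j : Fin g) : SchwartzFun g →L[ℂ] SchwartzFun g :=
  LineDeriv.lineDerivOpCLM ℂ (SchwartzFun g) (stdVec j)

theorem partialOp_apply (j : Fin g) (f : SchwartzFun g) (y : Fin g → ℝ) :
    partialOp j f y = fderiv ℝ f y (stdVec j) := rfl

theorem hasTemperateGrowth_coord (j : Fin g) :
    Function.HasTemperateGrowth fun y : Fin g → ℝ => (y j : ℂ) :=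
  (Complex.ofRealCLM.comp (ContinuousLinearMap.proj j : (Fin g → ℝ) →L[ℝ] ℝ)).hasTemperateGrowth

/-- Multiplication by the coordinate `y_j` on Schwartz functions. -/
noncomputable def coordOp (j : Fin g) : SchwartzFun g →L[ℂ] SchwartzFun g :=
  SchwartzMap.smulLeftCLM ℂ fun y : Fin g → ℝ => (y j : ℂ)

theorem coordOp_apply (j : Fin g) (f : SchwartzFun g) (y : Fin g → ℝ) :
    coordOp j f y = y j * f y :=
  SchwartzMap.smulLeftCLM_apply_apply (hasTemperateGrowth_coord j) f y

theorem isSchwartzFamily_id :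
    IsSchwartzFamily (fun f : SchwartzFun g => ⇑f) (fun j => partialOp j) (fun j => coordOp j)
      (SchwartzMap.seminorm ℂ 0 0) where
  differentiable f := f.differentiable
  fderiv_eq f j y := (partialOp_apply j f y).symm
  coord_eq f j y := (coordOp_apply j f y).symm
  bound f y := SchwartzMap.norm_le_seminorm ℂ f y

/-- Applied to the tautological family, the closure principle shows that the sup norms of iterated
`partialOp` and `coordOp` control the Schwartz topology. -/
theorem seminorm_le_schwartzBound (m n : ℕ) (f : SchwartzFun g) :
    SchwartzMap.seminorm ℂ m n f ≤
      schwartzBound (fun j => ⇑(partialOp j)) (fun j => ⇑(coordOp j))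
        (SchwartzMap.seminorm ℂ 0 0) m n f := by
  refine SchwartzMap.seminorm_le_bound ℂ m n f ?_
    (isSchwartzFamily_id.norm_pow_mul_iteratedFDeriv_le m n f)
  exact le_trans (by positivity) (isSchwartzFamily_id.norm_pow_mul_iteratedFDeriv_le m n f 0)

end Operators

/-! ### Gaussians as Schwartz functions -/

section GaussianSchwartz

variable {g : ℕ}

theorem Function.HasTemperateGrowth.fderiv_apply {f : (Fin g → ℝ) → ℂ}
    (hf : f.HasTemperateGrowth) (v : Fin g → ℝ) :
    Function.HasTemperateGrowth fun y => fderiv ℝ f y v := by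
  have h1 : Function.HasTemperateGrowth (fderiv ℝ f) := by
    refine ⟨hf.1.fderiv_right (by simp), fun n => ?_⟩
    obtain ⟨k, C, h⟩ := hf.2 (n + 1)
    exact ⟨k, C, fun y => by rw [norm_iteratedFDeriv_fderiv]; exact h y⟩
  exact (ContinuousLinearMap.apply ℝ ℂ v).hasTemperateGrowth.comp h1

/-- The function `y ↦ e^{-π ᵗy S y + z · y}`. -/
noncomputable def gaussianFn (S : Matrix (Fin g) (Fin g) ℂ) (z : Fin g → ℂ) (y : Fin g → ℝ) : ℂ :=
  Complex.exp (-(Real.pi * quadForm S (ofRealVec y)) + z ⬝ᵥ ofRealVec y)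

theorem hasFDerivAt_coord (j : Fin g) (y : Fin g → ℝ) :
    HasFDerivAt (fun y : Fin g → ℝ => ofRealVec y j)
      (Complex.ofRealCLM.comp (ContinuousLinearMap.proj j : (Fin g → ℝ) →L[ℝ] ℝ)) y :=
  (Complex.ofRealCLM.comp (ContinuousLinearMap.proj j : (Fin g → ℝ) →L[ℝ] ℝ)).hasFDerivAt

theorem hasFDerivAt_quadForm {S : Matrix (Fin g) (Fin g) ℂ} (hS : S.IsSymm) (y : Fin g → ℝ) :
    ∃ D : (Fin g → ℝ) →L[ℝ] ℂ, HasFDerivAt (fun y : Fin g → ℝ => quadForm S (ofRealVec y)) D y ∧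
      ∀ j, D (stdVec j) = 2 * (S *ᵥ ofRealVec y) j := by
  have h : (fun y : Fin g → ℝ => quadForm S (ofRealVec y)) =
      fun y => ∑ i, ∑ j, S i j * (ofRealVec y i * ofRealVec y j) := by
    funext y
    rw [quadForm_eq_sum]
    exact Finset.sum_congr rfl fun i _ => Finset.sum_congr rfl fun j _ => by ring
  have hd := HasFDerivAt.fun_sum (u := Finset.univ) fun i _ =>
    HasFDerivAt.fun_sum (u := Finset.univ) fun j _ =>
      ((hasFDerivAt_coord i y).mul (hasFDerivAt_coord j y)).const_mul (S i j)
  refine ⟨_, by rw [h]; exact hd, fun j => ?_⟩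
  have hS' : ∀ i j, S i j = S j i := fun i j => (congrFun (congrFun hS i) j).symm
  simp only [ContinuousLinearMap.sum_apply, _root_.smul_apply, _root_.add_apply,
    ContinuousLinearMap.comp_apply, ContinuousLinearMap.proj_apply, Complex.ofRealCLM_apply,
    smul_eq_mul, Pi.single_apply, mulVec, dotProduct]
  simp only [mul_add, Finset.sum_add_distrib, apply_ite Complex.ofReal, Complex.ofReal_one,
    Complex.ofReal_zero, mul_ite, mul_one, mul_zero, Finset.sum_ite_eq', Finset.mem_univ, if_true]
  rw [Finset.sum_comm]
  simp only [Finset.sum_ite_eq', Finset.mem_univ, if_true]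
  rw [two_mul]
  congr 1
  exact Finset.sum_congr rfl fun i _ => by rw [hS' i j]

theorem hasFDerivAt_gaussianFn {S : Matrix (Fin g) (Fin g) ℂ} (hS : S.IsSymm) (z : Fin g → ℂ)
    (y : Fin g → ℝ) :
    ∃ D : (Fin g → ℝ) →L[ℝ] ℂ, HasFDerivAt (gaussianFn S z) D y ∧
      ∀ j, D (stdVec j) = (-(2 * Real.pi * (S *ᵥ ofRealVec y) j) + z j) * gaussianFn S z y := by
  obtain ⟨D, hD, hDj⟩ := hasFDerivAt_quadForm hS y
  have h2 : HasFDerivAt (fun y : Fin g → ℝ => z ⬝ᵥ ofRealVec y) _ y :=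
    HasFDerivAt.fun_sum (u := Finset.univ) fun j _ => (hasFDerivAt_coord j y).const_mul (z j)
  have h3 := ((hD.const_mul (Real.pi : ℂ)).neg.add h2).cexp
  refine ⟨_, h3, fun j => ?_⟩
  simp only [_root_.smul_apply, _root_.add_apply, _root_.neg_apply, hDj, smul_eq_mul,
    ContinuousLinearMap.sum_apply, ContinuousLinearMap.comp_apply, ContinuousLinearMap.proj_apply,
    Complex.ofRealCLM_apply, Pi.single_apply, apply_ite Complex.ofReal, Complex.ofReal_one,
    Complex.ofReal_zero, mul_ite, mul_one, mul_zero, Finset.sum_ite_eq', Finset.mem_univ, if_true]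
  rw [mul_comm]
  congr 1
  ring

theorem norm_gaussianFn_le {S : Matrix (Fin g) (Fin g) ℂ} {c : ℝ} {y : Fin g → ℝ}
    (h : c * ‖y‖ ^ 2 ≤ (quadForm S (ofRealVec y)).re) (z : Fin g → ℂ) :
    ‖gaussianFn S z y‖ ≤ Real.exp (-(Real.pi * c * ‖y‖ ^ 2) + (∑ j, |(z j).re|) * ‖y‖) := by
  rw [gaussianFn, Complex.norm_exp, Real.exp_le_exp, Complex.add_re, Complex.neg_re,
    Complex.re_ofReal_mul]
  have h2 : (z ⬝ᵥ ofRealVec y).re ≤ (∑ j, |(z j).re|) * ‖y‖ := by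
    rw [dotProduct, Complex.re_sum, Finset.sum_mul]
    refine Finset.sum_le_sum fun j _ => ?_
    rw [ofRealVec, Complex.re_mul_ofReal]
    calc (z j).re * y j ≤ |(z j).re * y j| := le_abs_self _
      _ = |(z j).re| * |y j| := abs_mul _ _
      _ ≤ _ := by gcongr; exact norm_le_pi_norm y j
  have h1 : Real.pi * c * ‖y‖ ^ 2 ≤ Real.pi * (quadForm S (ofRealVec y)).re := by
    rw [mul_assoc]
    gcongr
  linarith

/-- Polynomial growth times Gaussian decay is bounded. -/
theorem one_add_pow_mul_exp_le {c : ℝ} (hc : 0 < c) (b : ℝ) (N : ℕ) {t : ℝ} (ht : 0 ≤ t) :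
    (1 + t) ^ N * Real.exp (-(c * t ^ 2) + b * t) ≤
      N.factorial * Real.exp (1 + (1 + b) ^ 2 / (4 * c)) := by
  have h1 : (1 + t) ^ N ≤ N.factorial * Real.exp (1 + t) := by
    have := Real.pow_div_factorial_le_exp (1 + t) (by positivity) N
    rwa [div_le_iff₀ (by positivity), mul_comm] at this
  calc (1 + t) ^ N * Real.exp (-(c * t ^ 2) + b * t)
      ≤ N.factorial * Real.exp (1 + t) * Real.exp (-(c * t ^ 2) + b * t) := by gcongr
    _ = N.factorial * Real.exp (1 + t + (-(c * t ^ 2) + b * t)) := by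
        rw [mul_assoc, ← Real.exp_add]
    _ ≤ _ := by
        refine mul_le_mul_of_nonneg_left (Real.exp_le_exp.2 ?_) (by positivity)
        -- Completing the square in the exponent `1 + t - c t² + b t`.
        have h3 : 0 ≤ (2 * c * t - (1 + b)) ^ 2 / (4 * c) := by positivity
        have h4 : (2 * c * t - (1 + b)) ^ 2 / (4 * c) =
            c * t ^ 2 - (1 + b) * t + (1 + b) ^ 2 / (4 * c) := by
          field_simp
          ring
        linarith

theorem exists_bound_temperate_mul_gaussian {S : Matrix (Fin g) (Fin g) ℂ} (hS : IsAccretive S)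
    (z : Fin g → ℂ) {Q : (Fin g → ℝ) → ℂ} (hQ : Q.HasTemperateGrowth) :
    ∃ C, ∀ y, ‖Q y * gaussianFn S z y‖ ≤ C := by
  obtain ⟨c, hc, h⟩ := hS.exists_coercive
  obtain ⟨k, C, hC⟩ := hQ.2 0
  have hC0 : 0 ≤ C := by
    have := hC 0
    simp at this
    exact (norm_nonneg _).trans this
  refine ⟨C * (k.factorial * Real.exp (1 + (1 + ∑ j, |(z j).re|) ^ 2 / (4 * (Real.pi * c)))),
    fun y => ?_⟩
  have h1 := hC y
  rw [norm_iteratedFDeriv_zero] at h1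
  rw [norm_mul]
  calc ‖Q y‖ * ‖gaussianFn S z y‖ ≤ C * (1 + ‖y‖) ^ k *
        Real.exp (-(Real.pi * c * ‖y‖ ^ 2) + (∑ j, |(z j).re|) * ‖y‖) := by
        gcongr
        exact norm_gaussianFn_le (h y) z
    _ ≤ _ := by
        rw [mul_assoc]
        refine mul_le_mul_of_nonneg_left ?_ hC0
        exact one_add_pow_mul_exp_le (by positivity) _ k (norm_nonneg y)

theorem hasTemperateGrowth_mulVec (S : Matrix (Fin g) (Fin g) ℂ) (j : Fin g) :
    Function.HasTemperateGrowth fun y : Fin g → ℝ => (S *ᵥ ofRealVec y) j :=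
  Function.HasTemperateGrowth.sum (s := Finset.univ) (f := fun i y => S j i * ofRealVec y i)
    fun i _ => (Function.HasTemperateGrowth.const (S j i)).mul (hasTemperateGrowth_coord i)

/-- Functions of temperate growth times a Gaussian form a Schwartz family. -/
theorem exists_isSchwartzFamily_gaussian {S : Matrix (Fin g) (Fin g) ℂ} (hS : IsAccretive S)
    (z : Fin g → ℂ) : ∃ (D Y : Fin g → {Q : (Fin g → ℝ) → ℂ // Q.HasTemperateGrowth} →
        {Q : (Fin g → ℝ) → ℂ // Q.HasTemperateGrowth}) (r : _ → ℝ),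
      IsSchwartzFamily (fun (Q : {Q : (Fin g → ℝ) → ℂ // Q.HasTemperateGrowth}) y =>
        Q.1 y * gaussianFn S z y) D Y r := by
  choose r hr using fun Q : {Q : (Fin g → ℝ) → ℂ // Q.HasTemperateGrowth} =>
    exists_bound_temperate_mul_gaussian hS z Q.2
  have hd : ∀ (Q : {Q : (Fin g → ℝ) → ℂ // Q.HasTemperateGrowth}) y, HasFDerivAt Q.1
      (fderiv ℝ Q.1 y) y := fun Q y =>
    (Q.2.1.differentiable (by simp)).differentiableAt.hasFDerivAt
  -- The logarithmic derivative of the Gaussian is affine in `y`, so differentiating `Q` times the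
  -- Gaussian replaces `Q` by `∂_j Q` plus `Q` times this affine function, again of temperate
  -- growth.
  refine ⟨fun j Q => ⟨fun y => fderiv ℝ Q.1 y (stdVec j) +
      Q.1 y * (-(2 * Real.pi * (S *ᵥ ofRealVec y) j) + z j), ?_⟩,
    fun j Q => ⟨fun y => y j * Q.1 y, (hasTemperateGrowth_coord j).mul Q.2⟩, r, ?_, ?_, ?_, hr⟩
  · exact (Q.2.fderiv_apply _).add (Q.2.mul ((((Function.HasTemperateGrowth.const
      (2 * Real.pi : ℂ)).mul (hasTemperateGrowth_mulVec S j)).neg).add (.const (z j))))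
  · intro Q y
    obtain ⟨D, hD, -⟩ := hasFDerivAt_gaussianFn hS.1 z y
    exact ((hd Q y).fun_mul hD).differentiableAt
  · intro Q j y
    obtain ⟨D, hD, hDj⟩ := hasFDerivAt_gaussianFn hS.1 z y
    rw [HasFDerivAt.fderiv ((hd Q y).fun_mul hD)]
    simp only [_root_.smul_apply, _root_.add_apply, hDj, smul_eq_mul]
    ring
  · intro Q j y
    ring

theorem exists_schwartz_gaussian {S : Matrix (Fin g) (Fin g) ℂ} (hS : IsAccretive S)
    (z : Fin g → ℂ) : ∃ f : SchwartzFun g, ∀ y, f y = gaussianFn S z y := by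
  obtain ⟨D, Y, r, h⟩ := exists_isSchwartzFamily_gaussian hS z
  exact ⟨h.toSchwartz ⟨fun _ => 1, .const 1⟩, fun y => by simp [h.toSchwartz_apply]⟩

/-- The Gaussian `e^{-π ᵗy S y + z · y}` as a Schwartz function. -/
noncomputable def gaussianSchwartz {S : Matrix (Fin g) (Fin g) ℂ} (hS : IsAccretive S)
    (z : Fin g → ℂ) : SchwartzFun g := (exists_schwartz_gaussian hS z).choose

theorem gaussianSchwartz_apply {S : Matrix (Fin g) (Fin g) ℂ} (hS : IsAccretive S)
    (z : Fin g → ℂ) (y : Fin g → ℝ) : gaussianSchwartz hS z y = gaussianFn S z y :=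
  (exists_schwartz_gaussian hS z).choose_spec y

theorem partialOp_gaussianSchwartz {S : Matrix (Fin g) (Fin g) ℂ} (hS : IsAccretive S)
    (z : Fin g → ℂ) (j : Fin g) :
    partialOp j (gaussianSchwartz hS z) =
      z j • gaussianSchwartz hS z -
        (2 * Real.pi : ℂ) • ∑ i, S j i • coordOp i (gaussianSchwartz hS z) := by
  ext y
  obtain ⟨D, hD, hDj⟩ := hasFDerivAt_gaussianFn hS.1 z y
  have h : ⇑(gaussianSchwartz hS z) = gaussianFn S z := funext (gaussianSchwartz_apply hS z)
  rw [partialOp_apply, h, hD.fderiv, hDj]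
  simp only [_root_.sub_apply, _root_.smul_apply, SchwartzMap.sum_apply, coordOp_apply, smul_eq_mul,
    gaussianSchwartz_apply, mulVec, dotProduct, ofRealVec]
  rw [add_mul, neg_mul, mul_assoc (2 * (Real.pi : ℂ)), Finset.sum_mul, sub_eq_neg_add]
  congr 3
  exact Finset.sum_congr rfl fun i _ => by ring

end GaussianSchwartz

open scoped FourierTransform

/-! ## Continuous operators on the Schwartz space -/

section SchwartzOperators

variable {g : ℕ}

/-- A Schwartz family that depends linearly on a parameter in a topological vector space, with
continuous operations and bound, is a continuous linear map into the Schwartz space. -/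
theorem IsSchwartzFamily.exists_clm {X : Type*} [AddCommGroup X] [Module ℂ X] [TopologicalSpace X]
    [IsTopologicalAddGroup X] {T : X →ₗ[ℂ] ((Fin g → ℝ) → ℂ)} {D Y : Fin g → X →L[ℂ] X}
    {r : Seminorm ℂ X} (hr : Continuous r)
    (h : IsSchwartzFamily (fun x => T x) (fun j => ⇑(D j)) (fun j => ⇑(Y j)) r) :
    ∃ A : X →L[ℂ] SchwartzFun g, ∀ x y, A x y = T x y := by
  let A : X →ₗ[ℂ] SchwartzFun g :=
    { toFun := h.toSchwartz
      map_add' := fun x x' => by ext y; simp [h.toSchwartz_apply]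
      map_smul' := fun c x => by ext y; simp [h.toSchwartz_apply] }
  refine ⟨⟨A, ?_⟩, fun x y => rfl⟩
  refine (schwartz_withSeminorms ℂ (Fin g → ℝ) ℂ).continuous_of_continuous_comp A fun i => ?_
  obtain ⟨q, hq, hq'⟩ := exists_seminorm_eq_schwartzBound D Y r hr i.1 i.2
  refine Seminorm.continuous_of_le hq fun x => ?_
  rw [hq']
  refine SchwartzMap.seminorm_le_bound ℂ i.1 i.2 _ ?_ (h.norm_pow_mul_iteratedFDeriv_le i.1 i.2 x)
  exact le_trans (by positivity) (h.norm_pow_mul_iteratedFDeriv_le i.1 i.2 x 0)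

theorem continuous_seminorm_schwartz (m n : ℕ) :
    Continuous (SchwartzMap.seminorm ℂ m n : Seminorm ℂ (SchwartzFun g)) :=
  (schwartz_withSeminorms ℂ (Fin g → ℝ) ℂ).continuous_seminorm (m, n)

/-- The `L¹` norm, as a seminorm on the Schwartz space. -/
noncomputable def l1Seminorm (g : ℕ) : Seminorm ℂ (SchwartzFun g) :=
  (normSeminorm ℂ _).comp (SchwartzMap.toLpCLM ℂ ℂ 1 (volume : Measure (Fin g → ℝ))).toLinearMap

theorem continuous_l1Seminorm : Continuous (l1Seminorm g) :=
  continuous_norm.comp (SchwartzMap.toLpCLM ℂ ℂ 1 (volume : Measure (Fin g → ℝ))).continuous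

theorem l1Seminorm_apply (f : SchwartzFun g) : l1Seminorm g f = ∫ v, ‖f v‖ := by
  change ‖f.toLp 1 volume‖ = _
  rw [L1.norm_eq_integral_norm]
  exact integral_congr_ae (by filter_upwards [f.coeFn_toLp 1 volume] with v hv using by rw [hv])

theorem integrable_schwartz_mul (f h : SchwartzFun g) : Integrable fun v => f v * h v := by
  have := (SchwartzMap.smulLeftCLM ℂ (⇑f) h).integrable (μ := volume)
  exact this.congr (Filter.Eventually.of_forall fun v =>
    SchwartzMap.smulLeftCLM_apply_apply f.hasTemperateGrowth h v)

theorem integral_mul_partialOp (f h : SchwartzFun g) (j : Fin g) :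
    ∫ v, f v * partialOp j h v = -∫ v, partialOp j f v * h v :=
  SchwartzMap.integral_mul_lineDerivOp_right_eq_neg_left f h (stdVec j)

theorem quadForm_ofReal (Q : Matrix (Fin g) (Fin g) ℝ) (y : Fin g → ℝ) :
    quadForm (Q.map Complex.ofReal) (ofRealVec y) = ((y ⬝ᵥ (Q *ᵥ y) : ℝ) : ℂ) := by
  simp [quadForm, ofRealVec, dotProduct, mulVec]

/-- The chirp has modulus one, and its derivative only adds a linear combination of coordinate
multiplications; these are continuous operations on `f`, so the family criterion applies. -/
theorem exists_chirp {Q : Matrix (Fin g) (Fin g) ℝ} (hQ : Q.IsSymm) :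
    ∃ A : SchwartzFun g →L[ℂ] SchwartzFun g, ∀ f y,
      A f y = Complex.exp (Real.pi * Complex.I * ((y ⬝ᵥ (Q *ᵥ y) : ℝ) : ℂ)) * f y := by
  let T : SchwartzFun g →ₗ[ℂ] ((Fin g → ℝ) → ℂ) :=
    { toFun := fun f y => Complex.exp (Real.pi * Complex.I * ((y ⬝ᵥ (Q *ᵥ y) : ℝ) : ℂ)) * f y
      map_add' := fun f h => by funext y; simp [mul_add]
      map_smul' := fun c f => by funext y; simp; ring }
  have hQ' : (Q.map Complex.ofReal).IsSymm := hQ.map _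
  have hexp : ∀ y, ∃ D : (Fin g → ℝ) →L[ℝ] ℂ, HasFDerivAt (fun y : Fin g → ℝ =>
      Complex.exp (Real.pi * Complex.I * ((y ⬝ᵥ (Q *ᵥ y) : ℝ) : ℂ))) D y ∧
      ∀ j, D (stdVec j) = Complex.exp (Real.pi * Complex.I * ((y ⬝ᵥ (Q *ᵥ y) : ℝ) : ℂ)) *
        (2 * Real.pi * Complex.I * ((Q.map Complex.ofReal) *ᵥ ofRealVec y) j) := by
    intro y
    obtain ⟨D, hD, hDj⟩ := hasFDerivAt_quadForm hQ' y
    simp only [quadForm_ofReal] at hD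
    refine ⟨_, (hD.const_mul (Real.pi * Complex.I)).cexp, fun j => ?_⟩
    simp only [_root_.smul_apply, hDj, smul_eq_mul]
    ring
  have h : IsSchwartzFamily (fun f => T f)
      (fun j => ⇑(partialOp j + (2 * Real.pi * Complex.I) •
        ∑ i, (Q j i : ℂ) • coordOp i : SchwartzFun g →L[ℂ] SchwartzFun g))
      (fun j => ⇑(coordOp j)) (SchwartzMap.seminorm ℂ 0 0) := by
    refine ⟨fun f y => ?_, fun f j y => ?_, fun f j y => ?_, fun f y => ?_⟩
    · obtain ⟨D, hD, -⟩ := hexp y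
      exact (hD.fun_mul f.differentiableAt.hasFDerivAt).differentiableAt
    · obtain ⟨D, hD, hDj⟩ := hexp y
      change fderiv ℝ (fun y => _ * f y) y _ = Complex.exp _ * _
      rw [HasFDerivAt.fderiv (hD.fun_mul f.differentiableAt.hasFDerivAt)]
      simp only [_root_.smul_apply, _root_.add_apply, hDj, smul_eq_mul, partialOp_apply,
        SchwartzMap.sum_apply, ContinuousLinearMap.sum_apply, coordOp_apply, mulVec, dotProduct,
        Matrix.map_apply, ofRealVec, Finset.mul_sum, mul_add]
      congr 1
      refine Finset.sum_congr rfl fun i _ => by ring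
    · change _ * (Complex.exp _ * _) = Complex.exp _ * _
      rw [coordOp_apply]
      ring
    · change ‖Complex.exp _ * f y‖ ≤ _
      rw [norm_mul, show (Real.pi * Complex.I * ((y ⬝ᵥ (Q *ᵥ y) : ℝ) : ℂ)) =
        ((Real.pi * (y ⬝ᵥ (Q *ᵥ y)) : ℝ) : ℂ) * Complex.I by push_cast; ring,
        Complex.norm_exp_ofReal_mul_I, one_mul]
      exact SchwartzMap.norm_le_seminorm ℂ f y
  exact h.exists_clm (continuous_seminorm_schwartz 0 0)

/-- Multiplication by the chirp `e^{πi ᵗy Q y}`. -/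
noncomputable def chirpOp {Q : Matrix (Fin g) (Fin g) ℝ} (hQ : Q.IsSymm) :
    SchwartzFun g →L[ℂ] SchwartzFun g := (exists_chirp hQ).choose

theorem chirpOp_apply {Q : Matrix (Fin g) (Fin g) ℝ} (hQ : Q.IsSymm) (f : SchwartzFun g)
    (y : Fin g → ℝ) : chirpOp hQ f y =
      Complex.exp (Real.pi * Complex.I * ((y ⬝ᵥ (Q *ᵥ y) : ℝ) : ℂ)) * f y :=
  (exists_chirp hQ).choose_spec f y

/-- The Fourier transform is taken on Euclidean space; the change from the sup norm to the Euclidean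
norm preserves Lebesgue measure. -/
theorem integral_euclidean (f : (Fin g → ℝ) → ℂ) :
    ∫ v : EuclideanSpace ℝ (Fin g), f (WithLp.ofLp v) = ∫ v, f v :=
  (PiLp.volume_preserving_ofLp (Fin g)).integral_comp
    (MeasurableEquiv.toLp 2 (Fin g → ℝ)).symm.measurableEmbedding f

/-- The Fourier transform on `𝒮(ℝ^g)`, where `ℝ^g` carries the sup norm. -/
noncomputable def fourierOp (g : ℕ) : SchwartzFun g →L[ℂ] SchwartzFun g :=
  (SchwartzMap.compCLMOfContinuousLinearEquiv ℂ (EuclideanSpace.equiv (Fin g) ℝ).symm).comp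
    ((SchwartzMap.fourierTransformCLM ℂ).comp
      (SchwartzMap.compCLMOfContinuousLinearEquiv ℂ (EuclideanSpace.equiv (Fin g) ℝ)))

theorem fourierOp_apply (f : SchwartzFun g) (ξ : Fin g → ℝ) :
    fourierOp g f ξ = ∫ v, Complex.exp (-(2 * Real.pi * Complex.I * ((ξ ⬝ᵥ v : ℝ) : ℂ))) * f v := by
  rw [← integral_euclidean]
  change 𝓕 (f ∘ (EuclideanSpace.equiv (Fin g) ℝ)) (WithLp.toLp 2 ξ) = _
  rw [Real.fourier_eq']
  refine integral_congr_ae (Filter.Eventually.of_forall fun v => ?_)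
  simp only [smul_eq_mul, PiLp.inner_apply, RCLike.inner_apply, conj_trivial, dotProduct]
  congr 2
  push_cast
  ring

theorem fourierOp_inversion (f : SchwartzFun g) (y : Fin g → ℝ) :
    f y = ∫ ξ, Complex.exp (2 * Real.pi * Complex.I * ((ξ ⬝ᵥ y : ℝ) : ℂ)) * fourierOp g f ξ := by
  rw [← integral_euclidean]
  set F : SchwartzMap (EuclideanSpace ℝ (Fin g)) ℂ :=
    SchwartzMap.compCLMOfContinuousLinearEquiv ℂ (EuclideanSpace.equiv (Fin g) ℝ) f with hF
  have h1 : f y = F (WithLp.toLp 2 y) := rfl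
  have h2 : F = 𝓕⁻ (𝓕 F) := (FourierTransform.fourierInv_fourier_eq F).symm
  rw [h1, h2, SchwartzMap.fourierInv_coe, Real.fourierInv_eq']
  refine integral_congr_ae (Filter.Eventually.of_forall fun v => ?_)
  change Complex.exp _ * fourierOp g f (WithLp.ofLp v) = _
  simp only [PiLp.inner_apply, RCLike.inner_apply, conj_trivial, dotProduct]
  congr 2
  push_cast
  simp only [mul_comm (y _ : ℂ)]
  ring

end SchwartzOperators

/-! ### The metaplectic integral operators on the Schwartz space -/

section GeneratorOperators

variable {g : ℕ}

theorem exists_comp_mulVec {L : Matrix (Fin g) (Fin g) ℝ} (hL : L.det ≠ 0) :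
    ∃ A : SchwartzFun g →L[ℂ] SchwartzFun g, ∀ f u, A f u = f (L *ᵥ u) := by
  let e : (Fin g → ℝ) ≃ₗ[ℝ] (Fin g → ℝ) :=
    Matrix.toLinearEquiv' L (Matrix.invertibleOfIsUnitDet L hL.isUnit)
  exact ⟨SchwartzMap.compCLMOfContinuousLinearEquiv ℂ e.toContinuousLinearEquiv, fun f u => rfl⟩

namespace MetaplecticGenerator

variable (k : ℕ) (γ : MetaplecticGenerator g)

/-- The constant factor of the integral operator. -/
noncomputable def opConst : ℂ :=
  Complex.exp (Real.pi * Complex.I / 2 * (-(g : ℂ) / 2 + γ.m)) *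
    ((Real.sqrt k ^ g * Real.sqrt |γ.L.det| : ℝ) : ℂ)

/-- Up to its constant the operator factors as the chirp of `kP`, after the substitution `u ↦ kLu`,
after the Fourier transform, after the chirp of `kQ`. -/
theorem exists_schwartzOp {k : ℕ} (hk : 0 < k) : ∃ A : SchwartzFun g →L[ℂ] SchwartzFun g, ∀ f u,
    A f u = γ.integralOp k f u := by
  have hkL : ((k : ℝ) • γ.L).det ≠ 0 := by
    rw [det_smul]
    exact mul_ne_zero (pow_ne_zero _ (by positivity)) γ.det_L
  obtain ⟨A, hA⟩ := exists_comp_mulVec hkL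
  refine ⟨γ.opConst k • (chirpOp (γ.symm_P.smul (k : ℝ))).comp (A.comp ((fourierOp g).comp
    (chirpOp (γ.symm_Q.smul (k : ℝ))))), fun f u => ?_⟩
  simp only [_root_.smul_apply, ContinuousLinearMap.comp_apply, chirpOp_apply, hA, fourierOp_apply,
    smul_eq_mul, integralOp, opConst]
  rw [← integral_const_mul]
  congr 2
  funext v
  rw [← mul_assoc, ← mul_assoc, ← Complex.exp_add, ← Complex.exp_add]
  congr 2
  rw [dotProduct_transpose_mulVec, dotProduct_comm v (γ.L *ᵥ u)]
  simp only [smul_mulVec, dotProduct_smul, smul_dotProduct, smul_eq_mul]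
  push_cast
  ring

/-- The integral operator `S(P, L, Q)_m` on the Schwartz space. -/
noncomputable def schwartzOp {k : ℕ} (hk : 0 < k) : SchwartzFun g →L[ℂ] SchwartzFun g :=
  (γ.exists_schwartzOp hk).choose

theorem schwartzOp_apply {k : ℕ} (hk : 0 < k) (f : SchwartzFun g) (u : Fin g → ℝ) :
    γ.schwartzOp hk f u = γ.integralOp k f u :=
  (γ.exists_schwartzOp hk).choose_spec f u

/-- The generator `(Q, ᵗL, P)_m`, whose operator is the transpose of that of `(P, L, Q)_m`. -/
def transpose : MetaplecticGenerator g where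
  P := γ.Q
  L := γ.Lᵀ
  Q := γ.P
  m := γ.m
  symm_P := γ.symm_Q
  symm_Q := γ.symm_P
  det_L := by rw [det_transpose]; exact γ.det_L
  root := by rw [det_transpose]; exact γ.root

/-- Exchanging `u` with `v`, `P` with `Q` and `L` with its transpose leaves the kernel unchanged, so
Fubini gives the transpose. This governs the action on test sections. -/
theorem integral_mul_schwartzOp {k : ℕ} (hk : 0 < k) (f h : SchwartzFun g) :
    ∫ u, γ.schwartzOp hk f u * h u = ∫ v, f v * γ.transpose.schwartzOp hk h v := by
  simp only [schwartzOp_apply, integralOp, transpose, transpose_transpose, det_transpose]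
  set c := Complex.exp (Real.pi * Complex.I / 2 * (-(g : ℂ) / 2 + γ.m)) *
    ((Real.sqrt k ^ g * Real.sqrt |γ.L.det| : ℝ) : ℂ)
  set e : (Fin g → ℝ) → (Fin g → ℝ) → ℂ := fun u v => Complex.exp (k * Real.pi * Complex.I *
      ((u ⬝ᵥ (γ.P *ᵥ u) - 2 * (u ⬝ᵥ (γ.Lᵀ *ᵥ v)) + v ⬝ᵥ (γ.Q *ᵥ v) : ℝ) : ℂ)) with he
  -- The kernel has modulus one, so integrability reduces to that of the tensor product of `h` and
  -- `f`.
  have h1 : Integrable (Function.uncurry fun u v => e u v * (h u * f v))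
      ((volume : Measure (Fin g → ℝ)).prod volume) := by
    refine Integrable.bdd_mul (c := 1) ((h.integrable (μ := volume)).mul_prod
      (f.integrable (μ := volume))) ?_ (Filter.Eventually.of_forall fun p => ?_)
    · refine Continuous.aestronglyMeasurable ?_
      have : Continuous fun p : (Fin g → ℝ) × (Fin g → ℝ) => (p.1 ⬝ᵥ (γ.P *ᵥ p.1) -
          2 * (p.1 ⬝ᵥ (γ.Lᵀ *ᵥ p.2)) + p.2 ⬝ᵥ (γ.Q *ᵥ p.2) : ℝ) := by
        simp only [dotProduct, mulVec]
        fun_prop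
      exact Complex.continuous_exp.comp (continuous_const.mul (Complex.continuous_ofReal.comp this))
    · simp only [he]
      rw [show ∀ t : ℝ, (k * Real.pi * Complex.I * (t : ℂ)) =
        ((k * Real.pi * t : ℝ) : ℂ) * Complex.I from fun t => by push_cast; ring,
        Complex.norm_exp_ofReal_mul_I]
  have hsymm : ∀ u v, Complex.exp (k * Real.pi * Complex.I * ((v ⬝ᵥ (γ.Q *ᵥ v) -
      2 * (v ⬝ᵥ (γ.L *ᵥ u)) + u ⬝ᵥ (γ.P *ᵥ u) : ℝ) : ℂ)) = e u v := fun u v => by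
    simp only [he]
    rw [dotProduct_transpose_mulVec]
    congr 3
    ring
  calc ∫ u, c * (∫ v, e u v * f v) * h u = c * ∫ u, ∫ v, e u v * (h u * f v) := by
        rw [← integral_const_mul]
        congr 1
        funext u
        rw [mul_assoc, ← integral_mul_const]
        congr 2
        funext v
        ring
    _ = c * ∫ v, ∫ u, e u v * (h u * f v) := by rw [integral_integral_swap h1]
    _ = _ := by
        rw [← integral_const_mul]
        refine integral_congr_ae (Filter.Eventually.of_forall fun v => ?_)
        simp only [hsymm]
        rw [mul_left_comm]
        congr 1
        rw [← integral_const_mul]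
        congr 1
        funext u
        ring

end MetaplecticGenerator

end GeneratorOperators

/-! ## Continuous functionals commute with integrals of Schwartz functions -/

section Words

variable {g : ℕ}

/-- The operators `∂_j` and `y_j` on the Schwartz space. -/
noncomputable def letterOp : Fin g ⊕ Fin g → SchwartzFun g →L[ℂ] SchwartzFun g :=
  Sum.elim partialOp coordOp

/-- Words in the operators `∂_j` and `y_j`; the first letter acts first. -/
noncomputable def wordOp : List (Fin g ⊕ Fin g) → SchwartzFun g →L[ℂ] SchwartzFun g
  | [] => ContinuousLinearMap.id ℂ _
  | a :: W => (wordOp W).comp (letterOp a)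

theorem exists_schwartzBound_eq_sum (r : SchwartzFun g → ℝ) (m n : ℕ) :
    ∃ (ι : Type) (_ : Fintype ι) (W : ι → List (Fin g ⊕ Fin g)), ∀ f,
      schwartzBound (fun j => ⇑(partialOp j)) (fun j => ⇑(coordOp j)) r m n f =
        ∑ i, r (wordOp (W i) f) := by
  induction n with
  | zero =>
    induction m with
    | zero => exact ⟨Unit, inferInstance, fun _ => [], fun f => by
        simp [schwartzBound_zero_zero, wordOp]⟩
    | succ m ih =>
      obtain ⟨ι, _, W, h⟩ := ih
      refine ⟨Fin g × ι, inferInstance, fun i => Sum.inr i.1 :: W i.2, fun f => ?_⟩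
      rw [schwartzBound_succ_zero, Fintype.sum_prod_type]
      exact Finset.sum_congr rfl fun j _ => h _
  | succ n ih =>
    obtain ⟨ι, _, W, h⟩ := ih
    refine ⟨Fin g × ι, inferInstance, fun i => Sum.inl i.1 :: W i.2, fun f => ?_⟩
    rw [schwartzBound_succ, Fintype.sum_prod_type]
    exact Finset.sum_congr rfl fun j _ => h _

/-- The inclusion of the Schwartz space into the bounded continuous functions. -/
noncomputable def toBCF (g : ℕ) :
    SchwartzFun g →L[ℂ] BoundedContinuousFunction (Fin g → ℝ) ℂ :=
  SchwartzMap.toBoundedContinuousFunctionCLM ℂ (Fin g → ℝ) ℂ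

theorem norm_apply_le_norm_toBCF (f : SchwartzFun g) (y : Fin g → ℝ) : ‖f y‖ ≤ ‖toBCF g f‖ :=
  (toBCF g f).norm_coe_le_norm y

/-- Finitely many sup norms of words dominate any continuous seminorm. In this way questions about
the Schwartz space are reduced to a finite power of a Banach space. -/
theorem exists_bound_of_seminorm {q : Seminorm ℂ (SchwartzFun g)} (hq : Continuous q) :
    ∃ (ι : Type) (_ : Fintype ι) (W : ι → List (Fin g ⊕ Fin g)) (C : ℝ), 0 ≤ C ∧
      ∀ f, q f ≤ C * ∑ i, ‖toBCF g (wordOp (W i) f)‖ := by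
  obtain ⟨s, C, -, h⟩ := Seminorm.bound_of_continuous (schwartz_withSeminorms ℂ (Fin g → ℝ) ℂ) q hq
  choose ι hι W hW using fun i : ℕ × ℕ =>
    exists_schwartzBound_eq_sum (fun f : SchwartzFun g => SchwartzMap.seminorm ℂ 0 0 f) i.1 i.2
  refine ⟨Σ i : s, ι i, inferInstance, fun i => W i.1 i.2, C, C.2, fun f => (h f).trans ?_⟩
  refine mul_le_mul_of_nonneg_left ?_ C.2
  refine (Seminorm.finset_sup_le_sum _ s f).trans ?_
  have hs : ∀ t : Finset (ℕ × ℕ), (∑ i ∈ t, schwartzSeminormFamily ℂ (Fin g → ℝ) ℂ i) f =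
      ∑ i ∈ t, SchwartzMap.seminorm ℂ i.1 i.2 f := by
    intro t
    induction t using Finset.induction_on with
    | empty => rfl
    | insert a t ha ih => rw [Finset.sum_insert ha, Finset.sum_insert ha, Seminorm.add_apply, ih]; rfl
  rw [hs, Fintype.sum_sigma, ← Finset.sum_coe_sort s]
  refine Finset.sum_le_sum fun i _ => (seminorm_le_schwartzBound _ _ f).trans ?_
  rw [hW]
  refine Finset.sum_le_sum fun j _ => SchwartzMap.seminorm_le_bound ℂ 0 0 _ (norm_nonneg _) ?_
  intro y
  rw [pow_zero, one_mul, norm_iteratedFDeriv_zero]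
  exact norm_apply_le_norm_toBCF _ y

variable {X : Type*} [MeasurableSpace X] {μ : Measure X} {φ : X → SchwartzFun g}

theorem integrable_apply_of_toBCF (hφ : Integrable (fun x => toBCF g (φ x)) μ) (y : Fin g → ℝ) :
    Integrable (fun x => φ x y) μ :=
  (BoundedContinuousFunction.evalCLM ℂ y).integrable_comp hφ

theorem partialOp_apply_eq_integral {f : SchwartzFun g}
    (h0 : Integrable (fun x => toBCF g (φ x)) μ) (j : Fin g)
    (h1 : Integrable (fun x => toBCF g (partialOp j (φ x))) μ)
    (hf : ∀ y, f y = ∫ x, φ x y ∂μ) (y : Fin g → ℝ) :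
    partialOp j f y = ∫ x, partialOp j (φ x) y ∂μ := by
  have hline : ∀ (h : SchwartzFun g) (t : ℝ),
      HasDerivAt (fun t : ℝ => h (y + t • stdVec j)) (partialOp j h (y + t • stdVec j)) t := by
    intro h t
    have h2 : HasDerivAt (fun t : ℝ => y + t • stdVec j) (stdVec j) t := by
      simpa using ((hasDerivAt_id t).smul_const (stdVec j)).const_add y
    exact h.differentiableAt.hasFDerivAt.comp_hasDerivAt t h2
  have key := hasDerivAt_integral_of_dominated_loc_of_deriv_le (μ := μ)
    (F := fun (t : ℝ) x => φ x (y + t • stdVec j))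
    (F' := fun t x => partialOp j (φ x) (y + t • stdVec j)) (x₀ := 0) (s := Set.univ)
    (bound := fun x => ‖toBCF g (partialOp j (φ x))‖) Filter.univ_mem
    (Filter.Eventually.of_forall fun t => (integrable_apply_of_toBCF h0 _).aestronglyMeasurable)
    (integrable_apply_of_toBCF h0 _) (integrable_apply_of_toBCF h1 _).aestronglyMeasurable
    (Filter.Eventually.of_forall fun x t _ => norm_apply_le_norm_toBCF _ _) h1.norm
    (Filter.Eventually.of_forall fun x t _ => hline (φ x) t)
  have h3 := hline f 0
  have h4 := key.2
  simp only [← hf] at h4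
  simpa using h3.unique h4

theorem wordOp_apply_eq_integral (W : List (Fin g ⊕ Fin g)) {f : SchwartzFun g}
    (hφ : ∀ W, Integrable (fun x => toBCF g (wordOp W (φ x))) μ)
    (hf : ∀ y, f y = ∫ x, φ x y ∂μ) (y : Fin g → ℝ) :
    wordOp W f y = ∫ x, wordOp W (φ x) y ∂μ := by
  induction W generalizing φ f with
  | nil => exact hf y
  | cons a W ih =>
    refine ih (φ := fun x => letterOp a (φ x)) (f := letterOp a f) (fun W => hφ (a :: W)) fun y => ?_
    cases a with
    | inl j => exact partialOp_apply_eq_integral (hφ []) j (hφ [Sum.inl j]) hf y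
    | inr j =>
      simp only [letterOp, Sum.elim_inr, coordOp_apply]
      rw [integral_const_mul, hf]

/-- A continuous functional on the Schwartz space commutes with integrals. -/
theorem clm_eq_integral {f : SchwartzFun g} (Λ : SchwartzFun g →L[ℂ] ℂ)
    (hφ : ∀ W, Integrable (fun x => toBCF g (wordOp W (φ x))) μ)
    (hf : ∀ y, f y = ∫ x, φ x y ∂μ) : Λ f = ∫ x, Λ (φ x) ∂μ := by
  obtain ⟨ι, _, W, C, hC, hΛ⟩ := exists_bound_of_seminorm (g := g)
    (q := (normSeminorm ℂ ℂ).comp Λ.toLinearMap) (continuous_norm.comp Λ.continuous)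
  -- `Λ` is bounded by the norm of `e f` in a finite power of the bounded continuous functions, so
  -- it factors through `e`. Hahn–Banach extends it to this Banach space, where Bochner integrals
  -- commute with continuous functionals.
  let e : SchwartzFun g →ₗ[ℂ] (ι → BoundedContinuousFunction (Fin g → ℝ) ℂ) :=
    LinearMap.pi fun i => (toBCF g ∘L wordOp (W i)).toLinearMap
  have hle : ∀ f, ‖Λ f‖ ≤ C * Fintype.card ι * ‖e f‖ := fun f => by
    refine (hΛ f).trans ?_
    rw [mul_assoc]
    refine mul_le_mul_of_nonneg_left ?_ hC
    calc ∑ i, ‖toBCF g (wordOp (W i) f)‖ ≤ ∑ _i : ι, ‖e f‖ :=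
          Finset.sum_le_sum fun i _ => norm_le_pi_norm (e f) i
      _ = _ := by simp
  have hker : LinearMap.ker e ≤ LinearMap.ker Λ.toLinearMap := fun f hf => by
    have := hle f
    rw [LinearMap.mem_ker.1 hf, norm_zero, mul_zero] at this
    exact norm_le_zero_iff.1 this
  let ℓ₀ : LinearMap.range e →ₗ[ℂ] ℂ :=
    (Submodule.liftQ _ Λ.toLinearMap hker) ∘ₗ e.quotKerEquivRange.symm.toLinearMap
  have hℓ₀ : ∀ f, ℓ₀ ⟨e f, f, rfl⟩ = Λ f := fun f => by
    have : e.quotKerEquivRange.symm ⟨e f, f, rfl⟩ = (LinearMap.ker e).mkQ f := by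
      rw [LinearEquiv.symm_apply_eq]
      rfl
    simp only [ℓ₀, LinearMap.comp_apply, LinearEquiv.coe_coe, this]
    rfl
  let ℓ₁ : LinearMap.range e →L[ℂ] ℂ := ℓ₀.mkContinuous (C * Fintype.card ι) (by
    rintro ⟨_, f, rfl⟩
    rw [hℓ₀]
    exact hle f)
  obtain ⟨ℓ, hℓ, -⟩ := exists_extension_norm_eq (LinearMap.range e) ℓ₁
  have hℓe : ∀ f, ℓ (e f) = Λ f := fun f => (hℓ ⟨e f, f, rfl⟩).trans (hℓ₀ f)
  have hint : Integrable (fun x => e (φ x)) μ := Integrable.of_eval fun i => hφ (W i)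
  have hef : e f = ∫ x, e (φ x) ∂μ := by
    funext i
    rw [MeasureTheory.eval_integral (f := fun x => e (φ x)) fun i => hφ (W i)]
    ext y
    exact (wordOp_apply_eq_integral (W i) hφ hf y).trans
      ((BoundedContinuousFunction.evalCLM ℂ y).integral_comp_comm (hφ (W i)))
  rw [← hℓe, hef, ← ℓ.integral_comp_comm hint]
  simp only [hℓe]

end Words

/-! ## Coherent states -/

section CoherentStates

variable {g : ℕ} {c : ℝ}

/-- The complex coordinate `2πc p + 2πi ξ` of the phase space point `(p, ξ)`. -/
noncomputable def phaseCoord (c : ℝ) (w : Cover g) (j : Fin g) : ℂ :=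
  ((2 * Real.pi * c * w.1 j : ℝ) : ℂ) + ((2 * Real.pi * w.2 j : ℝ) : ℂ) * Complex.I

theorem continuous_phaseCoord (j : Fin g) : Continuous fun w : Cover g => phaseCoord c w j := by
  unfold phaseCoord
  fun_prop

theorem isAccretive_smul_one (hc : 0 < c) :
    IsAccretive ((c : ℂ) • (1 : Matrix (Fin g) (Fin g) ℂ)) := isAccretive_one.smul hc

/-- The coherent state `y ↦ e^{-πc |y - p|² + 2πi ξ · y}`. -/
noncomputable def coherent (hc : 0 < c) (w : Cover g) : SchwartzFun g :=
  Complex.exp (-(Real.pi * c * ((w.1 ⬝ᵥ w.1 : ℝ) : ℂ))) •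
    gaussianSchwartz (isAccretive_smul_one hc) (phaseCoord c w)

theorem coherent_apply_eq (hc : 0 < c) (w : Cover g) (y : Fin g → ℝ) :
    coherent hc w y = Complex.exp (-(Real.pi * c * ((w.1 ⬝ᵥ w.1 : ℝ) : ℂ)) +
      (-(Real.pi * c * ((y ⬝ᵥ y : ℝ) : ℂ)) + ∑ j, phaseCoord c w j * y j)) := by
  rw [coherent, _root_.smul_apply, gaussianSchwartz_apply, gaussianFn, smul_eq_mul,
    ← Complex.exp_add, quadForm_smul, quadForm_one]
  congr 3
  rw [← mul_assoc]
  congr 2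
  simp [ofRealVec, dotProduct, sq]

theorem coherent_apply (hc : 0 < c) (w : Cover g) (y : Fin g → ℝ) :
    coherent hc w y = Complex.exp (((-(Real.pi * c * ∑ j, (y j - w.1 j) ^ 2) : ℝ) : ℂ) +
      ((2 * Real.pi * (w.2 ⬝ᵥ y) : ℝ) : ℂ) * Complex.I) := by
  rw [coherent_apply_eq]
  congr 1
  simp only [dotProduct, phaseCoord]
  push_cast
  simp only [Finset.mul_sum, Finset.sum_mul, ← Finset.sum_neg_distrib, ← Finset.sum_add_distrib]
  exact Finset.sum_congr rfl fun j _ => by ring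

theorem norm_coherent_apply (hc : 0 < c) (w : Cover g) (y : Fin g → ℝ) :
    ‖coherent hc w y‖ = Real.exp (-(Real.pi * c * ∑ j, (y j - w.1 j) ^ 2)) := by
  rw [coherent_apply, Complex.norm_exp, Complex.add_re, Complex.ofReal_re, Complex.re_ofReal_mul,
    Complex.I_re, mul_zero, add_zero]

theorem norm_coherent_apply_le_one (hc : 0 < c) (w : Cover g) (y : Fin g → ℝ) :
    ‖coherent hc w y‖ ≤ 1 := by
  rw [norm_coherent_apply, Real.exp_le_one_iff, neg_nonpos]
  have := Finset.sum_nonneg fun j (_ : j ∈ Finset.univ) => sq_nonneg (y j - w.1 j)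
  positivity

/-- The coherent state is an eigenvector of `∂_j + 2πc y_j`. Both the decay of the coherent state
transform and the solution of the vacuum equation rest on this. -/
theorem partialOp_coherent (hc : 0 < c) (w : Cover g) (j : Fin g) :
    partialOp j (coherent hc w) =
      phaseCoord c w j • coherent hc w - (2 * Real.pi * c : ℂ) • coordOp j (coherent hc w) := by
  rw [coherent, map_smul, partialOp_gaussianSchwartz, map_smul, smul_sub, smul_comm, smul_comm]
  congr 1
  rw [smul_comm, ← smul_smul (2 * Real.pi : ℂ)]
  congr 1
  rw [Finset.sum_eq_single j]
  · simp only [Matrix.smul_apply, one_apply_eq, smul_eq_mul, mul_one]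
    exact smul_comm _ _ _
  · intro i _ hij
    simp [one_apply_ne' hij]
  · simp

/-- A power of `‖y‖` splits into a power of `‖y - p‖`, absorbed by the Gaussian centred at `p`, and
a power of `‖w‖`. -/
theorem exists_growth_coherent (hc : 0 < c) (N : ℕ) : ∃ C : ℝ, 0 ≤ C ∧ ∀ (w : Cover g) y,
    (1 + ‖y‖) ^ N * ‖coherent hc w y‖ ≤ C * (1 + ‖w‖) ^ N := by
  refine ⟨N.factorial * Real.exp (1 + (1 + 0) ^ 2 / (4 * (Real.pi * c))), by positivity,
    fun w y => ?_⟩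
  have h1 := one_add_pow_mul_exp_le (c := Real.pi * c) (by positivity) 0 N (norm_nonneg (y - w.1))
  have h2 : ‖coherent hc w y‖ ≤ Real.exp (-(Real.pi * c * ‖y - w.1‖ ^ 2) + 0 * ‖y - w.1‖) := by
    rw [norm_coherent_apply, Real.exp_le_exp, zero_mul, add_zero, neg_le_neg_iff]
    exact mul_le_mul_of_nonneg_left (norm_sq_le_sum_sq (y - w.1)) (by positivity)
  have h3 : 1 + ‖y‖ ≤ (1 + ‖w‖) * (1 + ‖y - w.1‖) := by
    have h4 : ‖y‖ ≤ ‖y - w.1‖ + ‖w.1‖ := by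
      simpa using norm_add_le (y - w.1) w.1
    have h5 : ‖w.1‖ ≤ ‖w‖ := norm_fst_le w
    nlinarith [norm_nonneg w, norm_nonneg (y - w.1), mul_nonneg (norm_nonneg w) (norm_nonneg (y - w.1))]
  calc (1 + ‖y‖) ^ N * ‖coherent hc w y‖
      ≤ ((1 + ‖w‖) * (1 + ‖y - w.1‖)) ^ N *
        Real.exp (-(Real.pi * c * ‖y - w.1‖ ^ 2) + 0 * ‖y - w.1‖) := by gcongr
    _ = (1 + ‖w‖) ^ N * ((1 + ‖y - w.1‖) ^ N *
        Real.exp (-(Real.pi * c * ‖y - w.1‖ ^ 2) + 0 * ‖y - w.1‖)) := by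
        rw [mul_pow, mul_assoc]
    _ ≤ (1 + ‖w‖) ^ N * (N.factorial * Real.exp (1 + (1 + 0) ^ 2 / (4 * (Real.pi * c)))) :=
        mul_le_mul_of_nonneg_left h1 (by positivity)
    _ = _ := by ring

/-- Mean value inequality along the segment from `b` to `a`, on which the modulus of the exponential
is at most its larger end value. -/
theorem norm_cexp_sub_le (a b : ℂ) :
    ‖Complex.exp a - Complex.exp b‖ ≤ ‖a - b‖ * (‖Complex.exp a‖ + ‖Complex.exp b‖) := by
  have h := Convex.norm_image_sub_le_of_norm_hasDerivWithin_le (𝕜 := ℂ) (f := Complex.exp)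
    (f' := Complex.exp) (s := segment ℝ b a) (x := b) (y := a)
    (C := ‖Complex.exp a‖ + ‖Complex.exp b‖)
    (fun x _ => (Complex.hasDerivAt_exp x).hasDerivWithinAt) (fun x hx => ?_)
    (convex_segment b a) (left_mem_segment ℝ b a) (right_mem_segment ℝ b a)
  · rwa [mul_comm] at h
  · obtain ⟨s, t, hs, ht, hst, rfl⟩ := hx
    obtain rfl : s = 1 - t := by linarith
    simp only [Complex.norm_exp, Complex.add_re, Complex.real_smul, Complex.re_ofReal_mul]
    rcases le_total a.re b.re with hab | hab
    · refine le_add_of_nonneg_of_le (Real.exp_pos _).le (Real.exp_le_exp.2 ?_)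
      nlinarith
    · refine le_add_of_le_of_nonneg (Real.exp_le_exp.2 ?_) (Real.exp_pos _).le
      nlinarith

/-- The exponents at `w` and `w₀` differ by an affine function of `y` with small coefficients. This
costs one power of `1 + ‖y‖`, hence the growth bound for `N + 1`. -/
theorem tendsto_norm_coherent_sub (hc : 0 < c) (N : ℕ) (w₀ : Cover g) :
    ∃ δ : Cover g → ℝ, Filter.Tendsto δ (nhds w₀) (nhds 0) ∧
      ∀ w y, (1 + ‖y‖) ^ N * ‖coherent hc w y - coherent hc w₀ y‖ ≤ δ w := by
  obtain ⟨C, hC, hgrowth⟩ := exists_growth_coherent (g := g) hc (N + 1)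
  refine ⟨fun w => (‖(Real.pi * c * ((w.1 ⬝ᵥ w.1 : ℝ) : ℂ)) -
      (Real.pi * c * ((w₀.1 ⬝ᵥ w₀.1 : ℝ) : ℂ))‖ + ∑ j, ‖phaseCoord c w j - phaseCoord c w₀ j‖) *
      (C * (1 + ‖w‖) ^ (N + 1) + C * (1 + ‖w₀‖) ^ (N + 1)), ?_, fun w y => ?_⟩
  · have hcont : Continuous fun w : Cover g => (‖(Real.pi * c * ((w.1 ⬝ᵥ w.1 : ℝ) : ℂ)) -
      (Real.pi * c * ((w₀.1 ⬝ᵥ w₀.1 : ℝ) : ℂ))‖ + ∑ j, ‖phaseCoord c w j - phaseCoord c w₀ j‖) *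
      (C * (1 + ‖w‖) ^ (N + 1) + C * (1 + ‖w₀‖) ^ (N + 1)) := by
      simp only [dotProduct, phaseCoord]
      fun_prop
    have := hcont.tendsto w₀
    simpa using this
  · have h1 := norm_cexp_sub_le
      (-(Real.pi * c * ((w.1 ⬝ᵥ w.1 : ℝ) : ℂ)) +
        (-(Real.pi * c * ((y ⬝ᵥ y : ℝ) : ℂ)) + ∑ j, phaseCoord c w j * y j))
      (-(Real.pi * c * ((w₀.1 ⬝ᵥ w₀.1 : ℝ) : ℂ)) +
        (-(Real.pi * c * ((y ⬝ᵥ y : ℝ) : ℂ)) + ∑ j, phaseCoord c w₀ j * y j))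
    rw [← coherent_apply_eq hc, ← coherent_apply_eq hc] at h1
    set A := ‖(Real.pi * c * ((w.1 ⬝ᵥ w.1 : ℝ) : ℂ)) - (Real.pi * c * ((w₀.1 ⬝ᵥ w₀.1 : ℝ) : ℂ))‖
    set B := ∑ j, ‖phaseCoord c w j - phaseCoord c w₀ j‖ with hB
    have hB0 : 0 ≤ B := Finset.sum_nonneg fun _ _ => norm_nonneg _
    have h2 : ‖(-(Real.pi * c * ((w.1 ⬝ᵥ w.1 : ℝ) : ℂ)) +
        (-(Real.pi * c * ((y ⬝ᵥ y : ℝ) : ℂ)) + ∑ j, phaseCoord c w j * y j)) -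
      (-(Real.pi * c * ((w₀.1 ⬝ᵥ w₀.1 : ℝ) : ℂ)) +
        (-(Real.pi * c * ((y ⬝ᵥ y : ℝ) : ℂ)) + ∑ j, phaseCoord c w₀ j * y j))‖ ≤
        (A + B) * (1 + ‖y‖) := by
      have h3 : (-(Real.pi * c * ((w.1 ⬝ᵥ w.1 : ℝ) : ℂ)) +
        (-(Real.pi * c * ((y ⬝ᵥ y : ℝ) : ℂ)) + ∑ j, phaseCoord c w j * y j)) -
      (-(Real.pi * c * ((w₀.1 ⬝ᵥ w₀.1 : ℝ) : ℂ)) +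
        (-(Real.pi * c * ((y ⬝ᵥ y : ℝ) : ℂ)) + ∑ j, phaseCoord c w₀ j * y j)) =
        -((Real.pi * c * ((w.1 ⬝ᵥ w.1 : ℝ) : ℂ)) - (Real.pi * c * ((w₀.1 ⬝ᵥ w₀.1 : ℝ) : ℂ))) +
          ∑ j, (phaseCoord c w j - phaseCoord c w₀ j) * y j := by
        simp only [sub_mul, Finset.sum_sub_distrib]
        ring
      rw [h3]
      have h4 : ‖∑ j, (phaseCoord c w j - phaseCoord c w₀ j) * y j‖ ≤ B * ‖y‖ := by
        rw [hB, Finset.sum_mul]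
        refine (norm_sum_le _ _).trans (Finset.sum_le_sum fun j _ => ?_)
        rw [norm_mul, Complex.norm_real]
        exact mul_le_mul_of_nonneg_left (norm_le_pi_norm y j) (norm_nonneg _)
      refine (norm_add_le _ _).trans ?_
      rw [norm_neg]
      nlinarith [norm_nonneg y, mul_nonneg (norm_nonneg y) (norm_nonneg ((Real.pi * c *
        ((w.1 ⬝ᵥ w.1 : ℝ) : ℂ)) - (Real.pi * c * ((w₀.1 ⬝ᵥ w₀.1 : ℝ) : ℂ))))]
    calc (1 + ‖y‖) ^ N * ‖coherent hc w y - coherent hc w₀ y‖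
        ≤ (1 + ‖y‖) ^ N * (((A + B) * (1 + ‖y‖)) *
            (‖coherent hc w y‖ + ‖coherent hc w₀ y‖)) := by
          refine mul_le_mul_of_nonneg_left (h1.trans ?_) (by positivity)
          exact mul_le_mul_of_nonneg_right h2 (by positivity)
      _ = (A + B) * ((1 + ‖y‖) ^ (N + 1) * ‖coherent hc w y‖ +
            (1 + ‖y‖) ^ (N + 1) * ‖coherent hc w₀ y‖) := by ring
      _ ≤ _ := mul_le_mul_of_nonneg_left (add_le_add (hgrowth w y) (hgrowth w₀ y)) (by positivity)

/-- Products of the coordinates, as operators. -/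
noncomputable def coordWord (L : List (Fin g)) : SchwartzFun g →L[ℂ] SchwartzFun g :=
  L.foldr (fun j A => (coordOp j).comp A) (ContinuousLinearMap.id ℂ _)

theorem norm_coordWord_apply_le (L : List (Fin g)) (f : SchwartzFun g) (y : Fin g → ℝ) :
    ‖coordWord L f y‖ ≤ (1 + ‖y‖) ^ L.length * ‖f y‖ := by
  induction L with
  | nil => simp [coordWord]
  | cons j L ih =>
    change ‖coordOp j (coordWord L f) y‖ ≤ _
    rw [coordOp_apply, norm_mul, Complex.norm_real, List.length_cons, pow_succ', mul_assoc]
    refine mul_le_mul ?_ ih (norm_nonneg _) (by positivity)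
    exact (norm_le_pi_norm y j).trans (by linarith)

/-- The canonical commutation relation moves derivatives past coordinates, down to the coherent
state itself. -/
theorem coordOp_comm_partialOp (i j : Fin g) (f : SchwartzFun g) :
    partialOp i (coordOp j f) = coordOp j (partialOp i f) + (if i = j then (1 : ℂ) else 0) • f := by
  ext y
  have h : ⇑(coordOp j f) = fun y => ofRealVec y j * f y := funext fun y => coordOp_apply j f y
  have h2 : HasFDerivAt (fun y : Fin g → ℝ => ofRealVec y j * f y) _ y :=
    (hasFDerivAt_coord j y).fun_mul f.differentiableAt.hasFDerivAt
  rw [partialOp_apply, h, h2.fderiv]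
  simp only [_root_.add_apply, _root_.smul_apply, coordOp_apply, partialOp_apply, smul_eq_mul,
    ContinuousLinearMap.comp_apply, ContinuousLinearMap.proj_apply, Complex.ofRealCLM_apply,
    Pi.single_apply, ofRealVec, eq_comm (a := i)]
  split_ifs <;> simp

/-- Families of Schwartz functions obtained from the coherent states. -/
inductive CoherentFamily (hc : 0 < c) : (Cover g → SchwartzFun g) → Prop
  | base (L : List (Fin g)) : CoherentFamily hc fun w => coordWord L (coherent hc w)
  | add {F G : Cover g → SchwartzFun g} : CoherentFamily hc F → CoherentFamily hc G →
      CoherentFamily hc fun w => F w + G w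
  | smul (a : ℂ) {F : Cover g → SchwartzFun g} : CoherentFamily hc F →
      CoherentFamily hc fun w => a • F w
  | phase (j : Fin g) {F : Cover g → SchwartzFun g} : CoherentFamily hc F →
      CoherentFamily hc fun w => phaseCoord c w j • F w

namespace CoherentFamily

variable {hc : 0 < c} {F : Cover g → SchwartzFun g}

theorem coordOp (h : CoherentFamily hc F) (j : Fin g) :
    CoherentFamily hc fun w => coordOp j (F w) := by
  induction h with
  | base L => exact base (j :: L)
  | add _ _ h1 h2 => simpa only [map_add] using h1.add h2
  | smul a _ h => simpa only [map_smul] using h.smul a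
  | phase i _ h => simpa only [map_smul] using h.phase i

/-- Derivatives disappear: commuted down to the coherent state, they become a phase coordinate minus
a multiple of a coordinate multiplication. Hence all words in the two operators stay in the family.
-/
theorem partialOp (h : CoherentFamily hc F) (j : Fin g) :
    CoherentFamily hc fun w => partialOp j (F w) := by
  induction h with
  | base L =>
    induction L with
    | nil =>
      have h0 : CoherentFamily hc (coherent (g := g) hc) := base []
      have := (h0.phase j).add ((h0.coordOp j).smul (-(2 * Real.pi * c)))
      refine (congrArg (CoherentFamily hc) (funext fun w => ?_)).mp this
      change _ = _root_.partialOp j (coherent hc w)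
      rw [partialOp_coherent, neg_smul, ← sub_eq_add_neg]
    | cons i L ih =>
      have := (ih.coordOp i).add ((base (hc := hc) L).smul (if j = i then (1 : ℂ) else 0))
      refine (congrArg (CoherentFamily hc) (funext fun w => ?_)).mp this
      exact (coordOp_comm_partialOp j i (coordWord L (coherent hc w))).symm
  | add _ _ h1 h2 => simpa only [map_add] using h1.add h2
  | smul a _ h => simpa only [map_smul] using h.smul a
  | phase i _ h => simpa only [map_smul] using h.phase i

theorem wordOp (h : CoherentFamily hc F) (W : List (Fin g ⊕ Fin g)) :
    CoherentFamily hc fun w => wordOp W (F w) := by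
  induction W generalizing F with
  | nil => exact h
  | cons a W ih =>
    cases a with
    | inl j => exact ih (h.partialOp j)
    | inr j => exact ih (h.coordOp j)

theorem continuous (h : CoherentFamily hc F) : Continuous fun w => toBCF g (F w) := by
  induction h with
  | base L =>
    refine continuous_iff_continuousAt.2 fun w₀ => ?_
    obtain ⟨δ, hδ, h⟩ := tendsto_norm_coherent_sub hc L.length w₀
    refine tendsto_iff_norm_sub_tendsto_zero.2 (squeeze_zero (fun _ => norm_nonneg _)
      (fun w => ?_) hδ)
    rw [← map_sub, ← map_sub]
    refine (BoundedContinuousFunction.norm_le (le_trans (by positivity) (h w 0))).2 fun y => ?_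
    exact (norm_coordWord_apply_le _ _ _).trans (h w y)
  | add _ _ h1 h2 =>
    simp only [map_add]
    exact h1.add h2
  | smul a _ h =>
    simp only [map_smul]
    exact h.const_smul a
  | phase i _ h =>
    simp only [map_smul]
    exact (continuous_phaseCoord i).smul h

theorem norm_phaseCoord_le (hc : 0 < c) (w : Cover g) (j : Fin g) :
    ‖phaseCoord c w j‖ ≤ 2 * Real.pi * (c + 1) * (1 + ‖w‖) := by
  have h1 : |w.1 j| ≤ ‖w‖ := (norm_le_pi_norm w.1 j).trans (norm_fst_le w)
  have h2 : |w.2 j| ≤ ‖w‖ := (norm_le_pi_norm w.2 j).trans (norm_snd_le w)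
  have hpi := Real.pi_pos
  refine (norm_add_le _ _).trans ?_
  rw [norm_mul, Complex.norm_I, mul_one, Complex.norm_real, Complex.norm_real, Real.norm_eq_abs,
    Real.norm_eq_abs, abs_mul (2 * Real.pi * c), abs_mul (2 * Real.pi) (w.2 j), abs_of_pos (by positivity : 0 < 2 * Real.pi * c),
    abs_of_pos (by positivity : 0 < 2 * Real.pi)]
  calc 2 * Real.pi * c * |w.1 j| + 2 * Real.pi * |w.2 j| ≤
      2 * Real.pi * c * ‖w‖ + 2 * Real.pi * ‖w‖ := by gcongr
    _ = 2 * Real.pi * (c + 1) * ‖w‖ := by ring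
    _ ≤ _ := by gcongr; linarith

theorem growth (h : CoherentFamily hc F) :
    ∃ (C : ℝ) (N : ℕ), 0 ≤ C ∧ ∀ w, ‖toBCF g (F w)‖ ≤ C * (1 + ‖w‖) ^ N := by
  induction h with
  | base L =>
    obtain ⟨C, hC, h⟩ := exists_growth_coherent (g := g) hc L.length
    refine ⟨C, L.length, hC, fun w => ?_⟩
    refine (BoundedContinuousFunction.norm_le (by positivity)).2 fun y => ?_
    exact (norm_coordWord_apply_le _ _ _).trans (h w y)
  | add _ _ h1 h2 =>
    obtain ⟨C₁, N₁, hC₁, h1⟩ := h1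
    obtain ⟨C₂, N₂, hC₂, h2⟩ := h2
    refine ⟨C₁ + C₂, max N₁ N₂, add_nonneg hC₁ hC₂, fun w => ?_⟩
    have hw : 1 ≤ 1 + ‖w‖ := by linarith [norm_nonneg w]
    rw [map_add, add_mul]
    refine (norm_add_le _ _).trans (add_le_add ((h1 w).trans ?_) ((h2 w).trans ?_))
    · gcongr
      exact le_max_left _ _
    · gcongr
      exact le_max_right _ _
  | smul a _ h =>
    obtain ⟨C, N, hC, h⟩ := h
    refine ⟨‖a‖ * C, N, by positivity, fun w => ?_⟩
    rw [map_smul, norm_smul, mul_assoc]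
    exact mul_le_mul_of_nonneg_left (h w) (norm_nonneg a)
  | phase j _ h =>
    obtain ⟨C, N, hC, h⟩ := h
    refine ⟨2 * Real.pi * (c + 1) * C, N + 1, by positivity, fun w => ?_⟩
    rw [map_smul, norm_smul]
    calc _ ≤ 2 * Real.pi * (c + 1) * (1 + ‖w‖) * (C * (1 + ‖w‖) ^ N) :=
          mul_le_mul (norm_phaseCoord_le hc w j) (h w) (norm_nonneg _) (by positivity)
      _ = _ := by ring

end CoherentFamily

end CoherentStates

/-! ## The coherent state transform -/

section CoherentTransform

variable {g : ℕ} {c : ℝ}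

/-- The pairing `∫ f φ_w` with a coherent state. -/
noncomputable def coherentTransform (hc : 0 < c) (f : SchwartzFun g) (w : Cover g) : ℂ :=
  ∫ v, f v * coherent hc w v

theorem norm_coherentTransform_le (hc : 0 < c) (f : SchwartzFun g) (w : Cover g) :
    ‖coherentTransform hc f w‖ ≤ l1Seminorm g f := by
  rw [l1Seminorm_apply]
  refine norm_integral_le_of_norm_le f.integrable.norm (Filter.Eventually.of_forall fun v => ?_)
  rw [norm_mul]
  exact mul_le_of_le_one_right (norm_nonneg _) (norm_coherent_apply_le_one hc w v)

/-- The operator `2πc y_j - ∂_j`. -/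
noncomputable def creationOp (c : ℝ) (j : Fin g) : SchwartzFun g →L[ℂ] SchwartzFun g :=
  (2 * Real.pi * c : ℂ) • coordOp j - partialOp j

/-- Integration by parts in the eigenvalue equation: multiplication of the transform by the phase
coordinate is a differential operator applied to `f`. Iteration yields rapid decay. -/
theorem phaseCoord_mul_coherentTransform (hc : 0 < c) (f : SchwartzFun g) (w : Cover g)
    (j : Fin g) : phaseCoord c w j * coherentTransform hc f w =
      coherentTransform hc (creationOp c j f) w := by
  have h1 := integral_mul_partialOp f (coherent hc w) j
  have h2 : ∀ v, f v * partialOp j (coherent hc w) v =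
      phaseCoord c w j * (f v * coherent hc w v) -
        (2 * Real.pi * c : ℂ) * (coordOp j f v * coherent hc w v) := fun v => by
    rw [partialOp_coherent]
    simp only [_root_.sub_apply, _root_.smul_apply, coordOp_apply, smul_eq_mul]
    ring
  have h3 : ∀ v, creationOp c j f v * coherent hc w v =
      (2 * Real.pi * c : ℂ) * (coordOp j f v * coherent hc w v) -
        partialOp j f v * coherent hc w v := fun v => by
    simp only [creationOp, _root_.sub_apply, _root_.smul_apply, smul_eq_mul]
    ring
  have i1 := integrable_schwartz_mul f (coherent hc w)
  have i2 := integrable_schwartz_mul (coordOp j f) (coherent hc w)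
  have i3 := integrable_schwartz_mul (partialOp j f) (coherent hc w)
  simp only [h2] at h1
  rw [integral_sub (i1.const_mul _) (i2.const_mul _), integral_const_mul, integral_const_mul] at h1
  simp only [coherentTransform, h3]
  rw [integral_sub (i2.const_mul _) i3, integral_const_mul]
  linear_combination h1

theorem norm_le_sum_norm_phaseCoord (hc : 0 < c) (w : Cover g) :
    ‖w‖ ≤ ((2 * Real.pi * c)⁻¹ + (2 * Real.pi)⁻¹) * ∑ j, ‖phaseCoord c w j‖ := by
  have hpi := Real.pi_pos
  have hS : ∀ j, ‖phaseCoord c w j‖ ≤ ∑ j, ‖phaseCoord c w j‖ := fun j =>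
    Finset.single_le_sum (f := fun j => ‖phaseCoord c w j‖) (fun _ _ => norm_nonneg _)
      (Finset.mem_univ j)
  have hS0 : 0 ≤ ∑ j, ‖phaseCoord c w j‖ := Finset.sum_nonneg fun _ _ => norm_nonneg _
  have hre : ∀ j, 2 * Real.pi * c * |w.1 j| ≤ ‖phaseCoord c w j‖ := fun j => by
    have := Complex.abs_re_le_norm (phaseCoord c w j)
    rwa [phaseCoord, Complex.add_re, Complex.ofReal_re, Complex.re_ofReal_mul, Complex.I_re,
      mul_zero, add_zero, abs_mul, abs_of_pos (by positivity : 0 < 2 * Real.pi * c)] at this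
  have him : ∀ j, 2 * Real.pi * |w.2 j| ≤ ‖phaseCoord c w j‖ := fun j => by
    have := Complex.abs_im_le_norm (phaseCoord c w j)
    rwa [phaseCoord, Complex.add_im, Complex.ofReal_im, Complex.im_ofReal_mul, Complex.I_im,
      mul_one, zero_add, abs_mul, abs_of_pos (by positivity : 0 < 2 * Real.pi)] at this
  refine norm_prod_le_iff.2 ⟨?_, ?_⟩
  · refine (pi_norm_le_iff_of_nonneg (by positivity)).2 fun j => ?_
    have h1 : |w.1 j| ≤ (2 * Real.pi * c)⁻¹ * ∑ j, ‖phaseCoord c w j‖ := by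
      rw [inv_mul_eq_div, le_div_iff₀ (by positivity), mul_comm]
      exact (hre j).trans (hS j)
    rw [add_mul]
    exact h1.trans (le_add_of_nonneg_right (by positivity))
  · refine (pi_norm_le_iff_of_nonneg (by positivity)).2 fun j => ?_
    have h1 : |w.2 j| ≤ (2 * Real.pi)⁻¹ * ∑ j, ‖phaseCoord c w j‖ := by
      rw [inv_mul_eq_div, le_div_iff₀ (by positivity), mul_comm]
      exact (him j).trans (hS j)
    rw [add_mul]
    exact h1.trans (le_add_of_nonneg_left (by positivity))

theorem Seminorm.sum_comp_apply {X : Type*} [AddCommGroup X] [Module ℂ X] [TopologicalSpace X]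
    {ι : Type*} (s : Finset ι) (A : ι → X →L[ℂ] X) (q : Seminorm ℂ X) (x : X) :
    (∑ j ∈ s, q.comp (A j).toLinearMap) x = ∑ j ∈ s, q (A j x) := by
  classical
  induction s using Finset.induction_on with
  | empty => rfl
  | insert a s ha ih =>
    rw [Finset.sum_insert ha, Finset.sum_insert ha, Seminorm.add_apply, ih]
    rfl

/-- Each power of `‖w‖` is paid for by one operator `creationOp`. The bound is a continuous seminorm
of `f`, which is what later makes the estimates uniform on bounded sets. -/
theorem exists_decay_coherentTransform (hc : 0 < c) (N : ℕ) :
    ∃ q : Seminorm ℂ (SchwartzFun g), Continuous q ∧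
      ∀ f w, (1 + ‖w‖) ^ N * ‖coherentTransform hc f w‖ ≤ q f := by
  induction N with
  | zero => exact ⟨l1Seminorm g, continuous_l1Seminorm, fun f w => by
      simpa using norm_coherentTransform_le hc f w⟩
  | succ N ih =>
    obtain ⟨q, hq, h⟩ := ih
    have hpi := Real.pi_pos
    set a : NNReal := ⟨(2 * Real.pi * c)⁻¹ + (2 * Real.pi)⁻¹, by positivity⟩ with ha
    refine ⟨q + a • ∑ j, q.comp (creationOp c j).toLinearMap, ?_, fun f w => ?_⟩
    · have : ⇑(q + a • ∑ j, q.comp (creationOp (g := g) c j).toLinearMap) =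
          fun f => q f + (a : ℝ) * ∑ j, q (creationOp c j f) := by
        funext f
        rw [Seminorm.add_apply, Seminorm.smul_apply, Seminorm.sum_comp_apply]
        rfl
      rw [this]
      exact hq.add (continuous_const.mul (continuous_finsetSum _ fun j _ =>
        hq.comp (creationOp c j).continuous))
    · rw [Seminorm.add_apply, Seminorm.smul_apply, Seminorm.sum_comp_apply]
      change _ ≤ q f + (a : ℝ) * _
      calc (1 + ‖w‖) ^ (N + 1) * ‖coherentTransform hc f w‖
          = (1 + ‖w‖) ^ N * ‖coherentTransform hc f w‖ +
            ‖w‖ * ((1 + ‖w‖) ^ N * ‖coherentTransform hc f w‖) := by ring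
        _ ≤ (1 + ‖w‖) ^ N * ‖coherentTransform hc f w‖ + (a : ℝ) * (∑ j, ‖phaseCoord c w j‖) *
            ((1 + ‖w‖) ^ N * ‖coherentTransform hc f w‖) := by
          gcongr
          exact norm_le_sum_norm_phaseCoord hc w
        _ = (1 + ‖w‖) ^ N * ‖coherentTransform hc f w‖ + (a : ℝ) * ∑ j, (1 + ‖w‖) ^ N *
            ‖coherentTransform hc (creationOp c j f) w‖ := by
          rw [mul_assoc, Finset.sum_mul]
          congr 2
          refine Finset.sum_congr rfl fun j _ => ?_
          rw [← phaseCoord_mul_coherentTransform, norm_mul]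
          ring
        _ ≤ _ := add_le_add (h f w) (mul_le_mul_of_nonneg_left
          (Finset.sum_le_sum fun j _ => h _ w) a.2)

theorem continuous_coherentTransform (hc : 0 < c) (f : SchwartzFun g) :
    Continuous (coherentTransform hc f) := by
  refine continuous_of_dominated (bound := fun v => ‖f v‖) (fun w => ?_) (fun w => ?_)
    f.integrable.norm (Filter.Eventually.of_forall fun v => ?_)
  · exact (f.continuous.mul (coherent hc w).continuous).aestronglyMeasurable
  · refine Filter.Eventually.of_forall fun v => ?_
    rw [norm_mul]
    exact mul_le_of_le_one_right (norm_nonneg _) (norm_coherent_apply_le_one hc w v)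
  · refine continuous_const.mul ?_
    simp only [coherent_apply_eq, phaseCoord, dotProduct]
    fun_prop

/-- The conjugate phase space point. -/
def conjPoint (w : Cover g) : Cover g := (w.1, -w.2)

theorem norm_conjPoint (w : Cover g) : ‖conjPoint w‖ = ‖w‖ := by
  simp [conjPoint, Prod.norm_def]

theorem continuous_conjPoint : Continuous (conjPoint (g := g)) := by
  unfold conjPoint
  fun_prop

/-- The exponent exceeds the real dimension `2g` of phase space by one. -/
theorem integrable_one_add_norm_cover (g : ℕ) :
    Integrable fun w : Cover g => ((1 + ‖w‖) ^ (2 * g + 1))⁻¹ := by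
  have : (volume : Measure (Cover g)).IsAddHaarMeasure :=
    Measure.prod.instIsAddHaarMeasure _ _
  have h := integrable_one_add_norm (E := Cover g) (μ := volume) (r := 2 * g + 1) (by
    rw [Module.finrank_prod, Module.finrank_fin_fun]
    push_cast
    linarith)
  refine h.congr (Filter.Eventually.of_forall fun w => ?_)
  change (1 + ‖w‖) ^ (-(2 * (g : ℝ) + 1)) = ((1 + ‖w‖) ^ (2 * g + 1))⁻¹
  rw [Real.rpow_neg (by positivity), ← Real.rpow_natCast]
  push_cast
  rfl

theorem integrable_coherentTransform_mul (hc : 0 < c) (f : SchwartzFun g) {E : Type*}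
    [NormedAddCommGroup E] [NormedSpace ℂ E] {F : Cover g → E}
    (hF : AEStronglyMeasurable F) {C : ℝ} {N : ℕ} (hFC : ∀ w, ‖F w‖ ≤ C * (1 + ‖w‖) ^ N) :
    Integrable fun w => coherentTransform hc f (conjPoint w) • F w := by
  obtain ⟨q, -, h⟩ := exists_decay_coherentTransform (g := g) hc (2 * g + 1 + N)
  refine Integrable.mono' ((integrable_one_add_norm_cover g).const_mul (q f * C))
    (((continuous_coherentTransform hc f).comp continuous_conjPoint).aestronglyMeasurable.smul hF)
    (Filter.Eventually.of_forall fun w => ?_)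
  have hw : 0 < 1 + ‖w‖ := by positivity
  have h1 := h f (conjPoint w)
  rw [norm_conjPoint, pow_add] at h1
  rw [norm_smul, ← div_eq_mul_inv, le_div_iff₀ (by positivity)]
  have hC : 0 ≤ C := by
    have := (norm_nonneg _).trans (hFC w)
    exact nonneg_of_mul_nonneg_left this (by positivity)
  calc ‖coherentTransform hc f (conjPoint w)‖ * ‖F w‖ * (1 + ‖w‖) ^ (2 * g + 1)
      ≤ ‖coherentTransform hc f (conjPoint w)‖ * (C * (1 + ‖w‖) ^ N) * (1 + ‖w‖) ^ (2 * g + 1) := by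
        gcongr
        exact hFC w
    _ = ((1 + ‖w‖) ^ (2 * g + 1) * (1 + ‖w‖) ^ N * ‖coherentTransform hc f (conjPoint w)‖) * C := by
        ring
    _ ≤ _ := mul_le_mul_of_nonneg_right h1 hC

/-- The constant `∫ e^{-2πc |p|²} dp`. -/
noncomputable def resolutionConst (g : ℕ) (c : ℝ) : ℂ :=
  gaussInvSqrtDet (((2 * c : ℝ) : ℂ) • (1 : Matrix (Fin g) (Fin g) ℂ))

theorem resolutionConst_ne_zero (hc : 0 < c) : resolutionConst g c ≠ 0 :=
  gaussInvSqrtDet_ne_zero (isAccretive_smul_one (by positivity))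

/-- The resolution of the identity by coherent states. -/
theorem integral_coherentTransform_mul_coherent (hc : 0 < c) (f : SchwartzFun g) (y : Fin g → ℝ) :
    ∫ w, coherentTransform hc f (conjPoint w) * coherent hc w y = resolutionConst g c * f y := by
  have hmeas : AEStronglyMeasurable (fun w : Cover g => coherent hc w y) := by
    refine Continuous.aestronglyMeasurable ?_
    simp only [coherent_apply_eq, phaseCoord, dotProduct]
    fun_prop
  have hint := integrable_coherentTransform_mul hc f hmeas (C := 1) (N := 0) fun w => by
    simpa using norm_coherent_apply_le_one hc w y
  simp only [smul_eq_mul] at hint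
  change Integrable _ ((volume : Measure (Fin g → ℝ)).prod (volume : Measure (Fin g → ℝ))) at hint
  change ∫ w, _ ∂((volume : Measure (Fin g → ℝ)).prod (volume : Measure (Fin g → ℝ))) = _
  rw [integral_prod _ hint]
  -- For fixed `p` the integral over `ξ` is Fourier inversion for the product of `f` with the
  -- coherent state at `(p, 0)`. The remaining Gaussian in `y - p` integrates over `p` to the
  -- constant.
  have hinner : ∀ p : Fin g → ℝ, ∫ ξ, coherentTransform hc f (conjPoint (p, ξ)) *
      coherent hc (p, ξ) y = f y * Complex.exp (-(Real.pi * quadForm (((2 * c : ℝ) : ℂ) •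
        (1 : Matrix (Fin g) (Fin g) ℂ)) (ofRealVec (y - p)))) := by
    intro p
    obtain ⟨F, hF⟩ : ∃ F : SchwartzFun g, ∀ v, F v = f v * coherent hc (p, 0) v :=
      ⟨SchwartzMap.smulLeftCLM ℂ (⇑f) (coherent hc (p, 0)), fun v =>
        SchwartzMap.smulLeftCLM_apply_apply f.hasTemperateGrowth _ v⟩
    have h1 : ∀ ξ, coherentTransform hc f (conjPoint (p, ξ)) = fourierOp g F ξ := by
      intro ξ
      rw [fourierOp_apply, coherentTransform]
      congr 1
      funext v
      rw [hF, mul_left_comm, coherent_apply, coherent_apply, ← Complex.exp_add]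
      congr 2
      simp only [conjPoint, neg_dotProduct, zero_dotProduct]
      push_cast
      ring
    have h2 : ∀ ξ, coherent hc (p, ξ) y = Complex.exp (2 * Real.pi * Complex.I *
        ((ξ ⬝ᵥ y : ℝ) : ℂ)) * coherent hc (p, 0) y := by
      intro ξ
      rw [coherent_apply, coherent_apply, ← Complex.exp_add]
      congr 1
      simp only [zero_dotProduct]
      push_cast
      ring
    calc ∫ ξ, coherentTransform hc f (conjPoint (p, ξ)) * coherent hc (p, ξ) y
        = (∫ ξ, Complex.exp (2 * Real.pi * Complex.I * ((ξ ⬝ᵥ y : ℝ) : ℂ)) * fourierOp g F ξ) *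
          coherent hc (p, 0) y := by
          rw [← integral_mul_const]
          congr 1
          funext ξ
          rw [h1, h2]
          ring
      _ = f y * (coherent hc (p, 0) y * coherent hc (p, 0) y) := by
          rw [← fourierOp_inversion, hF, mul_assoc]
      _ = _ := by
          rw [coherent_apply, ← Complex.exp_add, quadForm_smul, quadForm_one]
          congr 2
          simp only [zero_dotProduct, ofRealVec, Pi.sub_apply]
          push_cast
          ring
  simp only [hinner]
  rw [integral_const_mul, integral_sub_left_eq_self (fun p => Complex.exp (-(Real.pi *
    quadForm (((2 * c : ℝ) : ℂ) • (1 : Matrix (Fin g) (Fin g) ℂ)) (ofRealVec p)))) volume y,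
    mul_comm]
  rfl

/-- A continuous functional on the Schwartz space is determined by its values on the coherent
states. -/
theorem clm_eq_integral_coherentTransform (hc : 0 < c) (Λ : SchwartzFun g →L[ℂ] ℂ)
    (f : SchwartzFun g) : resolutionConst g c * Λ f =
      ∫ w, coherentTransform hc f (conjPoint w) * Λ (coherent hc w) := by
  have h := clm_eq_integral (μ := (volume : Measure (Cover g)))
    (φ := fun w => coherentTransform hc f (conjPoint w) • coherent hc w)
    (f := resolutionConst g c • f) Λ (fun W => ?_) (fun y => ?_)
  · simpa only [map_smul, smul_eq_mul] using h
  · have hW := (CoherentFamily.base (hc := hc) []).wordOp W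
    obtain ⟨C, N, -, hC⟩ := hW.growth
    simp only [map_smul]
    exact integrable_coherentTransform_mul hc f hW.continuous.aestronglyMeasurable hC
  · simp only [_root_.smul_apply, smul_eq_mul]
    exact (integral_coherentTransform_mul_coherent hc f y).symm

end CoherentTransform

/-! ## Gaussian functionals -/

section VacuumEquation

variable {g : ℕ} {c : ℝ}

theorem continuous_of_wordOp {X : Type*} [TopologicalSpace X] {F : X → SchwartzFun g}
    (h : ∀ W, Continuous fun x => toBCF g (wordOp W (F x))) : Continuous F := by
  refine continuous_iff_continuousAt.2 fun x₀ => ?_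
  refine ((schwartz_withSeminorms ℂ (Fin g → ℝ) ℂ).tendsto_nhds F (F x₀)).2 fun i ε hε => ?_
  obtain ⟨ι, _, W, C, -, hC⟩ := exists_bound_of_seminorm (continuous_seminorm_schwartz (g := g) i.1 i.2)
  have hlim : Filter.Tendsto (fun x => C * ∑ i, ‖toBCF g (wordOp (W i) (F x - F x₀))‖)
      (nhds x₀) (nhds 0) := by
    have hcont : Continuous fun x => C * ∑ i, ‖toBCF g (wordOp (W i) (F x - F x₀))‖ := by
      refine continuous_const.mul (continuous_finsetSum _ fun i _ => ?_)
      simp only [map_sub]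
      exact ((h (W i)).sub continuous_const).norm
    simpa using hcont.tendsto x₀
  filter_upwards [hlim.eventually_lt_const hε] with x hx
  exact (hC _).trans_lt hx

theorem continuous_coherent (hc : 0 < c) : Continuous (coherent (g := g) hc) :=
  continuous_of_wordOp fun W => ((CoherentFamily.base (hc := hc) []).wordOp W).continuous

theorem integrable_toBCF_of_continuous {a b : ℝ} {F : ℝ → SchwartzFun g} (hF : Continuous F)
    (W : List (Fin g ⊕ Fin g)) :
    Integrable (fun t => toBCF g (wordOp W (F t))) (volume.restrict (Ioc a b)) :=
  ((((toBCF g).continuous.comp ((wordOp W).continuous.comp hF)).continuousOn).integrableOn_Icc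
    (a := a) (b := b)).mono_set Ioc_subset_Icc_self

/-- The operators `∑_i (1 + τ)_{ji} ∂_i - 2πc ∑_i (1 - τ)_{ji} y_i`. -/
noncomputable def vacuumOp (c : ℝ) (τ : Matrix (Fin g) (Fin g) ℂ) (j : Fin g) :
    SchwartzFun g →L[ℂ] SchwartzFun g :=
  ∑ i, (1 + τ) j i • partialOp i - (2 * Real.pi * c : ℂ) • ∑ i, (1 - τ) j i • coordOp i

theorem vacuumOp_apply (τ : Matrix (Fin g) (Fin g) ℂ) (j : Fin g) (f : SchwartzFun g) :
    vacuumOp c τ j f = ∑ i, (1 + τ) j i • partialOp i f -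
      (2 * Real.pi * c : ℂ) • ∑ i, (1 - τ) j i • coordOp i f := by
  simp [vacuumOp, ContinuousLinearMap.sum_apply]

/-- The functionals that are annihilated by the transposes of the operators `vacuumOp`. -/
def IsVacuum (c : ℝ) (τ : Matrix (Fin g) (Fin g) ℂ) (Λ : SchwartzFun g →L[ℂ] ℂ) : Prop :=
  ∀ j f, Λ (vacuumOp c τ j f) = 0

/-- Inserting the eigenvalue equation, the coefficients `1 + τ` and `1 - τ` of the coordinate terms
add up to `2`. The values on `y_j φ_w` are thus explicit, and no inverse of `1 + τ` is needed:
boundary points are treated like interior ones. -/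
theorem IsVacuum.coordOp_coherent {τ : Matrix (Fin g) (Fin g) ℂ} {Λ : SchwartzFun g →L[ℂ] ℂ}
    (h : IsVacuum c τ Λ) (hc : 0 < c) (w : Cover g) (j : Fin g) :
    4 * Real.pi * c * Λ (coordOp j (coherent hc w)) =
      ((1 + τ) *ᵥ phaseCoord c w) j * Λ (coherent hc w) := by
  have h1 := h j (coherent hc w)
  rw [vacuumOp_apply] at h1
  simp only [partialOp_coherent, map_sub, map_sum, map_smul, smul_sub, smul_eq_mul,
    Finset.sum_sub_distrib] at h1
  have h2 : ∑ i, (1 + τ) j i * (2 * Real.pi * c * Λ (coordOp i (coherent hc w))) +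
      2 * Real.pi * c * ∑ i, (1 - τ) j i * Λ (coordOp i (coherent hc w)) =
      4 * Real.pi * c * Λ (coordOp j (coherent hc w)) := by
    rw [Finset.mul_sum, ← Finset.sum_add_distrib, Finset.sum_eq_single j]
    · simp only [Matrix.add_apply, Matrix.sub_apply, one_apply_eq]
      ring
    · intro i _ hij
      simp only [Matrix.add_apply, Matrix.sub_apply, one_apply_ne' hij]
      ring
    · simp
  have h3 : ((1 + τ) *ᵥ phaseCoord c w) j * Λ (coherent hc w) =
      ∑ i, (1 + τ) j i * (phaseCoord c w i * Λ (coherent hc w)) := by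
    rw [mulVec, dotProduct, Finset.sum_mul]
    exact Finset.sum_congr rfl fun i _ => by ring
  rw [← h2, h3]
  linear_combination -h1

theorem phaseCoord_smul (t : ℝ) (w : Cover g) : phaseCoord c (t • w) = (t : ℂ) • phaseCoord c w := by
  funext j
  simp only [phaseCoord, Prod.smul_fst, Prod.smul_snd, Pi.smul_apply, smul_eq_mul]
  push_cast
  ring

/-- The symbol `e^{-πc |p|² + ᵗz (1 + τ) z / 8πc}`, `z = 2πc p + 2πi ξ`. -/
noncomputable def vacuumSymbol (c : ℝ) (τ : Matrix (Fin g) (Fin g) ℂ) (w : Cover g) : ℂ :=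
  Complex.exp (-(Real.pi * c * ((w.1 ⬝ᵥ w.1 : ℝ) : ℂ)) +
    quadForm (1 + τ) (phaseCoord c w) / (8 * Real.pi * c))

/-- The linear equation `u' = t a u` in integrated form, which requires only continuity of `u` to
start from. -/
theorem eq_exp_of_integral_eq {u : ℝ → ℂ} (hu : Continuous u) (a : ℂ)
    (h : ∀ t, u t - u 0 = ∫ s in (0 : ℝ)..t, s * a * u s) : u 1 = u 0 * Complex.exp (a / 2) := by
  have hd : ∀ t, HasDerivAt u (t * a * u t) t := by
    intro t
    have hcont : Continuous fun s : ℝ => (s : ℂ) * a * u s := by fun_prop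
    have h1 := intervalIntegral.integral_hasDerivAt_right (hcont.intervalIntegrable 0 t)
      (hcont.stronglyMeasurableAtFilter _ _) hcont.continuousAt
    have h2 : u = fun t => (∫ s in (0 : ℝ)..t, s * a * u s) + u 0 := funext fun t => by
      rw [← h, sub_add_cancel]
    have h3 := h1.add_const (u 0)
    rwa [← h2] at h3
  have hv : ∀ t : ℝ, HasDerivAt (fun t : ℝ => u t * Complex.exp (-(a / 2 * ((t : ℂ) * t)))) 0 t := by
    intro t
    have ht : HasDerivAt (fun t : ℝ => (t : ℂ)) 1 t := Complex.ofRealCLM.hasDerivAt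
    have h3 : HasDerivAt (fun t : ℝ => -(a / 2 * ((t : ℂ) * t))) (-(a / 2 * (1 * t + t * 1))) t :=
      ((ht.fun_mul ht).const_mul (a / 2)).fun_neg
    refine ((hd t).fun_mul h3.cexp).congr_deriv ?_
    ring
  have h4 := is_const_of_deriv_eq_zero (fun t => (hv t).differentiableAt) (fun t => (hv t).deriv) 1 0
  simp only [Complex.ofReal_one, Complex.ofReal_zero, mul_zero, neg_zero, Complex.exp_zero,
    mul_one] at h4
  rw [← h4, mul_assoc, ← Complex.exp_add]
  simp

/-- Along the ray `t w` the rescaled states `F t = e^{-πc|y|² + t z · y}` satisfy `F' = ∑ z_j y_j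
F`. By `IsVacuum.coordOp_coherent`, applying `Λ` gives a scalar linear equation with `a = ᵗz(1 + τ)z
/ 4πc`, whose solution at `t = 1` has exponent `a / 2`. -/
theorem IsVacuum.apply_coherent {τ : Matrix (Fin g) (Fin g) ℂ} {Λ : SchwartzFun g →L[ℂ] ℂ}
    (h : IsVacuum c τ Λ) (hc : 0 < c) (w : Cover g) :
    Λ (coherent hc w) = Λ (coherent hc 0) * vacuumSymbol c τ w := by
  set b : ℂ := Real.pi * c * ((w.1 ⬝ᵥ w.1 : ℝ) : ℂ) with hb
  -- The exponential prefactor cancels the Gaussian in `p`, so the exponent of `F t` is affine in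
  -- `t`.
  set F : ℝ → SchwartzFun g := fun t => Complex.exp (t ^ 2 * b) • coherent hc (t • w) with hF
  have hFc : Continuous F := by
    have h1 : Continuous fun t : ℝ => Complex.exp ((t : ℂ) ^ 2 * b) := by fun_prop
    exact h1.smul ((continuous_coherent hc).comp (by fun_prop))
  have hFy : ∀ t y, F t y = Complex.exp (-(Real.pi * c * ((y ⬝ᵥ y : ℝ) : ℂ)) +
      t * ∑ j, phaseCoord c w j * y j) := by
    intro t y
    simp only [hF, _root_.smul_apply, smul_eq_mul, coherent_apply_eq, ← Complex.exp_add,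
      phaseCoord_smul, Pi.smul_apply, Prod.smul_fst, smul_dotProduct, dotProduct_smul, mul_assoc,
      ← Finset.mul_sum]
    congr 1
    rw [hb]
    push_cast
    ring
  set F' : ℝ → SchwartzFun g := fun t => ∑ j, phaseCoord c w j • coordOp j (F t) with hF'
  have hF'c : Continuous F' := continuous_finsetSum _ fun j _ =>
    ((coordOp j).continuous.comp hFc).const_smul (phaseCoord c w j)
  have hF'y : ∀ t y, F' t y = (∑ j, phaseCoord c w j * y j) * F t y := by
    intro t y
    simp only [hF', SchwartzMap.sum_apply, _root_.smul_apply, coordOp_apply, smul_eq_mul,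
      Finset.sum_mul]
    exact Finset.sum_congr rfl fun j _ => by ring
  have hderiv : ∀ y t, HasDerivAt (fun t => F t y) (F' t y) t := by
    intro y t
    simp only [hFy, hF'y]
    have ht : HasDerivAt (fun t : ℝ => (t : ℂ)) 1 t := Complex.ofRealCLM.hasDerivAt
    refine (((ht.mul_const _).const_add _).cexp).congr_deriv ?_
    ring
  -- The path from `0` to `t` is rescaled to `[0, 1]`, so that one positive measure serves for `t`
  -- of either sign and `clm_eq_integral` applies.
  have hpt : ∀ t y, F t y - F 0 y = ∫ s in (0 : ℝ)..1, ((t : ℂ) • F' (t * s)) y := by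
    intro t y
    have h1 := intervalIntegral.integral_eq_sub_of_hasDerivAt (a := 0) (b := t)
      (fun s _ => hderiv y s) (Continuous.intervalIntegrable (by
        simp only [hF'y, hFy]
        fun_prop) _ _)
    rw [← h1]
    have h2 := intervalIntegral.smul_integral_comp_mul_left (a := 0) (b := 1) (fun s => F' s y) t
    rw [mul_zero, mul_one] at h2
    rw [← h2, ← intervalIntegral.integral_smul]
    rfl
  have hΛF : ∀ t, Λ (F t) - Λ (F 0) = ∫ s in (0 : ℝ)..t, Λ (F' s) := by
    intro t
    have hcont : Continuous fun s : ℝ => (t : ℂ) • F' (t * s) :=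
      (hF'c.comp (by fun_prop : Continuous fun s : ℝ => t * s)).const_smul (t : ℂ)
    have h1 := clm_eq_integral (μ := volume.restrict (Ioc 0 1))
      (φ := fun s : ℝ => (t : ℂ) • F' (t * s)) (f := F t - F 0) Λ
      (fun W => integrable_toBCF_of_continuous hcont W) (fun y => by
        rw [_root_.sub_apply, hpt, intervalIntegral.integral_of_le zero_le_one])
    rw [← intervalIntegral.integral_of_le zero_le_one] at h1
    have h2 := intervalIntegral.smul_integral_comp_mul_left (a := 0) (b := 1) (fun s => Λ (F' s)) t
    rw [mul_zero, mul_one] at h2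
    rw [← map_sub, h1, ← h2, ← intervalIntegral.integral_smul]
    simp only [map_smul, Complex.real_smul, smul_eq_mul]
  have hΛF' : ∀ s : ℝ, Λ (F' s) =
      s * (quadForm (1 + τ) (phaseCoord c w) / (4 * Real.pi * c)) * Λ (F s) := by
    intro s
    have hpi : (4 * Real.pi * c : ℂ) ≠ 0 := by
      have := Real.pi_pos
      exact_mod_cast (by positivity : 4 * Real.pi * c ≠ 0)
    have h1 : ∀ j, Λ (coordOp j (F s)) =
        s * ((1 + τ) *ᵥ phaseCoord c w) j / (4 * Real.pi * c) * Λ (F s) := by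
      intro j
      have h2 := h.coordOp_coherent hc (s • w) j
      rw [phaseCoord_smul, mulVec_smul, Pi.smul_apply, smul_eq_mul] at h2
      simp only [hF, map_smul, smul_eq_mul]
      field_simp
      linear_combination h2
    simp only [hF', map_sum, map_smul, smul_eq_mul, h1, quadForm, dotProduct]
    rw [Finset.sum_div, Finset.mul_sum, Finset.sum_mul]
    exact Finset.sum_congr rfl fun j _ => by ring
  have h5 := eq_exp_of_integral_eq (u := fun t => Λ (F t)) (Λ.continuous.comp hFc)
    (quadForm (1 + τ) (phaseCoord c w) / (4 * Real.pi * c)) (fun t => by rw [hΛF]; simp only [hΛF'])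
  have h6 : Λ (F 1) = Complex.exp b * Λ (coherent hc w) := by simp [hF]
  have h7 : Λ (F 0) = Λ (coherent hc 0) := by simp [hF]
  simp only [h6, h7] at h5
  rw [vacuumSymbol, Complex.exp_add, Complex.exp_neg, ← hb]
  rw [mul_left_comm, eq_inv_mul_iff_mul_eq₀ (Complex.exp_ne_zero _), h5]
  congr 2
  rw [div_div]
  congr 1
  ring

/-- The contraction property gives `Re ᵗzτz ≤ |z|²`, and `Re ᵗzz + |z|² = 2 ∑ (Re z_j)² =
8π²c²|p|²`, which after division by `8πc` exactly cancels `-πc|p|²`. The bound is uniform over the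
closed disc, and it is here that the disc condition enters. -/
theorem norm_vacuumSymbol_le_one (hc : 0 < c) {τ : Matrix (Fin g) (Fin g) ℂ}
    (hτ : τ ∈ closedSiegelDisc g) (w : Cover g) : ‖vacuumSymbol c τ w‖ ≤ 1 := by
  have hpi := Real.pi_pos
  set z := phaseCoord c w with hz
  have hre : ∀ j, (z j).re = 2 * Real.pi * c * w.1 j := fun j => by simp [hz, phaseCoord]
  have him : ∀ j, (z j).im = 2 * Real.pi * w.2 j := fun j => by simp [hz, phaseCoord]
  have h1 : (quadForm 1 z).re = ∑ j, ((z j).re ^ 2 - (z j).im ^ 2) := by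
    rw [quadForm_one, Complex.re_sum]
    exact Finset.sum_congr rfl fun j _ => by simp [sq]
  have h2 : (quadForm τ z).re ≤ sqNorm z := by
    have h3 := (mem_closedSiegelDisc_iff.1 hτ).2 z
    have h4 : (quadForm τ z).re ≤ (sqNorm z + sqNorm (τ *ᵥ z)) / 2 := by
      rw [quadForm, dotProduct, Complex.re_sum, sqNorm, sqNorm, ← Finset.sum_add_distrib,
        Finset.sum_div]
      refine Finset.sum_le_sum fun j _ => ?_
      simp only [Complex.normSq_apply, Complex.mul_re]
      nlinarith [sq_nonneg ((z j).re - ((τ *ᵥ z) j).re), sq_nonneg ((z j).im + ((τ *ᵥ z) j).im)]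
    linarith
  have h5 : sqNorm z = ∑ j, ((z j).re ^ 2 + (z j).im ^ 2) :=
    Finset.sum_congr rfl fun j _ => by simp only [Complex.normSq_apply, sq]
  have h6 : (quadForm (1 + τ) z).re ≤ 8 * Real.pi * c * (Real.pi * c * (w.1 ⬝ᵥ w.1)) := by
    rw [quadForm_add, Complex.add_re, h1]
    refine (add_le_add_right (h2.trans h5.le) _).trans (le_of_eq ?_)
    rw [← Finset.sum_add_distrib, dotProduct, Finset.mul_sum, Finset.mul_sum]
    refine Finset.sum_congr rfl fun j _ => ?_
    rw [hre]
    ring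
  rw [vacuumSymbol, Complex.norm_exp, Real.exp_le_one_iff, Complex.add_re]
  have h7 : (quadForm (1 + τ) z / (8 * Real.pi * c)).re = (quadForm (1 + τ) z).re / (8 * Real.pi * c) := by
    rw [show (8 * Real.pi * c : ℂ) = ((8 * Real.pi * c : ℝ) : ℂ) by push_cast; ring,
      Complex.div_ofReal_re]
  have h8 : (-(Real.pi * c * ((w.1 ⬝ᵥ w.1 : ℝ) : ℂ))).re = -(Real.pi * c * (w.1 ⬝ᵥ w.1)) := by
    rw [show -(Real.pi * c * ((w.1 ⬝ᵥ w.1 : ℝ) : ℂ)) =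
      ((-(Real.pi * c * (w.1 ⬝ᵥ w.1)) : ℝ) : ℂ) by push_cast; ring, Complex.ofReal_re]
  rw [h7, h8]
  have h9 : (quadForm (1 + τ) z).re / (8 * Real.pi * c) ≤ Real.pi * c * (w.1 ⬝ᵥ w.1) := by
    rw [div_le_iff₀ (by positivity), mul_comm]
    exact h6
  linarith

end VacuumEquation

/-! ### Existence, continuity and normalization of the vacuum functional -/

section GaussianFunctionals

variable {g : ℕ} {c : ℝ}

theorem continuous_vacuumSymbol :
    Continuous fun p : Matrix (Fin g) (Fin g) ℂ × Cover g => vacuumSymbol c p.1 p.2 := by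
  unfold vacuumSymbol
  refine Complex.continuous_exp.comp (Continuous.add ?_ (Continuous.div_const ?_ _))
  · simp only [dotProduct]
    fun_prop
  · refine continuous_quadForm.comp (Continuous.prodMk (by fun_prop) ?_)
    exact continuous_pi fun j => (continuous_phaseCoord j).comp continuous_snd

theorem continuous_vacuumSymbol_right (τ : Matrix (Fin g) (Fin g) ℂ) :
    Continuous (vacuumSymbol c τ) :=
  continuous_vacuumSymbol.comp (f := fun w => (τ, w)) (Continuous.prodMk_right τ)

theorem continuous_vacuumSymbol_left (w : Cover g) :
    Continuous fun τ : Matrix (Fin g) (Fin g) ℂ => vacuumSymbol c τ w :=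
  continuous_vacuumSymbol.comp (f := fun τ => (τ, w)) (Continuous.prodMk_left w)

theorem integrable_coherentTransform_mul_vacuumSymbol (hc : 0 < c)
    {τ : Matrix (Fin g) (Fin g) ℂ} (hτ : τ ∈ closedSiegelDisc g) (f : SchwartzFun g) :
    Integrable fun w => coherentTransform hc f (conjPoint w) * vacuumSymbol c τ w := by
  exact integrable_coherentTransform_mul (E := ℂ) hc f
    (continuous_vacuumSymbol_right τ).aestronglyMeasurable (C := 1) (N := 0) fun w => by
      simpa using norm_vacuumSymbol_le_one hc hτ w

theorem continuous_of_norm_le_seminorm {X : Type*} [AddCommGroup X] [Module ℂ X]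
    [TopologicalSpace X] [IsTopologicalAddGroup X] (T : X →ₗ[ℂ] ℂ) {q : Seminorm ℂ X}
    (hq : Continuous q) (h : ∀ x, ‖T x‖ ≤ q x) : Continuous T := by
  refine continuous_of_continuousAt_zero T ?_
  rw [ContinuousAt, map_zero]
  refine squeeze_zero_norm h ?_
  simpa using hq.tendsto 0

theorem coherentTransform_add (hc : 0 < c) (f h : SchwartzFun g) (w : Cover g) :
    coherentTransform hc (f + h) w = coherentTransform hc f w + coherentTransform hc h w := by
  rw [coherentTransform, coherentTransform, coherentTransform,
    ← integral_add (integrable_schwartz_mul f _) (integrable_schwartz_mul h _)]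
  simp only [_root_.add_apply, add_mul]

theorem coherentTransform_smul (hc : 0 < c) (a : ℂ) (f : SchwartzFun g) (w : Cover g) :
    coherentTransform hc (a • f) w = a * coherentTransform hc f w := by
  rw [coherentTransform, coherentTransform, ← integral_const_mul]
  simp only [_root_.smul_apply, smul_eq_mul, mul_assoc]

/-- A vacuum functional can only be a multiple of this integral, by its values on coherent states
and the resolution of the identity. The symbol is bounded and the transform decays rapidly, so it
converges even where `1 + τ` is singular. -/
theorem exists_gaussFunctional (hc : 0 < c) {τ : Matrix (Fin g) (Fin g) ℂ}
    (hτ : τ ∈ closedSiegelDisc g) : ∃ G : SchwartzFun g →L[ℂ] ℂ, ∀ f,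
      G f = ∫ w, coherentTransform hc f (conjPoint w) * vacuumSymbol c τ w := by
  let T : SchwartzFun g →ₗ[ℂ] ℂ :=
    { toFun := fun f => ∫ w, coherentTransform hc f (conjPoint w) * vacuumSymbol c τ w
      map_add' := fun f h => by
        rw [← integral_add (integrable_coherentTransform_mul_vacuumSymbol hc hτ f)
          (integrable_coherentTransform_mul_vacuumSymbol hc hτ h)]
        simp only [coherentTransform_add, add_mul]
      map_smul' := fun a f => by
        rw [RingHom.id_apply, smul_eq_mul, ← integral_const_mul]
        simp only [coherentTransform_smul, mul_assoc] }
  obtain ⟨q, hq, h⟩ := exists_decay_coherentTransform (g := g) hc (2 * g + 1)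
  set I : ℝ := ∫ w : Cover g, ((1 + ‖w‖) ^ (2 * g + 1))⁻¹ with hI
  have hI0 : 0 ≤ I := integral_nonneg fun w => by positivity
  let a : NNReal := ⟨I, hI0⟩
  refine ⟨⟨T, continuous_of_norm_le_seminorm T (q := a • q) ?_ fun f => ?_⟩, fun f => rfl⟩
  · exact continuous_const.mul hq
  · change ‖∫ w, coherentTransform hc f (conjPoint w) * vacuumSymbol c τ w‖ ≤ I * q f
    rw [hI, ← integral_mul_const]
    refine norm_integral_le_of_norm_le ((integrable_one_add_norm_cover g).mul_const _)
      (Filter.Eventually.of_forall fun w => ?_)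
    have h1 := h f (conjPoint w)
    rw [norm_conjPoint] at h1
    rw [norm_mul, inv_mul_eq_div, le_div_iff₀ (by positivity)]
    calc _ ≤ ‖coherentTransform hc f (conjPoint w)‖ * 1 * (1 + ‖w‖) ^ (2 * g + 1) := by
          gcongr
          exact norm_vacuumSymbol_le_one hc hτ w
      _ ≤ q f := by linarith

open Classical in
/-- The functional `f ↦ det(1 + τ)^{-1/2} ∫ e^{πci ᵗy Ω(τ) y} f(y) dy`, extended to the closed
Siegel disc. -/
noncomputable def gaussFunctional (hc : 0 < c) (τ : Matrix (Fin g) (Fin g) ℂ) :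
    SchwartzFun g →L[ℂ] ℂ :=
  -- Outside the closed disc the symbol need not be bounded, and zero is a default value.
  if hτ : τ ∈ closedSiegelDisc g then (exists_gaussFunctional hc hτ).choose else 0

theorem gaussFunctional_apply (hc : 0 < c) {τ : Matrix (Fin g) (Fin g) ℂ}
    (hτ : τ ∈ closedSiegelDisc g) (f : SchwartzFun g) : gaussFunctional hc τ f =
      ∫ w, coherentTransform hc f (conjPoint w) * vacuumSymbol c τ w := by
  rw [gaussFunctional, dif_pos hτ]
  exact (exists_gaussFunctional hc hτ).choose_spec f

/-- Uniqueness: the functional is determined by its single value at `coherent hc 0`, so the solution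
space has dimension at most one. -/
theorem IsVacuum.eq_smul_gaussFunctional (hc : 0 < c) {τ : Matrix (Fin g) (Fin g) ℂ}
    (hτ : τ ∈ closedSiegelDisc g) {Λ : SchwartzFun g →L[ℂ] ℂ} (h : IsVacuum c τ Λ)
    (f : SchwartzFun g) :
    resolutionConst g c * Λ f = Λ (coherent hc 0) * gaussFunctional hc τ f := by
  rw [clm_eq_integral_coherentTransform hc, gaussFunctional_apply hc hτ, ← integral_const_mul]
  congr 1
  funext w
  rw [h.apply_coherent hc w]
  ring

/-- The family `gaussFunctional` is continuous, uniformly on bounded sets. -/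
theorem exists_norm_gaussFunctional_sub_le (hc : 0 < c) {τ₀ : Matrix (Fin g) (Fin g) ℂ}
    (hτ₀ : τ₀ ∈ closedSiegelDisc g) :
    ∃ (q : Seminorm ℂ (SchwartzFun g)) (ρ : Matrix (Fin g) (Fin g) ℂ → ℝ), Continuous q ∧
      Filter.Tendsto ρ (nhdsWithin τ₀ (closedSiegelDisc g)) (nhds 0) ∧
      ∀ τ ∈ closedSiegelDisc g, ∀ f,
        ‖gaussFunctional hc τ f - gaussFunctional hc τ₀ f‖ ≤ q f * ρ τ := by
  obtain ⟨q, hq, h⟩ := exists_decay_coherentTransform (g := g) hc (2 * g + 1)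
  -- The modulus of continuity is a weighted `L¹` norm of the difference of symbols. It tends to
  -- zero by dominated convergence, since each symbol is bounded by one, and `f` enters only through
  -- `q f`.
  refine ⟨q, fun τ => ∫ w : Cover g, ((1 + ‖w‖) ^ (2 * g + 1))⁻¹ *
    ‖vacuumSymbol c τ w - vacuumSymbol c τ₀ w‖, hq, ?_, fun τ hτ f => ?_⟩
  · have h0 : (0 : ℝ) = ∫ w : Cover g, (0 : ℝ) := by simp
    rw [h0]
    refine tendsto_integral_filter_of_dominated_convergence
      (fun w => ((1 + ‖w‖) ^ (2 * g + 1))⁻¹ * 2) ?_ ?_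
      ((integrable_one_add_norm_cover g).mul_const 2) (Filter.Eventually.of_forall fun w => ?_)
    · refine Filter.Eventually.of_forall fun τ => Continuous.aestronglyMeasurable ?_
      refine Continuous.mul ?_ (Continuous.norm (Continuous.sub ?_ ?_))
      · exact ((continuous_const.add continuous_norm).pow _).inv₀ fun w => pow_ne_zero _
          (by positivity : (1 : ℝ) + ‖w‖ ≠ 0)
      · exact continuous_vacuumSymbol_right τ
      · exact continuous_vacuumSymbol_right τ₀
    · filter_upwards [self_mem_nhdsWithin] with τ hτ
      refine Filter.Eventually.of_forall fun w => ?_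
      rw [norm_mul, norm_norm, Real.norm_of_nonneg
        (by positivity : (0 : ℝ) ≤ ((1 + ‖w‖) ^ (2 * g + 1))⁻¹)]
      refine mul_le_mul_of_nonneg_left ?_ (by positivity)
      refine (norm_sub_le _ _).trans ?_
      linarith [norm_vacuumSymbol_le_one hc hτ w, norm_vacuumSymbol_le_one hc hτ₀ w]
    · have hcont : Continuous fun τ : Matrix (Fin g) (Fin g) ℂ => ((1 + ‖w‖) ^ (2 * g + 1))⁻¹ *
          ‖vacuumSymbol c τ w - vacuumSymbol c τ₀ w‖ :=
        continuous_const.mul (((continuous_vacuumSymbol_left w).sub continuous_const).norm)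
      simpa using (hcont.tendsto τ₀).mono_left nhdsWithin_le_nhds
  · rw [gaussFunctional_apply hc hτ, gaussFunctional_apply hc hτ₀,
      ← integral_sub (integrable_coherentTransform_mul_vacuumSymbol hc hτ f)
      (integrable_coherentTransform_mul_vacuumSymbol hc hτ₀ f), ← integral_const_mul]
    refine norm_integral_le_of_norm_le (Integrable.const_mul ?_ _)
      (Filter.Eventually.of_forall fun w => ?_)
    · refine (integrable_one_add_norm_cover g).mul_bdd (c := 2)
        (((continuous_vacuumSymbol_right τ).sub
          (continuous_vacuumSymbol_right τ₀)).norm.aestronglyMeasurable) (Filter.Eventually.of_forall fun w => ?_)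
      rw [norm_norm]
      refine (norm_sub_le _ _).trans ?_
      linarith [norm_vacuumSymbol_le_one hc hτ w, norm_vacuumSymbol_le_one hc hτ₀ w]
    · have h1 := h f (conjPoint w)
      rw [norm_conjPoint] at h1
      rw [← mul_sub, norm_mul, ← mul_assoc]
      refine mul_le_mul_of_nonneg_right ?_ (norm_nonneg _)
      rw [← div_eq_mul_inv, le_div_iff₀ (by positivity), mul_comm]
      exact h1

/-- Integration against a Schwartz function. -/
noncomputable def integralAgainst (h : SchwartzFun g) : SchwartzFun g →L[ℂ] ℂ :=
  (SchwartzMap.integralCLM ℂ volume).comp (SchwartzMap.smulLeftCLM ℂ (⇑h))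

theorem integralAgainst_apply (h f : SchwartzFun g) : integralAgainst h f = ∫ v, h v * f v := by
  change ∫ v, SchwartzMap.smulLeftCLM ℂ (⇑h) f v = _
  simp only [SchwartzMap.smulLeftCLM_apply_apply h.hasTemperateGrowth, smul_eq_mul]

/-- The Gaussian `e^{πci ᵗy Ω(τ) y}`, for `τ` in the open Siegel disc. -/
noncomputable def discGaussian (hc : 0 < c) {τ : Matrix (Fin g) (Fin g) ℂ}
    (hτ : τ ∈ openSiegelDisc g) : SchwartzFun g :=
  gaussianSchwartz ((isAccretive_cayley hτ).smul hc) 0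

theorem discGaussian_apply (hc : 0 < c) {τ : Matrix (Fin g) (Fin g) ℂ}
    (hτ : τ ∈ openSiegelDisc g) (y : Fin g → ℝ) : discGaussian hc hτ y =
      Complex.exp (-(Real.pi * quadForm ((c : ℂ) • cayley τ) (ofRealVec y))) := by
  rw [discGaussian, gaussianSchwartz_apply, gaussianFn]
  simp

theorem partialOp_discGaussian (hc : 0 < c) {τ : Matrix (Fin g) (Fin g) ℂ}
    (hτ : τ ∈ openSiegelDisc g) (j : Fin g) : partialOp j (discGaussian hc hτ) =
      -((2 * Real.pi * c : ℂ) • ∑ i, cayley τ j i • coordOp i (discGaussian hc hτ)) := by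
  rw [discGaussian, partialOp_gaussianSchwartz]
  simp only [Pi.zero_apply, zero_smul, zero_sub, Matrix.smul_apply, smul_eq_mul, Finset.smul_sum,
    smul_smul]
  congr 1
  exact Finset.sum_congr rfl fun i _ => by rw [mul_assoc (2 * (Real.pi : ℂ))]

/-- Integration by parts replaces each derivative by the linear form with matrix `2πc · cayley τ`,
and `(1 + τ) * cayley τ = 1 - τ` makes the two sums cancel. -/
theorem isVacuum_integralAgainst_discGaussian (hc : 0 < c) {τ : Matrix (Fin g) (Fin g) ℂ}
    (hτ : τ ∈ openSiegelDisc g) : IsVacuum c τ (integralAgainst (discGaussian hc hτ)) := by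
  intro j f
  set h := discGaussian hc hτ with hh
  set m : Fin g → ℂ := fun i => ∫ v, h v * coordOp i f v with hm
  have hmi : ∀ i, m i = ∫ v, coordOp i h v * f v := fun i => by
    simp only [hm, coordOp_apply]
    congr 1
    funext v
    ring
  have h1 : ∀ i, integralAgainst h (partialOp i f) =
      2 * Real.pi * c * ∑ l, cayley τ i l * m l := by
    intro i
    rw [integralAgainst_apply, integral_mul_partialOp, hh, partialOp_discGaussian, ← hh]
    have h2 : ∀ v, (-((2 * Real.pi * c : ℂ) • ∑ l, cayley τ i l • coordOp l h) : SchwartzFun g) v *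
        f v = ∑ l, -(2 * Real.pi * c * cayley τ i l) * (coordOp l h v * f v) := by
      intro v
      simp only [_root_.neg_apply, _root_.smul_apply, SchwartzMap.sum_apply, smul_eq_mul,
        Finset.mul_sum, ← Finset.sum_neg_distrib, Finset.sum_mul]
      exact Finset.sum_congr rfl fun l _ => by ring
    simp only [h2]
    rw [integral_finsetSum _ fun l _ => (integrable_schwartz_mul _ _).const_mul _]
    simp only [integral_const_mul, ← hmi]
    rw [← Finset.sum_neg_distrib, Finset.mul_sum]
    exact Finset.sum_congr rfl fun l _ => by ring
  have h3 : (1 + τ) * cayley τ = 1 - τ := by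
    have hu := isUnit_iff_ne_zero.2 (det_one_add_ne_zero hτ)
    have hcomm : (1 + τ) * (1 - τ) = (1 - τ) * (1 + τ) := by noncomm_ring
    rw [cayley, ← mul_assoc, hcomm, mul_assoc, mul_nonsing_inv _ hu, mul_one]
  rw [vacuumOp_apply, map_sub, map_smul, map_sum, map_sum]
  simp only [map_smul, smul_eq_mul, h1]
  have h4 : ∀ i, integralAgainst h (coordOp i f) = m i := fun i => integralAgainst_apply _ _
  simp only [h4]
  rw [← h3]
  simp only [Matrix.mul_apply, Finset.sum_mul, Finset.mul_sum]
  rw [Finset.sum_comm, sub_eq_zero]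
  exact Finset.sum_congr rfl fun i _ => Finset.sum_congr rfl fun l _ => by ring

theorem integralAgainst_discGaussian_coherent (hc : 0 < c) {τ : Matrix (Fin g) (Fin g) ℂ}
    (hτ : τ ∈ openSiegelDisc g) : integralAgainst (discGaussian hc hτ) (coherent hc 0) =
      gaussInvSqrtDet ((c : ℂ) • (1 + cayley τ)) := by
  rw [integralAgainst_apply, gaussInvSqrtDet_eq]
  congr 1
  funext v
  rw [discGaussian_apply, coherent_apply, ← Complex.exp_add, smul_add, quadForm_add, quadForm_smul,
    quadForm_smul, quadForm_one]
  congr 1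
  simp [ofRealVec]
  ring

theorem isAccretive_one_add_cayley (hc : 0 < c) {τ : Matrix (Fin g) (Fin g) ℂ}
    (hτ : τ ∈ openSiegelDisc g) : IsAccretive ((c : ℂ) • (1 + cayley τ)) :=
  (isAccretive_one.add (isAccretive_cayley hτ)).smul hc

/-- The squares agree because `(1 + τ)(1 + cayley τ) = 2`. The two sides are continuous on the
connected open disc, the right one is nonzero, and they agree at `τ = 0`; this settles the branch.
-/
theorem discInvSqrtDet_mul_gaussInvSqrtDet (hc : 0 < c) {τ : Matrix (Fin g) (Fin g) ℂ}
    (hτ : τ ∈ openSiegelDisc g) :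
    discInvSqrtDet τ * gaussInvSqrtDet ((c : ℂ) • (1 + cayley τ)) = resolutionConst g c := by
  have hsq : ∀ τ ∈ openSiegelDisc g, (discInvSqrtDet τ *
      gaussInvSqrtDet ((c : ℂ) • (1 + cayley τ))) ^ 2 = resolutionConst g c ^ 2 := by
    intro τ hτ
    have h1 : discInvSqrtDet τ ^ 2 * (1 + τ).det = 1 :=
      gaussInvSqrtDet_sq_mul_det (isAccretive_one_add hτ)
    have h2 := gaussInvSqrtDet_sq_mul_det (isAccretive_one_add_cayley hc hτ)
    have h3 : resolutionConst g c ^ 2 * (((2 * c : ℝ) : ℂ) • (1 : Matrix (Fin g) (Fin g) ℂ)).det = 1 :=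
      gaussInvSqrtDet_sq_mul_det (isAccretive_smul_one (by positivity))
    have hu := isUnit_iff_ne_zero.2 (det_one_add_ne_zero hτ)
    have h4 : (1 + τ).det * ((c : ℂ) • (1 + cayley τ)).det =
        (((2 * c : ℝ) : ℂ) • (1 : Matrix (Fin g) (Fin g) ℂ)).det := by
      rw [← det_mul, one_add_cayley hτ, Matrix.mul_smul, Matrix.mul_smul, mul_nonsing_inv _ hu,
        smul_smul]
      push_cast
      rw [mul_comm]
    have h5 : (((2 * c : ℝ) : ℂ) • (1 : Matrix (Fin g) (Fin g) ℂ)).det ≠ 0 :=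
      right_ne_zero_of_mul_eq_one h3
    refine mul_right_cancel₀ h5 ?_
    rw [h3, ← h4]
    linear_combination (gaussInvSqrtDet ((c : ℂ) • (1 + cayley τ))) ^ 2 *
      ((c : ℂ) • (1 + cayley τ)).det * h1 + h2
  have hcont : ContinuousOn (fun τ => discInvSqrtDet τ *
      gaussInvSqrtDet ((c : ℂ) • (1 + cayley τ))) (openSiegelDisc g) := by
    refine isNormalizedBranch_discInvSqrtDet.1.mul fun τ hτ => ?_
    refine ContinuousAt.comp_continuousWithinAt (f := fun τ => (c : ℂ) • (1 + cayley τ))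
      (continuousAt_gaussInvSqrtDet (isAccretive_one_add_cayley hc hτ)) ?_
    have h6 : ContinuousOn (fun τ : Matrix (Fin g) (Fin g) ℂ => (c : ℂ) • ((2 : ℂ) • (1 + τ)⁻¹))
        (openSiegelDisc g) := by
      intro τ hτ
      have h8 : ContinuousAt (fun τ : Matrix (Fin g) (Fin g) ℂ => (1 + τ)⁻¹) τ :=
        (continuousAt_matrix_inv _ (by
          rw [Ring.inverse_eq_inv']
          exact continuousAt_inv₀ (det_one_add_ne_zero hτ))).comp
        (f := fun τ => 1 + τ) (continuous_const.add continuous_id).continuousAt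
      exact ((h8.const_smul (2 : ℂ)).const_smul (c : ℂ)).continuousWithinAt
    exact (h6.congr fun τ hτ => by rw [one_add_cayley hτ]) τ hτ
  refine isPreconnected_openSiegelDisc.eq_of_sq_eq hcont continuousOn_const
    (fun τ hτ => hsq τ hτ) (fun _ => resolutionConst_ne_zero hc) zero_mem_openSiegelDisc ?_ hτ
  have h7 : cayley (0 : Matrix (Fin g) (Fin g) ℂ) = 1 := by simp [cayley]
  rw [isNormalizedBranch_discInvSqrtDet.2.1, h7, one_mul, resolutionConst]
  congr 1
  rw [← one_add_one_eq_two, add_mul, one_mul, Complex.ofReal_add, add_smul, smul_add]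

/-- Integration against the Gaussian is a vacuum functional, hence a multiple of `gaussFunctional`.
The multiple is read off at the standard coherent state and is exactly what `discInvSqrtDet`
compensates. -/
theorem gaussFunctional_eq_integral (hc : 0 < c) {τ : Matrix (Fin g) (Fin g) ℂ}
    (hτ : τ ∈ openSiegelDisc g) (f : SchwartzFun g) : gaussFunctional hc τ f =
      discInvSqrtDet τ * ∫ v, discGaussian hc hτ v * f v := by
  have h := (isVacuum_integralAgainst_discGaussian hc hτ).eq_smul_gaussFunctional hc
    (openSiegelDisc_subset hτ) f
  rw [integralAgainst_discGaussian_coherent] at h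
  refine mul_left_cancel₀ (resolutionConst_ne_zero (g := g) hc) ?_
  rw [← integralAgainst_apply]
  have h2 := discInvSqrtDet_mul_gaussInvSqrtDet hc hτ
  linear_combination (-gaussFunctional hc τ f) * h2 - discInvSqrtDet τ * h

theorem continuousOn_gaussFunctional_apply (hc : 0 < c) (f : SchwartzFun g) :
    ContinuousOn (fun τ => gaussFunctional hc τ f) (closedSiegelDisc g) := by
  intro τ₀ hτ₀
  obtain ⟨q, ρ, -, hρ, h⟩ := exists_norm_gaussFunctional_sub_le hc hτ₀
  refine tendsto_iff_norm_sub_tendsto_zero.2 ?_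
  refine squeeze_zero' (Filter.Eventually.of_forall fun _ => norm_nonneg _)
    (by filter_upwards [self_mem_nhdsWithin] with τ hτ using h τ hτ f) ?_
  simpa using hρ.const_mul (q f)

theorem eqOn_closedSiegelDisc {E : Type*} [TopologicalSpace E] [T2Space E]
    {F G : Matrix (Fin g) (Fin g) ℂ → E} (hF : ContinuousOn F (closedSiegelDisc g))
    (hG : ContinuousOn G (closedSiegelDisc g)) (h : EqOn F G (openSiegelDisc g)) :
    EqOn F G (closedSiegelDisc g) :=
  h.of_subset_closure hF hG openSiegelDisc_subset closedSiegelDisc_subset_closure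

/-- The constancy of this value up to the boundary is the reason why the frame nowhere degenerates.
-/
theorem gaussFunctional_coherent_zero (hc : 0 < c) {τ : Matrix (Fin g) (Fin g) ℂ}
    (hτ : τ ∈ closedSiegelDisc g) :
    gaussFunctional hc τ (coherent hc 0) = resolutionConst g c := by
  refine eqOn_closedSiegelDisc (continuousOn_gaussFunctional_apply hc _) continuousOn_const
    (fun τ hτ => ?_) hτ
  change gaussFunctional hc τ (coherent hc 0) = resolutionConst g c
  rw [gaussFunctional_eq_integral hc hτ, ← integralAgainst_apply,
    integralAgainst_discGaussian_coherent, discInvSqrtDet_mul_gaussInvSqrtDet hc hτ]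

/-- Over the open disc this is the Gaussian case. The operators depend affinely on `τ`, so the
equation persists on the closed disc by density. -/
theorem isVacuum_gaussFunctional (hc : 0 < c) {τ : Matrix (Fin g) (Fin g) ℂ}
    (hτ : τ ∈ closedSiegelDisc g) : IsVacuum c τ (gaussFunctional hc τ) := by
  intro j f
  refine eqOn_closedSiegelDisc (F := fun τ => gaussFunctional hc τ (vacuumOp c τ j f))
    (G := fun _ => 0) ?_ continuousOn_const (fun τ hτ => ?_) hτ
  · simp only [vacuumOp_apply, map_sub, map_sum, map_smul, smul_eq_mul]
    refine ContinuousOn.sub (continuousOn_finsetSum _ fun i _ => ContinuousOn.mul ?_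
      (continuousOn_gaussFunctional_apply hc _)) (ContinuousOn.mul continuousOn_const
      (continuousOn_finsetSum _ fun i _ => ContinuousOn.mul ?_
      (continuousOn_gaussFunctional_apply hc _)))
    · exact Continuous.continuousOn (by simp only [Matrix.add_apply]; fun_prop)
    · exact Continuous.continuousOn (by simp only [Matrix.sub_apply]; fun_prop)
  · have h := isVacuum_integralAgainst_discGaussian hc hτ j f
    rw [integralAgainst_apply] at h
    simp only [gaussFunctional_eq_integral hc hτ, h, mul_zero]

end GaussianFunctionals

/-! ## Lattice sums and periodic functions -/

section LatticeSums

variable {g : ℕ}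

/-- An integer vector as a real vector. -/
def intVec (m : Fin g → ℤ) : Fin g → ℝ := fun j => m j

theorem intVec_single (j : Fin g) : intVec (Pi.single j 1) = stdVec j := by
  ext i
  simp [intVec, Pi.single_apply]

/-- The translate by `m` of the half-open unit cube. -/
def latticeTile (m : Fin g → ℤ) : Set (Fin g → ℝ) := {y | ∀ j, ⌊y j⌋ = m j}

theorem measurableSet_latticeTile (m : Fin g → ℤ) : MeasurableSet (latticeTile m) := by
  have : latticeTile m = ⋂ j, {y : Fin g → ℝ | ⌊y j⌋ = m j} := by
    ext y
    simp [latticeTile]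
  rw [this]
  exact MeasurableSet.iInter fun j =>
    (Int.measurable_floor.comp (measurable_pi_apply j)) (measurableSet_singleton (m j))

theorem pairwise_disjoint_latticeTile :
    Pairwise (Function.onFun Disjoint (latticeTile (g := g))) := fun m m' h =>
  Set.disjoint_left.2 fun _ h1 h2 => h (funext fun j => (h1 j).symm.trans (h2 j))

theorem iUnion_latticeTile : ⋃ m, latticeTile (g := g) m = univ :=
  Set.eq_univ_of_forall fun y => Set.mem_iUnion.2 ⟨fun j => ⌊y j⌋, fun _ => rfl⟩

theorem preimage_latticeTile (m : Fin g → ℤ) :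
    (fun y => y + intVec m) ⁻¹' latticeTile m = Set.pi univ fun _ => Ico (0 : ℝ) 1 := by
  ext y
  simp only [latticeTile, intVec, mem_preimage, mem_setOf_eq, Pi.add_apply, Int.floor_add_intCast,
    add_eq_right, Int.floor_eq_zero_iff, mem_pi, mem_univ, true_imp_iff]

theorem setIntegral_latticeTile (m : Fin g → ℤ) (F : (Fin g → ℝ) → ℂ) :
    ∫ y in latticeTile m, F y = ∫ y in Icc (0 : Fin g → ℝ) 1, F (y + intVec m) := by
  have h := (measurePreserving_add_right (volume : Measure (Fin g → ℝ))
    (intVec m)).setIntegral_preimage_emb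
    (MeasurableEquiv.addRight (intVec m)).measurableEmbedding F (latticeTile m)
  rw [← h, preimage_latticeTile]
  exact setIntegral_congr_set Measure.univ_pi_Ico_ae_eq_Icc

theorem hasSum_integral_unitCube {F : (Fin g → ℝ) → ℂ} (hF : Integrable F) :
    HasSum (fun m => ∫ y in Icc (0 : Fin g → ℝ) 1, F (y + intVec m)) (∫ y, F y) := by
  have h := hasSum_integral_iUnion measurableSet_latticeTile pairwise_disjoint_latticeTile
    (f := F) (μ := volume) (by rw [iUnion_latticeTile]; exact hF.integrableOn)
  rw [iUnion_latticeTile, setIntegral_univ] at h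
  simpa only [setIntegral_latticeTile] using h

theorem norm_le_one_of_mem_Icc {y : Fin g → ℝ} (hy : y ∈ Icc (0 : Fin g → ℝ) 1) : ‖y‖ ≤ 1 :=
  (pi_norm_le_iff_of_nonneg zero_le_one).2 fun j => by
    rw [Real.norm_eq_abs, abs_of_nonneg (hy.1 j)]
    exact hy.2 j

theorem volume_unitCube : volume (Icc (0 : Fin g → ℝ) 1) = 1 := by
  simp [Real.volume_Icc_pi]

instance isFiniteMeasure_unitCube :
    IsFiniteMeasure ((volume : Measure (Fin g → ℝ)).restrict (Icc 0 1)) :=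
  ⟨by simp [volume_unitCube]⟩

/-- Comparison with the integral over unit cubes, on which `1 + ‖y + m‖ ≤ 2 (1 + ‖m‖)`; the exponent
`g + 1` exceeds the dimension. -/
theorem summable_one_add_norm_intVec (g : ℕ) :
    Summable fun m : Fin g → ℤ => ((1 + ‖intVec m‖) ^ (g + 1))⁻¹ := by
  have hint : Integrable fun y : Fin g → ℝ => (((1 + ‖y‖) ^ (g + 1))⁻¹ : ℂ) := by
    have := (integrable_one_add_norm (μ := (volume : Measure (Fin g → ℝ))) (r := (g + 1 : ℕ))
      (by simp)).ofReal (𝕜 := ℂ)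
    refine this.congr (Filter.Eventually.of_forall fun y => ?_)
    simp only [Real.rpow_neg (by positivity : (0 : ℝ) ≤ 1 + ‖y‖), Real.rpow_natCast]
    push_cast
    rfl
  have h := (hasSum_integral_unitCube hint).summable.norm
  refine Summable.of_nonneg_of_le (fun m => by positivity) (fun m => ?_)
    (h.mul_left ((2 : ℝ) ^ (g + 1)))
  have h1 : ∀ y : Fin g → ℝ, (((1 + ‖y‖) ^ (g + 1))⁻¹ : ℂ) = (((1 + ‖y‖) ^ (g + 1))⁻¹ : ℝ) :=
    fun y => by push_cast; rfl
  simp only [h1, integral_complex_ofReal, Complex.norm_real]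
  refine le_trans ?_ (mul_le_mul_of_nonneg_left (Real.le_norm_self _) (by positivity))
  have h2 : ((1 + ‖intVec m‖) ^ (g + 1))⁻¹ =
      ∫ _ in Icc (0 : Fin g → ℝ) 1, ((1 + ‖intVec m‖) ^ (g + 1))⁻¹ := by
    simp [volume_unitCube, Measure.real]
  rw [h2, ← integral_const_mul]
  refine setIntegral_mono_on (integrable_const _) ?_ measurableSet_Icc fun y hy => ?_
  · refine ContinuousOn.integrableOn_compact isCompact_Icc (Continuous.continuousOn ?_)
    refine continuous_const.mul (Continuous.inv₀ (by fun_prop) fun y => by positivity)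
  · have h3 : 1 + ‖y + intVec m‖ ≤ 2 * (1 + ‖intVec m‖) := by
      have := norm_add_le y (intVec m)
      have := norm_le_one_of_mem_Icc hy
      have := norm_nonneg (intVec m)
      linarith
    rw [← div_eq_mul_inv, inv_eq_one_div, div_le_div_iff₀ (by positivity) (by positivity), one_mul,
      ← mul_pow]
    gcongr

/-- The partial derivatives of a periodic function integrate to zero over a period. -/
theorem integral_unitCube_fderiv_eq_zero {F : (Fin g → ℝ) → ℂ} (hF : ContDiff ℝ 1 F)
    (j : Fin g) (hper : ∀ y, F (y + stdVec j) = F y) :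
    ∫ y in Icc (0 : Fin g → ℝ) 1, fderiv ℝ F y (stdVec j) = 0 := by
  obtain _ | n := g
  · exact j.elim0
  have hc : Continuous fun y => fderiv ℝ F y (stdVec j) :=
    (hF.continuous_fderiv one_ne_zero).clm_apply continuous_const
  -- The divergence theorem is applied to the field whose only nonzero component is `F` in direction
  -- `j`; the contributions of opposite faces cancel by periodicity. The existence of `j` has
  -- excluded dimension zero.
  have h := integral_divergence_of_hasFDerivAt_off_countable' (0 : Fin (n + 1) → ℝ) 1
    zero_le_one (fun i y => if i = j then F y else 0)
    (fun i y => if i = j then fderiv ℝ F y else 0) ∅ countable_empty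
    (fun i => by
      by_cases hi : i = j
      · simpa [hi] using hF.continuous.continuousOn
      · simpa [hi] using continuousOn_const)
    (fun y _ i => by
      by_cases hi : i = j
      · simpa [hi] using (hF.differentiable one_ne_zero y).hasFDerivAt
      · simpa [hi] using hasFDerivAt_const _ _)
  have hsum : ∀ y, ∑ i, (if i = j then fderiv ℝ F y else 0) (Pi.single i (1 : ℝ)) =
      fderiv ℝ F y (stdVec j) := fun y => by
    rw [Finset.sum_eq_single j (fun i _ hi => by simp [hi]) (by simp)]
    simp
  simp only [hsum] at h
  rw [h (hc.continuousOn.integrableOn_compact isCompact_Icc)]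
  refine Finset.sum_eq_zero fun i _ => ?_
  by_cases hi : i = j
  · subst hi
    simp only [if_true]
    rw [sub_eq_zero]
    refine integral_congr_ae (Filter.Eventually.of_forall fun y => ?_)
    change F (i.insertNth _ y) = F (i.insertNth _ y)
    refine Eq.trans ?_ (hper _)
    congr 1
    ext a
    obtain rfl | ⟨b, rfl⟩ := Fin.eq_self_or_eq_succAbove i a
    · simp [stdVec]
    · simp [stdVec, Pi.single_apply, Fin.succAbove_ne]
  · simp [hi]

/-- The character `x ↦ e^{2πi q · x}`. -/
noncomputable def latticeChar (q : Fin g → ℤ) (x : Fin g → ℝ) : ℂ :=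
  Complex.exp (2 * Real.pi * Complex.I * ((intVec q ⬝ᵥ x : ℝ) : ℂ))

theorem norm_latticeChar (q : Fin g → ℤ) (x : Fin g → ℝ) : ‖latticeChar q x‖ = 1 := by
  rw [latticeChar, show (2 * Real.pi * Complex.I * ((intVec q ⬝ᵥ x : ℝ) : ℂ)) =
    ((2 * Real.pi * (intVec q ⬝ᵥ x) : ℝ) : ℂ) * Complex.I by push_cast; ring]
  exact Complex.norm_exp_ofReal_mul_I _

theorem continuous_latticeChar (q : Fin g → ℤ) : Continuous (latticeChar q) := by
  unfold latticeChar dotProduct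
  fun_prop

theorem mFourier_coe (q : Fin g → ℤ) (x : Fin g → ℝ) :
    UnitAddTorus.mFourier q (fun i => (x i : UnitAddCircle)) = latticeChar q x := by
  simp only [UnitAddTorus.mFourier, ContinuousMap.coe_mk, fourier_coe_apply, latticeChar,
    ← Complex.exp_sum, dotProduct, intVec, Complex.ofReal_sum, Complex.ofReal_mul,
    Complex.ofReal_intCast, Complex.ofReal_one, div_one, Finset.mul_sum, mul_assoc]

theorem latticeChar_add_intVec (q m : Fin g → ℤ) (x : Fin g → ℝ) :
    latticeChar q (x + intVec m) = latticeChar q x := by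
  rw [← mFourier_coe, ← mFourier_coe]
  congr 1
  funext i
  simp only [Pi.add_apply, intVec, QuotientAddGroup.mk_add]
  rw [add_eq_left]
  exact (AddCircle.coe_eq_zero_iff 1).2 ⟨m i, by simp⟩

theorem latticeChar_zero (x : Fin g → ℝ) : latticeChar 0 x = 1 := by
  simp [latticeChar, intVec, dotProduct]

theorem isOpenQuotientMap_torus :
    IsOpenQuotientMap fun (x : Fin g → ℝ) i => (x i : UnitAddCircle) :=
  IsOpenQuotientMap.piMap fun _ => QuotientAddGroup.isOpenQuotientMap_mk

theorem mFourierCoeff_eq_setIntegral (f : UnitAddTorus (Fin g) → ℂ) (q : Fin g → ℤ) :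
    UnitAddTorus.mFourierCoeff f q = ∫ x in Icc (0 : Fin g → ℝ) 1,
      latticeChar (-q) x * f fun i => (x i : UnitAddCircle) := by
  rw [UnitAddTorus.mFourierCoeff_eq_integral f q 0]
  simp only [mFourier_coe, smul_eq_mul]
  refine setIntegral_congr_set ?_
  have h : {x : Fin g → ℝ | ∀ i, x i ∈ Ioc ((0 : Fin g → ℝ) i) ((0 : Fin g → ℝ) i + 1)} =
      Set.pi univ fun i => Ioc ((0 : Fin g → ℝ) i) ((1 : Fin g → ℝ) i) := by
    ext x
    simp
  rw [h]
  exact Measure.univ_pi_Ioc_ae_eq_Icc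

/-- Fourier inversion for periodic functions. -/
theorem hasSum_fourier_of_periodic {F : (Fin g → ℝ) → ℂ} (hF : Continuous F)
    (hper : ∀ (m : Fin g → ℤ) x, F (x + intVec m) = F x)
    (hsum : Summable fun q => ∫ x in Icc (0 : Fin g → ℝ) 1, latticeChar (-q) x * F x)
    (x : Fin g → ℝ) :
    HasSum (fun q => (∫ x in Icc (0 : Fin g → ℝ) 1, latticeChar (-q) x * F x) * latticeChar q x)
      (F x) := by
  have hs := isOpenQuotientMap_torus (g := g).surjective
  -- `F` descends to the torus through an arbitrary section of the projection, the choice being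
  -- immaterial by periodicity; continuity holds because the projection is a quotient map.
  let f : UnitAddTorus (Fin g) → ℂ := fun t => F (Function.surjInv hs t)
  have hf : ∀ x : Fin g → ℝ, f (fun i => (x i : UnitAddCircle)) = F x := by
    intro x
    have h1 := Function.surjInv_eq hs fun i => (x i : UnitAddCircle)
    have h2 : ∀ i, ∃ m : ℤ, Function.surjInv hs (fun i => (x i : UnitAddCircle)) i = x i + m := by
      intro i
      have h3 := sub_eq_zero.2 (congrFun h1 i)
      rw [← QuotientAddGroup.mk_sub] at h3
      obtain ⟨m, hm⟩ := (AddCircle.coe_eq_zero_iff 1).1 h3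
      exact ⟨m, by simp at hm; linarith⟩
    choose m hm using h2
    change F _ = F x
    rw [← hper m x]
    congr 1
    exact funext hm
  have hfc : Continuous f :=
    isOpenQuotientMap_torus.isQuotientMap.continuous_iff.2 (hF.congr fun x => (hf x).symm)
  have hcoef : ∀ q, UnitAddTorus.mFourierCoeff f q =
      ∫ x in Icc (0 : Fin g → ℝ) 1, latticeChar (-q) x * F x := fun q => by
    rw [mFourierCoeff_eq_setIntegral]
    simp only [hf]
  have := UnitAddTorus.hasSum_mFourier_series_apply_of_summable (f := ⟨f, hfc⟩)
    (by simpa only [ContinuousMap.coe_mk, funext hcoef] using hsum)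
    fun i => (x i : UnitAddCircle)
  simpa only [ContinuousMap.coe_mk, hcoef, mFourier_coe, hf, smul_eq_mul] using this

/-- The linear form `x ↦ z · x` on `ℝ^g`, for `z ∈ ℂ^g`. -/
noncomputable def complexDot (z : Fin g → ℂ) : (Fin g → ℝ) →L[ℝ] ℂ :=
  ∑ j, z j • Complex.ofRealCLM.comp (ContinuousLinearMap.proj j : (Fin g → ℝ) →L[ℝ] ℝ)

theorem complexDot_apply (z : Fin g → ℂ) (x : Fin g → ℝ) :
    complexDot z x = ∑ j, z j * (x j : ℂ) := by
  simp [complexDot, ContinuousLinearMap.sum_apply]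

theorem complexDot_stdVec (z : Fin g → ℂ) (j : Fin g) : complexDot z (stdVec j) = z j := by
  simp [complexDot_apply, Pi.single_apply, apply_ite Complex.ofReal]

/-- Orthogonality of the characters. -/
theorem integral_latticeChar (q : Fin g → ℤ) :
    ∫ x in Icc (0 : Fin g → ℝ) 1, latticeChar q x = if q = 0 then 1 else 0 := by
  split_ifs with h
  · simp [h, latticeChar_zero, volume_unitCube, Measure.real]
  · obtain ⟨j, hj⟩ := Function.ne_iff.1 h
    have hexp : latticeChar q = fun x =>
        Complex.exp (2 * Real.pi * Complex.I * complexDot (fun j => (q j : ℂ)) x) := by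
      funext x
      simp [latticeChar, dotProduct, intVec, complexDot_apply]
    have hd : ∀ x, fderiv ℝ (latticeChar q) x (stdVec j) =
        2 * Real.pi * Complex.I * q j * latticeChar q x := fun x => by
      rw [hexp, (((complexDot fun j => (q j : ℂ)).hasFDerivAt.const_mul _).cexp).fderiv]
      simp only [_root_.smul_apply, smul_eq_mul, complexDot_stdVec]
      ring
    have hcd : ContDiff ℝ 1 (latticeChar q) := by
      unfold latticeChar dotProduct
      exact Complex.contDiff_exp.comp (contDiff_const.mul (Complex.ofRealCLM.contDiff.comp
        (ContDiff.sum (s := Finset.univ) fun i _ => contDiff_const.mul (contDiff_apply ℝ ℝ i))))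

    -- The derivative of the character in a direction with `q_j ≠ 0` is a nonzero multiple of the
    -- character, and it integrates to zero.
    have h0 := integral_unitCube_fderiv_eq_zero hcd j fun y => by
      rw [← intVec_single, latticeChar_add_intVec]
    simp only [hd, integral_const_mul] at h0
    refine (mul_eq_zero.1 h0).resolve_left ?_
    have : (q j : ℂ) ≠ 0 := by exact_mod_cast hj
    have := Real.pi_ne_zero
    simp_all

end LatticeSums

/-! ## Families of sections -/

section SectionFamilies

variable {g : ℕ}

theorem exists_seminorm_eq_sum {X ι : Type*} [AddCommGroup X] [Module ℂ X] [TopologicalSpace X]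
    (s : Finset ι) (q : ι → Seminorm ℂ X) (hq : ∀ i ∈ s, Continuous (q i)) :
    ∃ p : Seminorm ℂ X, Continuous p ∧ ∀ x, p x = ∑ i ∈ s, q i x := by
  classical
  induction s using Finset.induction_on with
  | empty => exact ⟨0, continuous_const, fun x => by simp⟩
  | insert a s ha ih =>
    obtain ⟨p, hp, hp'⟩ := ih fun i hi => hq i (Finset.mem_insert_of_mem hi)
    refine ⟨q a + p, ?_, fun x => ?_⟩
    · exact (hq a (Finset.mem_insert_self a s)).add hp
    · rw [Seminorm.add_apply, hp', Finset.sum_insert ha]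

theorem exists_seminorm_eq_mul {X : Type*} [AddCommGroup X] [Module ℂ X] [TopologicalSpace X]
    {C : ℝ} (hC : 0 ≤ C) {q : Seminorm ℂ X} (hq : Continuous q) :
    ∃ p : Seminorm ℂ X, Continuous p ∧ ∀ x, p x = C * q x := by
  let a : NNReal := ⟨C, hC⟩
  exact ⟨a • q, by simpa using! hq.const_smul a, fun x => rfl⟩

theorem exists_norm_iteratedFDeriv_mul_le {E : Type*} [NormedAddCommGroup E] [NormedSpace ℝ E]
    {ℓ : E → ℂ} (hℓ : ContDiff ℝ ∞ ℓ) {K : Set E} (hK : IsCompact K) (N : ℕ) :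
    ∃ C : ℝ, 0 ≤ C ∧ ∀ f : E → ℂ, ContDiff ℝ N f → ∀ u ∈ K,
      ‖iteratedFDeriv ℝ N (fun v => ℓ v * f v) u‖ ≤
        C * ∑ i ∈ Finset.range (N + 1), ‖iteratedFDeriv ℝ i f u‖ := by
  have h1 : ∀ i : ℕ, ∃ B : ℝ, 0 ≤ B ∧ ∀ u ∈ K, ‖iteratedFDeriv ℝ i ℓ u‖ ≤ B := fun i => by
    obtain ⟨B, hB⟩ := hK.exists_bound_of_continuousOn
      (hℓ.continuous_iteratedFDeriv (m := i) (by exact_mod_cast le_top)).continuousOn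
    exact ⟨max B 0, le_max_right _ _, fun u hu => (hB u hu).trans (le_max_left _ _)⟩
  choose B hB0 hB using h1
  refine ⟨∑ i ∈ Finset.range (N + 1), N.choose i * B i,
    Finset.sum_nonneg fun i _ => mul_nonneg (Nat.cast_nonneg _) (hB0 i), fun f hf u hu => ?_⟩
  refine (norm_iteratedFDeriv_mul_le (hℓ.of_le (by exact_mod_cast le_top)) hf u le_rfl).trans ?_
  rw [Finset.sum_mul]
  refine Finset.sum_le_sum fun i hi => ?_
  refine mul_le_mul ?_ ?_ (norm_nonneg _) (mul_nonneg (Nat.cast_nonneg _) (hB0 i))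
  · exact mul_le_mul_of_nonneg_left (hB i u hu) (Nat.cast_nonneg _)
  · exact Finset.single_le_sum (f := fun i => ‖iteratedFDeriv ℝ i f u‖)
      (fun _ _ => norm_nonneg _) (Finset.mem_range.2 (by omega))

theorem norm_iteratedFDeriv_add_const_mul_le {E : Type*} [NormedAddCommGroup E] [NormedSpace ℝ E]
    {f h : E → ℂ} {N : ℕ} (hf : ContDiff ℝ N f) (hh : ContDiff ℝ N h) (c : ℂ) (u : E) :
    ‖iteratedFDeriv ℝ N (fun v => f v + c * h v) u‖ ≤
      ‖iteratedFDeriv ℝ N f u‖ + ‖c‖ * ‖iteratedFDeriv ℝ N h u‖ := by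
  have h1 : iteratedFDeriv ℝ N (fun v => f v + c * h v) u =
      iteratedFDeriv ℝ N f u + c • iteratedFDeriv ℝ N h u := by
    rw [← iteratedFDeriv_const_smul_apply hh.contDiffAt]
    exact iteratedFDeriv_add_apply hf.contDiffAt (contDiff_const.mul hh).contDiffAt
  rw [h1, ← norm_smul]
  exact norm_add_le _ _

/-- The coordinate frame of `ℝ^{2g}`. -/
def coverVec : Fin g ⊕ Fin g → Cover g :=
  Sum.elim (fun j => (stdVec j, 0)) fun j => (0, stdVec j)

/-- The coordinate functions of `ℝ^{2g}`. -/
def coverProj : Fin g ⊕ Fin g → Cover g →L[ℝ] ℝ :=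
  Sum.elim (fun j => (ContinuousLinearMap.proj j).comp (ContinuousLinearMap.fst ℝ _ _))
    fun j => (ContinuousLinearMap.proj j).comp (ContinuousLinearMap.snd ℝ _ _)

theorem norm_coverProj_le_one (a : Fin g ⊕ Fin g) : ‖coverProj a‖ ≤ 1 := by
  refine ContinuousLinearMap.opNorm_le_bound _ zero_le_one fun u => ?_
  rw [one_mul]
  cases a with
  | inl j => exact (norm_le_pi_norm u.1 j).trans (norm_fst_le u)
  | inr j => exact (norm_le_pi_norm u.2 j).trans (norm_snd_le u)

theorem sum_coverProj_smul_coverVec (u : Cover g) : ∑ a, coverProj a u • coverVec a = u := by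
  have h := fun v : Fin g → ℝ => sum_proj_smul_stdVec v
  simp only [ContinuousLinearMap.proj_apply] at h
  rw [Fintype.sum_sum_type]
  ext i
  · simpa [coverProj, coverVec, Prod.fst_sum, Finset.sum_apply] using congrFun (h u.1) i
  · simpa [coverProj, coverVec, Prod.snd_sum, Finset.sum_apply] using congrFun (h u.2) i

/-- The coefficients of the connection form of `L`, up to the factor `πi`. -/
def connForm (a : Fin g ⊕ Fin g) (u : Cover g) : ℝ := Sum.elim (fun j => -u.2 j) (fun j => u.1 j) a

theorem contDiff_connForm (a : Fin g ⊕ Fin g) :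
    ContDiff ℝ ∞ fun u : Cover g => (connForm a u : ℂ) := by
  refine Complex.ofRealCLM.contDiff.comp ?_
  cases a with
  | inl j => exact ((contDiff_apply ℝ ℝ j).comp contDiff_snd).neg
  | inr j => exact (contDiff_apply ℝ ℝ j).comp contDiff_fst

variable {X : Type*} {n : ℤ}

/-- A family of quasi-periodic functions that is stable under the covariant derivatives along the
coordinate frame, with a uniform bound on the unit cell. -/
structure IsSectionFamily (n : ℤ) (T : X → Cover g → ℂ) (D : Fin g ⊕ Fin g → X → X)
    (r : X → ℝ) : Prop where
  differentiable : ∀ x, Differentiable ℝ (T x)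
  fderiv_eq : ∀ x a u, fderiv ℝ (T x) u (coverVec a) =
    T (D a x) u - n * Real.pi * Complex.I * (connForm a u * T x u)
  quasiPeriodic : ∀ x a u, T x (u + latticeVec a) = automorphy a u ^ n * T x u
  bound : ∀ x, ∀ u ∈ unitCell g, ‖T x u‖ ≤ r x

namespace IsSectionFamily

variable {T : X → Cover g → ℂ} {D : Fin g ⊕ Fin g → X → X} {r : X → ℝ}

theorem contDiff_nat (h : IsSectionFamily n T D r) (N : ℕ) (x : X) : ContDiff ℝ N (T x) := by
  induction N generalizing x with
  | zero => exact contDiff_zero.2 (h.differentiable x).continuous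
  | succ N ih =>
    exact contDiff_of_partial coverVec _ sum_coverProj_smul_coverVec (h.differentiable x)
      (h.fderiv_eq x) fun a => (ih _).sub (contDiff_const.mul
        (((contDiff_connForm a).of_le (by exact_mod_cast le_top)).mul (ih x)))

theorem contDiff (h : IsSectionFamily n T D r) (x : X) : ContDiff ℝ ∞ (T x) :=
  contDiff_infty.2 fun N => h.contDiff_nat N x

end IsSectionFamily

/-- A derivative of order `N + 1` is a derivative of order `N` of the covariant derivative minus the
connection term, and by the Leibniz rule the latter involves only orders up to `N` on the compact
cell. Strong induction keeps all bounds continuous seminorms of the parameter. -/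
theorem IsSectionFamily.exists_seminorm_bound [AddCommGroup X] [Module ℂ X] [TopologicalSpace X]
    {T : X → Cover g → ℂ} {D : Fin g ⊕ Fin g → X →L[ℂ] X} {r : Seminorm ℂ X}
    (hr : Continuous r) (h : IsSectionFamily n T (fun a => ⇑(D a)) r) (N : ℕ) :
    ∃ q : Seminorm ℂ X, Continuous q ∧
      ∀ x, ∀ u ∈ unitCell g, ‖iteratedFDeriv ℝ N (T x) u‖ ≤ q x := by
  induction N using Nat.strong_induction_on with
  | _ N ih =>
    obtain _ | N := N
    · exact ⟨r, hr, fun x u hu => by rw [norm_iteratedFDeriv_zero]; exact h.bound x u hu⟩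
    choose! q hq hq' using ih
    have hC := fun a => exists_norm_iteratedFDeriv_mul_le (contDiff_connForm a)
      (isCompact_Icc : IsCompact (unitCell g)) N
    choose C hC0 hC using hC
    obtain ⟨p, hp, hp'⟩ := exists_seminorm_eq_sum (Finset.range (N + 1)) q
      fun i hi => hq i (Finset.mem_range.1 hi)
    have h2 := fun a => exists_seminorm_eq_mul
      (mul_nonneg (norm_nonneg (n * Real.pi * Complex.I : ℂ)) (hC0 a)) hp
    choose p2 hp2 hp2' using h2
    obtain ⟨p3, hp3, hp3'⟩ := exists_seminorm_eq_sum Finset.univ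
      (fun a => (q N).comp (D a).toLinearMap + p2 a)
      fun a _ => ((hq N (Nat.lt_succ_self N)).comp (D a).continuous).add (hp2 a)
    refine ⟨p3, hp3, fun x u hu => ?_⟩
    have hs : ∀ a, ContDiff ℝ N fun u => (connForm a u : ℂ) * T x u := fun a =>
      ((contDiff_connForm a).of_le (by exact_mod_cast le_top)).mul (h.contDiff_nat N x)
    refine (norm_iteratedFDeriv_succ_le_sum coverVec _ norm_coverProj_le_one
      sum_coverProj_smul_coverVec (h.fderiv_eq x)
      (fun a => (h.contDiff_nat N _).sub (contDiff_const.mul (hs a))) u).trans ?_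
    rw [hp3']
    refine Finset.sum_le_sum fun a _ => ?_
    have h4 := norm_iteratedFDeriv_add_const_mul_le (h.contDiff_nat N (D a x)) (hs a)
      (-(n * Real.pi * Complex.I)) u
    simp only [neg_mul, ← sub_eq_add_neg, norm_neg] at h4
    refine h4.trans ?_
    rw [Seminorm.add_apply, hp2', hp']
    refine add_le_add (hq' N (Nat.lt_succ_self N) _ u hu) ?_
    rw [mul_assoc ‖(n * Real.pi * Complex.I : ℂ)‖]
    refine mul_le_mul_of_nonneg_left ((hC a _ (h.contDiff_nat N x) u hu).trans ?_) (norm_nonneg _)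
    exact mul_le_mul_of_nonneg_left (Finset.sum_le_sum fun i hi =>
      hq' i (Finset.mem_range.1 hi) x u hu) (hC0 a)

/-- The value of the `N`-th section seminorm bounds the `N`-th derivative on the unit cell. -/
theorem norm_iteratedFDeriv_le_sectionSeminorm (N : ℕ) (s : SmoothSection g n) {u : Cover g}
    (hu : u ∈ unitCell g) : ‖iteratedFDeriv ℝ N s u‖ ≤ sectionSeminorm g n N s :=
  (derivOnCell g n N s).norm_coe_le_norm ⟨u, hu⟩

theorem sectionSeminorm_le {N : ℕ} {s : SmoothSection g n} {M : ℝ} (hM : 0 ≤ M)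
    (h : ∀ u ∈ unitCell g, ‖iteratedFDeriv ℝ N s u‖ ≤ M) : sectionSeminorm g n N s ≤ M :=
  (ContinuousMap.norm_le _ hM).2 fun u => h u u.2

theorem continuous_sectionSeminorm (N : ℕ) : Continuous (sectionSeminorm g n N) :=
  (sectionSeminorm_withSeminorms g n).continuous_seminorm N

/-- A section family that depends linearly on a parameter in a topological vector space, with
continuous operations and bound, is a continuous linear map into the smooth sections. -/
theorem IsSectionFamily.exists_clm [AddCommGroup X] [Module ℂ X] [TopologicalSpace X]
    [IsTopologicalAddGroup X] {T : X →ₗ[ℂ] (Cover g → ℂ)} {D : Fin g ⊕ Fin g → X →L[ℂ] X}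
    {r : Seminorm ℂ X} (hr : Continuous r)
    (h : IsSectionFamily n (fun x => T x) (fun a => ⇑(D a)) r) :
    ∃ A : X →L[ℂ] SmoothSection g n, ∀ x u, A x u = T x u := by
  let A : X →ₗ[ℂ] SmoothSection g n :=
    { toFun := fun x => ⟨T x, h.contDiff x, h.quasiPeriodic x⟩
      map_add' := fun x x' => Subtype.ext (map_add T x x')
      map_smul' := fun c x => Subtype.ext (map_smul T c x) }
  refine ⟨⟨A, ?_⟩, fun x u => rfl⟩
  refine (sectionSeminorm_withSeminorms g n).continuous_of_continuous_comp A fun N => ?_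
  obtain ⟨q, hq, hq'⟩ := h.exists_seminorm_bound hr N
  exact Seminorm.continuous_of_le hq fun x => sectionSeminorm_le (apply_nonneg q x) (hq' x)

end SectionFamilies

/-! ### Covariant derivatives as continuous operators on smooth sections -/

section CovariantDerivatives

variable {g : ℕ} {n : ℤ}

theorem SmoothSection.ext {s t : SmoothSection g n} (h : ∀ u, s u = t u) : s = t :=
  Subtype.ext (funext h)

theorem SmoothSection.add_apply (s t : SmoothSection g n) (u : Cover g) :
    (s + t) u = s u + t u := rfl

theorem SmoothSection.smul_apply (c : ℂ) (s : SmoothSection g n) (u : Cover g) :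
    (c • s) u = c * s u := rfl

theorem SmoothSection.sum_apply {ι : Type*} (S : Finset ι) (s : ι → SmoothSection g n)
    (u : Cover g) : (∑ i ∈ S, s i) u = ∑ i ∈ S, s i u := by
  let E : SmoothSection g n →ₗ[ℂ] ℂ :=
    { toFun := fun s => s u, map_add' := fun _ _ => rfl, map_smul' := fun _ _ => rfl }
  exact map_sum E s S

theorem SmoothSection.differentiable (s : SmoothSection g n) : Differentiable ℝ s :=
  s.2.1.differentiable (by simp)

theorem SmoothSection.continuous (s : SmoothSection g n) : Continuous s := s.2.1.continuous

/-- A constant vector field. -/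
def constField (w : CTangent g) : TorusVectorField g where
  toFun _ := w
  smooth := contDiff_const
  periodic _ _ := rfl

theorem divCovDeriv_apply (ξ : TorusVectorField g) (s : SmoothSection g n) (u : Cover g) :
    divCovDeriv n ξ s u = divergence ξ u * s u + covDeriv n s u (ξ.toFun u) := rfl

theorem divCovDeriv_constField_apply (w : CTangent g) (s : SmoothSection g n) (u : Cover g) :
    divCovDeriv n (constField w) s u = covDeriv n s u w := by
  rw [divCovDeriv_apply]
  simp [divergence, constField]

theorem symplForm_complexify_eq (u : Cover g) (w : CTangent g) :
    symplForm (complexify u) w =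
      -∑ a, Sum.elim w.1 w.2 a * (connForm a u : ℂ) := by
  simp only [symplForm, complexify, dotProduct, Fintype.sum_sum_type, Sum.elim_inl, Sum.elim_inr,
    connForm, Complex.ofReal_neg, mul_neg, Finset.sum_neg_distrib, neg_add, neg_neg]
  rw [sub_eq_add_neg]
  simp only [mul_comm]

theorem complexDeriv_eq_sum {f : Cover g → ℂ} (u : Cover g) (w : CTangent g) :
    complexDeriv f u w = ∑ a, Sum.elim w.1 w.2 a * fderiv ℝ f u (coverVec a) := by
  rw [complexDeriv]
  nth_rewrite 1 [← sum_coverProj_smul_coverVec (fun j => (w.1 j).re, fun j => (w.2 j).re)]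
  nth_rewrite 1 [← sum_coverProj_smul_coverVec (fun j => (w.1 j).im, fun j => (w.2 j).im)]
  simp only [map_sum, map_smul, Finset.mul_sum, ← Finset.sum_add_distrib]
  refine Finset.sum_congr rfl fun a _ => ?_
  have h : ∀ (z : ℂ) (b : ℂ), z.re • b + Complex.I * z.im • b = z * b := fun z b => by
    nth_rewrite 3 [← Complex.re_add_im z]
    simp only [Complex.real_smul]
    ring
  cases a with
  | inl j => exact h _ _
  | inr j => exact h _ _

/-- The covariant derivative in a coordinate direction. -/
theorem covDeriv_eq_sum {s : Cover g → ℂ} (u : Cover g) (w : CTangent g) :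
    covDeriv n s u w = ∑ a, Sum.elim w.1 w.2 a *
      (fderiv ℝ s u (coverVec a) + n * Real.pi * Complex.I * (connForm a u * s u)) := by
  rw [covDeriv, complexDeriv_eq_sum, symplForm_complexify_eq, mul_neg, sub_neg_eq_add,
    Finset.mul_sum, ← Finset.sum_add_distrib]
  exact Finset.sum_congr rfl fun a _ => by ring

theorem covDeriv_coverVec {s : Cover g → ℂ} (u : Cover g) (a : Fin g ⊕ Fin g) :
    covDeriv n s u (complexify (coverVec a)) =
      fderiv ℝ s u (coverVec a) + n * Real.pi * Complex.I * (connForm a u * s u) := by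
  rw [covDeriv_eq_sum, Finset.sum_eq_single a]
  · cases a <;> simp [complexify, coverVec]
  · intro b _ hb
    cases a <;> cases b <;> simp_all [complexify, coverVec]
  · simp

theorem divCovDeriv_coverVec_apply (a : Fin g ⊕ Fin g) (s : SmoothSection g n) (u : Cover g) :
    divCovDeriv n (constField (complexify (coverVec a))) s u =
      fderiv ℝ s u (coverVec a) + n * Real.pi * Complex.I * (connForm a u * s u) := by
  rw [divCovDeriv_constField_apply, covDeriv_coverVec]

/-- The covariant derivative along a coordinate direction, as a linear operator. -/
noncomputable def nablaLin (n : ℤ) (a : Fin g ⊕ Fin g) :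
    SmoothSection g n →ₗ[ℂ] SmoothSection g n where
  toFun := divCovDeriv n (constField (complexify (coverVec a)))
  map_add' s t := SmoothSection.ext fun u => by
    have h : fderiv ℝ (s + t : SmoothSection g n) u = fderiv ℝ s u + fderiv ℝ t u :=
      fderiv_add (s.differentiable u) (t.differentiable u)
    rw [SmoothSection.add_apply, divCovDeriv_coverVec_apply, divCovDeriv_coverVec_apply,
      divCovDeriv_coverVec_apply, h, SmoothSection.add_apply, _root_.add_apply]
    ring
  map_smul' c s := SmoothSection.ext fun u => by
    have h : fderiv ℝ (c • s : SmoothSection g n) u = c • fderiv ℝ s u :=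
      fderiv_const_smul (s.differentiable u) c
    rw [RingHom.id_apply, SmoothSection.smul_apply, divCovDeriv_coverVec_apply,
      divCovDeriv_coverVec_apply, h, SmoothSection.smul_apply, _root_.smul_apply, smul_eq_mul]
    ring

theorem coe_nablaLin (a : Fin g ⊕ Fin g) (s : SmoothSection g n) :
    (nablaLin n a s : Cover g → ℂ) = fun u =>
      fderiv ℝ s u (coverVec a) + n * Real.pi * Complex.I * (connForm a u * s u) :=
  funext fun u => divCovDeriv_coverVec_apply a s u

theorem norm_iteratedFDeriv_fderiv_apply_le {E : Type*} [NormedAddCommGroup E] [NormedSpace ℝ E]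
    {f : E → ℂ} {N : ℕ} (hf : ContDiff ℝ (N + 1 : ℕ) f) (v u : E) :
    ‖iteratedFDeriv ℝ N (fun u => fderiv ℝ f u v) u‖ ≤ ‖v‖ * ‖iteratedFDeriv ℝ (N + 1) f u‖ := by
  have hd : ContDiff ℝ N (fderiv ℝ f) := hf.fderiv_right (by norm_cast)
  have h1 : ‖ContinuousLinearMap.apply ℝ ℂ v‖ ≤ ‖v‖ :=
    ContinuousLinearMap.opNorm_le_bound _ (norm_nonneg _)
      fun f => by rw [mul_comm]; exact f.le_opNorm _
  refine ((ContinuousLinearMap.apply ℝ ℂ v).norm_iteratedFDeriv_comp_left hd.contDiffAt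
    le_rfl).trans ?_
  rw [norm_iteratedFDeriv_fderiv]
  exact mul_le_mul_of_nonneg_right h1 (norm_nonneg _)

theorem exists_norm_iteratedFDeriv_nablaLin_le (n : ℤ) (a : Fin g ⊕ Fin g) (N : ℕ) :
    ∃ C : ℝ, 0 ≤ C ∧ ∀ s : SmoothSection g n, ∀ u ∈ unitCell g,
      ‖iteratedFDeriv ℝ N (nablaLin n a s : Cover g → ℂ) u‖ ≤
        ‖(coverVec a : Cover g)‖ * sectionSeminorm g n (N + 1) s +
          C * ∑ i ∈ Finset.range (N + 1), sectionSeminorm g n i s := by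
  obtain ⟨C, hC0, hC⟩ := exists_norm_iteratedFDeriv_mul_le (contDiff_connForm a)
    (isCompact_Icc : IsCompact (unitCell g)) N
  refine ⟨‖(n * Real.pi * Complex.I : ℂ)‖ * C, mul_nonneg (norm_nonneg _) hC0, fun s u hu => ?_⟩
  have hs : ∀ M : ℕ, ContDiff ℝ M (s : Cover g → ℂ) := fun M => s.2.1.of_le (by exact_mod_cast le_top)
  have hℓ : ContDiff ℝ N fun u : Cover g => (connForm a u : ℂ) * s u :=
    ((contDiff_connForm a).of_le (by exact_mod_cast le_top)).mul (hs N)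
  have hd : ContDiff ℝ N fun u => fderiv ℝ (s : Cover g → ℂ) u (coverVec a) :=
    ((hs (N + 1)).fderiv_right (by norm_cast)).clm_apply contDiff_const
  rw [coe_nablaLin, mul_assoc ‖(n * Real.pi * Complex.I : ℂ)‖]
  refine (norm_iteratedFDeriv_add_const_mul_le hd hℓ _ u).trans (add_le_add ?_ ?_)
  · refine (norm_iteratedFDeriv_fderiv_apply_le (hs (N + 1)) _ u).trans ?_
    exact mul_le_mul_of_nonneg_left (norm_iteratedFDeriv_le_sectionSeminorm _ s hu) (norm_nonneg _)
  · refine mul_le_mul_of_nonneg_left ((hC _ (hs N) u hu).trans ?_) (norm_nonneg _)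
    exact mul_le_mul_of_nonneg_left (Finset.sum_le_sum fun i _ =>
      norm_iteratedFDeriv_le_sectionSeminorm i s hu) hC0

theorem continuous_nablaLin (n : ℤ) (a : Fin g ⊕ Fin g) : Continuous (nablaLin n a) := by
  refine (sectionSeminorm_withSeminorms g n).continuous_of_continuous_comp _ fun N => ?_
  obtain ⟨C, hC0, hC⟩ := exists_norm_iteratedFDeriv_nablaLin_le n a N
  obtain ⟨p, hp, hp'⟩ := exists_seminorm_eq_sum (Finset.range (N + 1)) (sectionSeminorm g n)
    fun i _ => continuous_sectionSeminorm i
  obtain ⟨p1, hp1, hp1'⟩ := exists_seminorm_eq_mul (norm_nonneg (coverVec a))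
    (continuous_sectionSeminorm (g := g) (n := n) (N + 1))
  obtain ⟨p2, hp2, hp2'⟩ := exists_seminorm_eq_mul hC0 hp
  have key : ∀ s, sectionSeminorm g n N (nablaLin n a s) ≤ (p1 + p2) s := fun s => by
    rw [Seminorm.add_apply, hp1', hp2', hp']
    refine sectionSeminorm_le ?_ (hC s)
    rw [← hp', ← hp1']
    positivity
  exact Seminorm.continuous_of_le (q := p1 + p2) (hp1.add hp2) key

/-- The covariant derivative along a coordinate direction. -/
noncomputable def nablaOp (n : ℤ) (a : Fin g ⊕ Fin g) :
    SmoothSection g n →L[ℂ] SmoothSection g n :=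
  ⟨nablaLin n a, continuous_nablaLin n a⟩

theorem nablaOp_apply (a : Fin g ⊕ Fin g) (s : SmoothSection g n) (u : Cover g) :
    nablaOp n a s u =
      fderiv ℝ s u (coverVec a) + n * Real.pi * Complex.I * (connForm a u * s u) :=
  divCovDeriv_coverVec_apply a s u

theorem covDeriv_eq_sum_nablaOp (s : SmoothSection g n) (u : Cover g) (w : CTangent g) :
    covDeriv n s u w = ∑ a, Sum.elim w.1 w.2 a * nablaOp n a s u := by
  simp only [covDeriv_eq_sum, nablaOp_apply]

theorem norm_automorphy (a : (Fin g → ℤ) × (Fin g → ℤ)) (u : Cover g) : ‖automorphy a u‖ = 1 := by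
  rw [automorphy, norm_mul, norm_zpow, norm_neg, norm_one, _root_.one_zpow, one_mul,
    show -(Real.pi * Complex.I * ((symplForm u (latticeVec a) : ℝ) : ℂ)) =
      ((-(Real.pi * symplForm u (latticeVec a)) : ℝ) : ℂ) * Complex.I by push_cast; ring,
    Complex.norm_exp_ofReal_mul_I]

/-- The automorphy factor has modulus one, so the bound on the unit cell is a global one. -/
theorem SmoothSection.norm_le (s : SmoothSection g n) (u : Cover g) :
    ‖s u‖ ≤ sectionSeminorm g n 0 s := by
  let a : (Fin g → ℤ) × (Fin g → ℤ) := (fun j => ⌊u.1 j⌋, fun j => ⌊u.2 j⌋)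
  have hu : u - latticeVec a ∈ unitCell g :=
    ⟨⟨fun j => Int.fract_nonneg (u.1 j), fun j => Int.fract_nonneg (u.2 j)⟩,
      ⟨fun j => (Int.fract_lt_one (u.1 j)).le, fun j => (Int.fract_lt_one (u.2 j)).le⟩⟩
  have h1 := s.2.2 a (u - latticeVec a)
  rw [sub_add_cancel] at h1
  rw [h1, norm_mul, norm_zpow, norm_automorphy, _root_.one_zpow, one_mul]
  have := norm_iteratedFDeriv_le_sectionSeminorm 0 s hu
  rwa [norm_iteratedFDeriv_zero] at this

end CovariantDerivatives

/-! ## The Weil–Brezin coefficients of a section -/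

section WeilBrezinAnalysis

variable {g : ℕ} {n : ℤ}

/-- The vector `q / n`. -/
noncomputable def shiftVec (n : ℤ) (q : Fin g → ℤ) : Fin g → ℝ := fun j => q j / n

theorem shiftVec_add_smul (hn : n ≠ 0) (q m : Fin g → ℤ) :
    shiftVec n (q + n • m) = shiftVec n q + intVec m := by
  have : (n : ℝ) ≠ 0 := by exact_mod_cast hn
  ext j
  simp only [shiftVec, intVec, Pi.add_apply, Pi.smul_apply, smul_eq_mul, Int.cast_add, Int.cast_mul]
  field_simp

theorem smul_shiftVec (hn : n ≠ 0) (q : Fin g → ℤ) : (n : ℝ) • shiftVec n q = intVec q := by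
  have : (n : ℝ) ≠ 0 := by exact_mod_cast hn
  ext j
  simp only [shiftVec, intVec, Pi.smul_apply, smul_eq_mul]
  field_simp

theorem automorphy_zpow_fst (n : ℤ) (m : Fin g → ℤ) (u : Cover g) :
    automorphy (m, 0) u ^ n = Complex.exp (-(n * Real.pi * Complex.I * ((u.2 ⬝ᵥ intVec m : ℝ) : ℂ))) := by
  have h : symplForm u (latticeVec (m, 0)) = u.2 ⬝ᵥ intVec m := by
    simp [symplForm, latticeVec, dotProduct, intVec]
  rw [automorphy, h, dotProduct_zero, zpow_zero, one_mul, ← Complex.exp_int_mul]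
  ring_nf

theorem automorphy_zpow_snd (n : ℤ) (m : Fin g → ℤ) (u : Cover g) :
    automorphy (0, m) u ^ n = Complex.exp (n * Real.pi * Complex.I * ((u.1 ⬝ᵥ intVec m : ℝ) : ℂ)) := by
  have h : symplForm u (latticeVec (0, m)) = -(u.1 ⬝ᵥ intVec m) := by
    simp [symplForm, latticeVec, dotProduct, intVec]
  rw [automorphy, h, zero_dotProduct, zpow_zero, one_mul, ← Complex.exp_int_mul]
  push_cast
  ring_nf

/-- The integrand of the Weil–Brezin coefficient. -/
noncomputable def wbIntegrand (n : ℤ) (q : Fin g → ℤ) (s : Cover g → ℂ) (u : Cover g) : ℂ :=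
  s (u + (0, shiftVec n q)) *
    Complex.exp (n * Real.pi * Complex.I * ((u.1 ⬝ᵥ (u.2 - shiftVec n q) : ℝ) : ℂ))

theorem norm_exp_int_mul_pi (n : ℤ) (t : ℝ) :
    ‖Complex.exp (n * Real.pi * Complex.I * (t : ℂ))‖ = 1 := by
  rw [show (n * Real.pi * Complex.I * (t : ℂ)) = ((n * Real.pi * t : ℝ) : ℂ) * Complex.I by
    push_cast; ring]
  exact Complex.norm_exp_ofReal_mul_I _

theorem norm_wbIntegrand_le (q : Fin g → ℤ) (s : SmoothSection g n) (u : Cover g) :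
    ‖wbIntegrand n q s u‖ ≤ sectionSeminorm g n 0 s := by
  rw [wbIntegrand, norm_mul, norm_exp_int_mul_pi, mul_one]
  exact s.norm_le _

theorem contDiff_dotProduct_cover (r : Fin g → ℝ) :
    ContDiff ℝ ∞ fun u : Cover g => u.1 ⬝ᵥ (u.2 - r) := by
  unfold dotProduct
  exact ContDiff.sum fun j _ => ((contDiff_apply ℝ ℝ j).comp contDiff_fst).mul
    (((contDiff_apply ℝ ℝ j).comp contDiff_snd).sub contDiff_const)

theorem contDiff_wbIntegrand (q : Fin g → ℤ) (s : SmoothSection g n) :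
    ContDiff ℝ ∞ (wbIntegrand n q s) :=
  (s.2.1.comp (contDiff_id.add contDiff_const)).mul
    (Complex.contDiff_exp.comp (contDiff_const.mul
      (Complex.ofRealCLM.contDiff.comp (contDiff_dotProduct_cover _))))

theorem hasFDerivAt_dotProduct_cover (r : Fin g → ℝ) (u : Cover g) :
    ∃ D : Cover g →L[ℝ] ℝ, HasFDerivAt (fun u : Cover g => u.1 ⬝ᵥ (u.2 - r)) D u ∧
      (∀ j, D (coverVec (Sum.inl j)) = u.2 j - r j) ∧
      ∀ j, D (coverVec (Sum.inr j)) = u.1 j := by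
  have h : HasFDerivAt (fun u : Cover g => ∑ j, coverProj (Sum.inl j) u *
      (coverProj (Sum.inr j) u - r j)) _ u := HasFDerivAt.fun_sum (u := Finset.univ)
    fun j _ => (coverProj (Sum.inl j)).hasFDerivAt.fun_mul
      ((coverProj (Sum.inr j)).hasFDerivAt.sub_const (r j))
  refine ⟨_, h, fun j => ?_, fun j => ?_⟩ <;>
  simp [coverProj, coverVec, ContinuousLinearMap.sum_apply, Pi.single_apply]

/-- The phase is chosen to absorb the connection: differentiation in `y` becomes exactly the
covariant derivative, and in `x` only the term with `2πi n y_j` remains. -/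
theorem fderiv_wbIntegrand (q : Fin g → ℤ) (s : SmoothSection g n) (u : Cover g) (a : Fin g ⊕ Fin g) :
    fderiv ℝ (wbIntegrand n q s) u (coverVec a) = wbIntegrand n q (nablaOp n a s) u +
      Sum.elim (fun j => 2 * Real.pi * Complex.I * n * u.2 j * wbIntegrand n q s u) 0 a := by
  obtain ⟨D, hD, hl, hr⟩ := hasFDerivAt_dotProduct_cover (shiftVec n q) u
  have h1 : HasFDerivAt (fun u => (s : Cover g → ℂ) (u + (0, shiftVec n q)))
      (fderiv ℝ s (u + (0, shiftVec n q))) u :=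
    (hasFDerivAt_comp_add_right _).2 (s.differentiable _).hasFDerivAt
  have h2 := ((Complex.ofRealCLM.hasFDerivAt.comp u hD).const_mul
    (n * Real.pi * Complex.I)).cexp
  have h3 := h1.fun_mul h2
  have h4 : fderiv ℝ (wbIntegrand n q s) u = _ := h3.fderiv
  rw [h4]
  simp only [_root_.add_apply, _root_.smul_apply, smul_eq_mul, ContinuousLinearMap.comp_apply,
    Complex.ofRealCLM_apply, wbIntegrand, nablaOp_apply, Function.comp]
  cases a with
  | inl j =>
    simp only [hl, connForm, Sum.elim_inl, Prod.snd_add, Pi.add_apply, Complex.ofReal_neg,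
      Complex.ofReal_sub, Complex.ofReal_add]
    ring
  | inr j =>
    simp only [hr, connForm, Sum.elim_inr, Prod.fst_add, Pi.add_apply, Pi.zero_apply, add_zero]
    ring

theorem latticeChar_intVec (q m : Fin g → ℤ) : latticeChar q (intVec m) = 1 := by
  rw [← zero_add (intVec m), latticeChar_add_intVec]
  simp [latticeChar]

/-- Periodicity in `x` is what kills boundary terms below. Integrality of `q` enters through `e^{2πi
q · m} = 1`. -/
theorem wbIntegrand_add_intVec (hn : n ≠ 0) (q m : Fin g → ℤ) (s : SmoothSection g n)
    (x y : Fin g → ℝ) : wbIntegrand n q s (x + intVec m, y) = wbIntegrand n q s (x, y) := by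
  have h1 : ((x + intVec m, y) + (0, shiftVec n q) : Cover g) =
      (x, y + shiftVec n q) + latticeVec (m, 0) := by
    ext j <;> simp [latticeVec, intVec]
  have h2 : ((x, y) + (0, shiftVec n q) : Cover g) = (x, y + shiftVec n q) := by
    ext j <;> simp
  have h3 := latticeChar_intVec q m
  rw [latticeChar] at h3
  have h4 : (n : ℂ) * ((shiftVec n q ⬝ᵥ intVec m : ℝ) : ℂ) = ((intVec q ⬝ᵥ intVec m : ℝ) : ℂ) := by
    rw [← smul_shiftVec hn q, smul_dotProduct, smul_eq_mul]
    push_cast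
    rfl
  have h5 : -(n * Real.pi * Complex.I * (((y + shiftVec n q) ⬝ᵥ intVec m : ℝ) : ℂ)) +
      n * Real.pi * Complex.I * (((x + intVec m) ⬝ᵥ (y - shiftVec n q) : ℝ) : ℂ) =
      n * Real.pi * Complex.I * ((x ⬝ᵥ (y - shiftVec n q) : ℝ) : ℂ) -
        2 * Real.pi * Complex.I * ((intVec q ⬝ᵥ intVec m : ℝ) : ℂ) := by
    rw [← h4, add_dotProduct, add_dotProduct, dotProduct_sub (intVec m), dotProduct_comm (intVec m),
      dotProduct_comm (intVec m)]
    push_cast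
    ring
  rw [wbIntegrand, wbIntegrand, h1, s.2.2, automorphy_zpow_fst, h2, mul_right_comm,
    ← Complex.exp_add, h5, Complex.exp_sub, h3, div_one, mul_comm]

/-- The Weil–Brezin coefficient of a section of `L^n` for the index `q`. -/
noncomputable def wbCoeff (n : ℤ) (q : Fin g → ℤ) (s : Cover g → ℂ) (y : Fin g → ℝ) : ℂ :=
  ∫ x in Icc (0 : Fin g → ℝ) 1, wbIntegrand n q s (x, y)

theorem continuous_wbIntegrand_left (q : Fin g → ℤ) (s : SmoothSection g n) (y : Fin g → ℝ) :
    Continuous fun x => wbIntegrand n q s (x, y) :=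
  (contDiff_wbIntegrand q s).continuous.comp (Continuous.prodMk_left y)

theorem integrableOn_wbIntegrand (q : Fin g → ℤ) (s : SmoothSection g n) (y : Fin g → ℝ) :
    IntegrableOn (fun x => wbIntegrand n q s (x, y)) (Icc 0 1) :=
  (continuous_wbIntegrand_left q s y).continuousOn.integrableOn_compact isCompact_Icc

theorem norm_wbCoeff_le (q : Fin g → ℤ) (s : SmoothSection g n) (y : Fin g → ℝ) :
    ‖wbCoeff n q s y‖ ≤ sectionSeminorm g n 0 s := by
  have := norm_setIntegral_le_of_norm_le_const (μ := volume) (s := Icc (0 : Fin g → ℝ) 1)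
    (by simp [volume_unitCube]) fun x _ => norm_wbIntegrand_le q s (x, y)
  simpa [wbCoeff, volume_unitCube, Measure.real] using this

theorem hasFDerivAt_wbIntegrand_right (q : Fin g → ℤ) (s : SmoothSection g n) (x y : Fin g → ℝ) :
    HasFDerivAt (fun y => wbIntegrand n q s (x, y))
      (complexDot fun j => wbIntegrand n q (nablaOp n (Sum.inr j) s) (x, y)) y := by
  have h := ((contDiff_wbIntegrand q s).differentiable (by simp) (x, y)).hasFDerivAt.comp y
    (hasFDerivAt_prodMk_right x y)
  refine h.congr_fderiv (ContinuousLinearMap.ext fun v => ?_)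
  rw [← sum_proj_smul_stdVec v]
  simp only [map_sum, map_smul, complexDot_stdVec]
  refine Finset.sum_congr rfl fun j _ => ?_
  have := fderiv_wbIntegrand q s (x, y) (Sum.inr j)
  simp only [Sum.elim_inr, Pi.zero_apply, add_zero] at this
  rw [← this]
  rfl

theorem norm_complexDot_le (z : Fin g → ℂ) : ‖complexDot z‖ ≤ ∑ j, ‖z j‖ := by
  refine ContinuousLinearMap.opNorm_le_bound _ (Finset.sum_nonneg fun _ _ => norm_nonneg _)
    fun v => ?_
  rw [complexDot_apply, Finset.sum_mul]
  refine (norm_sum_le _ _).trans (Finset.sum_le_sum fun j _ => ?_)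
  rw [norm_mul, Complex.norm_real]
  exact mul_le_mul_of_nonneg_left (norm_le_pi_norm v j) (norm_nonneg _)

theorem continuous_complexDot {Y : Type*} [TopologicalSpace Y] {z : Y → Fin g → ℂ}
    (hz : ∀ j, Continuous fun t => z t j) : Continuous fun t => complexDot (z t) := by
  unfold complexDot
  exact continuous_finsetSum _ fun j _ => (hz j).smul continuous_const

theorem hasFDerivAt_wbCoeff (q : Fin g → ℤ) (s : SmoothSection g n) (y : Fin g → ℝ) :
    HasFDerivAt (wbCoeff n q s)
      (complexDot fun j => wbCoeff n q (nablaOp n (Sum.inr j) s) y) y := by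
  have hc : Continuous fun x => complexDot fun j =>
      wbIntegrand n q (nablaOp n (Sum.inr j) s) (x, y) :=
    continuous_complexDot fun j => continuous_wbIntegrand_left q _ y
  have h := hasFDerivAt_integral_of_dominated_of_fderiv_le (𝕜 := ℝ)
    (μ := (volume : Measure (Fin g → ℝ)).restrict (Icc 0 1)) (s := univ)
    (F := fun y x => wbIntegrand n q s (x, y)) (x₀ := y)
    (F' := fun y x => complexDot fun j => wbIntegrand n q (nablaOp n (Sum.inr j) s) (x, y))
    (bound := fun _ => ∑ j, sectionSeminorm g n 0 (nablaOp n (Sum.inr j) s))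
    Filter.univ_mem
    (Filter.Eventually.of_forall fun y =>
      (continuous_wbIntegrand_left q s y).aestronglyMeasurable)
    (integrableOn_wbIntegrand q s y) hc.aestronglyMeasurable
    (Filter.Eventually.of_forall fun x y _ => (norm_complexDot_le _).trans
      (Finset.sum_le_sum fun j _ => norm_wbIntegrand_le q _ _))
    (integrable_const _)
    (Filter.Eventually.of_forall fun x y _ => hasFDerivAt_wbIntegrand_right q s x y)
  refine h.congr_fderiv (ContinuousLinearMap.ext fun v => ?_)
  rw [ContinuousLinearMap.integral_apply
    (hc.continuousOn.integrableOn_compact isCompact_Icc)]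
  simp only [complexDot_apply]
  rw [integral_finsetSum _ fun j _ => (integrableOn_wbIntegrand q _ y).mul_const _]
  exact Finset.sum_congr rfl fun j _ => integral_mul_const _ _

/-- The total `x`-derivative integrates to zero over a period, which leaves the multiplication term
of `fderiv_wbIntegrand` with opposite sign. -/
theorem wbCoeff_nablaOp_inl (hn : n ≠ 0) (q : Fin g → ℤ) (s : SmoothSection g n) (j : Fin g)
    (y : Fin g → ℝ) : wbCoeff n q (nablaOp n (Sum.inl j) s) y =
      -(2 * Real.pi * Complex.I * n) * (y j * wbCoeff n q s y) := by
  have hcd : ContDiff ℝ 1 fun x => wbIntegrand n q s (x, y) :=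
    ((contDiff_wbIntegrand q s).of_le (by simp)).comp (contDiff_id.prodMk contDiff_const)
  have h0 := integral_unitCube_fderiv_eq_zero hcd j fun x => by
    rw [← intVec_single, wbIntegrand_add_intVec hn]
  have h1 : ∀ x, fderiv ℝ (fun x => wbIntegrand n q s (x, y)) x (stdVec j) =
      wbIntegrand n q (nablaOp n (Sum.inl j) s) (x, y) +
        2 * Real.pi * Complex.I * n * y j * wbIntegrand n q s (x, y) := fun x => by
    have h := HasFDerivAt.comp x
      ((contDiff_wbIntegrand q s).differentiable (by simp) (x, y)).hasFDerivAt
      (hasFDerivAt_prodMk_left (𝕜 := ℝ) x y)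
    have h' : fderiv ℝ (fun x => wbIntegrand n q s (x, y)) x = _ := h.fderiv
    rw [h']
    exact fderiv_wbIntegrand q s (x, y) (Sum.inl j)
  simp only [h1] at h0
  rw [integral_add (integrableOn_wbIntegrand q _ y) ((integrableOn_wbIntegrand q s y).const_mul _),
    integral_const_mul] at h0
  rw [wbCoeff, wbCoeff, eq_neg_of_add_eq_zero_left h0]
  ring

/-- The Weil–Brezin coefficient as a linear map into functions. -/
noncomputable def wbCoeffLin (n : ℤ) (q : Fin g → ℤ) :
    SmoothSection g n →ₗ[ℂ] ((Fin g → ℝ) → ℂ) where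
  toFun s := wbCoeff n q s
  map_add' s t := funext fun y => by
    rw [Pi.add_apply, wbCoeff, wbCoeff, wbCoeff,
      ← integral_add (integrableOn_wbIntegrand q s y) (integrableOn_wbIntegrand q t y)]
    exact integral_congr_ae (Filter.Eventually.of_forall fun x => add_mul _ _ _)
  map_smul' c s := funext fun y => by
    rw [Pi.smul_apply, wbCoeff, wbCoeff, ← integral_smul]
    exact integral_congr_ae (Filter.Eventually.of_forall fun x => mul_assoc _ _ _)

/-- Both operations of a Schwartz family come from covariant derivatives of the section:
differentiation from those in `y`, multiplication by coordinates from those in `x`. Smoothness in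
`x` is thus the source of decay in `y`. -/
theorem exists_wbOp (hn : n ≠ 0) (q : Fin g → ℤ) :
    ∃ A : SmoothSection g n →L[ℂ] SchwartzFun g, ∀ s y, A s y = wbCoeff n q s y := by
  have hc : (-(2 * Real.pi * Complex.I * n) : ℂ) ≠ 0 := by
    have := Real.pi_ne_zero
    simp_all
  refine IsSchwartzFamily.exists_clm (T := wbCoeffLin n q)
    (D := fun j => nablaOp n (Sum.inr j))
    (Y := fun j => (-(2 * Real.pi * Complex.I * n) : ℂ)⁻¹ • nablaOp n (Sum.inl j))
    (continuous_sectionSeminorm 0) ⟨fun s y => ?_, fun s j y => ?_, fun s j y => ?_, norm_wbCoeff_le q⟩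
  · exact (hasFDerivAt_wbCoeff q s y).differentiableAt
  · change fderiv ℝ (wbCoeff n q s) y (stdVec j) = _
    rw [(hasFDerivAt_wbCoeff q s y).fderiv, complexDot_stdVec]
    rfl
  · simp only [_root_.smul_apply, map_smul, Pi.smul_apply, smul_eq_mul]
    change _ = _ * wbCoeff n q (nablaOp n (Sum.inl j) s) y
    rw [wbCoeff_nablaOp_inl hn, inv_mul_cancel_left₀ hc]
    rfl

/-- The Weil–Brezin coefficient, as a continuous operator into the Schwartz space. -/
noncomputable def wbOp (hn : n ≠ 0) (q : Fin g → ℤ) : SmoothSection g n →L[ℂ] SchwartzFun g :=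
  (exists_wbOp hn q).choose

theorem wbOp_apply (hn : n ≠ 0) (q : Fin g → ℤ) (s : SmoothSection g n) (y : Fin g → ℝ) :
    wbOp hn q s y = wbCoeff n q s y :=
  (exists_wbOp hn q).choose_spec s y

theorem wbOp_nablaOp_inr (hn : n ≠ 0) (q : Fin g → ℤ) (s : SmoothSection g n) (j : Fin g) :
    wbOp hn q (nablaOp n (Sum.inr j) s) = partialOp j (wbOp hn q s) := by
  ext y
  rw [partialOp_apply, wbOp_apply, show ⇑(wbOp hn q s) = wbCoeff n q s from
    funext (wbOp_apply hn q s), (hasFDerivAt_wbCoeff q s y).fderiv, complexDot_stdVec]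

theorem wbOp_nablaOp_inl (hn : n ≠ 0) (q : Fin g → ℤ) (s : SmoothSection g n) (j : Fin g) :
    wbOp hn q (nablaOp n (Sum.inl j) s) =
      (-(2 * Real.pi * Complex.I * n) : ℂ) • coordOp j (wbOp hn q s) := by
  ext y
  rw [wbOp_apply, wbCoeff_nablaOp_inl hn, SchwartzMap.smul_apply, coordOp_apply, wbOp_apply,
    smul_eq_mul]

/-- Quasi-periodicity in `y` makes the coefficient depend only on `q` modulo `n`, so finitely many
coefficients carry the whole section. -/
theorem wbCoeff_add_smul (hn : n ≠ 0) (q m : Fin g → ℤ) (s : SmoothSection g n) :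
    wbCoeff n (q + n • m) s = wbCoeff n q s := by
  funext y
  refine integral_congr_ae (Filter.Eventually.of_forall fun x => ?_)
  have h1 : ((x, y) + (0, shiftVec n (q + n • m)) : Cover g) =
      (x, y + shiftVec n q) + latticeVec (0, m) := by
    rw [shiftVec_add_smul hn]
    ext j <;> simp [latticeVec, intVec, add_assoc]
  have h2 : ((x, y) + (0, shiftVec n q) : Cover g) = (x, y + shiftVec n q) := by
    ext j <;> simp
  simp only [wbIntegrand]
  rw [h1, s.2.2, automorphy_zpow_snd, h2, mul_right_comm, ← Complex.exp_add, shiftVec_add_smul hn,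
    mul_comm]
  congr 2
  simp only [dotProduct_sub, dotProduct_add]
  push_cast
  ring

end WeilBrezinAnalysis

/-! ## The synthesis of sections from Schwartz functions -/

section Synthesis

variable {g : ℕ} {n : ℤ}

theorem exists_decay_seminorm (g N : ℕ) : ∃ p : Seminorm ℂ (SchwartzFun g), Continuous p ∧
    ∀ f y, ‖f y‖ ≤ p f * ((1 + ‖y‖) ^ N)⁻¹ := by
  have h := fun f : SchwartzFun g => SchwartzMap.one_add_le_sup_seminorm_apply (𝕜 := ℂ)
    (m := (N, 0)) (k := N) (n := 0) le_rfl le_rfl f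
  have hc : Continuous ⇑((Finset.Iic (N, 0)).sup fun m : ℕ × ℕ =>
      (SchwartzMap.seminorm ℂ m.1 m.2 : Seminorm ℂ (SchwartzFun g))) :=
    Seminorm.continuous_finsetSup fun m _ => continuous_seminorm_schwartz m.1 m.2
  obtain ⟨p, hp, hp'⟩ := exists_seminorm_eq_mul (by positivity : (0 : ℝ) ≤ 2 ^ N) hc
  refine ⟨p, hp, fun f y => ?_⟩
  rw [← div_eq_mul_inv, le_div_iff₀ (by positivity), mul_comm, hp']
  simpa using h f y

/-- The linear form on `ℝ^{2g}` with values `c a` on the coordinate frame. -/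
noncomputable def frameForm (c : Fin g ⊕ Fin g → ℂ) : Cover g →L[ℝ] ℂ :=
  ∑ a, c a • Complex.ofRealCLM.comp (coverProj a)

theorem coverProj_coverVec (a b : Fin g ⊕ Fin g) :
    coverProj a (coverVec b) = if a = b then 1 else 0 := by
  cases a <;> cases b <;> simp [coverProj, coverVec, Pi.single_apply]

theorem coverVec_inl_snd (j : Fin g) : (coverVec (Sum.inl j)).2 = (0 : Fin g → ℝ) := rfl

theorem coverVec_inr_snd (j : Fin g) : (coverVec (Sum.inr j)).2 = stdVec j := rfl

theorem frameForm_coverVec (c : Fin g ⊕ Fin g → ℂ) (a : Fin g ⊕ Fin g) :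
    frameForm c (coverVec a) = c a := by
  simp [frameForm, ContinuousLinearMap.sum_apply, coverProj_coverVec, apply_ite Complex.ofReal,
    -Fintype.sum_sum_type]

theorem eq_frameForm (D : Cover g →L[ℝ] ℂ) : D = frameForm fun a => D (coverVec a) := by
  refine ContinuousLinearMap.ext fun u => ?_
  rw [← sum_coverProj_smul_coverVec u]
  simp only [map_sum, map_smul, frameForm_coverVec]

theorem norm_frameForm_le (c : Fin g ⊕ Fin g → ℂ) : ‖frameForm c‖ ≤ ∑ a, ‖c a‖ := by
  refine ContinuousLinearMap.opNorm_le_bound _ (Finset.sum_nonneg fun _ _ => norm_nonneg _)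
    fun v => ?_
  rw [frameForm, ContinuousLinearMap.sum_apply, Finset.sum_mul]
  refine (norm_sum_le _ _).trans (Finset.sum_le_sum fun a _ => ?_)
  rw [_root_.smul_apply, norm_smul, ContinuousLinearMap.comp_apply, Complex.ofRealCLM_apply,
    Complex.norm_real]
  refine mul_le_mul_of_nonneg_left ?_ (norm_nonneg _)
  exact ((coverProj a).le_opNorm v).trans
    (mul_le_of_le_one_left (norm_nonneg _) (norm_coverProj_le_one a))

/-- The term `e^{-nπi x · y + 2πi q · x} f(y - q / n)` of the synthesis. -/
noncomputable def synTerm (n : ℤ) (q : Fin g → ℤ) (f : (Fin g → ℝ) → ℂ) (u : Cover g) : ℂ :=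
  Complex.exp (n * Real.pi * Complex.I *
    ((-(u.1 ⬝ᵥ (u.2 - (2 : ℝ) • shiftVec n q)) : ℝ) : ℂ)) * f (u.2 - shiftVec n q)

theorem norm_synTerm (q : Fin g → ℤ) (f : (Fin g → ℝ) → ℂ) (u : Cover g) :
    ‖synTerm n q f u‖ = ‖f (u.2 - shiftVec n q)‖ := by
  rw [synTerm, norm_mul, norm_exp_int_mul_pi, one_mul]

theorem continuous_synTerm (q : Fin g → ℤ) (f : SchwartzFun g) : Continuous (synTerm n q f) := by
  refine Continuous.mul (Complex.continuous_exp.comp (continuous_const.mul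
    (Complex.continuous_ofReal.comp (contDiff_dotProduct_cover _).continuous.neg))) ?_
  exact f.continuous.comp (continuous_snd.sub continuous_const)

/-- The operators that correspond to the covariant derivatives under synthesis. -/
noncomputable def schwartzNabla (n : ℤ) (a : Fin g ⊕ Fin g) : SchwartzFun g →L[ℂ] SchwartzFun g :=
  Sum.elim (fun j => (-(2 * Real.pi * Complex.I * n) : ℂ) • coordOp j) (fun j => partialOp j) a

/-- The partial derivatives of a term of the synthesis. -/
noncomputable def synTermDeriv (n : ℤ) (q : Fin g → ℤ) (f : SchwartzFun g) (u : Cover g)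
    (a : Fin g ⊕ Fin g) : ℂ :=
  synTerm n q (schwartzNabla n a f) u - n * Real.pi * Complex.I * (connForm a u * synTerm n q f u)

theorem hasFDerivAt_synTerm (q : Fin g → ℤ) (f : SchwartzFun g) (u : Cover g) :
    HasFDerivAt (synTerm n q f) (frameForm (synTermDeriv n q f u)) u := by
  obtain ⟨D, hD, hl, hr⟩ := hasFDerivAt_dotProduct_cover ((2 : ℝ) • shiftVec n q) u
  have h1 : HasFDerivAt (fun u : Cover g => f (u.2 - shiftVec n q)) _ u :=
    (f.differentiable (u.2 - shiftVec n q)).hasFDerivAt.comp u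
      ((hasFDerivAt_snd (𝕜 := ℝ)).sub_const (shiftVec n q))
  have h2 := ((Complex.ofRealCLM.hasFDerivAt.comp u hD.neg).const_mul
    (n * Real.pi * Complex.I)).cexp
  have h3 := h2.fun_mul h1
  refine h3.congr_fderiv ?_
  rw [eq_frameForm (_ + _)]
  congr 1
  funext a
  simp only [_root_.add_apply, _root_.smul_apply, smul_eq_mul, ContinuousLinearMap.comp_apply,
    Complex.ofRealCLM_apply, Function.comp, synTermDeriv, synTerm, _root_.neg_apply,
    ContinuousLinearMap.coe_snd']
  cases a with
  | inl j =>
    simp only [hl, connForm, Sum.elim_inl, schwartzNabla, coverVec_inl_snd, map_zero, SchwartzMap.smul_apply,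
      coordOp_apply, smul_eq_mul]
    simp only [Pi.neg_apply, Pi.sub_apply, Pi.smul_apply, smul_eq_mul]
    push_cast
    ring
  | inr j =>
    simp only [hr, connForm, Sum.elim_inr, schwartzNabla, coverVec_inr_snd, partialOp_apply]
    simp only [Pi.neg_apply]
    push_cast
    ring

/-- A lattice translation permutes the terms of the synthesis, shifting `q` by `n b`. The sign in
the automorphy factor arises from `e^{πi n a · b}`. -/
theorem synTerm_add_latticeVec (hn : n ≠ 0) (q : Fin g → ℤ) (f : (Fin g → ℝ) → ℂ)
    (a b : Fin g → ℤ) (u : Cover g) :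
    synTerm n (q + n • b) f (u + latticeVec (a, b)) = automorphy (a, b) u ^ n * synTerm n q f u := by
  have h1 : (u + latticeVec (a, b)).2 - shiftVec n (q + n • b) = u.2 - shiftVec n q := by
    rw [shiftVec_add_smul hn]
    ext j
    simp [latticeVec, intVec]
  have h3 := latticeChar_intVec q a
  rw [latticeChar] at h3
  have h4 : (n : ℂ) * ((shiftVec n q ⬝ᵥ intVec a : ℝ) : ℂ) = ((intVec q ⬝ᵥ intVec a : ℝ) : ℂ) := by
    rw [← smul_shiftVec hn q, smul_dotProduct, smul_eq_mul]
    push_cast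
    rfl
  have h5 : ((-1 : ℂ) ^ (a ⬝ᵥ b)) = Complex.exp (Real.pi * Complex.I * ((intVec a ⬝ᵥ intVec b : ℝ) : ℂ)) := by
    rw [← Complex.exp_pi_mul_I, ← Complex.exp_int_mul]
    simp [dotProduct, intVec, mul_comm]
  have h6 : symplForm u (latticeVec (a, b)) = u.2 ⬝ᵥ intVec a - u.1 ⬝ᵥ intVec b := rfl
  have h7 : (u + latticeVec (a, b)).1 = u.1 + intVec a := rfl
  have h8 : (u + latticeVec (a, b)).2 = u.2 + intVec b := rfl
  rw [synTerm, synTerm, h1, ← mul_assoc]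
  congr 1
  simp only [automorphy]
  rw [h5, ← Complex.exp_add, ← Complex.exp_int_mul, ← Complex.exp_add,
    ← mul_one (Complex.exp (_ + _)), ← h3, ← Complex.exp_add, h7, h8, h6, shiftVec_add_smul hn, ← h4]
  congr 1
  simp only [dotProduct_sub, dotProduct_add, add_dotProduct, dotProduct_smul, smul_add, smul_eq_mul,
    dotProduct_comm (shiftVec n q) (intVec a), dotProduct_comm u.2 (intVec a)]
  push_cast
  ring

theorem exists_norm_synTerm_le (hn : n ≠ 0) (q : Fin g → ℤ) :
    ∃ p : Seminorm ℂ (SchwartzFun g), Continuous p ∧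
      ∀ (f : SchwartzFun g) (m : Fin g → ℤ) (u : Cover g),
      ‖synTerm n (q + n • m) f u‖ ≤
        p f * (1 + ‖u‖) ^ (g + 1) * ((1 + ‖intVec m‖) ^ (g + 1))⁻¹ := by
  obtain ⟨p, hp, hp'⟩ := exists_decay_seminorm g (g + 1)
  obtain ⟨p2, hp2, hp2'⟩ := exists_seminorm_eq_mul
    (by positivity : (0 : ℝ) ≤ (1 + ‖shiftVec n q‖) ^ (g + 1)) hp
  refine ⟨p2, hp2, fun f m u => ?_⟩
  rw [norm_synTerm, hp2', shiftVec_add_smul hn]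
  refine (hp' f _).trans ?_
  -- The triangle inequality in multiplicative form converts decay of `f` at `u.2 - q/n - m` into
  -- decay in `m`, at the price of a power of `1 + ‖u‖`.
  have h1 : 1 + ‖intVec m‖ ≤ (1 + ‖shiftVec n q‖) * (1 + ‖u‖) *
      (1 + ‖u.2 - (shiftVec n q + intVec m)‖) := by
    have e : intVec m = u.2 - shiftVec n q - (u.2 - (shiftVec n q + intVec m)) := by abel
    have h2 : ‖intVec m‖ ≤ ‖u‖ + ‖shiftVec n q‖ + ‖u.2 - (shiftVec n q + intVec m)‖ := by
      conv_lhs => rw [e]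
      refine (norm_sub_le _ _).trans (add_le_add ((norm_sub_le _ _).trans ?_) le_rfl)
      exact add_le_add (norm_snd_le u) le_rfl
    have := norm_nonneg u
    have := norm_nonneg (shiftVec n q)
    have := norm_nonneg (u.2 - (shiftVec n q + intVec m))
    have h3 : 0 ≤ ‖u‖ * ‖shiftVec n q‖ := by positivity
    have h4 : 0 ≤ (‖u‖ + ‖shiftVec n q‖ + ‖u‖ * ‖shiftVec n q‖) *
      ‖u.2 - (shiftVec n q + intVec m)‖ := by positivity
    nlinarith
  rw [mul_comm _ (p f), mul_assoc (p f), mul_assoc (p f)]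
  refine mul_le_mul_of_nonneg_left ?_ (apply_nonneg p f)
  rw [inv_eq_one_div, ← div_eq_mul_inv, div_le_div_iff₀ (by positivity) (by positivity), one_mul,
    ← mul_pow, ← mul_pow]
  gcongr

theorem summable_synTerm (hn : n ≠ 0) (q : Fin g → ℤ) (f : SchwartzFun g) (u : Cover g) :
    Summable fun m => ‖synTerm n (q + n • m) f u‖ := by
  obtain ⟨p, -, hp⟩ := exists_norm_synTerm_le hn q
  exact Summable.of_nonneg_of_le (fun _ => norm_nonneg _) (fun m => hp f m u)
    ((summable_one_add_norm_intVec g).mul_left _)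

/-- The synthesis `∑_m e^{-nπi x · y + 2πi (q + n m) · x} f(y - q / n - m)` of a section of `L^n`. -/
noncomputable def synFun (n : ℤ) (q : Fin g → ℤ) (f : (Fin g → ℝ) → ℂ) (u : Cover g) : ℂ :=
  ∑' m : Fin g → ℤ, synTerm n (q + n • m) f u

theorem hasFDerivAt_synFun (hn : n ≠ 0) (q : Fin g → ℤ) (f : SchwartzFun g) (u : Cover g) :
    HasFDerivAt (synFun n q f) (∑' m : Fin g → ℤ, frameForm (synTermDeriv n (q + n • m) f u)) u ∧
      Summable fun m : Fin g → ℤ => frameForm (synTermDeriv n (q + n • m) f u) := by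
  obtain ⟨p, -, hp⟩ := exists_norm_synTerm_le hn q
  have hconn : ∀ a (v : Cover g), ‖(connForm a v : ℂ)‖ ≤ ‖v‖ := fun a v => by
    rw [Complex.norm_real]
    cases a with
    | inl j =>
      rw [connForm, Sum.elim_inl, norm_neg]
      exact (norm_le_pi_norm v.2 j).trans (norm_snd_le v)
    | inr j => exact (norm_le_pi_norm v.1 j).trans (norm_fst_le v)
  -- Termwise differentiation takes place on the ball of this radius about the origin, which
  -- contains `u` and on which the bounds in `u` are uniform.
  let R : ℝ := ‖u‖ + 1
  let K : (Fin g → ℤ) → ℝ := fun m => ((1 + ‖intVec m‖) ^ (g + 1))⁻¹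
  let B : ℝ := ∑ a : Fin g ⊕ Fin g, (p (schwartzNabla n a f) * (1 + R) ^ (g + 1) +
    ‖(n * Real.pi * Complex.I : ℂ)‖ * (R * (p f * (1 + R) ^ (g + 1))))
  have hbound : ∀ (m : Fin g → ℤ), ∀ v ∈ Metric.ball (0 : Cover g) R,
      ‖frameForm (synTermDeriv n (q + n • m) f v)‖ ≤ B * K m := by
    intro m v hv
    have hv' : ‖v‖ ≤ R := by simpa using (mem_ball_zero_iff.1 hv).le
    have hK : 0 ≤ K m := by positivity
    have hT : ∀ h : SchwartzFun g, ‖synTerm n (q + n • m) h v‖ ≤ p h * (1 + R) ^ (g + 1) * K m :=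
      fun h => (hp h m v).trans (mul_le_mul_of_nonneg_right (mul_le_mul_of_nonneg_left
        (by gcongr) (apply_nonneg p h)) hK)
    refine (norm_frameForm_le _).trans ?_
    rw [Finset.sum_mul]
    refine Finset.sum_le_sum fun a _ => (norm_sub_le _ _).trans ?_
    rw [add_mul, norm_mul, norm_mul (connForm a v : ℂ), mul_assoc ‖(n * Real.pi * Complex.I : ℂ)‖,
      mul_assoc R]
    refine add_le_add (hT _) (mul_le_mul_of_nonneg_left ?_ (norm_nonneg _))
    exact mul_le_mul ((hconn a v).trans hv') (hT f) (norm_nonneg _) (by positivity)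
  have hs := (summable_one_add_norm_intVec g).mul_left B
  have hu : u ∈ Metric.ball (0 : Cover g) R := by
    rw [mem_ball_zero_iff]
    exact lt_add_one _
  refine ⟨?_, Summable.of_norm_bounded hs fun m => hbound m u hu⟩
  exact hasFDerivAt_tsum_of_isPreconnected hs Metric.isOpen_ball
    (convex_ball (0 : Cover g) R).isPreconnected
    (fun m v _ => hasFDerivAt_synTerm (q + n • m) f v) hbound hu
    (summable_synTerm hn q f u).of_norm hu

/-- The synthesis as a linear map into functions. -/
noncomputable def synLin (hn : n ≠ 0) (q : Fin g → ℤ) : SchwartzFun g →ₗ[ℂ] (Cover g → ℂ) where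
  toFun f := synFun n q f
  map_add' f h := funext fun u => by
    rw [Pi.add_apply, synFun, synFun, synFun, ← (summable_synTerm hn q f u).of_norm.tsum_add
      (summable_synTerm hn q h u).of_norm]
    exact tsum_congr fun m => by simp only [synTerm, SchwartzMap.add_apply, mul_add]
  map_smul' c f := funext fun u => by
    rw [RingHom.id_apply, Pi.smul_apply, smul_eq_mul, synFun, synFun, ← tsum_mul_left]
    exact tsum_congr fun m => by
      simp only [synTerm, SchwartzMap.smul_apply, smul_eq_mul, mul_left_comm]

theorem exists_synOp (hn : n ≠ 0) (q : Fin g → ℤ) :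
    ∃ A : SchwartzFun g →L[ℂ] SmoothSection g n, ∀ f u, A f u = synFun n q f u := by
  obtain ⟨p, hpc, hp⟩ := exists_norm_synTerm_le hn q
  have hs := summable_one_add_norm_intVec g
  obtain ⟨r, hr, hr'⟩ := exists_seminorm_eq_mul (mul_nonneg
    (by positivity : (0 : ℝ) ≤ 2 ^ (g + 1)) (tsum_nonneg fun m : Fin g → ℤ =>
      (by positivity : (0 : ℝ) ≤ ((1 + ‖intVec m‖) ^ (g + 1))⁻¹))) hpc
  refine IsSectionFamily.exists_clm (T := synLin hn q) (D := schwartzNabla n) hr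
    ⟨fun f u => ?_, fun f a u => ?_, fun f a u => ?_, fun f u hu => ?_⟩
  · exact (hasFDerivAt_synFun hn q f u).1.differentiableAt
  · obtain ⟨h1, h2⟩ := hasFDerivAt_synFun hn q f u
    change fderiv ℝ (synFun n q f) u (coverVec a) = _
    rw [h1.fderiv]
    have h3 := (ContinuousLinearMap.apply ℝ ℂ (coverVec a : Cover g)).map_tsum h2
    simp only [ContinuousLinearMap.apply_apply, frameForm_coverVec] at h3
    rw [h3]
    simp only [synTermDeriv]
    rw [(summable_synTerm hn q _ u).of_norm.tsum_sub
      (((summable_synTerm hn q f u).of_norm.mul_left _).mul_left _), tsum_mul_left, tsum_mul_left]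
    rfl
  · obtain ⟨a, b⟩ := a
    change synFun n q f _ = _ * synFun n q f u
    rw [synFun, ← (Equiv.addRight b).tsum_eq, synFun, ← tsum_mul_left]
    refine tsum_congr fun m => ?_
    rw [← synTerm_add_latticeVec hn, Equiv.coe_addRight, smul_add, add_assoc]
  · have hu1 : ‖u‖ ≤ 1 := by
      have h1 : u.1 ∈ Icc (0 : Fin g → ℝ) 1 := ⟨hu.1.1, hu.2.1⟩
      have h2 : u.2 ∈ Icc (0 : Fin g → ℝ) 1 := ⟨hu.1.2, hu.2.2⟩
      exact max_le (norm_le_one_of_mem_Icc h1) (norm_le_one_of_mem_Icc h2)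
    change ‖synFun n q f u‖ ≤ _
    rw [hr', synFun, mul_right_comm, ← tsum_mul_left]
    refine (norm_tsum_le_tsum_norm (summable_synTerm hn q f u)).trans
      ((summable_synTerm hn q f u).tsum_le_tsum (fun m => (hp f m u).trans ?_)
        (hs.mul_left _))
    refine mul_le_mul_of_nonneg_right ?_ (by positivity)
    rw [mul_comm]
    refine mul_le_mul_of_nonneg_right ?_ (apply_nonneg p f)
    gcongr
    linarith

/-- The synthesis operator from the Schwartz space to the smooth sections of `L^n`. -/
noncomputable def synOp (hn : n ≠ 0) (q : Fin g → ℤ) : SchwartzFun g →L[ℂ] SmoothSection g n :=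
  (exists_synOp hn q).choose

theorem synOp_apply (hn : n ≠ 0) (q : Fin g → ℤ) (f : SchwartzFun g) (u : Cover g) :
    synOp hn q f u = ∑' m : Fin g → ℤ, synTerm n (q + n • m) f u :=
  (exists_synOp hn q).choose_spec f u

end Synthesis

/-! ## The Weil–Brezin isomorphism -/

section WeilBrezinIsomorphism

variable {g : ℕ} {n : ℤ}

/-- The phases of analysis and synthesis combine into a single character of the torus, so
orthogonality of characters selects one term. -/
theorem wbIntegrand_synTerm (hn : n ≠ 0) (p q : Fin g → ℤ) (f : (Fin g → ℝ) → ℂ)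
    (x y : Fin g → ℝ) : wbIntegrand n q (synTerm n p f) (x, y) =
      latticeChar (p - q) x * f (y + shiftVec n q - shiftVec n p) := by
  have h1 : ((x, y) + (0, shiftVec n q) : Cover g) = (x, y + shiftVec n q) := by
    ext j <;> simp
  have h2 : intVec (p - q) = (n : ℝ) • shiftVec n p - (n : ℝ) • shiftVec n q := by
    rw [smul_shiftVec hn, smul_shiftVec hn]
    ext j
    simp [intVec]
  rw [wbIntegrand, h1, synTerm, mul_right_comm, ← Complex.exp_add, latticeChar, h2]
  congr 2
  simp only [sub_dotProduct, smul_dotProduct, dotProduct_sub, dotProduct_add, dotProduct_smul,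
    smul_eq_mul, dotProduct_comm (shiftVec n p) x, dotProduct_comm (shiftVec n q) x]
  push_cast
  ring

theorem hasSum_wbCoeff_synOp (hn : n ≠ 0) (q q' : Fin g → ℤ) (f : SchwartzFun g)
    (y : Fin g → ℝ) :
    HasSum (fun m : Fin g → ℤ => if q + n • m = q' then f y else 0)
      (wbOp hn q' (synOp hn q f) y) := by
  have hF : ∀ (m : Fin g → ℤ) x, wbIntegrand n q' (synTerm n (q + n • m) f) (x, y) =
      latticeChar (q + n • m - q') x * f (y + shiftVec n q' - shiftVec n (q + n • m)) :=
    fun m x => wbIntegrand_synTerm hn _ _ _ _ _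
  have hcont : ∀ m : Fin g → ℤ, Continuous fun x =>
      wbIntegrand n q' (synTerm n (q + n • m) f) (x, y) := fun m => by
    simp only [hF]
    exact (continuous_latticeChar _).mul continuous_const
  have h1 := hasSum_integral_of_summable_integral_norm
    (μ := (volume : Measure (Fin g → ℝ)).restrict (Icc 0 1))
    (F := fun (m : Fin g → ℤ) x => wbIntegrand n q' (synTerm n (q + n • m) f) (x, y))
    (fun m => (hcont m).continuousOn.integrableOn_compact isCompact_Icc) (by
      simp only [hF, norm_mul, norm_latticeChar, one_mul]
      have := summable_synTerm hn q f (0, y + shiftVec n q')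
      simp only [norm_synTerm] at this
      simpa [volume_unitCube, Measure.real] using this)
  have h2 : ∀ x, ∑' m : Fin g → ℤ, wbIntegrand n q' (synTerm n (q + n • m) f) (x, y) =
      wbIntegrand n q' (synOp hn q f) (x, y) := fun x => by
    simp only [wbIntegrand, synOp_apply]
    rw [tsum_mul_right]
  simp only [h2] at h1
  rw [wbOp_apply, wbCoeff]
  refine h1.congr_fun fun m => ?_
  simp only [hF]
  rw [integral_mul_const, integral_latticeChar]
  by_cases h : q + n • m = q'
  · rw [if_pos h, h]
    simp
  · rw [if_neg h, if_neg (sub_ne_zero.2 h), zero_mul]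

theorem wbOp_synOp_self (hn : n ≠ 0) (q : Fin g → ℤ) (f : SchwartzFun g) :
    wbOp hn q (synOp hn q f) = f := by
  ext y
  have h := hasSum_wbCoeff_synOp hn q q f y
  have h' := hasSum_ite_eq (0 : Fin g → ℤ) (f y)
  refine (h.congr_fun fun m => ?_).unique h'
  have : q + n • m = q ↔ m = 0 := by
    rw [add_eq_left, smul_eq_zero, or_iff_right hn]
  simp only [this]

theorem wbOp_synOp_of_ne (hn : n ≠ 0) {q q' : Fin g → ℤ} (h : ∀ m, q + n • m ≠ q')
    (f : SchwartzFun g) : wbOp hn q' (synOp hn q f) = 0 := by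
  ext y
  have h1 := hasSum_wbCoeff_synOp hn q q' f y
  simp only [h, if_false] at h1
  exact h1.unique hasSum_zero

/-- The Fourier expansion of a section. -/
theorem hasSum_synTerm_wbCoeff (hn : n ≠ 0) (s : SmoothSection g n) (u : Cover g)
    (hsum : Summable fun q => ‖synTerm n q (wbCoeff n q s) u‖) :
    HasSum (fun q => synTerm n q (wbCoeff n q s) u) (s u) := by
  obtain ⟨x, y⟩ := u
  -- Multiplication by `e^{nπi x · y}` makes the section periodic in `x`, and the Fourier
  -- coefficient of index `q` is the Weil–Brezin coefficient at `y - q/n`.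
  let E : (Fin g → ℝ) → ℂ := fun x => Complex.exp (n * Real.pi * Complex.I * ((x ⬝ᵥ y : ℝ) : ℂ))
  have hE : Continuous E := by
    unfold E dotProduct
    fun_prop
  let F : (Fin g → ℝ) → ℂ := fun x => s (x, y) * E x
  have h0 : ∀ (q : Fin g → ℤ) x, latticeChar (-q) x * F x =
      wbIntegrand n q s (x, y - shiftVec n q) := by
    intro q x
    have h1 : ((x, y - shiftVec n q) + (0, shiftVec n q) : Cover g) = (x, y) := by
      ext j <;> simp
    have h2 : intVec (-q) = -((n : ℝ) • shiftVec n q) := by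
      rw [smul_shiftVec hn]
      ext j
      simp [intVec]
    rw [wbIntegrand, h1, latticeChar, mul_left_comm, ← Complex.exp_add, h2]
    congr 2
    simp only [neg_dotProduct, smul_dotProduct, dotProduct_sub, smul_eq_mul,
      dotProduct_comm (shiftVec n q) x]
    push_cast
    ring
  have hF : Continuous F := (s.continuous.comp (Continuous.prodMk_left y)).mul hE
  have hper : ∀ (m : Fin g → ℤ) x, F (x + intVec m) = F x := fun m x => by
    have h1 := h0 0 x
    have h2 := h0 0 (x + intVec m)
    rw [wbIntegrand_add_intVec hn, ← h1] at h2
    simpa [latticeChar_zero] using h2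
  have hcoef : ∀ q : Fin g → ℤ, ∫ x in Icc (0 : Fin g → ℝ) 1, latticeChar (-q) x * F x =
      wbCoeff n q s (y - shiftVec n q) := fun q => by
    simp only [h0]
    rfl
  simp only [norm_synTerm] at hsum
  have h1 := hasSum_fourier_of_periodic hF hper (by simpa only [hcoef] using hsum.of_norm) x
  have hE0 : (E x)⁻¹ * E x = 1 := inv_mul_cancel₀ (Complex.exp_ne_zero _)
  have h2 := h1.mul_left (E x)⁻¹
  have h3 : (E x)⁻¹ * F x = s (x, y) := by
    rw [mul_comm, mul_assoc, mul_comm (E x), hE0, mul_one]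
  rw [h3] at h2
  refine h2.congr_fun fun q => ?_
  rw [hcoef, synTerm, mul_left_comm, mul_comm _ (wbCoeff _ _ _ _)]
  congr 1
  rw [← Complex.exp_neg, latticeChar, ← smul_shiftVec hn, ← Complex.exp_add]
  congr 1
  simp only [smul_dotProduct, dotProduct_sub, dotProduct_smul, smul_eq_mul,
    dotProduct_comm (shiftVec n q) x]
  push_cast
  ring

/-- A family of indices is a set of representatives modulo `n`. -/
def IsResidueSystem (n : ℤ) {I : Type*} (idx : I → Fin g → ℤ) : Prop :=
  Function.Bijective fun p : I × (Fin g → ℤ) => idx p.1 + n • p.2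

/-- The Fourier modes of the section are grouped by residue class modulo `n`. Within a class the
coefficients coincide by `wbCoeff_add_smul`, so each class sums to one synthesis. -/
theorem sum_synOp_wbOp {I : Type*} [Fintype I] (hn : n ≠ 0) {idx : I → Fin g → ℤ}
    (hI : IsResidueSystem n idx) (s : SmoothSection g n) :
    ∑ i, synOp hn (idx i) (wbOp hn (idx i) s) = s := by
  refine SmoothSection.ext fun u => ?_
  let e := Equiv.ofBijective _ hI
  have h1 : ∀ i m, synTerm n (e (i, m)) (wbCoeff n (e (i, m)) s) u =
      synTerm n (idx i + n • m) (wbOp hn (idx i) s) u := fun i m => by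
    have h2 : e (i, m) = idx i + n • m := rfl
    rw [h2, wbCoeff_add_smul hn, show ⇑(wbOp hn (idx i) s) = _ from funext (wbOp_apply hn _ s)]
  have h2 : Summable fun p : I × (Fin g → ℤ) => ‖synTerm n (e p) (wbCoeff n (e p) s) u‖ := by
    rw [summable_prod_of_nonneg fun _ => norm_nonneg _]
    refine ⟨fun i => ?_, (hasSum_fintype _).summable⟩
    simp only [h1]
    exact summable_synTerm hn _ _ _
  have h3 := hasSum_synTerm_wbCoeff hn s u (e.summable_iff.1 h2)
  rw [SmoothSection.sum_apply]
  have h4 := e.hasSum_iff.2 h3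
  have h5 := h4.prod_fiberwise fun i => by
    simp only [Function.comp, h1]
    exact (summable_synTerm hn _ _ u).of_norm.hasSum
  rw [h5.unique (hasSum_fintype _)]
  exact Finset.sum_congr rfl fun i _ => synOp_apply hn _ _ u

theorem isResidueSystem_natCast {k : ℕ} (hk : 0 < k) :
    IsResidueSystem (k : ℤ) fun (l : Fin g → Fin k) j => ((l j : ℕ) : ℤ) := by
  have hk' : (0 : ℤ) < k := by exact_mod_cast hk
  have hl : ∀ (l : Fin g → Fin k) j, (((l j : ℕ) : ℤ)) < k := fun l j => by exact_mod_cast (l j).2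
  constructor
  · rintro ⟨l, m⟩ ⟨l', m'⟩ h
    have h1 : ∀ j, ((l j : ℕ) : ℤ) + k * m j = ((l' j : ℕ) : ℤ) + k * m' j := fun j => congrFun h j
    have h2 : ∀ j, m j = m' j := fun j => by
      have h3 := congrArg (· / (k : ℤ)) (h1 j)
      simpa [Int.add_mul_ediv_left _ _ hk'.ne', Int.ediv_eq_zero_of_lt, hl] using h3
    refine Prod.ext (funext fun j => Fin.ext ?_) (funext h2)
    have := h1 j
    rw [h2 j] at this
    exact_mod_cast add_right_cancel this
  · intro p
    refine ⟨(fun j => ⟨(p j % k).toNat, ?_⟩, fun j => p j / k), funext fun j => ?_⟩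
    · have := Int.emod_lt_of_pos (p j) hk'
      have := Int.emod_nonneg (p j) hk'.ne'
      omega
    · have := Int.emod_nonneg (p j) hk'.ne'
      simp only [Pi.add_apply, Pi.smul_apply, smul_eq_mul, Int.toNat_of_nonneg this]
      exact Int.emod_add_mul_ediv (p j) k

theorem IsResidueSystem.neg {I : Type*} {idx : I → Fin g → ℤ} (h : IsResidueSystem n idx) :
    IsResidueSystem (-n) fun i => -idx i := by
  have : (fun p : I × (Fin g → ℤ) => -idx p.1 + -n • p.2) =
      (Equiv.neg (Fin g → ℤ)) ∘ fun p => idx p.1 + n • p.2 := by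
    funext p
    simp only [Function.comp, Equiv.neg_apply, neg_smul, neg_add]
  rw [IsResidueSystem, this]
  exact (Equiv.neg _).bijective.comp h

theorem IsResidueSystem.add_smul_ne {I : Type*} {idx : I → Fin g → ℤ} (h : IsResidueSystem n idx)
    {i i' : I} (hi : i ≠ i') (m : Fin g → ℤ) : idx i + n • m ≠ idx i' := fun h' =>
  hi (congrArg Prod.fst (h.1 (a₁ := (i, m)) (a₂ := (i', 0)) (by simpa using h')))

theorem shiftVec_neg_neg (n : ℤ) (q : Fin g → ℤ) : shiftVec (-n) (-q) = shiftVec n q := by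
  ext j
  simp [shiftVec]

theorem setIntegral_unitCell {F : Cover g → ℂ} (hF : Continuous F) :
    ∫ u in unitCell g, F u =
      ∫ y in Icc (0 : Fin g → ℝ) 1, ∫ x in Icc (0 : Fin g → ℝ) 1, F (x, y) := by
  have h1 : unitCell g = Icc (0 : Fin g → ℝ) 1 ×ˢ Icc (0 : Fin g → ℝ) 1 :=
    (Icc_prod_eq _ _).trans rfl
  have hi : IntegrableOn F (unitCell g) := hF.continuousOn.integrableOn_compact isCompact_Icc
  rw [h1] at hi ⊢
  rw [Measure.volume_eq_prod, ← setIntegral_prod_swap, setIntegral_prod]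
  · rfl
  · exact hi.swap

theorem volume_unitCell : volume (unitCell g) = 1 := by
  have h1 : unitCell g = Icc (0 : Fin g → ℝ) 1 ×ˢ Icc (0 : Fin g → ℝ) 1 :=
    (Icc_prod_eq _ _).trans rfl
  rw [h1, Measure.volume_eq_prod, Measure.prod_prod, volume_unitCube, one_mul]

theorem norm_le_one_of_mem_unitCell {u : Cover g} (hu : u ∈ unitCell g) : ‖u‖ ≤ 1 :=
  max_le (norm_le_one_of_mem_Icc (y := u.1) ⟨hu.1.1, hu.2.1⟩)
    (norm_le_one_of_mem_Icc (y := u.2) ⟨hu.1.2, hu.2.2⟩)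

theorem integrable_schwartzMul_sub (f h : SchwartzFun g) (r : Fin g → ℝ) :
    Integrable fun y => f (y - r) * h (y - r) :=
  (integrable_schwartz_mul f h).comp_sub_right r

/-- The synthesis operator is the transpose of the Weil–Brezin coefficient. -/
theorem integral_unitCell_synOp_mul (hn : n ≠ 0) (hn' : -n ≠ 0) (q : Fin g → ℤ) (f : SchwartzFun g)
    (φ : SmoothSection g (-n)) :
    ∫ u in unitCell g, synOp hn q f u * φ u = ∫ v, f v * wbOp hn' (-q) φ v := by
  obtain ⟨p, -, hp⟩ := exists_norm_synTerm_le hn q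
  have hcont : ∀ m : Fin g → ℤ, Continuous fun u => synTerm n (q + n • m) f u * φ u := fun m =>
    (continuous_synTerm _ f).mul φ.continuous
  have hint : ∀ m : Fin g → ℤ, IntegrableOn (fun u => synTerm n (q + n • m) f u * φ u) (unitCell g) :=
    fun m => (hcont m).continuousOn.integrableOn_compact isCompact_Icc
  have h1 := hasSum_integral_of_summable_integral_norm hint (by
    refine Summable.of_nonneg_of_le (fun m => integral_nonneg fun _ => norm_nonneg _) (fun m => ?_)
      ((summable_one_add_norm_intVec g).mul_left
        (p f * 2 ^ (g + 1) * sectionSeminorm g (-n) 0 φ))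
    have hb : ∀ u ∈ unitCell g, ‖synTerm n (q + n • m) f u * φ u‖ ≤
        p f * 2 ^ (g + 1) * sectionSeminorm g (-n) 0 φ * ((1 + ‖intVec m‖) ^ (g + 1))⁻¹ := by
      intro u hu
      rw [norm_mul, mul_right_comm]
      refine mul_le_mul ((hp f m u).trans ?_) (φ.norm_le u) (norm_nonneg _) (by positivity)
      refine mul_le_mul_of_nonneg_right (mul_le_mul_of_nonneg_left ?_ (apply_nonneg p f))
        (by positivity)
      have := norm_le_one_of_mem_unitCell hu
      gcongr
      linarith
    have := norm_setIntegral_le_of_norm_le_const (μ := volume) (s := unitCell g)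
      (f := fun u => ‖synTerm n (q + n • m) f u * φ u‖) (by simp [volume_unitCell])
      fun u hu => by rw [norm_norm]; exact hb u hu
    refine (Real.le_norm_self _).trans ?_
    simpa only [volume_unitCell, Measure.real, ENNReal.toReal_one, mul_one] using this)
  have h2 : ∀ u, ∑' m : Fin g → ℤ, synTerm n (q + n • m) f u * φ u = synOp hn q f u * φ u :=
    fun u => by rw [tsum_mul_right, synOp_apply]
  simp only [h2] at h1
  -- For each `m` the `x`-integral is the coefficient of `φ` of index `-(q + nm)`, which depends
  -- only on `-q`. The remaining integrals over unit cubes are those of translates of one function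
  -- and add up to its integral over `ℝ^g`.
  let G : (Fin g → ℝ) → ℂ := fun y => f (y - shiftVec n q) * wbOp hn' (-q) φ (y - shiftVec n q)
  have h3 : ∀ m : Fin g → ℤ, ∫ u in unitCell g, synTerm n (q + n • m) f u * φ u =
      ∫ y in Icc (0 : Fin g → ℝ) 1, G (y + intVec (-m)) := fun m => by
    rw [setIntegral_unitCell (hcont m)]
    refine integral_congr_ae (Filter.Eventually.of_forall fun y => ?_)
    have h4 : wbOp hn' (-q) φ = wbOp hn' (-(q + n • m)) φ := by
      ext v
      rw [wbOp_apply, wbOp_apply, neg_add, ← neg_smul, wbCoeff_add_smul hn']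
    have h5 : y + intVec (-m) - shiftVec n q = y - shiftVec n (q + n • m) := by
      rw [shiftVec_add_smul hn]
      ext j
      simp [intVec]
      ring
    simp only [G]
    rw [h4, h5, wbOp_apply, wbCoeff, ← integral_const_mul]
    refine integral_congr_ae (Filter.Eventually.of_forall fun x => ?_)
    have h6 : ((x, y - shiftVec n (q + n • m)) + (0, shiftVec n (q + n • m)) : Cover g) = (x, y) := by
      ext j <;> simp
    simp only [synTerm, wbIntegrand, shiftVec_neg_neg]
    rw [h6, mul_comm (Complex.exp _), mul_assoc, mul_comm (Complex.exp _)]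
    congr 3
    rw [sub_sub, ← two_smul ℝ]
    push_cast
    ring
  simp only [h3] at h1
  have h7 := (Equiv.neg (Fin g → ℤ)).hasSum_iff.2
    (hasSum_integral_unitCube (integrable_schwartzMul_sub f (wbOp hn' (-q) φ) (shiftVec n q)))
  rw [← integral_sub_right_eq_self (fun v => f v * wbOp hn' (-q) φ v) (shiftVec n q)]
  exact h1.unique h7

end WeilBrezinIsomorphism

/-! ## The quantum spaces -/

section CovariantSynthesis

variable {g : ℕ} {n : ℤ}

theorem wbOp_nablaOp (hn : n ≠ 0) (q : Fin g → ℤ) (s : SmoothSection g n) (a : Fin g ⊕ Fin g) :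
    wbOp hn q (nablaOp n a s) = schwartzNabla n a (wbOp hn q s) := by
  cases a with
  | inl j => rw [wbOp_nablaOp_inl]; rfl
  | inr j => rw [wbOp_nablaOp_inr]; rfl

theorem nablaOp_synOp (hn : n ≠ 0) (q : Fin g → ℤ) (f : SchwartzFun g) (a : Fin g ⊕ Fin g) :
    nablaOp n a (synOp hn q f) = synOp hn q (schwartzNabla n a f) := by
  refine SmoothSection.ext fun u => ?_
  obtain ⟨h1, h2⟩ := hasFDerivAt_synFun hn q f u
  have h3 := (ContinuousLinearMap.apply ℝ ℂ (coverVec a : Cover g)).map_tsum h2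
  simp only [ContinuousLinearMap.apply_apply, frameForm_coverVec] at h3
  have h4 : (synOp hn q f : Cover g → ℂ) = synFun n q f := funext (synOp_apply hn q f)
  rw [nablaOp_apply, h4, h1.fderiv, h3, synOp_apply, synFun]
  simp only [synTermDeriv]
  rw [(summable_synTerm hn q _ u).of_norm.tsum_sub
    (((summable_synTerm hn q f u).of_norm.mul_left _).mul_left _), tsum_mul_left, tsum_mul_left,
    sub_add_cancel]

/-- The product of a section with a smooth periodic function. -/
noncomputable def mulSection (a : Cover g → ℂ) (ha : ContDiff ℝ ∞ a)
    (hper : ∀ (m : (Fin g → ℤ) × (Fin g → ℤ)) (u : Cover g), a (u + latticeVec m) = a u)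
    (s : SmoothSection g n) : SmoothSection g n :=
  ⟨fun u => a u * s u, ha.mul s.2.1, fun m u => by
    change a (u + latticeVec m) * s.1 (u + latticeVec m) = _ * (a u * s.1 u)
    rw [hper, s.2.2, mul_left_comm]⟩

/-- The covariant derivative along the vector `conjPolVec τ e_j`. -/
noncomputable def polNabla (n : ℤ) (τ : Matrix (Fin g) (Fin g) ℂ) (j : Fin g) :
    SmoothSection g n →L[ℂ] SmoothSection g n :=
  ∑ a, Sum.elim (fun i => Complex.I * (1 - τ) i j) (fun i => (1 + τ) i j) a • nablaOp n a

theorem polNabla_apply (τ : Matrix (Fin g) (Fin g) ℂ) (j : Fin g) (s : SmoothSection g n) :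
    polNabla n τ j s =
      ∑ a, Sum.elim (fun i => Complex.I * (1 - τ) i j) (fun i => (1 + τ) i j) a • nablaOp n a s := by
  rw [polNabla, ContinuousLinearMap.sum_apply]
  rfl

theorem polNabla_apply_apply (τ : Matrix (Fin g) (Fin g) ℂ) (j : Fin g) (s : SmoothSection g n)
    (u : Cover g) : polNabla n τ j s u = covDeriv n s u (conjPolVec τ (Pi.single j 1)) := by
  rw [polNabla_apply, SmoothSection.sum_apply, covDeriv_eq_sum_nablaOp]
  refine Finset.sum_congr rfl fun a _ => ?_
  rw [SmoothSection.smul_apply]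
  cases a <;> simp [conjPolVec]

theorem divCovDeriv_constField_conjPolVec (τ : Matrix (Fin g) (Fin g) ℂ) (j : Fin g)
    (s : SmoothSection g n) :
    divCovDeriv n (constField (conjPolVec τ (Pi.single j 1))) s = polNabla n τ j s :=
  SmoothSection.ext fun u => by rw [divCovDeriv_constField_apply, polNabla_apply_apply]

theorem sum_conjPolVec_coord (τ : Matrix (Fin g) (Fin g) ℂ) (v : Fin g → ℂ) (a : Fin g ⊕ Fin g) :
    Sum.elim (conjPolVec τ v).1 (conjPolVec τ v).2 a =
      ∑ j, v j * Sum.elim (conjPolVec τ (Pi.single j 1)).1 (conjPolVec τ (Pi.single j 1)).2 a := by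
  cases a with
  | inl i =>
    simp only [conjPolVec, Sum.elim_inl, mulVec_single_one, Pi.smul_apply, smul_eq_mul, mulVec,
      dotProduct, Finset.mul_sum, col_apply]
    exact Finset.sum_congr rfl fun j _ => by ring
  | inr i =>
    simp only [conjPolVec, Sum.elim_inr, mulVec_single_one, mulVec, dotProduct, col_apply]
    exact Finset.sum_congr rfl fun j _ => by ring

theorem covDeriv_mul {a s : Cover g → ℂ} {u : Cover g} (ha : DifferentiableAt ℝ a u)
    (hs : DifferentiableAt ℝ s u) (w : CTangent g) :
    covDeriv n (fun u => a u * s u) u w = a u * covDeriv n s u w + complexDeriv a u w * s u := by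
  have h2 := (ha.hasFDerivAt.fun_mul hs.hasFDerivAt).fderiv
  rw [covDeriv_eq_sum, covDeriv_eq_sum, complexDeriv_eq_sum, h2, Finset.mul_sum, Finset.sum_mul,
    ← Finset.sum_add_distrib]
  refine Finset.sum_congr rfl fun b _ => ?_
  simp only [_root_.add_apply, _root_.smul_apply, smul_eq_mul]
  ring

theorem covDeriv_conjPolVec {s : Cover g → ℂ} (u : Cover g) (τ : Matrix (Fin g) (Fin g) ℂ)
    (v : Fin g → ℂ) : covDeriv n s u (conjPolVec τ v) =
      ∑ j, v j * covDeriv n s u (conjPolVec τ (Pi.single j 1)) := by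
  simp only [covDeriv_eq_sum]
  simp only [sum_conjPolVec_coord τ v, Finset.mul_sum, Finset.sum_mul]
  rw [Finset.sum_comm]
  simp only [mul_assoc]

theorem divergence_eq_sum_complexDeriv {τ : Matrix (Fin g) (Fin g) ℂ} (ξ : TorusVectorField g)
    {v : Cover g → Fin g → ℂ} (hv : ∀ u, ξ.toFun u = conjPolVec τ (v u)) {u : Cover g}
    (hd : ∀ j, DifferentiableAt ℝ (fun u => v u j) u) :
    divergence ξ u = ∑ j, complexDeriv (fun u => v u j) u (conjPolVec τ (Pi.single j 1)) := by
  have h1 : divergence ξ u = ∑ a : Fin g ⊕ Fin g,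
      fderiv ℝ (fun u' => Sum.elim (ξ.toFun u').1 (ξ.toFun u').2 a) u (coverVec a) := by
    rw [Fintype.sum_sum_type, ← Finset.sum_add_distrib]
    rfl
  rw [h1]
  simp only [complexDeriv_eq_sum]
  rw [Finset.sum_comm]
  refine Finset.sum_congr rfl fun a _ => ?_
  simp only [hv, sum_conjPolVec_coord τ (v _)]
  have h2 := HasFDerivAt.fun_sum (u := Finset.univ) fun j _ => (hd j).hasFDerivAt.mul_const
    (Sum.elim (conjPolVec τ (Pi.single j 1)).1 (conjPolVec τ (Pi.single j 1)).2 a)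
  rw [h2.fderiv, ContinuousLinearMap.sum_apply]
  exact Finset.sum_congr rfl fun j _ => by simp

/-- The weak covariant derivative along a field with values in the conjugate polarization is a sum
of covariant derivatives along constant fields. -/
theorem exists_divCovDeriv_eq_sum {τ : Matrix (Fin g) (Fin g) ℂ} (ξ : TorusVectorField g)
    (hξ : ∀ u, star (ξ.toFun u) ∈ siegelPolarization τ) (s : SmoothSection g n) :
    ∃ t : Fin g → SmoothSection g n, divCovDeriv n ξ s = ∑ j, polNabla n τ j (t j) := by
  -- The field is expanded in the constant frame `conjPolVec τ e_j` with periodic coefficients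
  -- `v_j`. Its divergence is the sum of the derivatives of `v_j` along the frame, which is exactly
  -- the Leibniz term for the sections `v_j s`.
  obtain ⟨v, hv'⟩ : ∃ v : Cover g → Fin g → ℂ, ∀ u, v u = (1 / 2 : ℂ) • antiPart (ξ.toFun u) :=
    ⟨_, fun _ => rfl⟩
  have hv : ∀ u, ξ.toFun u = conjPolVec τ (v u) := fun u => by
    rw [hv']
    exact eq_conjPolVec_of_star_mem (hξ u)
  have hs : ∀ j, ContDiff ℝ ∞ fun u => v u j := fun j => by
    have h1 : ContDiff ℝ ∞ fun u => (ξ.toFun u).1 j :=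
      (contDiff_apply ℝ ℂ j).comp (contDiff_fst.comp ξ.smooth)
    have h2 : ContDiff ℝ ∞ fun u => (ξ.toFun u).2 j :=
      (contDiff_apply ℝ ℂ j).comp (contDiff_snd.comp ξ.smooth)
    simp only [hv', Pi.smul_apply, antiPart_apply, smul_eq_mul, Pi.sub_apply]
    exact contDiff_const.mul (h2.sub (contDiff_const.mul h1))
  have hper : ∀ j (m : (Fin g → ℤ) × (Fin g → ℤ)) (u : Cover g),
      v (u + latticeVec m) j = v u j := fun j m u => by simp only [hv', ξ.periodic]
  refine ⟨fun j => mulSection (fun u => v u j) (hs j) (hper j) s, SmoothSection.ext fun u => ?_⟩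
  have hd : ∀ j, DifferentiableAt ℝ (fun u => v u j) u := fun j =>
    (hs j).differentiable (by simp) u
  rw [divCovDeriv_apply, SmoothSection.sum_apply, divergence_eq_sum_complexDeriv ξ hv hd, hv,
    covDeriv_conjPolVec, Finset.sum_mul, ← Finset.sum_add_distrib]
  refine Finset.sum_congr rfl fun j _ => ?_
  rw [polNabla_apply_apply, add_comm]
  exact (covDeriv_mul (hd j) (s.differentiable u) _).symm

end CovariantSynthesis

/-! ### The theta sections as a basis of the quantum space -/

section QuantumSpace

variable {g k : ℕ}

/-- Only constant fields need to be tested, because periodic coefficients can be moved into the test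
section. -/
theorem mem_quantumSpace_iff {τ : Matrix (Fin g) (Fin g) ℂ} {σ : DistSection g k} :
    σ ∈ quantumSpace k (siegelPolarization τ) ↔ ∀ j φ, σ (polNabla (-(k : ℤ)) τ j φ) = 0 := by
  constructor
  · intro h j φ
    have h1 := h (constField (conjPolVec τ (Pi.single j 1)))
      (fun _ => star_conjPolVec_mem τ _) φ
    rwa [weakCovDeriv, neg_eq_zero, divCovDeriv_constField_conjPolVec] at h1
  · intro h ξ hξ φ
    obtain ⟨t, ht⟩ := exists_divCovDeriv_eq_sum (n := -(k : ℤ)) ξ hξ φ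
    rw [weakCovDeriv, ht, map_sum, neg_eq_zero]
    exact Finset.sum_eq_zero fun j _ => h j (t j)

/-- The index `l` as an integer vector. -/
def residue (l : Fin g → Fin k) : Fin g → ℤ := fun j => ((l j : ℕ) : ℤ)

theorem natCast_int_ne_zero (hk : 0 < k) : (k : ℤ) ≠ 0 := by exact_mod_cast hk.ne'

theorem neg_natCast_int_ne_zero (hk : 0 < k) : -(k : ℤ) ≠ 0 :=
  neg_ne_zero.2 (natCast_int_ne_zero hk)

theorem isResidueSystem_residue (hk : 0 < k) :
    IsResidueSystem (k : ℤ) (residue : (Fin g → Fin k) → Fin g → ℤ) := isResidueSystem_natCast hk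

/-- The Weil–Brezin coefficient of a test section. -/
noncomputable def testCoeff (hk : 0 < k) (l : Fin g → Fin k) :
    SmoothSection g (-(k : ℤ)) →L[ℂ] SchwartzFun g :=
  wbOp (neg_natCast_int_ne_zero hk) (-residue l)

/-- The synthesis of a test section. -/
noncomputable def testSyn (hk : 0 < k) (l : Fin g → Fin k) :
    SchwartzFun g →L[ℂ] SmoothSection g (-(k : ℤ)) :=
  synOp (neg_natCast_int_ne_zero hk) (-residue l)

theorem sum_testSyn_testCoeff (hk : 0 < k) (φ : SmoothSection g (-(k : ℤ))) :
    ∑ l, testSyn hk l (testCoeff hk l φ) = φ :=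
  sum_synOp_wbOp (neg_natCast_int_ne_zero hk) (isResidueSystem_residue hk).neg φ

theorem testCoeff_testSyn (hk : 0 < k) (l l' : Fin g → Fin k) (f : SchwartzFun g) :
    testCoeff hk l' (testSyn hk l f) = if l = l' then f else 0 := by
  split_ifs with h
  · subst h
    exact wbOp_synOp_self _ _ f
  · exact wbOp_synOp_of_ne _ (fun m => (isResidueSystem_residue hk).neg.add_smul_ne h m) f

/-- On `L^{-k}` the derivative `∇_{x_i}` acts as `2πi k y_i`; with the frame coefficient `i(1 - τ)`
this is the coordinate part of `vacuumOp` for `c = k`. Symmetry of `τ` matches rows with columns. -/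
theorem sum_schwartzNabla_eq_vacuumOp {τ : Matrix (Fin g) (Fin g) ℂ} (hτ : τ.IsSymm) (j : Fin g)
    (f : SchwartzFun g) :
    ∑ a, Sum.elim (fun i => Complex.I * (1 - τ) i j) (fun i => (1 + τ) i j) a •
      schwartzNabla (-(k : ℤ)) a f = vacuumOp (k : ℝ) τ j f := by
  have h1 : ∀ i, (1 - τ) i j = (1 - τ) j i := fun i =>
    congrFun (congrFun ((isSymm_one.sub hτ) : (1 - τ)ᵀ = 1 - τ) j) i
  have h2 : ∀ i, (1 + τ) i j = (1 + τ) j i := fun i =>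
    congrFun (congrFun ((isSymm_one.add hτ) : (1 + τ)ᵀ = 1 + τ) j) i
  rw [vacuumOp_apply, Fintype.sum_sum_type, Finset.smul_sum,
    sub_eq_neg_add (∑ i, (1 + τ) j i • partialOp i f), ← Finset.sum_neg_distrib]
  congr 1
  · refine Finset.sum_congr rfl fun i _ => ?_
    simp only [Sum.elim_inl, schwartzNabla, _root_.smul_apply, smul_smul, h1, ← neg_smul]
    congr 1
    push_cast
    linear_combination (2 * Real.pi * k * (1 - τ) j i : ℂ) * Complex.I_mul_I
  · exact Finset.sum_congr rfl fun i _ => by simp only [Sum.elim_inr, schwartzNabla, h2]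

theorem testCoeff_polNabla (hk : 0 < k) {τ : Matrix (Fin g) (Fin g) ℂ} (hτ : τ.IsSymm)
    (l : Fin g → Fin k) (j : Fin g) (φ : SmoothSection g (-(k : ℤ))) :
    testCoeff hk l (polNabla (-(k : ℤ)) τ j φ) = vacuumOp (k : ℝ) τ j (testCoeff hk l φ) := by
  rw [polNabla_apply, map_sum, ← sum_schwartzNabla_eq_vacuumOp hτ]
  exact Finset.sum_congr rfl fun a _ => by rw [map_smul, testCoeff, wbOp_nablaOp]

theorem polNabla_testSyn (hk : 0 < k) {τ : Matrix (Fin g) (Fin g) ℂ} (hτ : τ.IsSymm)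
    (l : Fin g → Fin k) (j : Fin g) (f : SchwartzFun g) :
    polNabla (-(k : ℤ)) τ j (testSyn hk l f) = testSyn hk l (vacuumOp (k : ℝ) τ j f) := by
  rw [polNabla_apply, ← sum_schwartzNabla_eq_vacuumOp hτ, map_sum]
  exact Finset.sum_congr rfl fun a _ => by rw [map_smul, testSyn, nablaOp_synOp]

theorem natCast_real_pos (hk : 0 < k) : (0 : ℝ) < k := by exact_mod_cast hk

/-- The normalized theta sections, as distributional sections over the closed disc. -/
noncomputable def thetaDist (hk : 0 < k) (l : Fin g → Fin k) (τ : Matrix (Fin g) (Fin g) ℂ) :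
    DistSection g k :=
  (gaussFunctional (natCast_real_pos hk) τ).comp (testCoeff hk l)

theorem thetaDist_apply (hk : 0 < k) (l : Fin g → Fin k) (τ : Matrix (Fin g) (Fin g) ℂ)
    (φ : SmoothSection g (-(k : ℤ))) :
    thetaDist hk l τ φ = gaussFunctional (natCast_real_pos hk) τ (testCoeff hk l φ) := rfl

theorem thetaDist_mem_quantumSpace (hk : 0 < k) (l : Fin g → Fin k)
    {τ : Matrix (Fin g) (Fin g) ℂ} (hτ : τ ∈ closedSiegelDisc g) :
    thetaDist hk l τ ∈ quantumSpace k (siegelPolarization τ) := by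
  rw [mem_quantumSpace_iff]
  intro j φ
  rw [thetaDist_apply, testCoeff_polNabla hk hτ.1]
  exact isVacuum_gaussFunctional _ hτ j _

/-- The test section that detects the coefficient of the `l`-th theta section. -/
noncomputable def probeSection (hk : 0 < k) (l : Fin g → Fin k) : SmoothSection g (-(k : ℤ)) :=
  testSyn hk l (coherent (natCast_real_pos hk) 0)

/-- The probe sections are dual to the frame up to a nonzero constant independent of `τ`. Linear
independence and the continuous inverse of the trivialization both follow. -/
theorem sum_smul_thetaDist_probeSection (hk : 0 < k) {τ : Matrix (Fin g) (Fin g) ℂ}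
    (hτ : τ ∈ closedSiegelDisc g) (c : (Fin g → Fin k) → ℂ) (l : Fin g → Fin k) :
    (∑ l', c l' • thetaDist hk l' τ) (probeSection hk l) = c l * resolutionConst g k := by
  rw [ContinuousLinearMap.sum_apply, Finset.sum_eq_single l]
  · rw [_root_.smul_apply, smul_eq_mul, thetaDist_apply, probeSection, testCoeff_testSyn, if_pos rfl,
      gaussFunctional_coherent_zero _ hτ]
  · intro l' _ hl
    rw [_root_.smul_apply, thetaDist_apply, probeSection, testCoeff_testSyn, if_neg hl.symm, map_zero,
      smul_zero]
  · simp

/-- Composed with the synthesis of each residue class, `σ` becomes a vacuum functional, which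
uniqueness identifies with a multiple of `gaussFunctional`. -/
theorem eq_sum_smul_thetaDist (hk : 0 < k) {τ : Matrix (Fin g) (Fin g) ℂ}
    (hτ : τ ∈ closedSiegelDisc g) {σ : DistSection g k}
    (hσ : σ ∈ quantumSpace k (siegelPolarization τ)) :
    σ = ∑ l, (σ (probeSection hk l) / resolutionConst g k) • thetaDist hk l τ := by
  have hR := resolutionConst_ne_zero (g := g) (natCast_real_pos hk)
  rw [mem_quantumSpace_iff] at hσ
  have hvac : ∀ l, IsVacuum (k : ℝ) τ (σ.comp (testSyn hk l)) := fun l j f => by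
    rw [ContinuousLinearMap.comp_apply, ← polNabla_testSyn hk hτ.1, hσ]
  ext φ
  conv_lhs => rw [← sum_testSyn_testCoeff hk φ, map_sum]
  rw [ContinuousLinearMap.sum_apply]
  refine Finset.sum_congr rfl fun l _ => ?_
  have h := (hvac l).eq_smul_gaussFunctional (natCast_real_pos hk) hτ (testCoeff hk l φ)
  rw [_root_.smul_apply, smul_eq_mul, thetaDist_apply, div_mul_eq_mul_div, eq_div_iff hR, mul_comm]
  exact h

theorem linearIndependent_thetaDist (hk : 0 < k) {τ : Matrix (Fin g) (Fin g) ℂ}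
    (hτ : τ ∈ closedSiegelDisc g) : LinearIndependent ℂ fun l => thetaDist hk l τ := by
  rw [Fintype.linearIndependent_iff]
  intro c hc l
  have h := sum_smul_thetaDist_probeSection hk hτ c l
  rw [hc] at h
  exact (mul_eq_zero.1 h.symm).resolve_right (resolutionConst_ne_zero (natCast_real_pos hk))

theorem span_thetaDist (hk : 0 < k) {τ : Matrix (Fin g) (Fin g) ℂ}
    (hτ : τ ∈ closedSiegelDisc g) : Submodule.span ℂ (Set.range fun l => thetaDist hk l τ) =
      quantumSpace k (siegelPolarization τ) := by
  refine le_antisymm (Submodule.span_le.2 ?_) fun σ hσ => ?_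
  · rintro _ ⟨l, rfl⟩
    exact thetaDist_mem_quantumSpace hk l hτ
  · rw [eq_sum_smul_thetaDist hk hτ hσ]
    exact Submodule.sum_mem _ fun l _ => Submodule.smul_mem _ _ (Submodule.subset_span ⟨l, rfl⟩)

theorem finrank_quantumSpace (hk : 0 < k) {P : Submodule ℂ (CTangent g)}
    (hP : P ∈ nonnegLagrangians g) : Module.finrank ℂ (quantumSpace k P) = k ^ g := by
  obtain ⟨τ, hτ, rfl⟩ := (bijOn_siegelPolarization (g := g)).surjOn hP
  rw [← span_thetaDist hk hτ, finrank_span_eq_card (linearIndependent_thetaDist hk hτ)]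
  simp

/-- Convergence in the strong dual is uniform on bounded sets of test sections. On such a set the
continuous seminorm controlling `gaussFunctional` is bounded, and the other factor of the estimate
depends only on `τ`. -/
theorem continuousOn_thetaDist (hk : 0 < k) (l : Fin g → Fin k) :
    ContinuousOn (thetaDist hk l) (closedSiegelDisc g) := by
  intro τ₀ hτ₀
  obtain ⟨q, ρ, hq, hρ, h⟩ := exists_norm_gaussFunctional_sub_le (natCast_real_pos hk) hτ₀
  refine (UniformConvergenceCLM.tendsto_iff_tendstoUniformlyOn (RingHom.id ℂ) ℂ _).2 fun S hS => ?_
  obtain ⟨I, B, -, hB⟩ := Seminorm.bound_of_continuous (sectionSeminorm_withSeminorms g (-(k : ℤ)))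
    (q.comp (testCoeff hk l).toLinearMap) (hq.comp (testCoeff hk l).continuous)
  obtain ⟨r, -, hr⟩ :=
    (sectionSeminorm_withSeminorms g (-(k : ℤ))).isVonNBounded_iff_finset_seminorm_bounded.1 hS I
  have hC : ∀ φ ∈ S, q (testCoeff hk l φ) ≤ B * r := fun φ hφ =>
    (hB φ).trans (mul_le_mul_of_nonneg_left (hr φ hφ).le B.2)
  rw [Metric.tendstoUniformlyOn_iff]
  intro ε hε
  -- The maximum and the absolute value are needed because no sign is recorded for `r` and `ρ τ`.
  have h1 : Filter.Tendsto (fun τ => max (B * r) 0 * |ρ τ|) (nhdsWithin τ₀ (closedSiegelDisc g))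
      (nhds 0) := by simpa using hρ.abs.const_mul (max (B * r) 0)
  filter_upwards [h1.eventually_lt_const hε, self_mem_nhdsWithin] with τ h2 hτ φ hφ
  rw [dist_comm, dist_eq_norm]
  refine lt_of_le_of_lt (h τ hτ _) (lt_of_le_of_lt ?_ h2)
  exact (mul_le_mul_of_nonneg_left (le_abs_self _) (apply_nonneg q _)).trans
    (mul_le_mul_of_nonneg_right ((hC φ hφ).trans (le_max_left _ _)) (abs_nonneg _))

end QuantumSpace

/-! ### Trivialization of the quantum bundle and the classical theta series -/

section ThetaFrame

variable {g k : ℕ}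

/-- The trivialization of the quantum bundle by the theta sections. -/
noncomputable def thetaFrame (hk : 0 < k) (p : closedSiegelDisc g × ((Fin g → Fin k) → ℂ)) :
    CorrectedBundle g k :=
  (p.1, ∑ l, p.2 l • thetaDist hk l p.1)

theorem continuous_thetaFrame (hk : 0 < k) : Continuous (thetaFrame (g := g) hk) := by
  refine Continuous.prodMk (continuous_subtype_val.comp continuous_fst) ?_
  refine continuous_finsetSum _ fun l _ => Continuous.smul
    ((continuous_apply l).comp continuous_snd) ?_
  exact (continuousOn_iff_continuous_restrict.1 (continuousOn_thetaDist hk l)).comp continuous_fst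

/-- Evaluation on the probe sections is continuous on the whole ambient bundle and recovers the
coefficients, so the topology is induced. -/
theorem isEmbedding_thetaFrame (hk : 0 < k) : Topology.IsEmbedding (thetaFrame (g := g) hk) := by
  let r : CorrectedBundle g k → Matrix (Fin g) (Fin g) ℂ × ((Fin g → Fin k) → ℂ) :=
    fun p => (p.1, fun l => p.2 (probeSection hk l) / resolutionConst g k)
  have hr : Continuous r := by
    refine Continuous.prodMk continuous_fst (continuous_pi fun l => ?_)
    exact ((ContinuousEvalConst.continuous_eval_const (probeSection hk l)).comp
      continuous_snd).div_const _
  refine Topology.IsEmbedding.of_comp (continuous_thetaFrame hk) hr ?_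
  have h : r ∘ thetaFrame hk = Prod.map Subtype.val id := by
    funext p
    refine Prod.ext rfl (funext fun l => ?_)
    have h1 := sum_smul_thetaDist_probeSection hk p.1.2 p.2 l
    simp only [r, Function.comp, thetaFrame, Prod.map, id]
    rw [h1, mul_div_cancel_right₀ _ (resolutionConst_ne_zero (natCast_real_pos hk))]
  rw [h]
  exact Topology.IsEmbedding.subtypeVal.prodMap Topology.IsEmbedding.id

theorem sum_smul_thetaDist_mem (hk : 0 < k) {τ : Matrix (Fin g) (Fin g) ℂ}
    (hτ : τ ∈ closedSiegelDisc g) (c : (Fin g → Fin k) → ℂ) :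
    ∑ l, c l • thetaDist hk l τ ∈ quantumSpace k (siegelPolarization τ) :=
  Submodule.sum_mem _ fun l _ => Submodule.smul_mem _ _ (thetaDist_mem_quantumSpace hk l hτ)

theorem thetaFrame_mem_quantumBundle (hk : 0 < k)
    (p : closedSiegelDisc g × ((Fin g → Fin k) → ℂ)) : thetaFrame hk p ∈ quantumBundle g k :=
  And.intro p.1.2 (sum_smul_thetaDist_mem hk p.1.2 p.2)

theorem range_thetaFrame (hk : 0 < k) : Set.range (thetaFrame (g := g) hk) = quantumBundle g k := by
  ext p
  constructor
  · rintro ⟨p, rfl⟩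
    exact thetaFrame_mem_quantumBundle hk p
  · rintro ⟨h1, h2⟩
    refine ⟨(⟨p.1, h1⟩, fun l => p.2 (probeSection hk l) / resolutionConst g k), ?_⟩
    exact Prod.ext rfl (eq_sum_smul_thetaDist hk h1 h2).symm

/-- The pairing of a synthesized section with a test section. -/
theorem torusPairing_synOp (hk : 0 < k) (l : Fin g → Fin k) (f : SchwartzFun g)
    (φ : SmoothSection g (-(k : ℤ))) :
    torusPairing (synOp (natCast_int_ne_zero hk) (residue l) f) φ =
      ∫ v, f v * testCoeff hk l φ v :=
  integral_unitCell_synOp_mul (natCast_int_ne_zero hk) (neg_natCast_int_ne_zero hk) _ f φ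

theorem torusPairing_smul (c : ℂ) (s : SmoothSection g k) (φ : SmoothSection g (-(k : ℤ))) :
    torusPairing (c • s) φ = c * torusPairing s φ := by
  rw [torusPairing, torusPairing, ← integral_const_mul]
  exact integral_congr_ae (Filter.Eventually.of_forall fun u => mul_assoc _ _ _)

theorem smul_quadForm (c : ℂ) (Z : Matrix (Fin g) (Fin g) ℂ) (v : Fin g → ℂ) :
    quadForm (c • Z) v = c * quadForm Z v := by
  rw [quadForm, quadForm, smul_mulVec, dotProduct_smul, smul_eq_mul]

/-- The theta series is the synthesis of a single Gaussian, term by term. -/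
theorem synOp_discGaussian_apply (hk : 0 < k) (l : Fin g → Fin k)
    {τ : Matrix (Fin g) (Fin g) ℂ} (hτ : τ ∈ openSiegelDisc g) (u : Cover g) :
    synOp (natCast_int_ne_zero hk) (residue l) (discGaussian (natCast_real_pos hk) hτ) u =
      thetaSection l (cayleyInv τ) u := by
  have hk' : (k : ℂ) ≠ 0 := by exact_mod_cast hk.ne'
  rw [synOp_apply, thetaSection, ← tsum_mul_left]
  refine tsum_congr fun m => ?_
  have hv : (fun j => (u.2 j : ℂ) - (m j : ℂ) - ((l j : ℕ) : ℂ) / k) =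
      ofRealVec (u.2 - shiftVec (k : ℤ) (residue l + (k : ℤ) • m)) := by
    rw [shiftVec_add_smul (natCast_int_ne_zero hk)]
    funext j
    simp only [ofRealVec, Pi.sub_apply, Pi.add_apply, shiftVec, intVec, residue]
    push_cast
    ring
  have hx : ∑ j, ((m j : ℂ) + ((l j : ℕ) : ℂ) / k) * (u.1 j : ℂ) =
      ((u.1 ⬝ᵥ shiftVec (k : ℤ) (residue l + (k : ℤ) • m) : ℝ) : ℂ) := by
    rw [shiftVec_add_smul (natCast_int_ne_zero hk), dotProduct, Complex.ofReal_sum]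
    refine Finset.sum_congr rfl fun j _ => ?_
    simp only [Pi.add_apply, shiftVec, intVec, residue]
    push_cast
    ring
  rw [synTerm, discGaussian_apply, hv, hx, ← Complex.exp_add, ← Complex.exp_add, cayleyInv_eq,
    smul_quadForm, smul_quadForm]
  congr 1
  rw [dotProduct_sub, dotProduct_smul, smul_eq_mul]
  push_cast
  linear_combination (-(k * Real.pi * quadForm (cayley τ)
    (ofRealVec (u.2 - shiftVec (k : ℤ) (residue l + (k : ℤ) • m)))) : ℂ) * Complex.I_mul_I

/-- Synthesis is transposed to taking coefficients, so pairing with the theta series is integration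
of the Gaussian against one coefficient of the test section. -/
theorem exists_section_normalizedTheta (hk : 0 < k) (l : Fin g → Fin k)
    {τ : Matrix (Fin g) (Fin g) ℂ} (hτ : τ ∈ openSiegelDisc g) :
    ∃ s : SmoothSection g k, (∀ u, s u = normalizedTheta l τ u) ∧
      ∀ φ, thetaDist hk l τ φ = torusPairing s φ := by
  refine ⟨discInvSqrtDet τ • synOp (natCast_int_ne_zero hk) (residue l)
    (discGaussian (natCast_real_pos hk) hτ), fun u => ?_, fun φ => ?_⟩
  · rw [SmoothSection.smul_apply, synOp_discGaussian_apply hk, normalizedTheta]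
  · rw [torusPairing_smul, torusPairing_synOp, thetaDist_apply, gaussFunctional_eq_integral _ hτ]

end ThetaFrame

/-! ## The metaplectic action on sections -/

section SectionAction

variable {g k : ℕ}

/-- Testing against coherent states suffices, by the resolution of the identity. -/
theorem SchwartzFun.eq_of_forall_integral_mul_eq {h h' : SchwartzFun g}
    (H : ∀ f : SchwartzFun g, ∫ v, f v * h v = ∫ v, f v * h' v) : h = h' := by
  have h1 : ∀ w, coherentTransform one_pos h w = coherentTransform one_pos h' w := fun w => by
    simpa only [coherentTransform, mul_comm] using H (coherent one_pos w)
  ext y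
  have h2 := integral_coherentTransform_mul_coherent one_pos h y
  simp only [h1, integral_coherentTransform_mul_coherent one_pos h' y] at h2
  exact (mul_left_cancel₀ (resolutionConst_ne_zero one_pos) h2).symm

/-- The Weil–Brezin coefficient, as a Schwartz function. -/
noncomputable def sectionCoeff (hk : 0 < k) (l : Fin g → Fin k) :
    SmoothSection g (k : ℤ) →L[ℂ] SchwartzFun g :=
  wbOp (natCast_int_ne_zero hk) (residue l)

/-- The section with a single Weil–Brezin coefficient. -/
noncomputable def sectionSyn (hk : 0 < k) (l : Fin g → Fin k) :
    SchwartzFun g →L[ℂ] SmoothSection g (k : ℤ) :=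
  synOp (natCast_int_ne_zero hk) (residue l)

theorem sum_sectionSyn_sectionCoeff (hk : 0 < k) (s : SmoothSection g (k : ℤ)) :
    ∑ l, sectionSyn hk l (sectionCoeff hk l s) = s :=
  sum_synOp_wbOp (natCast_int_ne_zero hk) (isResidueSystem_residue hk) s

theorem sectionCoeff_sectionSyn (hk : 0 < k) (l l' : Fin g → Fin k) (f : SchwartzFun g) :
    sectionCoeff hk l' (sectionSyn hk l f) = if l = l' then f else 0 := by
  split_ifs with h
  · subst h
    exact wbOp_synOp_self _ _ f
  · exact wbOp_synOp_of_ne _ (fun m => (isResidueSystem_residue hk).add_smul_ne h m) f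

theorem sectionCoeff_sum_sectionSyn (hk : 0 < k) (f : (Fin g → Fin k) → SchwartzFun g)
    (l : Fin g → Fin k) : sectionCoeff hk l (∑ l', sectionSyn hk l' (f l')) = f l := by
  rw [map_sum, Finset.sum_eq_single l]
  · rw [sectionCoeff_sectionSyn, if_pos rfl]
  · intro l' _ h
    rw [sectionCoeff_sectionSyn, if_neg h]
  · simp

theorem testCoeff_sum_testSyn (hk : 0 < k) (f : (Fin g → Fin k) → SchwartzFun g)
    (l : Fin g → Fin k) : testCoeff hk l (∑ l', testSyn hk l' (f l')) = f l := by
  rw [map_sum, Finset.sum_eq_single l]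
  · rw [testCoeff_testSyn, if_pos rfl]
  · intro l' _ h
    rw [testCoeff_testSyn, if_neg h]
  · simp

theorem weilBrezin_eq (hk : 0 < k) (s : SmoothSection g (k : ℤ)) (l : Fin g → Fin k)
    (y : Fin g → ℝ) : weilBrezin s l y = sectionCoeff hk l s y := by
  have hk' : (k : ℂ) ≠ 0 := by exact_mod_cast hk.ne'
  rw [sectionCoeff, wbOp_apply, weilBrezin, wbCoeff]
  refine integral_congr_ae (Filter.Eventually.of_forall fun x => ?_)
  have h1 : (x, y) + ((0 : Fin g → ℝ), shiftVec (k : ℤ) (residue l)) =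
      ((x, fun j => y j + ((l j : ℕ) : ℝ) / k) : Cover g) := by
    refine Prod.ext (add_zero x) (funext fun j => ?_)
    simp [shiftVec, residue]
  simp only [wbIntegrand]
  rw [h1, mul_assoc, ← Complex.exp_add]
  congr 2
  simp only [dotProduct, Complex.ofReal_sum, Finset.mul_sum, ← sub_eq_add_neg,
    ← Finset.sum_sub_distrib]
  refine Finset.sum_congr rfl fun j _ => ?_
  simp only [Pi.sub_apply, shiftVec, residue]
  push_cast
  field_simp
  ring

theorem torusPairing_sum {ι : Type*} (S : Finset ι) (s : ι → SmoothSection g (k : ℤ))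
    (φ : SmoothSection g (-(k : ℤ))) :
    torusPairing (∑ i ∈ S, s i) φ = ∑ i ∈ S, torusPairing (s i) φ := by
  simp only [torusPairing]
  rw [← integral_finsetSum _ fun i _ => ?_]
  · refine integral_congr_ae (Filter.Eventually.of_forall fun u => ?_)
    simp only [SmoothSection.sum_apply, Finset.sum_mul]
  · exact (((s i).continuous.mul φ.continuous).continuousOn).integrableOn_compact isCompact_Icc

theorem torusPairing_sectionSyn (hk : 0 < k) (l : Fin g → Fin k) (f : SchwartzFun g)
    (φ : SmoothSection g (-(k : ℤ))) :
    torusPairing (sectionSyn hk l f) φ = ∫ v, f v * testCoeff hk l φ v :=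
  torusPairing_synOp hk l f φ

namespace MetaplecticGenerator

/-- The action of a generator on the smooth sections. -/
noncomputable def sectionOp (hk : 0 < k) (γ : MetaplecticGenerator g) :
    SmoothSection g (k : ℤ) →L[ℂ] SmoothSection g (k : ℤ) :=
  ∑ l, (sectionSyn hk l).comp ((γ.schwartzOp hk).comp (sectionCoeff hk l))

/-- The transposed action of a generator on the test sections. -/
noncomputable def testOp (hk : 0 < k) (γ : MetaplecticGenerator g) :
    SmoothSection g (-(k : ℤ)) →L[ℂ] SmoothSection g (-(k : ℤ)) :=
  ∑ l, (testSyn hk l).comp ((γ.transpose.schwartzOp hk).comp (testCoeff hk l))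

theorem sectionOp_apply (hk : 0 < k) (γ : MetaplecticGenerator g) (s : SmoothSection g (k : ℤ)) :
    γ.sectionOp hk s = ∑ l, sectionSyn hk l (γ.schwartzOp hk (sectionCoeff hk l s)) := by
  rw [sectionOp, ContinuousLinearMap.sum_apply]
  rfl

theorem testOp_apply (hk : 0 < k) (γ : MetaplecticGenerator g) (φ : SmoothSection g (-(k : ℤ))) :
    γ.testOp hk φ = ∑ l, testSyn hk l (γ.transpose.schwartzOp hk (testCoeff hk l φ)) := by
  rw [testOp, ContinuousLinearMap.sum_apply]
  rfl

theorem torusPairing_sectionOp (hk : 0 < k) (γ : MetaplecticGenerator g)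
    (s : SmoothSection g (k : ℤ)) (φ : SmoothSection g (-(k : ℤ))) :
    torusPairing (γ.sectionOp hk s) φ = torusPairing s (γ.testOp hk φ) := by
  conv_rhs => rw [← sum_sectionSyn_sectionCoeff hk s]
  rw [sectionOp_apply, torusPairing_sum, torusPairing_sum]
  refine Finset.sum_congr rfl fun l _ => ?_
  rw [torusPairing_sectionSyn, torusPairing_sectionSyn, testOp_apply, testCoeff_sum_testSyn,
    integral_mul_schwartzOp]

theorem integralOp_weilBrezin (hk : 0 < k) (γ : MetaplecticGenerator g)
    (s : SmoothSection g (k : ℤ)) (l : Fin g → Fin k) (y : Fin g → ℝ) :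
    γ.integralOp k (weilBrezin s l) y = γ.schwartzOp hk (sectionCoeff hk l s) y := by
  rw [schwartzOp_apply, show weilBrezin s l = sectionCoeff hk l s from
    funext (weilBrezin_eq hk s l)]

theorem exists_isSectionAction (hk : 0 < k) (γ : MetaplecticGenerator g) :
    ∃ T : DistSection g k →ₗ[ℂ] DistSection g k, γ.IsSectionAction T := by
  refine ⟨{ toFun := fun σ => σ.comp (γ.testOp hk)
            map_add' := fun σ σ' => rfl
            map_smul' := fun c σ => rfl }, (γ.sectionOp hk).toLinearMap, γ.testOp hk,
    fun s l y => ?_, γ.torusPairing_sectionOp hk, fun σ => rfl⟩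
  rw [integralOp_weilBrezin hk, weilBrezin_eq hk, ContinuousLinearMap.coe_coe, sectionOp_apply,
    sectionCoeff_sum_sectionSyn]

/-- The action of a generator on the theta sections, through the transposed operator. -/
theorem IsSectionAction.apply_thetaDist (hk : 0 < k) {γ : MetaplecticGenerator g}
    {T : DistSection g k →ₗ[ℂ] DistSection g k} (hT : γ.IsSectionAction T) (l : Fin g → Fin k)
    (τ : Matrix (Fin g) (Fin g) ℂ) (φ : SmoothSection g (-(k : ℤ))) :
    T (thetaDist hk l τ) φ = gaussFunctional (natCast_real_pos hk) τ
      (γ.transpose.schwartzOp hk (testCoeff hk l φ)) := by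
  obtain ⟨A, B, hA, hAB, hTB⟩ := hT
  -- The action is not assumed to be the constructed one. The condition on coefficients determines
  -- `A`, and nondegeneracy of the pairing then determines the coefficients of `B φ`, so every
  -- admissible `T` acts in the same way on theta sections.
  have h1 : ∀ s l, sectionCoeff hk l (A s) = γ.schwartzOp hk (sectionCoeff hk l s) := fun s l => by
    ext y
    rw [← weilBrezin_eq, hA, integralOp_weilBrezin hk]
  have h2 : ∀ f, A (sectionSyn hk l f) = sectionSyn hk l (γ.schwartzOp hk f) := fun f => by
    rw [← sum_sectionSyn_sectionCoeff hk (A (sectionSyn hk l f)), Finset.sum_eq_single l]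
    · rw [h1, sectionCoeff_sectionSyn, if_pos rfl]
    · intro l' _ h
      rw [h1, sectionCoeff_sectionSyn, if_neg h.symm, map_zero, map_zero]
    · simp
  have h3 : testCoeff hk l (B φ) = γ.transpose.schwartzOp hk (testCoeff hk l φ) := by
    refine SchwartzFun.eq_of_forall_integral_mul_eq fun f => ?_
    rw [← torusPairing_sectionSyn, ← hAB, h2, torusPairing_sectionSyn, integral_mul_schwartzOp]
  rw [hTB, ContinuousLinearMap.comp_apply, thetaDist_apply, h3]

end MetaplecticGenerator

end SectionAction

/-! ### The Fourier transform of complex Gaussians -/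

section GaussianFourier

variable {g : ℕ}

theorem IsAccretive.isUnit_det {S : Matrix (Fin g) (Fin g) ℂ} (hS : IsAccretive S) :
    IsUnit S.det := isUnit_iff_ne_zero.2 hS.det_ne_zero

/-- The Fourier transform of a Gaussian. -/
theorem integral_gaussian_mul_exp {S : Matrix (Fin g) (Fin g) ℂ} (hS : IsAccretive S)
    (ξ : Fin g → ℝ) :
    ∫ v : Fin g → ℝ, Complex.exp (-(Real.pi * quadForm S (ofRealVec v)) +
        2 * Real.pi * Complex.I * ((ξ ⬝ᵥ v : ℝ) : ℂ)) =
      gaussInvSqrtDet S * Complex.exp (-(Real.pi * quadForm S⁻¹ (ofRealVec ξ))) := by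
  obtain ⟨C, d, hC, hSD⟩ := hS.exists_diagonalization
  have hCu : IsUnit Cᵀ.det := by rw [det_transpose]; exact hC.isUnit
  -- With `ξ = ᵗC η` the linear term is `η · Cv`, so in the diagonalizing coordinates the integral
  -- splits into one-dimensional ones.
  obtain ⟨η, hη⟩ : ∃ η, ξ = Cᵀ *ᵥ η :=
    ⟨Cᵀ⁻¹ *ᵥ ξ, by rw [mulVec_mulVec, mul_nonsing_inv _ hCu, one_mulVec]⟩
  have hd : ∀ j, (1 + Complex.I * d j : ℂ) ≠ 0 := fun j h => by
    have := congrArg Complex.re h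
    simp at this
  have hπ : (Real.pi : ℂ) ≠ 0 := by exact_mod_cast Real.pi_ne_zero
  have hre : ∀ j, 0 < (Real.pi * (1 + Complex.I * d j) : ℂ).re := fun j => by
    simp [Real.pi_pos]
  let G : (Fin g → ℂ) → (Fin g → ℝ) → ℂ := fun c w => Complex.exp
    (-∑ j, (Real.pi * (1 + Complex.I * d j)) * (w j : ℂ) ^ 2 + ∑ j, c j * w j)
  have hG : ∀ ζ v, Complex.exp (-(Real.pi * quadForm S (ofRealVec v)) +
      2 * Real.pi * Complex.I * (((Cᵀ *ᵥ ζ) ⬝ᵥ v : ℝ) : ℂ)) =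
      G (fun j => 2 * Real.pi * Complex.I * ζ j) (C *ᵥ v) := fun ζ v => by
    simp only [G]
    rw [hSD, quadForm_transpose_mul_diagonal_mul, mulVec_transpose, ← dotProduct_mulVec]
    congr 2
    · rw [Finset.mul_sum]
      simp only [mul_assoc]
    · simp only [dotProduct, Complex.ofReal_sum, Complex.ofReal_mul, Finset.mul_sum, mul_assoc]
  have key : ∀ ζ, ∫ v : Fin g → ℝ, Complex.exp (-(Real.pi * quadForm S (ofRealVec v)) +
        2 * Real.pi * Complex.I * (((Cᵀ *ᵥ ζ) ⬝ᵥ v : ℝ) : ℂ)) = |C.det|⁻¹ •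
      ((∏ j, ((Real.pi : ℂ) / (Real.pi * (1 + Complex.I * d j))) ^ (1 / 2 : ℂ)) *
        Complex.exp (∑ j, -(Real.pi * ((ζ j : ℂ) ^ 2 / (1 + Complex.I * d j))))) := fun ζ => by
    simp only [hG]
    rw [integral_comp_mulVec hC (G _), Complex.exp_sum, ← Finset.prod_mul_distrib]
    simp only [G]
    rw [GaussianFourier.integral_cexp_neg_sum_mul_add hre]
    congr 1
    refine Finset.prod_congr rfl fun j _ => ?_
    congr 2
    have := hd j
    field_simp
    linear_combination (4 * (ζ j : ℂ) ^ 2) * Complex.I_mul_I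
  -- The case `ζ = 0` identifies the product of one-dimensional roots with `gaussInvSqrtDet S`, so
  -- no branches have to be compared.
  have h0 : gaussInvSqrtDet S = |C.det|⁻¹ •
      (∏ j, ((Real.pi : ℂ) / (Real.pi * (1 + Complex.I * d j))) ^ (1 / 2 : ℂ)) := by
    have := key 0
    simpa [gaussInvSqrtDet_eq] using this
  have hinv : quadForm S⁻¹ (ofRealVec ξ) = ∑ j, (η j : ℂ) ^ 2 / (1 + Complex.I * d j) := by
    have hCc : IsUnit (C.map Complex.ofRealHom).det := by
      have : (C.map Complex.ofRealHom).det = (C.det : ℂ) :=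
        (RingHom.map_det Complex.ofRealHom C).symm
      rw [this]
      exact isUnit_iff_ne_zero.2 (by exact_mod_cast hC)
    obtain ⟨w, hw⟩ : ∃ w, C.map Complex.ofRealHom *ᵥ w =
        fun j => (η j : ℂ) / (1 + Complex.I * d j) :=
      ⟨(C.map Complex.ofRealHom)⁻¹ *ᵥ _, by rw [mulVec_mulVec, mul_nonsing_inv _ hCc, one_mulVec]⟩
    have hξ : ofRealVec ξ = (C.map Complex.ofRealHom)ᵀ *ᵥ ofRealVec η := by
      rw [hη, ← transpose_map, map_ofRealHom_mulVec]
    have hSw : S *ᵥ w = ofRealVec ξ := by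
      rw [hξ, hSD, ← mulVec_mulVec, ← mulVec_mulVec, hw]
      congr 1
      ext j
      rw [mulVec_diagonal, mul_div_cancel₀ _ (hd j)]
      rfl
    rw [quadForm, ← hSw, mulVec_mulVec, nonsing_inv_mul _ hS.isUnit_det, one_mulVec, hSw, hξ,
      mulVec_transpose, ← dotProduct_mulVec, hw]
    exact Finset.sum_congr rfl fun j _ => by simp only [ofRealVec]; ring
  rw [hinv, h0, hη, key, smul_mul_assoc, Finset.mul_sum, Finset.sum_neg_distrib]

end GaussianFourier

/-! ### The symplectic matrix of a generator -/

section GeneratorMatrix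

variable {g : ℕ}

theorem one_add_siegelAct_mul {M : Matrix (Fin g ⊕ Fin g) (Fin g ⊕ Fin g) ℝ}
    (hM : M ∈ symplecticGroup (Fin g) ℝ) {τ : Matrix (Fin g) (Fin g) ℂ}
    (hτ : τ ∈ closedSiegelDisc g) :
    (1 + siegelAct M τ) * siegelCocycle M τ = (2 : ℂ) • siegelDen M τ := by
  rw [siegelAct_eq, add_mul, one_mul,
    nonsing_inv_mul_cancel_right _ _ (isUnit_iff_ne_zero.2 (det_siegelCocycle_ne_zero hM hτ)),
    siegelCocycle, two_smul]
  abel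

theorem one_sub_siegelAct_mul {M : Matrix (Fin g ⊕ Fin g) (Fin g ⊕ Fin g) ℝ}
    (hM : M ∈ symplecticGroup (Fin g) ℝ) {τ : Matrix (Fin g) (Fin g) ℂ}
    (hτ : τ ∈ closedSiegelDisc g) :
    (1 - siegelAct M τ) * siegelCocycle M τ = -((2 * Complex.I) • siegelNum M τ) := by
  rw [siegelAct_eq, sub_mul, one_mul,
    nonsing_inv_mul_cancel_right _ _ (isUnit_iff_ne_zero.2 (det_siegelCocycle_ne_zero hM hτ)),
    siegelCocycle, mul_smul, two_smul]
  abel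

theorem cayleyInv_mul_one_add {τ : Matrix (Fin g) (Fin g) ℂ} (hτ : τ ∈ openSiegelDisc g) :
    cayleyInv τ * (1 + τ) = Complex.I • (1 - τ) := by
  rw [cayleyInv, smul_mul_assoc,
    nonsing_inv_mul_cancel_right _ _ (isUnit_iff_ne_zero.2 (det_one_add_ne_zero hτ))]

/-- `siegelNum` and `siegelDen` are `AΩ + B` and `CΩ + D` multiplied by `1 + τ`, so over the open
disc this is the classical fractional linear action. -/
theorem cayleyInv_siegelAct_mul {M : Matrix (Fin g ⊕ Fin g) (Fin g ⊕ Fin g) ℝ}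
    (hM : M ∈ symplecticGroup (Fin g) ℝ) {τ : Matrix (Fin g) (Fin g) ℂ}
    (hτ : τ ∈ openSiegelDisc g) :
    cayleyInv (siegelAct M τ) * siegelDen M τ = siegelNum M τ := by
  have hτ' := openSiegelDisc_subset hτ
  have h1 := congrArg (· * siegelCocycle M τ) (cayleyInv_mul_one_add (siegelAct_mem_open hM hτ))
  simp only [mul_assoc, smul_mul_assoc, one_add_siegelAct_mul hM hτ', one_sub_siegelAct_mul hM hτ',
    mul_smul_comm, smul_smul, ← neg_smul] at h1
  have h2 : Complex.I * -(2 * Complex.I) = 2 := by linear_combination (-2) * Complex.I_mul_I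
  rw [h2] at h1
  exact smul_right_injective _ two_ne_zero h1

namespace MetaplecticGenerator

variable (γ : MetaplecticGenerator g)

theorem isUnit_det_L : IsUnit γ.L.det := isUnit_iff_ne_zero.2 γ.det_L

theorem toMatrix_mem_symplecticGroup : γ.toMatrix ∈ symplecticGroup (Fin g) ℝ := by
  have hP := γ.symm_P.eq
  have hQ := γ.symm_Q.eq
  have h1 : γ.Lᵀ * (γ.L⁻¹)ᵀ = 1 := by
    rw [← transpose_mul, nonsing_inv_mul _ γ.isUnit_det_L, transpose_one]
  rw [SymplecticGroup.mem_iff, toMatrix, Matrix.J, fromBlocks_transpose, fromBlocks_multiply,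
    fromBlocks_multiply]
  simp only [transpose_mul, transpose_sub, transpose_transpose, hP, hQ, mul_zero, mul_one,
    zero_add, add_zero, mul_neg, neg_mul, sub_mul, mul_sub, h1, ← mul_assoc]
  have h2 : γ.L⁻¹ * γ.L = 1 := nonsing_inv_mul _ γ.isUnit_det_L
  congr 1
  · simp only [mul_assoc]
    rw [h2]
    simp
  · abel
  · rw [h2]
    abel
  · abel

/-- The complexified matrix `L`. -/
noncomputable def cL : Matrix (Fin g) (Fin g) ℂ := γ.L.map Complex.ofRealHom

theorem det_cL : γ.cL.det = (γ.L.det : ℂ) := (RingHom.map_det Complex.ofRealHom γ.L).symm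

theorem isUnit_det_cL : IsUnit γ.cL.det := by
  rw [det_cL]
  exact isUnit_iff_ne_zero.2 (by exact_mod_cast γ.det_L)

theorem map_inv_L : γ.L⁻¹.map Complex.ofReal = γ.cL⁻¹ := by
  refine (inv_eq_left_inv ?_).symm
  change γ.L⁻¹.map Complex.ofRealHom * γ.L.map Complex.ofRealHom = 1
  rw [← Matrix.map_mul, nonsing_inv_mul _ γ.isUnit_det_L, Matrix.map_one _ (by simp) (by simp)]

/-- The matrix `Ω(τ) + Q`. -/
noncomputable def shift (τ : Matrix (Fin g) (Fin g) ℂ) : Matrix (Fin g) (Fin g) ℂ :=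
  cayleyInv τ + γ.Q.map Complex.ofReal

theorem isAccretive_shift {τ : Matrix (Fin g) (Fin g) ℂ} (hτ : τ ∈ openSiegelDisc g) :
    IsAccretive (-Complex.I • γ.shift τ) := by
  have h := (isAccretive_cayley hτ).sub_I_smul γ.symm_Q
  convert h using 1
  rw [shift, cayleyInv_eq, smul_add, smul_smul, neg_mul, Complex.I_mul_I, neg_neg, one_smul,
    neg_smul, sub_eq_add_neg]

theorem siegelDen_toMatrix {τ : Matrix (Fin g) (Fin g) ℂ} (hτ : τ ∈ openSiegelDisc g) :
    siegelDen γ.toMatrix τ = γ.cL⁻¹ * (γ.shift τ * (1 + τ)) := by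
  have h : (γ.L⁻¹ * γ.Q).map Complex.ofReal = γ.cL⁻¹ * γ.Q.map Complex.ofReal := by
    rw [← map_inv_L]
    exact Matrix.map_mul (f := Complex.ofRealHom)
  rw [siegelDen, toMatrix, toBlocks_fromBlocks₂₁, toBlocks_fromBlocks₂₂, h, map_inv_L, shift, add_mul,
    cayleyInv_mul_one_add hτ, mul_add γ.cL⁻¹, mul_assoc]

theorem siegelNum_toMatrix (τ : Matrix (Fin g) (Fin g) ℂ) :
    siegelNum γ.toMatrix τ =
      γ.P.map Complex.ofReal * siegelDen γ.toMatrix τ - γ.cLᵀ * (1 + τ) := by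
  have h1 : (γ.P * γ.L⁻¹).map Complex.ofReal = γ.P.map Complex.ofReal * γ.L⁻¹.map Complex.ofReal :=
    Matrix.map_mul (f := Complex.ofRealHom)
  have h2 : (γ.P * γ.L⁻¹ * γ.Q - γ.Lᵀ).map Complex.ofReal =
      γ.P.map Complex.ofReal * (γ.L⁻¹ * γ.Q).map Complex.ofReal - γ.cLᵀ := by
    rw [mul_assoc]
    ext i j
    have h3 : (γ.P * (γ.L⁻¹ * γ.Q)).map Complex.ofReal =
        γ.P.map Complex.ofReal * (γ.L⁻¹ * γ.Q).map Complex.ofReal :=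
      Matrix.map_mul (f := Complex.ofRealHom)
    rw [Matrix.sub_apply, ← h3]
    exact Complex.ofReal_sub _ _
  rw [siegelNum, siegelDen, toMatrix, toBlocks_fromBlocks₁₁, toBlocks_fromBlocks₁₂,
    toBlocks_fromBlocks₂₁, toBlocks_fromBlocks₂₂, h1, h2, sub_mul,
    mul_add (γ.P.map _), mul_assoc, mul_assoc, add_sub_assoc]

theorem isUnit_det_shift {τ : Matrix (Fin g) (Fin g) ℂ} (hτ : τ ∈ openSiegelDisc g) :
    IsUnit (γ.shift τ).det := by
  have h := (γ.isAccretive_shift hτ).det_ne_zero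
  rw [det_smul] at h
  exact isUnit_iff_ne_zero.2 (right_ne_zero_of_mul h)

/-- The action of a generator on the Siegel upper half-space. -/
theorem cayleyInv_siegelAct {τ : Matrix (Fin g) (Fin g) ℂ} (hτ : τ ∈ openSiegelDisc g) :
    cayleyInv (siegelAct γ.toMatrix τ) =
      γ.P.map Complex.ofReal - γ.cLᵀ * ((γ.shift τ)⁻¹ * γ.cL) := by
  have hu : IsUnit (siegelDen γ.toMatrix τ) := by
    rw [isUnit_iff_isUnit_det, siegelDen_toMatrix γ hτ, det_mul, det_mul, det_nonsing_inv,
      Ring.inverse_eq_inv']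
    exact (γ.isUnit_det_cL.inv).mul ((γ.isUnit_det_shift hτ).mul
      (isUnit_iff_ne_zero.2 (det_one_add_ne_zero hτ)))
  refine hu.mul_right_cancel ?_
  rw [cayleyInv_siegelAct_mul γ.toMatrix_mem_symplecticGroup hτ, siegelNum_toMatrix, sub_mul]
  congr 1
  rw [siegelDen_toMatrix γ hτ, mul_assoc, mul_assoc, mul_nonsing_inv_cancel_left _ _ γ.isUnit_det_cL,
    nonsing_inv_mul_cancel_left _ _ (γ.isUnit_det_shift hτ)]

/-- Taking determinants in `(1 + M(τ)) W = 2 L⁻¹ (Ω + Q)(1 + τ)` links the factor `det(W / 2)` of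
canonical forms to `det(Ω + Q)` in the half-form formula. -/
theorem det_half_siegelCocycle {τ : Matrix (Fin g) (Fin g) ℂ} (hτ : τ ∈ openSiegelDisc g) :
    (1 + siegelAct γ.toMatrix τ).det * ((1 / 2 : ℂ) • siegelCocycle γ.toMatrix τ).det *
      (γ.L.det : ℂ) = (γ.shift τ).det * (1 + τ).det := by
  rw [← det_mul, mul_smul_comm, one_add_siegelAct_mul γ.toMatrix_mem_symplecticGroup
    (openSiegelDisc_subset hτ), smul_smul, one_div_mul_cancel two_ne_zero, one_smul,
    siegelDen_toMatrix γ hτ, ← det_cL, mul_comm, ← det_mul,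
    mul_nonsing_inv_cancel_left _ _ γ.isUnit_det_cL, det_mul]

end MetaplecticGenerator

end GeneratorMatrix

/-! ### The action of a generator on Gaussians -/

section GeneratorGaussian

variable {g k : ℕ}

theorem gaussInvSqrtDet_smul {c : ℝ} (hc : 0 < c) (S : Matrix (Fin g) (Fin g) ℂ) :
    gaussInvSqrtDet ((c : ℂ) • S) = ((Real.sqrt c ^ g : ℝ) : ℂ)⁻¹ * gaussInvSqrtDet S := by
  have hs : 0 < Real.sqrt c := Real.sqrt_pos.2 hc
  have hdet : (Real.sqrt c • (1 : Matrix (Fin g) (Fin g) ℝ)).det = Real.sqrt c ^ g := by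
    simp
  have h := integral_comp_mulVec (C := Real.sqrt c • (1 : Matrix (Fin g) (Fin g) ℝ))
    (by rw [hdet]; positivity) fun ξ => Complex.exp (-(Real.pi * quadForm S (ofRealVec ξ)))
  rw [hdet, abs_of_pos (by positivity), Complex.real_smul, Complex.ofReal_inv] at h
  rw [gaussInvSqrtDet_eq, gaussInvSqrtDet_eq, ← h]
  refine integral_congr_ae (Filter.Eventually.of_forall fun ξ => ?_)
  have h1 : ofRealVec ((Real.sqrt c • (1 : Matrix (Fin g) (Fin g) ℝ)) *ᵥ ξ) =
      ((Real.sqrt c : ℝ) : ℂ) • ofRealVec ξ := by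
    rw [smul_mulVec, one_mulVec]
    funext j
    simp [ofRealVec]
  simp only [h1, quadForm_smul, quadForm_smul_right]
  rw [← Complex.ofReal_pow, Real.sq_sqrt hc.le]

theorem quadForm_transpose_mul_mul (C : Matrix (Fin g) (Fin g) ℝ) (Z : Matrix (Fin g) (Fin g) ℂ)
    (ξ : Fin g → ℝ) : quadForm ((C.map Complex.ofRealHom)ᵀ * (Z * C.map Complex.ofRealHom))
      (ofRealVec ξ) = quadForm Z (ofRealVec (C *ᵥ ξ)) := by
  rw [quadForm, ← mulVec_mulVec, ← mulVec_mulVec, map_ofRealHom_mulVec, dotProduct_mulVec,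
    vecMul_transpose, map_ofRealHom_mulVec, quadForm]

namespace MetaplecticGenerator

variable (γ : MetaplecticGenerator g)

/-- The factor by which a generator acts on Gaussians. -/
noncomputable def gaussFactor (τ : Matrix (Fin g) (Fin g) ℂ) : ℂ :=
  Complex.I ^ γ.m * ((Real.sqrt |γ.L.det| : ℝ) : ℂ) *
    (Complex.exp (-(Real.pi * Complex.I * g / 4)) * gaussInvSqrtDet (-Complex.I • γ.shift τ))

theorem sqrt_abs_det_ne_zero : ((Real.sqrt |γ.L.det| : ℝ) : ℂ) ≠ 0 := by
  have := Real.sqrt_pos.2 (abs_pos.2 γ.det_L)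
  exact_mod_cast this.ne'

theorem gaussFactor_ne_zero {τ : Matrix (Fin g) (Fin g) ℂ} (hτ : τ ∈ openSiegelDisc g) :
    γ.gaussFactor τ ≠ 0 :=
  mul_ne_zero (mul_ne_zero (zpow_ne_zero _ Complex.I_ne_zero) γ.sqrt_abs_det_ne_zero)
    (mul_ne_zero (Complex.exp_ne_zero _) (gaussInvSqrtDet_ne_zero (γ.isAccretive_shift hτ)))

/-- The factor `k^{g/2}` of the operator cancels the scaling of the Gaussian integral, so the
resulting factor does not depend on `k`. -/
theorem opConst_mul_gaussInvSqrtDet (hk : 0 < k) (τ : Matrix (Fin g) (Fin g) ℂ) :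
    γ.opConst k * gaussInvSqrtDet (((k : ℝ) : ℂ) • (-Complex.I • γ.shift τ)) =
      γ.gaussFactor τ := by
  have h1 : Complex.exp (Real.pi * Complex.I / 2 * (-(g : ℂ) / 2 + γ.m)) =
      Complex.I ^ γ.m * Complex.exp (-(Real.pi * Complex.I * g / 4)) := by
    have h2 : Complex.I ^ γ.m = Complex.exp (γ.m * (Real.pi / 2 * Complex.I)) := by
      rw [Complex.exp_int_mul, Complex.exp_pi_div_two_mul_I]
    rw [h2, ← Complex.exp_add]
    congr 1
    ring
  have h3 : ((Real.sqrt k : ℝ) : ℂ) ^ g ≠ 0 := by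
    have := Real.sqrt_pos.2 (natCast_real_pos hk)
    exact pow_ne_zero _ (by exact_mod_cast this.ne')
  rw [gaussInvSqrtDet_smul (natCast_real_pos hk), opConst, gaussFactor, h1]
  push_cast
  field_simp

/-- The integral is the Fourier transform at `-kLu` of the Gaussian with matrix `-ik(Ω + Q)`.
Together with the chirp it produces the quadratic form `P - ᵗL(Ω + Q)⁻¹L`, which is `M(Ω)` by
`cayleyInv_siegelAct`. -/
theorem schwartzOp_discGaussian_apply (hk : 0 < k) {τ : Matrix (Fin g) (Fin g) ℂ}
    (hτ : τ ∈ openSiegelDisc g) (u : Fin g → ℝ) :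
    γ.schwartzOp hk (discGaussian (natCast_real_pos hk) hτ) u = γ.gaussFactor τ *
      discGaussian (natCast_real_pos hk)
        (siegelAct_mem_open γ.toMatrix_mem_symplecticGroup hτ) u := by
  have hk' : (k : ℂ) ≠ 0 := by exact_mod_cast hk.ne'
  have hS := (γ.isAccretive_shift hτ).smul (natCast_real_pos hk)
  have hint : ∀ v : Fin g → ℝ, Complex.exp (k * Real.pi * Complex.I *
      ((u ⬝ᵥ (γ.P *ᵥ u) - 2 * (u ⬝ᵥ (γ.Lᵀ *ᵥ v)) + v ⬝ᵥ (γ.Q *ᵥ v) : ℝ) : ℂ)) *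
        discGaussian (natCast_real_pos hk) hτ v =
      Complex.exp (k * Real.pi * Complex.I * quadForm (γ.P.map Complex.ofReal) (ofRealVec u)) *
        Complex.exp (-(Real.pi * quadForm (((k : ℝ) : ℂ) • (-Complex.I • γ.shift τ)) (ofRealVec v)) +
          2 * Real.pi * Complex.I * (((-(k : ℝ) • (γ.L *ᵥ u)) ⬝ᵥ v : ℝ) : ℂ)) := fun v => by
    rw [discGaussian_apply, ← Complex.exp_add, ← Complex.exp_add, quadForm_ofReal, quadForm_smul,
      quadForm_smul, quadForm_smul, shift, quadForm_add, quadForm_ofReal, cayleyInv_eq,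
      quadForm_smul, dotProduct_transpose_mulVec, smul_dotProduct, dotProduct_comm v (γ.L *ᵥ u),
      smul_eq_mul]
    congr 1
    push_cast
    linear_combination (-(Real.pi * k * quadForm (cayley τ) (ofRealVec v)) : ℂ) *
      Complex.I_mul_I
  have hinv : (((k : ℝ) : ℂ) • (-Complex.I • γ.shift τ))⁻¹ =
      ((k : ℂ)⁻¹ * Complex.I) • (γ.shift τ)⁻¹ := by
    refine inv_eq_left_inv ?_
    rw [smul_mul_smul_comm, mul_smul_comm, nonsing_inv_mul _ (γ.isUnit_det_shift hτ), smul_smul]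
    have : (k : ℂ)⁻¹ * Complex.I * ((k : ℝ) : ℂ) * -Complex.I = 1 := by
      push_cast
      field_simp
      linear_combination -Complex.I_mul_I
    rw [this, one_smul]
  have hvec : ofRealVec (-(k : ℝ) • (γ.L *ᵥ u)) = (-(k : ℂ)) • ofRealVec (γ.L *ᵥ u) := by
    funext j
    simp [ofRealVec]
  rw [schwartzOp_apply, integralOp, integral_congr_ae (Filter.Eventually.of_forall hint),
    integral_const_mul, integral_gaussian_mul_exp hS, ← opConst_mul_gaussInvSqrtDet γ hk τ,
    discGaussian_apply, hinv, hvec, quadForm_smul, quadForm_smul_right]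
  have hq : quadForm (((k : ℝ) : ℂ) • cayley (siegelAct γ.toMatrix τ)) (ofRealVec u) =
      -(k * Complex.I) * (quadForm (γ.P.map Complex.ofReal) (ofRealVec u) -
        quadForm (γ.shift τ)⁻¹ (ofRealVec (γ.L *ᵥ u))) := by
    have h1 : quadForm (cayleyInv (siegelAct γ.toMatrix τ)) (ofRealVec u) =
        quadForm (γ.P.map Complex.ofReal) (ofRealVec u) -
          quadForm (γ.shift τ)⁻¹ (ofRealVec (γ.L *ᵥ u)) := by
      rw [γ.cayleyInv_siegelAct hτ, quadForm_sub, cL, quadForm_transpose_mul_mul]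
    rw [← h1, cayleyInv_eq, quadForm_smul, quadForm_smul]
    push_cast
    linear_combination (k * quadForm (cayley (siegelAct γ.toMatrix τ)) (ofRealVec u) : ℂ) *
      Complex.I_mul_I
  rw [hq, opConst]
  have hexp : ∀ a b c : ℂ, Complex.exp (k * Real.pi * Complex.I * a) *
      (c * Complex.exp (-(Real.pi * ((k : ℂ)⁻¹ * Complex.I * ((-(k : ℂ)) ^ 2 * b))))) =
      c * Complex.exp (-(Real.pi * (-(k * Complex.I) * (a - b)))) := fun a b c => by
    rw [mul_left_comm, ← Complex.exp_add]
    congr 2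
    field_simp
    ring
  rw [hexp, mul_assoc, mul_assoc, mul_assoc]

theorem gaussFunctional_transpose_schwartzOp (hk : 0 < k) {τ : Matrix (Fin g) (Fin g) ℂ}
    (hτ : τ ∈ openSiegelDisc g) (f : SchwartzFun g) :
    discInvSqrtDet (siegelAct γ.toMatrix τ) *
      gaussFunctional (natCast_real_pos hk) τ (γ.transpose.schwartzOp hk f) =
        γ.gaussFactor τ * discInvSqrtDet τ *
          gaussFunctional (natCast_real_pos hk) (siegelAct γ.toMatrix τ) f := by
  rw [gaussFunctional_eq_integral _ hτ, gaussFunctional_eq_integral _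
    (siegelAct_mem_open γ.toMatrix_mem_symplecticGroup hτ), ← integral_mul_schwartzOp]
  simp only [schwartzOp_discGaussian_apply γ hk hτ, mul_assoc (γ.gaussFactor τ)]
  rw [integral_const_mul]
  ring

end MetaplecticGenerator

end GeneratorGaussian

/-! ## The metaplectic action on half-forms -/

section HalfForms

variable {g k : ℕ}

/-- The components of `(1 + τ) dx - i (1 - τ) dy`. -/
noncomputable def discForm (τ : Matrix (Fin g) (Fin g) ℂ) : CTangent g →ₗ[ℂ] (Fin g → ℂ) :=
  (1 + τ).mulVecLin ∘ₗ LinearMap.fst ℂ _ _ -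
    Complex.I • ((1 - τ).mulVecLin ∘ₗ LinearMap.snd ℂ _ _)

theorem discForm_apply (τ : Matrix (Fin g) (Fin g) ℂ) (v : CTangent g) :
    discForm τ v = (1 + τ) *ᵥ v.1 - Complex.I • ((1 - τ) *ᵥ v.2) := rfl

/-- The components of `(1 + τ)dx - i(1 - τ)dy` are contractions of `ω` with a basis of the conjugate
of `P_τ`, so their transformation law follows from the invariance of `ω`. -/
theorem symplForm_conjPolVec {τ : Matrix (Fin g) (Fin g) ℂ} (hτ : τ.IsSymm) (a : Fin g → ℂ)
    (v : CTangent g) : symplForm (conjPolVec τ a) v = a ⬝ᵥ discForm τ v := by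
  have h1 : (1 + τ)ᵀ = 1 + τ := isSymm_one.add hτ
  have h2 : (1 - τ)ᵀ = 1 - τ := isSymm_one.sub hτ
  rw [discForm_apply, dotProduct_sub, dotProduct_smul, dotProduct_mulVec, dotProduct_mulVec,
    ← mulVec_transpose, ← mulVec_transpose, h1, h2, symplForm, conjPolVec, smul_dotProduct]

theorem matrixAct_conjPolVec_eq {M : Matrix (Fin g ⊕ Fin g) (Fin g ⊕ Fin g) ℝ}
    (hM : M ∈ symplecticGroup (Fin g) ℝ) {τ : Matrix (Fin g) (Fin g) ℂ}
    (hτ : τ ∈ closedSiegelDisc g) (a : Fin g → ℂ) :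
    matrixAct M (conjPolVec τ a) =
      conjPolVec (siegelAct M τ) (((1 / 2 : ℂ) • siegelCocycle M τ) *ᵥ a) := by
  have h : star (matrixAct M (conjPolVec τ a)) ∈ siegelPolarization (siegelAct M τ) := by
    rw [siegelPolarization_siegelAct hM hτ, star_matrixAct]
    exact Submodule.mem_map_of_mem (star_conjPolVec_mem τ a)
  rw [eq_conjPolVec_of_star_mem h, antiPart_matrixAct_conjPolVec, smul_mulVec]

theorem discForm_eq_transpose_mulVec {M : Matrix (Fin g ⊕ Fin g) (Fin g ⊕ Fin g) ℝ}
    (hM : M ∈ symplecticGroup (Fin g) ℝ) {τ : Matrix (Fin g) (Fin g) ℂ}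
    (hτ : τ ∈ closedSiegelDisc g) (v : CTangent g) :
    discForm τ v = ((1 / 2 : ℂ) • siegelCocycle M τ)ᵀ *ᵥ discForm (siegelAct M τ) (matrixAct M v) := by
  refine dotProduct_eq _ _ fun a => ?_
  rw [dotProduct_comm, ← symplForm_conjPolVec hτ.1, ← symplForm_matrixAct hM,
    matrixAct_conjPolVec_eq hM hτ, symplForm_conjPolVec (siegelAct_mem_closed hM hτ).1,
    mulVec_transpose, ← dotProduct_mulVec, dotProduct_comm]

theorem canonicalForm_apply (τ : Matrix (Fin g) (Fin g) ℂ) (v : Fin g → CTangent g) :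
    canonicalForm τ v = (Matrix.of fun i => discForm τ (v i)).det := rfl

/-- The multiplier of canonical forms is the determinant of half the cocycle, which is polynomial in
`τ` and so defined and continuous up to the boundary. -/
theorem canonicalForm_comp_matrixAct_inv {M : Matrix (Fin g ⊕ Fin g) (Fin g ⊕ Fin g) ℝ}
    (hM : M ∈ symplecticGroup (Fin g) ℝ) {τ : Matrix (Fin g) (Fin g) ℂ}
    (hτ : τ ∈ closedSiegelDisc g) :
    (canonicalForm τ).compLinearMap (matrixAct M⁻¹) =
      ((1 / 2 : ℂ) • siegelCocycle M τ).det • canonicalForm (siegelAct M τ) := by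
  refine AlternatingMap.ext fun v => ?_
  have h : ∀ w, matrixAct M (matrixAct M⁻¹ w) = w := fun w => by
    rw [← LinearMap.comp_apply, ← matrixAct_mul,
      mul_nonsing_inv _ (SymplecticGroup.symplectic_det hM), matrixAct_one, LinearMap.id_apply]
  rw [AlternatingMap.compLinearMap_apply, AlternatingMap.smul_apply, canonicalForm_apply,
    canonicalForm_apply, smul_eq_mul, mul_comm, ← det_mul]
  congr 1
  refine Matrix.ext fun i j => ?_
  rw [of_apply, discForm_eq_transpose_mulVec hM hτ, h, mulVec_transpose]
  rfl

theorem discInvSqrtDet_ne_zero {τ : Matrix (Fin g) (Fin g) ℂ} (hτ : τ ∈ openSiegelDisc g) :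
    discInvSqrtDet τ ≠ 0 := gaussInvSqrtDet_ne_zero (isAccretive_one_add hτ)

theorem continuous_siegelCocycle (M : Matrix (Fin g ⊕ Fin g) (Fin g ⊕ Fin g) ℝ) :
    Continuous (siegelCocycle M) := by
  unfold siegelCocycle siegelDen siegelNum
  fun_prop

namespace MetaplecticGenerator

variable (γ : MetaplecticGenerator g)

theorem gaussFactor_sq_mul_det {τ : Matrix (Fin g) (Fin g) ℂ} (hτ : τ ∈ openSiegelDisc g) :
    γ.gaussFactor τ ^ 2 * (γ.shift τ).det = (γ.L.det : ℂ) := by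
  have h1 := gaussInvSqrtDet_sq_mul_det (γ.isAccretive_shift hτ)
  rw [det_smul, Fintype.card_fin] at h1
  have h2 : Complex.exp (-(Real.pi * Complex.I * g / 4)) ^ 2 = (-Complex.I) ^ g := by
    rw [← Complex.exp_nat_mul, ← Complex.exp_neg_pi_div_two_mul_I, ← Complex.exp_nat_mul]
    congr 1
    push_cast
    ring
  have h3 : ((Real.sqrt |γ.L.det| : ℝ) : ℂ) ^ 2 = ((|γ.L.det| : ℝ) : ℂ) := by
    rw [← Complex.ofReal_pow, Real.sq_sqrt (abs_nonneg _)]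
  have h4 : (Complex.I ^ γ.m) ^ 2 * ((|γ.L.det| : ℝ) : ℂ) = (γ.L.det : ℂ) := by
    rw [γ.root, ← Complex.ofReal_mul, div_mul_cancel₀ _ (abs_ne_zero.2 γ.det_L)]
  rw [gaussFactor, mul_pow, mul_pow, mul_pow, h3, h4, h2]
  linear_combination (γ.L.det : ℂ) * h1

/-- The value of the transported vacuum functional at the standard coherent state. -/
noncomputable def vacuumAmplitude (hk : 0 < k) (τ : Matrix (Fin g) (Fin g) ℂ) : ℂ :=
  gaussFunctional (natCast_real_pos hk) τ
    (γ.transpose.schwartzOp hk (coherent (natCast_real_pos hk) 0))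

theorem discInvSqrtDet_mul_vacuumAmplitude (hk : 0 < k) {τ : Matrix (Fin g) (Fin g) ℂ}
    (hτ : τ ∈ openSiegelDisc g) :
    discInvSqrtDet (siegelAct γ.toMatrix τ) * γ.vacuumAmplitude hk τ =
      γ.gaussFactor τ * discInvSqrtDet τ * resolutionConst g k := by
  rw [vacuumAmplitude, gaussFunctional_transpose_schwartzOp γ hk hτ, gaussFunctional_coherent_zero _
    (siegelAct_mem_closed γ.toMatrix_mem_symplecticGroup (openSiegelDisc_subset hτ))]

/-- Over the open disc this follows from the explicit Gaussian factors, and density extends it. The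
amplitude is therefore nowhere zero on the closed disc and supplies a continuous square root of the
multiplier there. -/
theorem vacuumAmplitude_sq (hk : 0 < k) {τ : Matrix (Fin g) (Fin g) ℂ}
    (hτ : τ ∈ closedSiegelDisc g) :
    ((1 / 2 : ℂ) • siegelCocycle γ.toMatrix τ).det * γ.vacuumAmplitude hk τ ^ 2 =
      resolutionConst g k ^ 2 := by
  refine eqOn_closedSiegelDisc (F := fun τ => ((1 / 2 : ℂ) • siegelCocycle γ.toMatrix τ).det *
    γ.vacuumAmplitude hk τ ^ 2) (G := fun _ => resolutionConst g k ^ 2) ?_ continuousOn_const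
    (fun τ hτ => ?_) hτ
  · exact (((continuous_siegelCocycle _).const_smul (1 / 2 : ℂ)).matrix_det.continuousOn).mul
      ((continuousOn_gaussFunctional_apply (natCast_real_pos hk) _).pow 2)
  · have hτ' := siegelAct_mem_open γ.toMatrix_mem_symplecticGroup hτ
    have h1 := γ.discInvSqrtDet_mul_vacuumAmplitude hk hτ
    have h2 := γ.gaussFactor_sq_mul_det hτ
    have h3 := γ.det_half_siegelCocycle hτ
    have h4 := isNormalizedBranch_discInvSqrtDet.2.2 τ hτ
    have h5 := isNormalizedBranch_discInvSqrtDet.2.2 _ hτ'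
    have h6 : (γ.L.det : ℂ) ≠ 0 := by exact_mod_cast γ.det_L
    set c := ((1 / 2 : ℂ) • siegelCocycle γ.toMatrix τ).det
    set G := γ.vacuumAmplitude hk τ
    set d := discInvSqrtDet τ
    set d' := discInvSqrtDet (siegelAct γ.toMatrix τ)
    set κ := γ.gaussFactor τ
    refine mul_left_cancel₀ h6 ?_
    calc (γ.L.det : ℂ) * (c * G ^ 2) = (d' ^ 2 * (1 + siegelAct γ.toMatrix τ).det) *
          ((γ.L.det : ℂ) * (c * G ^ 2)) := by rw [h5, one_mul]
      _ = ((1 + siegelAct γ.toMatrix τ).det * c * (γ.L.det : ℂ)) * (d' * G) ^ 2 := by ring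
      _ = (κ ^ 2 * (γ.shift τ).det) * (d ^ 2 * (1 + τ).det) * resolutionConst g k ^ 2 := by
          rw [h1, h3]
          ring
      _ = _ := by rw [h2, h4, mul_one]

theorem vacuumAmplitude_ne_zero (hk : 0 < k) {τ : Matrix (Fin g) (Fin g) ℂ}
    (hτ : τ ∈ closedSiegelDisc g) : γ.vacuumAmplitude hk τ ≠ 0 := fun h => by
  have h1 := γ.vacuumAmplitude_sq hk hτ
  rw [h, zero_pow two_ne_zero, mul_zero] at h1
  exact pow_ne_zero 2 (resolutionConst_ne_zero (g := g) (natCast_real_pos hk)) h1.symm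

theorem halfForm_formula_eq (τ : Matrix (Fin g) (Fin g) ℂ) :
    Complex.I ^ (-γ.m) * (((Real.sqrt |γ.L.det|)⁻¹ : ℝ) : ℂ) *
      (Complex.exp (-(Real.pi * Complex.I * g / 4)) *
        gaussInvSqrtDet (-Complex.I • (cayleyInv τ + γ.Q.map Complex.ofReal)))⁻¹ =
      (γ.gaussFactor τ)⁻¹ := by
  rw [gaussFactor, shift, mul_inv (Complex.I ^ γ.m * _), mul_inv (Complex.I ^ γ.m), _root_.zpow_neg,
    Complex.ofReal_inv]

/-- The stated formula uses `Ω(τ)` and may lose its meaning at the boundary; dividing the constant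
by the vacuum amplitude gives the same factor in a form that extends continuously. -/
theorem exists_isHalfFormAction (hk : 0 < k) : ∃ h, γ.IsHalfFormAction h := by
  refine ⟨fun τ => resolutionConst g k / γ.vacuumAmplitude hk τ, ?_, fun τ hτ => ?_, fun τ hτ => ?_⟩
  · exact continuousOn_const.div (continuousOn_gaussFunctional_apply (natCast_real_pos hk) _)
      fun τ hτ => γ.vacuumAmplitude_ne_zero hk hτ
  · rw [canonicalForm_comp_matrixAct_inv γ.toMatrix_mem_symplecticGroup hτ, div_pow,
      ← γ.vacuumAmplitude_sq hk hτ,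
      mul_div_cancel_right₀ _ (pow_ne_zero 2 (γ.vacuumAmplitude_ne_zero hk hτ))]
  · have h1 := γ.discInvSqrtDet_mul_vacuumAmplitude hk hτ
    have h2 := γ.vacuumAmplitude_ne_zero hk (openSiegelDisc_subset hτ)
    have h3 := γ.gaussFactor_ne_zero hτ
    rw [halfForm_formula_eq]
    field_simp
    linear_combination -h1

/-- The frame of theta sections is invariant under the generators. -/
theorem smul_apply_thetaDist (hk : 0 < k) {T : DistSection g k →ₗ[ℂ] DistSection g k}
    (hT : γ.IsSectionAction T) {h : Matrix (Fin g) (Fin g) ℂ → ℂ} (hh : γ.IsHalfFormAction h)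
    {τ : Matrix (Fin g) (Fin g) ℂ} (hτ : τ ∈ closedSiegelDisc g) (l : Fin g → Fin k) :
    h τ • T (thetaDist hk l τ) = thetaDist hk l (siegelAct γ.toMatrix τ) := by
  have hM := γ.toMatrix_mem_symplecticGroup
  ext φ
  rw [_root_.smul_apply, smul_eq_mul, hT.apply_thetaDist hk, thetaDist_apply]
  -- After pairing with a fixed test section both sides are continuous in `τ`, so it suffices to
  -- argue over the open disc, where the half-form factor inverts the factor on Gaussians.
  refine eqOn_closedSiegelDisc (F := fun τ => h τ * gaussFunctional (natCast_real_pos hk) τ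
    (γ.transpose.schwartzOp hk (testCoeff hk l φ))) (G := fun τ => gaussFunctional
    (natCast_real_pos hk) (siegelAct γ.toMatrix τ) (testCoeff hk l φ))
    (hh.1.mul (continuousOn_gaussFunctional_apply _ _))
    ((continuousOn_gaussFunctional_apply (natCast_real_pos hk) _).comp (continuousOn_siegelAct hM)
      fun τ hτ => siegelAct_mem_closed hM hτ) (fun τ hτ => ?_) hτ
  have h1 := hh.2.2 τ hτ
  rw [halfForm_formula_eq] at h1
  have h2 := γ.gaussFunctional_transpose_schwartzOp hk hτ (testCoeff hk l φ)
  have h3 := γ.gaussFactor_ne_zero hτ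
  have h4 := discInvSqrtDet_ne_zero (siegelAct_mem_open hM hτ)
  have h5 : γ.gaussFactor τ * (h τ * discInvSqrtDet τ) = discInvSqrtDet (siegelAct γ.toMatrix τ) := by
    rw [h1, mul_inv_cancel_left₀ h3]
  refine mul_left_cancel₀ h4 ?_
  linear_combination h τ * h2 + gaussFunctional (natCast_real_pos hk)
    (siegelAct γ.toMatrix τ) (testCoeff hk l φ) * h5

end MetaplecticGenerator

end HalfForms

/-! ## The metaplectic group -/

section MetaplecticGroup

variable {g k : ℕ}

/-- Invariance of the frame passes from generators to products. Since it holds for every element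
over `M`, the choice of that element does not matter. -/
theorem IsMetaplectic.mem_symplecticGroup_and {M : Matrix (Fin g ⊕ Fin g) (Fin g ⊕ Fin g) ℝ}
    {T : DistSection g k →ₗ[ℂ] DistSection g k} {h : Matrix (Fin g) (Fin g) ℂ → ℂ} (hk : 0 < k)
    (H : IsMetaplectic M T h) : M ∈ symplecticGroup (Fin g) ℝ ∧
      ∀ τ ∈ closedSiegelDisc g, ∀ l, h τ • T (thetaDist hk l τ) = thetaDist hk l (siegelAct M τ) := by
  induction H with
  | gen γ T h hT hh =>
    exact ⟨γ.toMatrix_mem_symplecticGroup, fun τ hτ l => γ.smul_apply_thetaDist hk hT hh hτ l⟩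
  | mul _ _ ih₁ ih₂ =>
    refine ⟨mul_mem ih₁.1 ih₂.1, fun τ hτ l => ?_⟩
    rw [LinearMap.comp_apply, mul_smul, ← map_smul, ih₂.2 τ hτ l,
      ih₁.2 _ (siegelAct_mem_closed ih₂.1 hτ) l, siegelAct_mul ih₁.1 ih₂.1 hτ]

theorem MetaplecticGenerator.exists_isMetaplectic (hk : 0 < k) (γ : MetaplecticGenerator g) :
    ∃ (T : DistSection g k →ₗ[ℂ] DistSection g k) (h : Matrix (Fin g) (Fin g) ℂ → ℂ),
      IsMetaplectic γ.toMatrix T h := by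
  obtain ⟨T, hT⟩ := γ.exists_isSectionAction hk
  obtain ⟨h, hh⟩ := γ.exists_isHalfFormAction hk
  exact ⟨T, h, IsMetaplectic.gen γ T h hT hh⟩

theorem exists_I_zpow_sq_eq_sign {x : ℝ} (hx : x ≠ 0) :
    ∃ m : ℤ, (Complex.I ^ m) ^ 2 = ((x / |x| : ℝ) : ℂ) := by
  rcases lt_or_gt_of_ne hx with h | h
  · exact ⟨1, by rw [abs_of_neg h, div_neg, div_self hx]; simp⟩
  · exact ⟨0, by rw [abs_of_pos h, div_self hx]; simp⟩

/-- A symplectic matrix with invertible lower left block is covered by a generator. -/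
theorem exists_toMatrix_eq {M : Matrix (Fin g ⊕ Fin g) (Fin g ⊕ Fin g) ℝ}
    (hM : M ∈ symplecticGroup (Fin g) ℝ) (hC : M.toBlocks₂₁.det ≠ 0) :
    ∃ γ : MetaplecticGenerator g, γ.toMatrix = M := by
  have hu : IsUnit M.toBlocks₂₁.det := hC.isUnit
  have h1 := SymplecticGroup.mem_iff.1 hM
  have h2 := SymplecticGroup.mem_iff.1 (SymplecticGroup.transpose_mem hM)
  rw [← fromBlocks_toBlocks M] at h1 h2
  set A := M.toBlocks₁₁
  set B := M.toBlocks₁₂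
  set C := M.toBlocks₂₁
  set D := M.toBlocks₂₂
  simp only [Matrix.J, fromBlocks_transpose, fromBlocks_multiply, transpose_transpose, mul_zero,
    mul_one, zero_add, add_zero, mul_neg, neg_mul, fromBlocks_inj] at h1 h2
  have hCD : C * Dᵀ = D * Cᵀ := (eq_of_sub_eq_zero (by rw [sub_eq_add_neg]; exact h1.2.2.2)).symm
  have hAC : Cᵀ * A = Aᵀ * C := eq_of_sub_eq_zero (by rw [sub_eq_add_neg]; exact h2.1)
  have hBD : Cᵀ * B = Aᵀ * D - 1 := by
    rw [sub_eq_add_neg, ← h2.2.1]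
    abel
  have huT : IsUnit Cᵀ.det := by rwa [det_transpose]
  have hLL : (C⁻¹)⁻¹ = C := nonsing_inv_nonsing_inv _ hu
  have hCu : IsUnit C := (isUnit_iff_isUnit_det _).2 hu
  have hCTu : IsUnit Cᵀ := (isUnit_iff_isUnit_det _).2 huT
  have hL : (C⁻¹).det ≠ 0 := by
    rw [det_nonsing_inv, Ring.inverse_eq_inv']
    exact inv_ne_zero hC
  obtain ⟨m, hm⟩ := exists_I_zpow_sq_eq_sign hL
  refine ⟨{ P := A * C⁻¹, L := C⁻¹, Q := C⁻¹ * D, m := m, symm_P := ?_, symm_Q := ?_, det_L := hL,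
            root := hm }, ?_⟩
  · refine hCTu.mul_left_cancel ?_
    rw [transpose_mul, transpose_nonsing_inv, mul_nonsing_inv_cancel_left _ _ huT, ← mul_assoc, hAC,
      mul_nonsing_inv_cancel_right _ _ hu]
  · refine hCTu.mul_right_cancel (hCu.mul_left_cancel ?_)
    rw [transpose_mul, transpose_nonsing_inv, nonsing_inv_mul_cancel_right _ _ huT, mul_assoc,
      mul_nonsing_inv_cancel_left _ _ hu, hCD]
  · rw [MetaplecticGenerator.toMatrix]
    simp only [hLL, nonsing_inv_mul_cancel_right _ _ hu, mul_nonsing_inv_cancel_left _ _ hu]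
    rw [← fromBlocks_toBlocks M]
    congr 1
    refine hCTu.mul_left_cancel ?_
    rw [transpose_nonsing_inv, mul_sub, mul_nonsing_inv _ huT, hBD, ← mul_assoc, hAC, mul_assoc,
      mul_nonsing_inv_cancel_left _ _ hu]

/-- Used at `τ = 0`, where it says that `iC + D` is invertible. -/
theorem det_siegelDen_ne_zero {M : Matrix (Fin g ⊕ Fin g) (Fin g ⊕ Fin g) ℝ}
    (hM : M ∈ symplecticGroup (Fin g) ℝ) {τ : Matrix (Fin g) (Fin g) ℂ}
    (hτ : τ ∈ openSiegelDisc g) : (siegelDen M τ).det ≠ 0 := fun h => by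
  have h1 := congrArg det (one_add_siegelAct_mul hM (openSiegelDisc_subset hτ))
  rw [det_mul, det_smul, h, mul_zero] at h1
  exact mul_ne_zero (det_one_add_ne_zero (siegelAct_mem_open hM hτ))
    (det_siegelCocycle_ne_zero hM (openSiegelDisc_subset hτ)) h1

-- The determinant of `sC + D` is a polynomial in `s`. If it vanished at all real `s` it would be
-- zero, and hence vanish at `s = i` as well.
open Polynomial in
theorem exists_det_smul_add_ne_zero {C D : Matrix (Fin g) (Fin g) ℝ}
    (h : (Complex.I • C.map Complex.ofRealHom + D.map Complex.ofRealHom).det ≠ 0) :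
    ∃ s : ℝ, (s • C + D).det ≠ 0 := by
  by_contra! H
  let N : Matrix (Fin g) (Fin g) ℝ[X] := (X : ℝ[X]) • C.map Polynomial.C + D.map Polynomial.C
  have h0 : N.det = 0 := by
    refine Polynomial.funext fun s => ?_
    rw [eval_zero, ← H s]
    change (evalRingHom s) N.det = _
    rw [RingHom.map_det]
    congr 1
    ext i j
    simpa [N] using mul_comm _ _
  apply h
  have h1 := congrArg (eval₂RingHom Complex.ofRealHom Complex.I) h0
  rw [RingHom.map_det, map_zero] at h1
  rw [← h1]
  congr 1
  ext i j
  simpa [N] using mul_comm _ _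

/-- The generator over the matrix with blocks `s, -1, 1, 0`. -/
def shearGenerator (g : ℕ) (s : ℝ) : MetaplecticGenerator g where
  P := s • 1
  L := 1
  Q := 0
  m := 0
  symm_P := isSymm_one.smul s
  symm_Q := isSymm_zero
  det_L := by simp
  root := by simp

theorem shearGenerator_toMatrix (s : ℝ) :
    (shearGenerator g s).toMatrix = fromBlocks (s • 1) (-1) 1 0 := by
  simp [MetaplecticGenerator.toMatrix, shearGenerator]

/-- Write `M = (M S) S⁻¹` with `S` the shear of parameter `s`. The lower left block of `M S` is `sC
+ D`, invertible for a suitable `s`, and that of `S⁻¹` is `-1`; both factors are thus covered by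
generators. -/
theorem exists_isMetaplectic (hk : 0 < k) {M : Matrix (Fin g ⊕ Fin g) (Fin g ⊕ Fin g) ℝ}
    (hM : M ∈ symplecticGroup (Fin g) ℝ) :
    ∃ (T : DistSection g k →ₗ[ℂ] DistSection g k) (h : Matrix (Fin g) (Fin g) ℂ → ℂ),
      IsMetaplectic M T h := by
  have h0 := det_siegelDen_ne_zero hM zero_mem_openSiegelDisc
  obtain ⟨s, hs⟩ := exists_det_smul_add_ne_zero (C := M.toBlocks₂₁) (D := M.toBlocks₂₂) (by
    simp only [siegelDen, sub_zero, add_zero, mul_one, mul_smul_comm] at h0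
    exact h0)
  set S := shearGenerator g s with hS
  have hSm := S.toMatrix_mem_symplecticGroup
  have hSu := SymplecticGroup.symplectic_det hSm
  have hSi : S.toMatrix⁻¹ ∈ symplecticGroup (Fin g) ℝ := by
    rw [← SymplecticGroup.coe_inv' ⟨_, hSm⟩]
    exact Subtype.property _
  have hSinv : S.toMatrix⁻¹ = fromBlocks 0 1 (-1) (s • 1) := by
    refine inv_eq_left_inv ?_
    rw [shearGenerator_toMatrix, fromBlocks_multiply]
    simp
  obtain ⟨γ₁, h₁⟩ := exists_toMatrix_eq (mul_mem hM hSm) (by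
    have : (M * S.toMatrix).toBlocks₂₁ = s • M.toBlocks₂₁ + M.toBlocks₂₂ := by
      conv_lhs => rw [← fromBlocks_toBlocks M, shearGenerator_toMatrix, fromBlocks_multiply]
      simp
    rwa [this])
  obtain ⟨γ₂, h₂⟩ := exists_toMatrix_eq hSi (by
    rw [hSinv, toBlocks_fromBlocks₂₁, det_neg, det_one, mul_one]
    exact pow_ne_zero _ (by norm_num))
  obtain ⟨T₁, f₁, H₁⟩ := γ₁.exists_isMetaplectic hk
  obtain ⟨T₂, f₂, H₂⟩ := γ₂.exists_isMetaplectic hk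
  have h := IsMetaplectic.mul H₁ H₂
  rw [h₁, h₂, mul_nonsing_inv_cancel_right _ _ hSu] at h
  exact ⟨_, _, h⟩

theorem symplecticActs_thetaDist_iff (hk : 0 < k) {M : Matrix (Fin g ⊕ Fin g) (Fin g ⊕ Fin g) ℝ}
    (hM : M ∈ symplecticGroup (Fin g) ℝ) {τ : Matrix (Fin g) (Fin g) ℂ}
    (hτ : τ ∈ closedSiegelDisc g) (l : Fin g → Fin k) (q : CorrectedBundle g k) :
    SymplecticActs M (τ, thetaDist hk l τ) q ↔ q = (siegelAct M τ, thetaDist hk l (siegelAct M τ)) := by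
  constructor
  · rintro ⟨T, h, H, rfl⟩
    exact Prod.ext rfl ((H.mem_symplecticGroup_and hk).2 τ hτ l)
  · rintro rfl
    obtain ⟨T, h, H⟩ := exists_isMetaplectic (k := k) hk hM
    exact ⟨T, h, H, Prod.ext rfl ((H.mem_symplecticGroup_and hk).2 τ hτ l).symm⟩

end MetaplecticGroup

theorem mainTheorem1 (g k : ℕ) (hk : 0 < k) :
    -- the closed Siegel disc parametrizes the invariant nonnegative polarizations
    Set.BijOn (siegelPolarization (g := g)) (closedSiegelDisc g) (nonnegLagrangians g) ∧
    -- the symplectic action on the closed disc is the push-forward of polarizations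
    (∀ M ∈ Matrix.symplecticGroup (Fin g) ℝ, ∀ τ ∈ closedSiegelDisc g,
      siegelAct M τ ∈ closedSiegelDisc g ∧
      siegelPolarization (siegelAct M τ) = (siegelPolarization τ).map (matrixAct M)) ∧
    -- the branch of the normalizing factor
    IsNormalizedBranch (discInvSqrtDet (g := g)) ∧
    ∃ Θ : (Fin g → Fin k) → Matrix (Fin g) (Fin g) ℂ → DistSection g k,
      -- the normalized theta sections extend continuously to the closed disc
      (∀ l, ContinuousOn (Θ l) (closedSiegelDisc g)) ∧
      (∀ l, ∀ τ ∈ openSiegelDisc g, ∃ s : SmoothSection g k,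
        (∀ u, s u = normalizedTheta l τ u) ∧ ∀ φ, Θ l τ φ = torusPairing s φ) ∧
      -- they form a global frame of the quantum bundle, which is trivial of rank `k ^ g`
      (∀ τ ∈ closedSiegelDisc g,
        LinearIndependent ℂ (fun l => Θ l τ) ∧
        Submodule.span ℂ (Set.range fun l => Θ l τ) = quantumSpace k (siegelPolarization τ)) ∧
      (∀ P ∈ nonnegLagrangians g, Module.finrank ℂ (quantumSpace k P) = k ^ g) ∧
      Topology.IsEmbedding (fun p : closedSiegelDisc g × ((Fin g → Fin k) → ℂ) =>
        ((p.1, ∑ l, p.2 l • Θ l p.1) : CorrectedBundle g k)) ∧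
      Set.range (fun p : closedSiegelDisc g × ((Fin g → Fin k) → ℂ) =>
        ((p.1, ∑ l, p.2 l • Θ l p.1) : CorrectedBundle g k)) = quantumBundle g k ∧
      -- the frame is invariant under the action of `Sp(2g, ℝ)`
      (∀ M ∈ Matrix.symplecticGroup (Fin g) ℝ, ∀ τ ∈ closedSiegelDisc g,
        ∀ (l : Fin g → Fin k) (q : CorrectedBundle g k),
          SymplecticActs M (τ, Θ l τ) q ↔ q = (siegelAct M τ, Θ l (siegelAct M τ))) := by
  exact ⟨bijOn_siegelPolarization,
    fun M hM τ hτ => ⟨siegelAct_mem_closed hM hτ, siegelPolarization_siegelAct hM hτ⟩,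
    isNormalizedBranch_discInvSqrtDet, thetaDist hk, continuousOn_thetaDist hk,
    fun l τ hτ => exists_section_normalizedTheta hk l hτ,
    fun τ hτ => ⟨linearIndependent_thetaDist hk hτ, span_thetaDist hk hτ⟩,
    fun P hP => finrank_quantumSpace hk hP, isEmbedding_thetaFrame hk, range_thetaFrame hk,
    fun M hM τ hτ l q => symplecticActs_thetaDist_iff hk hM hτ l q⟩
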